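/- Let $\mathbb{K}$ be $\mathbb{R}$ or $\mathbb{C}$, let $M$ be a smooth finite-dimensional manifold (Hausdorff and $\sigma$-compact), and let $F \subset T_{\mathbb{K}}M = TM\otimes_{\mathbb{R}}\mathbb{K}$ be an integrable distribution, i.e. a smooth $\mathbb{K}$-vector subbundle whose sections are closed under the Lie bracket. Put $B := T_{\mathbb{K}}M/F$, with projection $\mathrm{pr}_B\colon T_{\mathbb{K}}M\to B$. Then $B$ is an $F$-module by the Bott connection $\nabla_V\,\mathrm{pr}_B(X)=\mathrm{pr}_B[V,X]$, and so are the bundles $\mathbb{T}^n_m(B):=B^{\otimes n}\otimes (B^\vee)^{\otimes m}$, $n,m\ge 0$. Let $H^\bullet_{\mathrm{CE}}(F,\mathbb{T}^n_m(B))$ be the cohomology of $\Omega^\bullet_F(\mathbb{T}^n_m(B)):=\Gamma(\wedge^\bullet F^\vee\otimes \mathbb{T}^n_m(B))$ with its Chevalley–Eilenberg differential. Let $F[1]$ be the graded manifold whose algebra of functions is $\Omega_F^\bullet=\Gamma(\wedge^\bullet F^\vee)$, and let $d_F$ be the Chevalley–Eilenberg differential on $\Omega_F^\bullet$, so that $(F[1],d_F)$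 is a DG manifold; vector fields on $F[1]$ are the graded derivations of $\Omega_F^\bullet$. For $n,m\ge0$ let $$\mathfrak{T}^n_m:=\Gamma\big(F[1],\,T(F[1])^{\otimes n}\otimes (T^\vee(F[1]))^{\otimes m}\big)$$ be the graded space of $(n,m)$-tensor fields on $F[1]$, with the differential $L_{d_F}$ (Lie derivative along $d_F$). Define a map $\phi$ from vector fields on $F[1]$ to $\Omega^\bullet_F(B)$ as follows: $\phi(X)$ is obtained by restricting $X$ to the functions on $M$, which gives an element of $\Omega_F^\bullet(T_{\mathbb{K}}M)$, and applying $\mathrm{pr}_B$. A splitting is a bundle map $j\colon B\to T_{\mathbb{K}}M$ with $\mathrm{pr}_B\circ j=\mathrm{id}$; it gives a projection $\mathrm{pr}_F=\mathrm{id}-j\circ \mathrm{pr}_B$ onto $F$ and an $\Omega_F^\bullet$-linear map $\psi_j$ from $\Omega_F^\bullet(B)$ to vector fields on $F[1]$, determined for $Z\in\Gamma(B)$ by $$\psi_j(Z)f=j(Z)f,\qquad \langle \psi_j(Z)\xi, V\rangle=j(Z)\langle \xi,V\rangle-\langle \xi,\mathrm{pr}_F[j(Z),V]\rangle$$ for $f\in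 C^\infty(M,\mathbb{K})$, $\xi\in\Gamma(F^\vee)$, $V\in\Gamma(F)$. Then a splitting exists, and there is a family of $\mathbb{K}$-linear isomorphisms $$\Phi^n_m\colon H^k(\mathfrak{T}^n_m,L_{d_F})\xrightarrow{\ \cong\ }H^k_{\mathrm{CE}}(F,\mathbb{T}^n_m(B)),\qquad n,m\ge 0,\ k\in\mathbb{Z},$$ with the following properties. 1. (Canonicity.) For every splitting $j$ and all $n,m,k$, the map $\phi^{\otimes n}\otimes(\psi_j^\vee)^{\otimes m}\colon \mathfrak{T}^n_m\to\Omega_F^\bullet(\mathbb{T}^n_m(B))$ sends cocycles to cocycles and induces $\Phi^n_m$ on cohomology. In particular $\Phi^n_m$ does not depend on the splitting. 2. (Tensor products.) Tensor products of cocycles are cocycles on both sides, the induced products of cohomology classes are compatible with $\Phi$, and $$\Phi^{n_1+n_2}_{m_1+m_2}(\sigma\otimes\tau)=\Phi^{n_1}_{m_1}(\sigma)\otimes\Phi^{n_2}_{m_2}(\tau)$$ for all classes $\sigma\in H^{k_1}(\mathfrak{T}^{n_1}_{m_1},L_{d_F})$ and $\tau\in H^{k_2}(\mathfrak{T}^{n_2}_{m_2},L_{d_F})$.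 -/

import Mathlib

set_option linter.unusedSectionVars false

noncomputable section

open scoped TensorProduct

namespace DGFoliation

/-! ### Alternating forms -/

section Forms

variable {A : Type*} [CommRing A] {V : Type*} [AddCommGroup V] [Module A V]
  {E E₁ E₂ E₃ : Type*} [AddCommGroup E] [Module A E] [AddCommGroup E₁] [Module A E₁]
  [AddCommGroup E₂] [Module A E₂] [AddCommGroup E₃] [Module A E₃]

variable (A V E) in
/-- `Forms A V E` is the module of `E`-valued alternating forms on the `A`-module `V`, all degrees
together. For sections `V` of a vector bundle of finite rank only finitely many degrees are nonzero,
so that this product over all degrees is the direct sum `Γ(⋀ V^∨ ⊗ E)`. -/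
def Forms : Type _ := (k : ℕ) → V [⋀^Fin k]→ₗ[A] E

namespace Forms

instance : AddCommGroup (Forms A V E) :=
  inferInstanceAs (AddCommGroup ((k : ℕ) → V [⋀^Fin k]→ₗ[A] E))

instance {S : Type*} [Semiring S] [Module S E] [SMulCommClass A S E] : Module S (Forms A V E) :=
  inferInstanceAs (Module S ((k : ℕ) → V [⋀^Fin k]→ₗ[A] E))

instance {S : Type*} [CommRing S] [Algebra S A] [Module S E] [IsScalarTower S A E] :
    IsScalarTower S A (Forms A V E) where
  smul_assoc c f a := funext fun k => AlternatingMap.ext fun x => smul_assoc c f (a k x)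

@[ext] lemma ext {a b : Forms A V E} (h : ∀ k, a k = b k) : a = b := funext h

@[simp] lemma add_apply (a b : Forms A V E) (k : ℕ) : (a + b) k = a k + b k := rfl

@[simp] lemma zero_apply (k : ℕ) : (0 : Forms A V E) k = 0 := rfl

@[simp] lemma neg_apply (a : Forms A V E) (k : ℕ) : (-a) k = -a k := rfl

@[simp] lemma sub_apply (a b : Forms A V E) (k : ℕ) : (a - b) k = a k - b k := rfl

@[simp] lemma smul_apply {S : Type*} [Semiring S] [Module S E] [SMulCommClass A S E] (c : S)
    (a : Forms A V E) (k : ℕ) : (c • a) k = c • a k := rfl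

@[simp] lemma units_smul_apply (u : ℤˣ) (a : Forms A V E) (k : ℕ) : (u • a) k = u • a k := by
  rcases Int.units_eq_one_or u with rfl | rfl <;> simp

end Forms

/-- The forms that are homogeneous of degree `k`; zero for negative `k`. -/
def formsOfDegree (𝕂 : Type*) [CommRing 𝕂] [Module 𝕂 E] [SMulCommClass A 𝕂 E] (k : ℤ) :
    Submodule 𝕂 (Forms A V E) where
  carrier := {a | ∀ i : ℕ, (i : ℤ) ≠ k → a i = 0}
  add_mem' ha hb i hi := by simp [ha i hi, hb i hi]
  zero_mem' i _ := rfl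
  smul_mem' c a ha i hi := by simp [ha i hi]

/-- Multiplication of the component of degree `k` by `(-1)^(p k)`. -/
def twist (p : ℤ) : Forms A V E →ₗ[A] Forms A V E where
  toFun a k := (p * k).negOnePow • a k
  map_add' a b := Forms.ext fun k => smul_add (p * (k : ℤ)).negOnePow (a k) (b k)
  map_smul' c a := by
    ext1 k
    exact smul_comm (p * (k : ℤ)).negOnePow c (a k)

/-- The contraction `ι_v`, insertion of `v` into the first slot of a form. -/
def contract (v : V) : Forms A V E →ₗ[A] Forms A V E where
  toFun a k := (a (k + 1)).curryLeft v
  map_add' a b := by ext1 k; rfl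
  map_smul' c a := by ext1 k; rfl

/-- The wedge product of two forms on `n` vectors, by recursion on `n` through
`ι_v (a ∧ b) = ι_v a ∧ b + (-1)^|a| a ∧ ι_v b`. -/
def wedgeFun (p : E₁ →ₗ[A] E₂ →ₗ[A] E₃) :
    (n : ℕ) → Forms A V E₁ → Forms A V E₂ → (Fin n → V) → E₃
  | 0, a, b, v => p (a 0 v) (b 0 v)
  | n + 1, a, b, v =>
      wedgeFun p n (contract (v 0) a) b (Fin.tail v) +
        wedgeFun p n (twist 1 a) (contract (v 0) b) (Fin.tail v)

@[simp] lemma twist_apply (p : ℤ) (a : Forms A V E) (k : ℕ) :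
    twist p a k = (p * k).negOnePow • a k := rfl

lemma contract_apply (v : V) (a : Forms A V E) (k : ℕ) :
    contract v a k = (a (k + 1)).curryLeft v := rfl

lemma contract_add (v w : V) (a : Forms A V E) :
    contract (v + w) a = contract v a + contract w a := by
  ext1 k; simp [contract_apply]

lemma contract_smul (c : A) (v : V) (a : Forms A V E) :
    contract (c • v) a = c • contract v a := by
  ext1 k; simp [contract_apply]

@[simp] lemma contract_contract_self (v : V) (a : Forms A V E) :
    contract v (contract v a) = 0 := by
  ext1 k; simp [contract_apply]

lemma contract_twist (p : ℤ) (v : V) (a : Forms A V E) :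
    contract v (twist p a) = p.negOnePow • twist p (contract v a) := by
  ext1 k
  ext w
  simp [contract_apply, mul_add, Int.negOnePow_add, smul_smul, mul_comm]

lemma twist_twist (p q : ℤ) (a : Forms A V E) : twist p (twist q a) = twist (p + q) a := by
  ext1 k
  simp [smul_smul, add_mul, Int.negOnePow_add]

@[simp] lemma twist_one_one (a : Forms A V E) : twist 1 (twist 1 a) = a := by
  rw [twist_twist]
  ext1 k
  rw [twist_apply, Int.negOnePow_even _ ⟨k, by ring⟩, one_smul]

/-- An alternating map from its curried form. -/
def altOfCurry {n : ℕ} (T : V →ₗ[A] V [⋀^Fin n]→ₗ[A] E)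
    (h : ∀ v w (i : Fin n), w i = v → T v w = 0) : V [⋀^Fin (n + 1)]→ₗ[A] E where
  toMultilinearMap := LinearMap.uncurryLeft (AlternatingMap.toMultilinearMapLM ∘ₗ T)
  map_eq_zero_of_eq' := by
    intro v i j hv hij
    change T (v 0) (Fin.tail v) = 0
    induction i using Fin.cases with
    | zero =>
      induction j using Fin.cases with
      | zero => exact absurd rfl hij
      | succ j => exact h _ _ j hv.symm
    | succ i =>
      induction j using Fin.cases with
      | zero => exact h _ _ i hv
      | succ j => exact (T (v 0)).map_eq_zero_of_eq (Fin.tail v) hv (fun e => hij (by rw [e]))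

@[simp] lemma altOfCurry_apply {n : ℕ} (T : V →ₗ[A] V [⋀^Fin n]→ₗ[A] E) (h)
    (v : Fin (n + 1) → V) : altOfCurry T h v = T (v 0) (Fin.tail v) := rfl

lemma eq_zero_of_head {n : ℕ} (f : V [⋀^Fin n]→ₗ[A] E) (v : V)
    (h : ∀ w : Fin n → V, ∀ h0 : 0 < n, w ⟨0, h0⟩ = v → f w = 0) (w : Fin n → V) (i : Fin n)
    (hi : w i = v) : f w = 0 := by
  have h0 : 0 < n := i.pos
  by_cases hi0 : i = ⟨0, h0⟩
  · exact h w h0 (hi0 ▸ hi)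
  · have := f.map_swap w hi0
    rw [h (w ∘ Equiv.swap i ⟨0, h0⟩) h0 (by simp [hi])] at this
    simpa using this.symm

lemma wedgeFun_zero_left (p : E₁ →ₗ[A] E₂ →ₗ[A] E₃) (n : ℕ) (b : Forms A V E₂) (v : Fin n → V) :
    wedgeFun p n 0 b v = 0 := by
  induction n generalizing b with
  | zero => simp [wedgeFun]
  | succ n ih => simp [wedgeFun, ih]

lemma wedgeFun_zero_right (p : E₁ →ₗ[A] E₂ →ₗ[A] E₃) (n : ℕ) (a : Forms A V E₁) (v : Fin n → V) :
    wedgeFun p n a 0 v = 0 := by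
  induction n generalizing a with
  | zero => simp [wedgeFun]
  | succ n ih => simp [wedgeFun, ih]

lemma wedgeFun_neg_left (p : E₁ →ₗ[A] E₂ →ₗ[A] E₃) (n : ℕ) (a : Forms A V E₁)
    (b : Forms A V E₂) (v : Fin n → V) : wedgeFun p n (-a) b v = - wedgeFun p n a b v := by
  induction n generalizing a b with
  | zero => simp [wedgeFun]
  | succ n ih => simp [wedgeFun, ih]; abel

lemma exists_wedge (p : E₁ →ₗ[A] E₂ →ₗ[A] E₃) (n : ℕ) :
    ∃ W : Forms A V E₁ →ₗ[A] Forms A V E₂ →ₗ[A] (V [⋀^Fin n]→ₗ[A] E₃),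
      ∀ a b v, W a b v = wedgeFun p n a b v := by
  induction n with
  | zero =>
    refine ⟨LinearMap.mk₂ A (fun a b => AlternatingMap.constOfIsEmpty A V (Fin 0)
      (p (a 0 0) (b 0 0))) ?_ ?_ ?_ ?_, ?_⟩
    · intro a a' b; ext v; simp
    · intro c a b; ext v; simp
    · intro a b b'; ext v; simp
    · intro c a b; ext v; simp
    · intro a b v
      rw [Subsingleton.elim v 0]
      simp [wedgeFun]
  | succ n ih =>
    obtain ⟨W, hW⟩ := ih
    let T (a : Forms A V E₁) (b : Forms A V E₂) : V →ₗ[A] V [⋀^Fin n]→ₗ[A] E₃ :=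
      { toFun := fun v => W (contract v a) b + W (twist 1 a) (contract v b)
        map_add' := fun v w => by simp only [contract_add, map_add, LinearMap.add_apply]; abel
        map_smul' := fun c v => by
          simp only [contract_smul, map_smul, LinearMap.smul_apply, RingHom.id_apply, smul_add] }
    have hT : ∀ a b v w (i : Fin n), w i = v → T a b v w = 0 := by
      intro a b v
      refine eq_zero_of_head _ v ?_
      intro w h0 hw
      obtain ⟨m, rfl⟩ : ∃ m, n = m + 1 := ⟨n - 1, by omega⟩
      change (W (contract v a) b + W (twist 1 a) (contract v b)) w = 0
      have hw' : w 0 = v := hw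
      rw [AlternatingMap.add_apply, hW, hW]
      simp [wedgeFun, hw', contract_twist, wedgeFun_zero_left, wedgeFun_zero_right,
        wedgeFun_neg_left]
    refine ⟨LinearMap.mk₂ A (fun a b => altOfCurry (T a b) (hT a b)) ?_ ?_ ?_ ?_, ?_⟩
    · intro a a' b; ext v; simp [T]; abel
    · intro c a b; ext v; simp [T]
    · intro a b b'; ext v; simp [T]; abel
    · intro c a b; ext v; simp [T]
    · intro a b v
      simp [T, wedgeFun, hW]

/-- The wedge product of forms with respect to a bilinear pairing of the coefficients.
See `contract_wedge` and `wedge_zero_apply` for the two properties that characterize it. -/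
def wedge (p : E₁ →ₗ[A] E₂ →ₗ[A] E₃) (a : Forms A V E₁) (b : Forms A V E₂) : Forms A V E₃ :=
  fun n =>
  { toFun := wedgeFun p n a b
    map_update_add' := by
      obtain ⟨W, hW⟩ := exists_wedge (V := V) p n
      intro _ v i x y
      simp only [← hW, AlternatingMap.map_update_add]
    map_update_smul' := by
      obtain ⟨W, hW⟩ := exists_wedge (V := V) p n
      intro _ v i c x
      simp only [← hW, AlternatingMap.map_update_smul]
    map_eq_zero_of_eq' := by
      obtain ⟨W, hW⟩ := exists_wedge (V := V) p n
      intro v i j hv hij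
      simp only [← hW]
      exact (W a b).map_eq_zero_of_eq v hv hij }

lemma wedge_apply (p : E₁ →ₗ[A] E₂ →ₗ[A] E₃) (a : Forms A V E₁) (b : Forms A V E₂) (n : ℕ)
    (v : Fin n → V) : wedge p a b n v = wedgeFun p n a b v := rfl

lemma wedge_add_left (p : E₁ →ₗ[A] E₂ →ₗ[A] E₃) (a a' : Forms A V E₁) (b : Forms A V E₂) :
    wedge p (a + a') b = wedge p a b + wedge p a' b := by
  ext1 n; ext v
  obtain ⟨W, hW⟩ := exists_wedge (V := V) p n
  simp [wedge_apply, ← hW]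

lemma wedge_add_right (p : E₁ →ₗ[A] E₂ →ₗ[A] E₃) (a : Forms A V E₁) (b b' : Forms A V E₂) :
    wedge p a (b + b') = wedge p a b + wedge p a b' := by
  ext1 n; ext v
  obtain ⟨W, hW⟩ := exists_wedge (V := V) p n
  simp [wedge_apply, ← hW]

lemma wedge_smul_left (p : E₁ →ₗ[A] E₂ →ₗ[A] E₃) (c : A) (a : Forms A V E₁) (b : Forms A V E₂) :
    wedge p (c • a) b = c • wedge p a b := by
  ext1 n; ext v
  obtain ⟨W, hW⟩ := exists_wedge (V := V) p n
  simp [wedge_apply, ← hW]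

lemma wedge_smul_right (p : E₁ →ₗ[A] E₂ →ₗ[A] E₃) (c : A) (a : Forms A V E₁) (b : Forms A V E₂) :
    wedge p a (c • b) = c • wedge p a b := by
  ext1 n; ext v
  obtain ⟨W, hW⟩ := exists_wedge (V := V) p n
  simp [wedge_apply, ← hW]

lemma contract_wedge (p : E₁ →ₗ[A] E₂ →ₗ[A] E₃) (v : V) (a : Forms A V E₁) (b : Forms A V E₂) :
    contract v (wedge p a b) = wedge p (contract v a) b + wedge p (twist 1 a) (contract v b) := by
  ext1 n; ext w
  rfl

lemma wedge_zero_apply (p : E₁ →ₗ[A] E₂ →ₗ[A] E₃) (a : Forms A V E₁) (b : Forms A V E₂)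
    (v : Fin 0 → V) : wedge p a b 0 v = p (a 0 v) (b 0 v) := rfl

/-- Two forms agree in degree `n + 1` if their contractions agree in degree `n`. -/
lemma forms_succ_ext {a b : Forms A V E} {n : ℕ}
    (h : ∀ v, contract v a n = contract v b n) : a (n + 1) = b (n + 1) := by
  ext w
  have := congrArg (fun f => f (Fin.tail w)) (h (w 0))
  simpa [contract_apply, Matrix.vecCons, Fin.cons_self_tail] using this

lemma wedge_units_smul_left (p : E₁ →ₗ[A] E₂ →ₗ[A] E₃) (u : ℤˣ) (a : Forms A V E₁)
    (b : Forms A V E₂) : wedge p (u • a) b = u • wedge p a b := by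
  rcases Int.units_eq_one_or u with rfl | rfl
  · simp
  · have := wedge_smul_left p (-1 : A) a b
    simpa using this

lemma wedge_units_smul_right (p : E₁ →ₗ[A] E₂ →ₗ[A] E₃) (u : ℤˣ) (a : Forms A V E₁)
    (b : Forms A V E₂) : wedge p a (u • b) = u • wedge p a b := by
  rcases Int.units_eq_one_or u with rfl | rfl
  · simp
  · have := wedge_smul_right p (-1 : A) a b
    simpa using this

lemma map_units_smul {M N : Type*} [AddCommGroup M] [AddCommGroup N] [Module A M] [Module A N]
    (f : M →ₗ[A] N) (u : ℤˣ) (x : M) : f (u • x) = u • f x := by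
  rcases Int.units_eq_one_or u with rfl | rfl <;> simp

lemma twist_wedge (p : E₁ →ₗ[A] E₂ →ₗ[A] E₃) (q : ℤ) (a : Forms A V E₁) (b : Forms A V E₂) :
    twist q (wedge p a b) = wedge p (twist q a) (twist q b) := by
  ext1 n
  induction n generalizing a b with
  | zero => ext v; simp [wedge_zero_apply]
  | succ n ih =>
    refine forms_succ_ext fun v => ?_
    simp only [contract_twist, contract_wedge, map_add, Forms.add_apply, Forms.units_smul_apply, ih,
      wedge_units_smul_left, wedge_units_smul_right, smul_add, twist_twist, add_comm]

/-- The wedge product of scalar-valued forms is associative. -/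
lemma wedge_assoc (a b c : Forms A V A) :
    wedge (LinearMap.mul A A) (wedge (LinearMap.mul A A) a b) c =
      wedge (LinearMap.mul A A) a (wedge (LinearMap.mul A A) b c) := by
  ext1 n
  induction n generalizing a b c with
  | zero => ext v; simp [wedge_zero_apply, mul_assoc]
  | succ n ih =>
    refine forms_succ_ext fun v => ?_
    simp only [contract_wedge, wedge_add_left, wedge_add_right, twist_wedge, Forms.add_apply, ih,
      add_assoc]

section deg
variable {𝕂 : Type*} [CommRing 𝕂] [Module 𝕂 E] [SMulCommClass A 𝕂 E]
  [Module 𝕂 E₁] [SMulCommClass A 𝕂 E₁] [Module 𝕂 E₂] [SMulCommClass A 𝕂 E₂]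
  [Module 𝕂 E₃] [SMulCommClass A 𝕂 E₃]

lemma contract_mem {k : ℤ} {a : Forms A V E} (ha : a ∈ formsOfDegree 𝕂 k) (v : V) :
    contract v a ∈ formsOfDegree 𝕂 (k - 1) := by
  intro i hi
  rw [contract_apply, ha (i + 1) (by push_cast; omega), AlternatingMap.curryLeft_zero]
  rfl

lemma units_smul_mem {k : ℤ} {a : Forms A V E} (ha : a ∈ formsOfDegree 𝕂 k) (u : ℤˣ) :
    u • a ∈ formsOfDegree 𝕂 k := by
  intro i hi
  simp [ha i hi]

lemma twist_eq {k : ℤ} {a : Forms A V E} (ha : a ∈ formsOfDegree 𝕂 k) (q : ℤ) :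
    twist q a = (q * k).negOnePow • a := by
  ext1 i
  by_cases hi : (i : ℤ) = k
  · subst hi; rfl
  · simp [ha i hi]

lemma twist_mem {k : ℤ} {a : Forms A V E} (ha : a ∈ formsOfDegree 𝕂 k) (q : ℤ) :
    twist q a ∈ formsOfDegree 𝕂 k := by
  rw [twist_eq ha]
  exact units_smul_mem ha _

lemma wedge_mem (p : E₁ →ₗ[A] E₂ →ₗ[A] E₃) {k l : ℤ} {a : Forms A V E₁} {b : Forms A V E₂}
    (ha : a ∈ formsOfDegree 𝕂 k) (hb : b ∈ formsOfDegree 𝕂 l) :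
    wedge p a b ∈ formsOfDegree 𝕂 (k + l) := by
  intro n
  induction n generalizing a b k l with
  | zero =>
    intro h
    ext v
    rw [wedge_zero_apply]
    by_cases hk : ((0 : ℕ) : ℤ) = k
    · rw [hb 0 (by omega)]; simp
    · rw [ha 0 hk]; simp
  | succ n ih =>
    intro h
    refine forms_succ_ext (b := 0) fun v => ?_
    rw [contract_wedge, Forms.add_apply, ih (contract_mem ha v) hb (by push_cast at h; omega),
      ih (twist_mem ha 1) (contract_mem hb v) (by push_cast at h; omega)]
    simp

lemma wedge_comm [Module 𝕂 A] [SMulCommClass A 𝕂 A] {k : ℤ} {a : Forms A V A}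
    (ha : a ∈ formsOfDegree 𝕂 k) (b : Forms A V A) :
    wedge (LinearMap.mul A A) a b = wedge (LinearMap.mul A A) (twist k b) a := by
  ext1 n
  induction n generalizing a b k with
  | zero =>
    ext v
    simp only [wedge_zero_apply]
    by_cases hk : ((0 : ℕ) : ℤ) = k
    · subst hk; simp [mul_comm]
    · rw [ha 0 hk]; simp
  | succ n ih =>
    refine forms_succ_ext fun v => ?_
    rw [contract_wedge, contract_wedge, Forms.add_apply, Forms.add_apply, ih (contract_mem ha v),
      ih (twist_mem ha 1), twist_eq ha, contract_twist, twist_twist,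
      wedge_units_smul_left, wedge_units_smul_right, one_mul, add_comm]
    congr 3
    rw [add_comm, sub_eq_add_neg]
    refine LinearMap.ext fun c => Forms.ext fun i => ?_
    simp [add_mul, Int.negOnePow_add]

end deg

end Forms
/-! ### Derivations of forms -/

section Derivations

variable {𝕂 A : Type*} [CommRing 𝕂] [CommRing A] [Algebra 𝕂 A]
  {V : Type*} [AddCommGroup V] [Module A V] [Module 𝕂 V]
  {E : Type*} [AddCommGroup E] [Module A E] [Module 𝕂 E] [IsScalarTower 𝕂 A E]

/-- The derivation of multilinear maps induced by derivations of the arguments and of the values: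
`(D τ)(x₁, …) = δE (τ (x₁, …)) - ∑ i, τ (…, δV xᵢ, …)`. -/
def multiDer {ι : Type*} [Fintype ι] [dι : DecidableEq ι] (D : Derivation 𝕂 A A) (δV : V →ₗ[𝕂] V)
    (δE : E →ₗ[𝕂] E) (hV : ∀ (f : A) v, δV (f • v) = f • δV v + D f • v)
    (hE : ∀ (f : A) e, δE (f • e) = f • δE e + D f • e)
    (τ : MultilinearMap A (fun _ : ι => V) E) : MultilinearMap A (fun _ : ι => V) E where
  toFun x := δE (τ x) - ∑ i, τ (Function.update x i (δV (x i)))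
  map_update_add' := by
    intro inst x i a b
    obtain rfl : inst = dι := Subsingleton.elim _ _
    rw [← Finset.add_sum_erase _ _ (Finset.mem_univ i),
      ← Finset.add_sum_erase (Finset.univ) (fun j => τ (Function.update (Function.update x i a) j
        (δV (Function.update x i a j)))) (Finset.mem_univ i),
      ← Finset.add_sum_erase (Finset.univ) (fun j => τ (Function.update (Function.update x i b) j
        (δV (Function.update x i b j)))) (Finset.mem_univ i)]
    have key : ∑ j ∈ Finset.univ.erase i, τ (Function.update (Function.update x i (a + b)) j
          (δV (Function.update x i (a + b) j))) =
        ∑ j ∈ Finset.univ.erase i, τ (Function.update (Function.update x i a) j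
          (δV (Function.update x i a j))) +
        ∑ j ∈ Finset.univ.erase i, τ (Function.update (Function.update x i b) j
          (δV (Function.update x i b j))) := by
      rw [← Finset.sum_add_distrib]
      refine Finset.sum_congr rfl fun j hj => ?_
      have hji : j ≠ i := Finset.ne_of_mem_erase hj
      simp only [Function.update_of_ne hji]
      rw [Function.update_comm hji.symm, Function.update_comm hji.symm,
        Function.update_comm hji.symm, τ.map_update_add]
    rw [key]
    simp only [Function.update_self, Function.update_idem, map_add, τ.map_update_add]
    abel
  map_update_smul' := by
    intro inst x i c a
    obtain rfl : inst = dι := Subsingleton.elim _ _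
    rw [← Finset.add_sum_erase _ _ (Finset.mem_univ i),
      ← Finset.add_sum_erase (Finset.univ) (fun j => τ (Function.update (Function.update x i a) j
        (δV (Function.update x i a j)))) (Finset.mem_univ i)]
    have key : ∑ j ∈ Finset.univ.erase i, τ (Function.update (Function.update x i (c • a)) j
          (δV (Function.update x i (c • a) j))) =
        c • ∑ j ∈ Finset.univ.erase i, τ (Function.update (Function.update x i a) j
          (δV (Function.update x i a j))) := by
      rw [Finset.smul_sum]
      refine Finset.sum_congr rfl fun j hj => ?_
      have hji : j ≠ i := Finset.ne_of_mem_erase hj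
      simp only [Function.update_of_ne hji]
      rw [Function.update_comm hji.symm, Function.update_comm hji.symm, τ.map_update_smul]
    rw [key]
    simp only [Function.update_self, Function.update_idem, hV, hE, τ.map_update_add,
      τ.map_update_smul, smul_sub, smul_add]
    abel

/-- The same derivation on alternating maps. -/
def altDer {k : ℕ} (D : Derivation 𝕂 A A) (δV : V →ₗ[𝕂] V)
    (δE : E →ₗ[𝕂] E) (hV : ∀ (f : A) v, δV (f • v) = f • δV v + D f • v)
    (hE : ∀ (f : A) e, δE (f • e) = f • δE e + D f • e)
    (τ : V [⋀^Fin k]→ₗ[A] E) : V [⋀^Fin k]→ₗ[A] E where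
  toMultilinearMap := multiDer D δV δE hV hE τ.toMultilinearMap
  map_eq_zero_of_eq' := by
    intro x i j hx hij
    change δE (τ x) - ∑ i, τ (Function.update x i (δV (x i))) = 0
    rw [τ.map_eq_zero_of_eq x hx hij, map_zero, zero_sub, neg_eq_zero,
      Fintype.sum_eq_add i j hij]
    · have h := τ.map_swap (Function.update x i (δV (x i))) hij
      have e : (Function.update x i (δV (x i))) ∘ Equiv.swap i j =
          Function.update x j (δV (x j)) := by
        funext l
        simp only [Function.comp_apply]
        by_cases hl : l = j
        · subst hl; simp [hx]
        by_cases hl' : l = i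
        · subst hl'; simp [hl, hx, Ne.symm hl]
        · rw [Equiv.swap_apply_of_ne_of_ne hl' hl]; simp [hl, hl']
      rw [e] at h
      rw [h]; abel
    · rintro l ⟨hli, hlj⟩
      refine τ.map_eq_zero_of_eq _ ?_ hij
      simp [Ne.symm hli, Ne.symm hlj, hx]

lemma altDer_apply {k : ℕ} (D : Derivation 𝕂 A A) (δV : V →ₗ[𝕂] V)
    (δE : E →ₗ[𝕂] E) (hV : ∀ (f : A) v, δV (f • v) = f • δV v + D f • v)
    (hE : ∀ (f : A) e, δE (f • e) = f • δE e + D f • e)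
    (τ : V [⋀^Fin k]→ₗ[A] E) (x : Fin k → V) : altDer D δV δE hV hE τ x =
      δE (τ x) - ∑ i, τ (Function.update x i (δV (x i))) := rfl

/-- The same derivation on forms of all degrees. -/
def formsDer (D : Derivation 𝕂 A A) (δV : V →ₗ[𝕂] V)
    (δE : E →ₗ[𝕂] E) (hV : ∀ (f : A) v, δV (f • v) = f • δV v + D f • v)
    (hE : ∀ (f : A) e, δE (f • e) = f • δE e + D f • e) :
    Forms A V E →ₗ[𝕂] Forms A V E where
  toFun a k := altDer D δV δE hV hE (a k)
  map_add' a b := by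
    ext1 k; ext x
    change altDer D δV δE hV hE (a k + b k) x =
      altDer D δV δE hV hE (a k) x + altDer D δV δE hV hE (b k) x
    simp only [AlternatingMap.add_apply, altDer_apply, map_add, Finset.sum_add_distrib]
    abel
  map_smul' c a := by
    ext1 k; ext x
    change altDer D δV δE hV hE (c • a k) x = c • altDer D δV δE hV hE (a k) x
    simp only [AlternatingMap.smul_apply, altDer_apply, map_smul, Finset.smul_sum, smul_sub]

lemma formsDer_apply (D : Derivation 𝕂 A A) (δV : V →ₗ[𝕂] V)
    (δE : E →ₗ[𝕂] E) (hV : ∀ (f : A) v, δV (f • v) = f • δV v + D f • v)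
    (hE : ∀ (f : A) e, δE (f • e) = f • δE e + D f • e) (a : Forms A V E) (k : ℕ)
    (x : Fin k → V) : formsDer D δV δE hV hE a k x =
      δE (a k x) - ∑ i, a k (Function.update x i (δV (x i))) := rfl

lemma contract_formsDer (D : Derivation 𝕂 A A) (δV : V →ₗ[𝕂] V)
    (δE : E →ₗ[𝕂] E) (hV : ∀ (f : A) v, δV (f • v) = f • δV v + D f • v)
    (hE : ∀ (f : A) e, δE (f • e) = f • δE e + D f • e) (a : Forms A V E) (v : V) :
    contract v (formsDer D δV δE hV hE a) =
      formsDer D δV δE hV hE (contract v a) - contract (δV v) a := by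
  ext1 k; ext x
  simp only [contract_apply, AlternatingMap.curryLeft_apply_apply, formsDer_apply, Forms.sub_apply,
    AlternatingMap.sub_apply, Fin.sum_univ_succ, Matrix.vecCons, Fin.cons_zero, Fin.cons_succ,
    Fin.update_cons_zero, Fin.cons_update]
  abel

lemma formsDer_twist (D : Derivation 𝕂 A A) (δV : V →ₗ[𝕂] V)
    (δE : E →ₗ[𝕂] E) (hV : ∀ (f : A) v, δV (f • v) = f • δV v + D f • v)
    (hE : ∀ (f : A) e, δE (f • e) = f • δE e + D f • e) (a : Forms A V E) (q : ℤ) :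
    formsDer D δV δE hV hE (twist q a) = twist q (formsDer D δV δE hV hE a) := by
  ext1 k; ext x
  rcases Int.units_eq_one_or (q * k).negOnePow with h | h <;>
  simp [formsDer_apply, h, sub_eq_add_neg, add_comm]

lemma formsDer_wedge (D : Derivation 𝕂 A A) (δV : V →ₗ[𝕂] V)
    (hV : ∀ (f : A) v, δV (f • v) = f • δV v + D f • v)
    (hA : ∀ (f e : A), D.toLinearMap (f • e) = f • D.toLinearMap e + D f • e)
    (a b : Forms A V A) :
    formsDer D δV D.toLinearMap hV hA (wedge (LinearMap.mul A A) a b) =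
      wedge (LinearMap.mul A A) (formsDer D δV D.toLinearMap hV hA a) b +
        wedge (LinearMap.mul A A) a (formsDer D δV D.toLinearMap hV hA b) := by
  ext1 n
  induction n generalizing a b with
  | zero =>
    ext v
    simp [formsDer_apply, wedge_zero_apply, mul_comm, add_comm]
  | succ n ih =>
    refine forms_succ_ext fun v => ?_
    have e1 : ∀ x y : Forms A V A, wedge (LinearMap.mul A A) (x - y) b =
      wedge (LinearMap.mul A A) x b - wedge (LinearMap.mul A A) y b := fun x y => by
        rw [eq_sub_iff_add_eq, ← wedge_add_left, sub_add_cancel]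
    have e2 : ∀ x y z : Forms A V A, wedge (LinearMap.mul A A) z (x - y) =
      wedge (LinearMap.mul A A) z x - wedge (LinearMap.mul A A) z y := fun x y z => by
        rw [eq_sub_iff_add_eq, ← wedge_add_right, sub_add_cancel]
    simp only [contract_formsDer, contract_wedge, map_add, Forms.add_apply, Forms.sub_apply, ih, e1, e2,
      formsDer_twist]
    abel

end Derivations

/-! ### The Chevalley-Eilenberg complex -/

section ChevalleyEilenberg

variable {𝕂 A : Type*} [CommRing 𝕂] [CommRing A] [Algebra 𝕂 A]
  (F : LieRinehartSubalgebra A (Derivation 𝕂 A A))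
  (E : Type*) [AddCommGroup E] [Module A E] [Module 𝕂 E] [IsScalarTower 𝕂 A E]

instance sectionsModule : Module A F := inferInstance

instance sectionsScalarModule : Module 𝕂 F := inferInstance

/-- A flat `F`-connection on `E`, where `F` is a Lie-Rinehart subalgebra of the derivations of `A`:
that is, a representation of the Lie algebroid `F` on `E`. -/
structure FModule where
  /-- the connection -/
  nabla : F →ₗ[A] E →ₗ[𝕂] E
  /-- the Leibniz rule -/
  leibniz : ∀ (v : F) (f : A) (e : E),
    nabla v (f • e) = f • nabla v e + (v : Derivation 𝕂 A A) f • e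
  /-- flatness -/
  flat : ∀ (v w : F) (e : E), nabla ⁅v, w⁆ e = nabla v (nabla w e) - nabla w (nabla v e)

variable {F E}

/-- The adjoint action on the sections of `F`. -/
def adF (v : F) : F →ₗ[𝕂] F where
  toFun w := ⁅v, w⁆
  map_add' := lie_add v
  map_smul' c w := lie_smul c v w

lemma adF_leibniz (v : F) (f : A) (w : F) :
    adF v (f • w) = f • adF v w + (v : Derivation 𝕂 A A) f • w := by
  ext g
  simp [adF, Derivation.commutator_apply]

lemma adF_smul (f : A) (v w : F) :
    adF (f • v) w = f • adF v w - (w : Derivation 𝕂 A A) f • v := by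
  ext g
  simp [adF, Derivation.commutator_apply]
  ring

/-- The Lie derivative of forms along `v`. -/
def lieDer (M : FModule F E) (v : F) : Forms A F E →ₗ[𝕂] Forms A F E :=
  formsDer (v : Derivation 𝕂 A A) (adF v) (M.nabla v) (adF_leibniz v) (M.leibniz v)

lemma lieDer_apply (M : FModule F E) (v : F) (a : Forms A F E) (k : ℕ) (x : Fin k → F) :
    lieDer M v a k x = M.nabla v (a k x) - ∑ i, a k (Function.update x i ⁅v, x i⁆) := rfl

/-- The Koszul formula
`∑ i, (-1)^i ∇_{vᵢ} a(v₀, …, v̂ᵢ, …) + ∑ i < j, (-1)^(i+j) a([vᵢ, vⱼ], v₀, …, v̂ᵢ, …, v̂ⱼ, …)`,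
where in the second sum the bracket `[vᵢ, vⱼ]` has been moved to the position of `vⱼ`, which turns
the sign into `-(-1)^i`. -/
def koszulFun (M : FModule F E) {k : ℕ} (a : F [⋀^Fin k]→ₗ[A] E) (v : Fin (k + 1) → F) : E :=
  ∑ i : Fin (k + 1), (-1 : ℤ) ^ (i : ℕ) •
    (M.nabla (v i) (a (i.removeNth v)) -
      ∑ j ∈ Finset.Ioi i, a (i.removeNth (Function.update v j ⁅v i, v j⁆)))

lemma koszulFun_cons_zero (M : FModule F E) (a : F [⋀^Fin 0]→ₗ[A] E) (v : F) (w : Fin 0 → F) :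
    koszulFun M a (Fin.cons v w : Fin 1 → F) = M.nabla v (a w) := by
  have h : Fin.removeNth (α := fun _ => F) 0 (Fin.cons v w : Fin 1 → F) = w :=
    Subsingleton.elim _ _
  simp [koszulFun, h]

lemma removeNth_zero_cons {α : Type*} {n : ℕ} (v : α) (w : Fin n → α) :
    Fin.removeNth (α := fun _ => α) 0 (Fin.cons v w : Fin (n + 1) → α) = w := by
  funext i; simp [Fin.removeNth]

lemma removeNth_succ_cons {α : Type*} {n : ℕ} (v : α) (w : Fin (n + 1) → α) (i : Fin (n + 1)) :
    Fin.removeNth (α := fun _ => α) i.succ (Fin.cons v w : Fin (n + 2) → α) =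
      (Fin.cons v (i.removeNth w) : Fin (n + 1) → α) := by
  funext l
  induction l using Fin.cases <;> simp [Fin.removeNth]

lemma koszulFun_cons (M : FModule F E) {k : ℕ} (a : Forms A F E) (v : F)
    (w : Fin (k + 1) → F) :
    koszulFun M (a (k + 1)) (Fin.cons v w : Fin (k + 2) → F) =
      lieDer M v a (k + 1) w - koszulFun M (contract v a k) w := by
  unfold koszulFun
  rw [Fin.sum_univ_succ]
  have h0 : ∀ g : Fin (k + 2) → E, ∑ j ∈ Finset.Ioi (0 : Fin (k + 2)), g j =
      ∑ j : Fin (k + 1), g j.succ := by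
    intro g
    rw [Fin.Ioi_zero_eq_map, Finset.sum_map]; rfl
  have h1 : ∀ (i : Fin (k + 1)) (g : Fin (k + 2) → E), ∑ j ∈ Finset.Ioi i.succ, g j =
      ∑ j ∈ Finset.Ioi i, g j.succ := by
    intro i g
    rw [← Fin.map_succEmb_Ioi, Finset.sum_map]; rfl
  simp only [h0, h1, Fin.cons_zero, Fin.cons_succ, ← Fin.cons_update, removeNth_zero_cons,
    removeNth_succ_cons, Fin.val_zero, pow_zero, one_smul, Fin.val_succ, pow_succ, mul_neg, mul_one,
    neg_smul, Finset.sum_neg_distrib, lieDer_apply, sub_eq_add_neg, contract_apply,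
    AlternatingMap.curryLeft_apply_apply, Matrix.vecCons]

lemma koszulFun_add (M : FModule F E) {k : ℕ} (a b : F [⋀^Fin k]→ₗ[A] E) (v : Fin (k + 1) → F) :
    koszulFun M (a + b) v = koszulFun M a v + koszulFun M b v := by
  simp only [koszulFun, AlternatingMap.add_apply, map_add, ← Finset.sum_add_distrib, ← smul_add]
  refine Finset.sum_congr rfl fun i _ => ?_
  rw [Finset.sum_add_distrib]
  congr 1
  abel

lemma koszulFun_smul (M : FModule F E) {k : ℕ} (f : A) (a : F [⋀^Fin k]→ₗ[A] E)
    (v : Fin (k + 1) → F) :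
    koszulFun M (f • a) v = f • koszulFun M a v +
      ∑ i : Fin (k + 1), (-1 : ℤ) ^ (i : ℕ) • (v i : Derivation 𝕂 A A) f • a (i.removeNth v) := by
  simp only [koszulFun, AlternatingMap.smul_apply, M.leibniz]
  rw [Finset.smul_sum, ← Finset.sum_add_distrib]
  refine Finset.sum_congr rfl fun i _ => ?_
  rw [← Finset.smul_sum, smul_comm f ((-1 : ℤ) ^ (i : ℕ)), ← smul_add, smul_sub f]
  congr 1
  abel

lemma koszulFun_smul' (M : FModule F E) {k : ℕ} (c : 𝕂) (a : F [⋀^Fin k]→ₗ[A] E)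
    (v : Fin (k + 1) → F) :
    koszulFun M (c • a) v = c • koszulFun M a v := by
  simp only [koszulFun, AlternatingMap.smul_apply, map_smul, Finset.smul_sum]
  refine Finset.sum_congr rfl fun i _ => ?_
  rw [← Finset.smul_sum, smul_comm c ((-1 : ℤ) ^ (i : ℕ)), smul_sub c]

lemma lieDer_smul (M : FModule F E) {k : ℕ} (f : A) (v : F) (a : Forms A F E)
    (w : Fin (k + 1) → F) :
    lieDer M (f • v) a (k + 1) w = f • lieDer M v a (k + 1) w +
      ∑ i : Fin (k + 1), (-1 : ℤ) ^ (i : ℕ) • (w i : Derivation 𝕂 A A) f •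
        contract v a k (i.removeNth w) := by
  have h : ∀ i : Fin (k + 1), (-1 : ℤ) ^ (i : ℕ) • contract v a k (i.removeNth w) =
      a (k + 1) (Function.update w i v) := by
    intro i
    have := (a (k + 1)).neg_one_pow_smul_map_insertNth i v (i.removeNth w)
    rw [contract_apply, AlternatingMap.curryLeft_apply_apply, ← this, smul_smul, ← pow_add,
      Even.neg_one_pow ⟨_, rfl⟩, one_smul, Fin.insertNth_removeNth]
  have h2 : ∀ i : Fin (k + 1), ⁅f • v, w i⁆ = f • ⁅v, w i⁆ - (w i : Derivation 𝕂 A A) f • v :=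
    fun i => adF_smul f v (w i)
  simp only [smul_comm ((-1 : ℤ) ^ _), h, lieDer_apply, h2, map_smul, LinearMap.smul_apply,
    smul_sub, AlternatingMap.map_update_sub, AlternatingMap.map_update_smul,
    Finset.sum_sub_distrib, Finset.smul_sum]
  abel

lemma exists_koszul (M : FModule F E) (k : ℕ) (a : F [⋀^Fin k]→ₗ[A] E) :
    ∃ b : F [⋀^Fin (k + 1)]→ₗ[A] E, ∀ v, b v = koszulFun M a v := by
  induction k with
  | zero =>
    let T : F →ₗ[A] F [⋀^Fin 0]→ₗ[A] E :=
      { toFun := fun v => AlternatingMap.constOfIsEmpty A F (Fin 0) (M.nabla v (a 0))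
        map_add' := fun v w => by ext; simp
        map_smul' := fun c v => by ext; simp }
    refine ⟨altOfCurry T fun v w i => i.elim0, fun v => ?_⟩
    obtain ⟨x, w, rfl⟩ : ∃ x w, v = (Fin.cons x w : Fin 1 → F) :=
      ⟨v 0, Fin.tail v, (Fin.cons_self_tail v).symm⟩
    rw [koszulFun_cons_zero, Subsingleton.elim w 0]
    rfl
  | succ k ih =>
    choose η hη using ih
    let a' : Forms A F E := Pi.single (k + 1) a
    have ha' : a' (k + 1) = a := by simp [a']
    let T : F →ₗ[A] F [⋀^Fin (k + 1)]→ₗ[A] E :=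
      { toFun := fun v => lieDer M v a' (k + 1) - η (contract v a' k)
        map_add' := fun v w => by
          ext x
          simp only [AlternatingMap.sub_apply, AlternatingMap.add_apply, hη, contract_add,
            Forms.add_apply, koszulFun_add, lieDer_apply, map_add, LinearMap.add_apply, add_lie,
            AlternatingMap.map_update_add, Finset.sum_add_distrib]
          abel
        map_smul' := fun f v => by
          ext x
          simp only [AlternatingMap.sub_apply, AlternatingMap.smul_apply, hη, contract_smul,
            Forms.smul_apply, koszulFun_smul, lieDer_smul, RingHom.id_apply, smul_sub]
          abel }
    refine ⟨altOfCurry T fun v => eq_zero_of_head _ v fun w h0 hw => ?_, fun v => ?_⟩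
    · obtain ⟨x, u, rfl⟩ : ∃ x u, w = (Fin.cons x u : Fin (k + 1) → F) :=
        ⟨w 0, Fin.tail w, (Fin.cons_self_tail w).symm⟩
      obtain rfl : x = v := hw
      change (lieDer M x a' (k + 1) - η (contract x a' k)) _ = 0
      rw [AlternatingMap.sub_apply, hη]
      have e : lieDer M x a' (k + 1) (Fin.cons x u : Fin (k + 1) → F) =
          lieDer M x (contract x a') k u := by
        have := congrArg (fun b => b k u) (contract_formsDer (x : Derivation 𝕂 A A) (adF x)
          (M.nabla x) (adF_leibniz x) (M.leibniz x) a' x)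
        have hx : adF x x = 0 := lie_self x
        have h0 : contract (0 : F) a' = 0 := by
          have := contract_smul (0 : A) (0 : F) a'
          simpa using this
        rw [hx, h0, sub_zero] at this
        exact this
      rw [e]
      cases k with
      | zero =>
        rw [koszulFun_cons_zero]
        simp [lieDer_apply]
      | succ k =>
        rw [koszulFun_cons, contract_contract_self]
        simp [koszulFun]
    · have e := koszulFun_cons M a' (v 0) (Fin.tail v)
      rw [ha', ← hη, Fin.cons_self_tail] at e
      exact Eq.trans (AlternatingMap.sub_apply _ _ _) e.symm

/-- The Koszul formula as an alternating map. -/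
def ceStep (M : FModule F E) {k : ℕ} (a : F [⋀^Fin k]→ₗ[A] E) : F [⋀^Fin (k + 1)]→ₗ[A] E where
  toFun := koszulFun M a
  map_update_add' := by
    obtain ⟨b, hb⟩ := exists_koszul M k a
    intro _ v i x y
    simp only [← hb, AlternatingMap.map_update_add]
  map_update_smul' := by
    obtain ⟨b, hb⟩ := exists_koszul M k a
    intro _ v i c x
    simp only [← hb, AlternatingMap.map_update_smul]
  map_eq_zero_of_eq' := by
    obtain ⟨b, hb⟩ := exists_koszul M k a
    intro v i j hv hij
    simp only [← hb]
    exact b.map_eq_zero_of_eq v hv hij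

/-- The Chevalley-Eilenberg differential on `E`-valued forms. -/
def ceDiff (M : FModule F E) : Forms A F E →ₗ[𝕂] Forms A F E where
  toFun a
    | 0 => 0
    | k + 1 => ceStep M (a k)
  map_add' a b := by
    ext1 k
    cases k with
    | zero => exact (add_zero (0 : F [⋀^Fin 0]→ₗ[A] E)).symm
    | succ k => ext v; exact koszulFun_add M (a k) (b k) v
  map_smul' c a := by
    ext1 k
    cases k with
    | zero => exact (smul_zero c).symm
    | succ k => ext v; exact koszulFun_smul' M c (a k) v

lemma ceDiff_zero (M : FModule F E) (a : Forms A F E) : ceDiff M a 0 = 0 := rfl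

lemma ceDiff_succ_apply (M : FModule F E) (a : Forms A F E) (k : ℕ) (v : Fin (k + 1) → F) :
    ceDiff M a (k + 1) v = koszulFun M (a k) v := rfl

/-- The Cartan formula. -/
lemma contract_ceDiff (M : FModule F E) (v : F) (a : Forms A F E) :
    contract v (ceDiff M a) = lieDer M v a - ceDiff M (contract v a) := by
  ext1 k; ext w
  cases k with
  | zero =>
    change koszulFun M (a 0) (Fin.cons v w : Fin 1 → F) = _
    rw [koszulFun_cons_zero]
    simp [ceDiff_zero, lieDer_apply]
  | succ k =>
    exact koszulFun_cons M a v w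

end ChevalleyEilenberg

/-! ### The Bott representation and its tensor powers -/

section Modules

variable {𝕂 A : Type*} [CommRing 𝕂] [CommRing A] [Algebra 𝕂 A]
  (F : LieRinehartSubalgebra A (Derivation 𝕂 A A))
  {E : Type*} [AddCommGroup E] [Module A E] [Module 𝕂 E] [IsScalarTower 𝕂 A E]
  {E' : Type*} [AddCommGroup E'] [Module A E'] [Module 𝕂 E'] [IsScalarTower 𝕂 A E']

/-- The trivial representation of `F` on functions, `∇_v f = v f`. -/
def trivialModule : FModule F A where
  nabla :=
    { toFun := fun v => (v : Derivation 𝕂 A A).toLinearMap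
      map_add' := fun _ _ => rfl
      map_smul' := fun _ _ => rfl }
  leibniz v f g := by simp [mul_comm]
  flat v w f := Derivation.commutator_apply (D1 := v.1) (D2 := w.1) f

/-- The module `Γ(B)` of sections of `B = T M / F`, as the quotient of the vector fields by the
sections of `F`. -/
abbrev NormalSections : Type _ := Derivation 𝕂 A A ⧸ F.toSubmodule

instance normalSectionsAddCommGroup : AddCommGroup (NormalSections F) := inferInstance

instance normalSectionsModule : Module A (NormalSections F) := inferInstance

instance normalSectionsScalarModule : Module 𝕂 (NormalSections F) := inferInstance

/-- The Bott connection in the direction `v`, induced by `X ↦ [v, X]`. -/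
def bottLinear (v : F) : NormalSections F →ₗ[𝕂] NormalSections F :=
  (Submodule.Quotient.restrictScalarsEquiv 𝕂 F.toSubmodule).toLinearMap ∘ₗ
    Submodule.mapQ (F.toSubmodule.restrictScalars 𝕂) (F.toSubmodule.restrictScalars 𝕂)
      (LieModule.toEnd 𝕂 (Derivation 𝕂 A A) (Derivation 𝕂 A A) (v : Derivation 𝕂 A A))
      (fun _ hw => F.lie_mem v.2 hw) ∘ₗ
    (Submodule.Quotient.restrictScalarsEquiv 𝕂 F.toSubmodule).symm.toLinearMap

lemma bottLinear_mk (v : F) (X : Derivation 𝕂 A A) :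
    bottLinear F v (Submodule.Quotient.mk X) =
      Submodule.Quotient.mk ⁅(v : Derivation 𝕂 A A), X⁆ := rfl

/-- The Bott connection `∇_v (pr_B X) = pr_B [v, X]`. -/
def bottModule : FModule F (NormalSections F) where
  nabla :=
    { toFun := bottLinear F
      map_add' := fun v w => by
        refine LinearMap.ext fun e => ?_
        induction e using Submodule.Quotient.induction_on with
        | _ X =>
          simp only [LinearMap.add_apply, bottLinear_mk, ← Submodule.Quotient.mk_add, ← add_lie]
          rfl
      map_smul' := fun f v => by
        refine LinearMap.ext fun e => ?_
        induction e using Submodule.Quotient.induction_on with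
        | _ X =>
          simp only [LinearMap.smul_apply, RingHom.id_apply, bottLinear_mk,
            ← Submodule.Quotient.mk_smul]
          rw [Submodule.Quotient.eq]
          have : ⁅((f • v : F) : Derivation 𝕂 A A), X⁆ - f • ⁅(v : Derivation 𝕂 A A), X⁆ =
              - (X f • (v : Derivation 𝕂 A A)) := by
            ext g
            simp [Derivation.commutator_apply]
            ring
          rw [this]
          exact neg_mem (F.toSubmodule.smul_mem _ v.2) }
  leibniz v f e := by
    induction e using Submodule.Quotient.induction_on with
    | _ X =>
      change bottLinear F v (f • Submodule.Quotient.mk X) =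
        f • bottLinear F v (Submodule.Quotient.mk X) + _
      simp only [bottLinear_mk, ← Submodule.Quotient.mk_smul, ← Submodule.Quotient.mk_add]
      congr 1
      ext g
      simp [Derivation.commutator_apply]
  flat v w e := by
    induction e using Submodule.Quotient.induction_on with
    | _ X =>
      change bottLinear F ⁅v, w⁆ (Submodule.Quotient.mk X) =
        bottLinear F v (bottLinear F w (Submodule.Quotient.mk X)) -
        bottLinear F w (bottLinear F v (Submodule.Quotient.mk X))
      simp only [bottLinear_mk, ← Submodule.Quotient.mk_sub]
      congr 1
      exact lie_lie _ _ _

instance multilinearMap_isScalarTower {ι : Type*} :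
    IsScalarTower 𝕂 A (MultilinearMap A (fun _ : ι => E) E') where
  smul_assoc c f τ := MultilinearMap.ext fun x => smul_assoc c f (τ x)

variable {F}

/-- The dual representation, `(∇_v ξ)(e) = v (ξ e) - ξ (∇_v e)`. -/
def dualModule (M : FModule F E) : FModule F (Module.Dual A E) where
  nabla :=
    { toFun := fun v =>
        { toFun := fun ξ =>
            { toFun := fun e => (v : Derivation 𝕂 A A) (ξ e) - ξ (M.nabla v e)
              map_add' := fun e e' => by simp only [map_add]; abel
              map_smul' := fun f e => by
                simp only [map_smul, M.leibniz, map_add, smul_eq_mul, Derivation.leibniz,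
                  RingHom.id_apply]
                ring }
          map_add' := fun ξ η => by ext e; simp; ring
          map_smul' := fun c ξ => by
            refine LinearMap.ext fun e => ?_
            simp [smul_sub] }
      map_add' := fun v w => by
        refine LinearMap.ext fun ξ => LinearMap.ext fun e => ?_
        simp; ring
      map_smul' := fun f v => by
        refine LinearMap.ext fun ξ => LinearMap.ext fun e => ?_
        simp; ring }
  leibniz v f ξ := by
    refine LinearMap.ext fun e => ?_
    simp; ring
  flat v w ξ := by
    refine LinearMap.ext fun e => ?_
    simp [M.flat, Derivation.commutator_apply]
    ring

lemma multiDer_apply {V : Type*} [AddCommGroup V] [Module A V] [Module 𝕂 V]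
    {ι : Type*} [Fintype ι] [dι : DecidableEq ι] (D : Derivation 𝕂 A A) (δV : V →ₗ[𝕂] V)
    (δE : E →ₗ[𝕂] E) (hV : ∀ (f : A) v, δV (f • v) = f • δV v + D f • v)
    (hE : ∀ (f : A) e, δE (f • e) = f • δE e + D f • e)
    (τ : MultilinearMap A (fun _ : ι => V) E) (x : ι → V) : multiDer D δV δE hV hE τ x =
      δE (τ x) - ∑ i, τ (Function.update x i (δV (x i))) := rfl

/-- The connection on multilinear maps in the direction `v`. -/
def nablaMultilinear {n : ℕ} (M : FModule F E) (M' : FModule F E') (v : F) :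
    MultilinearMap A (fun _ : Fin n => E) E' →ₗ[𝕂] MultilinearMap A (fun _ : Fin n => E) E' where
  toFun := multiDer (v : Derivation 𝕂 A A) (M.nabla v) (M'.nabla v) (M.leibniz v) (M'.leibniz v)
  map_add' σ τ := by
    ext x
    simp only [multiDer_apply, add_apply, map_add, Finset.sum_add_distrib]
    abel
  map_smul' c σ := by
    ext x
    simp only [multiDer_apply, smul_apply, map_smul, Finset.smul_sum, smul_sub, RingHom.id_apply]

lemma nablaMultilinear_apply {n : ℕ} (M : FModule F E) (M' : FModule F E') (v : F)
    (τ : MultilinearMap A (fun _ : Fin n => E) E') (x : Fin n → E) :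
    nablaMultilinear M M' v τ x =
      M'.nabla v (τ x) - ∑ i, τ (Function.update x i (M.nabla v (x i))) := rfl

/-- The representation on multilinear maps,
`(∇_v τ)(x₁, …) = ∇_v (τ (x₁, …)) - ∑ i, τ (…, ∇_v xᵢ, …)`. -/
def multilinearModule (n : ℕ) (M : FModule F E) (M' : FModule F E') :
    FModule F (MultilinearMap A (fun _ : Fin n => E) E') where
  nabla :=
    { toFun := nablaMultilinear M M'
      map_add' := fun v w => by
        refine LinearMap.ext fun τ => MultilinearMap.ext fun x => ?_
        simp only [LinearMap.add_apply, add_apply, nablaMultilinear_apply, map_add,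
          MultilinearMap.map_update_add, Finset.sum_add_distrib]
        abel
      map_smul' := fun f v => by
        refine LinearMap.ext fun τ => MultilinearMap.ext fun x => ?_
        simp only [LinearMap.smul_apply, smul_apply, nablaMultilinear_apply, map_smul,
          MultilinearMap.map_update_smul, Finset.smul_sum, smul_sub, RingHom.id_apply] }
  leibniz v f τ := by
    refine MultilinearMap.ext fun x => ?_
    change nablaMultilinear M M' v (f • τ) x = f • nablaMultilinear M M' v τ x +
      (v : Derivation 𝕂 A A) f • τ x
    simp only [nablaMultilinear_apply, smul_apply, M'.leibniz, Finset.smul_sum, smul_sub]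
    abel
  flat v w τ := by
    refine MultilinearMap.ext fun x => ?_
    change nablaMultilinear M M' ⁅v, w⁆ τ x =
      nablaMultilinear M M' v (nablaMultilinear M M' w τ) x -
      nablaMultilinear M M' w (nablaMultilinear M M' v τ) x
    simp only [nablaMultilinear_apply, M.flat, M'.flat, MultilinearMap.map_update_sub, map_sub,
      map_sum, Finset.sum_sub_distrib]
    have h : ∀ v w : F, ∑ i, ∑ j, τ (Function.update (Function.update x i (M.nabla w (x i))) j
          (M.nabla v (Function.update x i (M.nabla w (x i)) j))) =
        ∑ i, τ (Function.update x i (M.nabla v (M.nabla w (x i)))) +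
        ∑ i, ∑ j ∈ Finset.univ.erase i, τ (Function.update (Function.update x i
          (M.nabla w (x i))) j (M.nabla v (x j))) := by
      intro v w
      rw [← Finset.sum_add_distrib]
      refine Finset.sum_congr rfl fun i _ => ?_
      rw [← Finset.add_sum_erase _ _ (Finset.mem_univ i), Function.update_idem,
        Function.update_self]
      congr 1
      refine Finset.sum_congr rfl fun j hj => ?_
      rw [Function.update_of_ne (Finset.ne_of_mem_erase hj)]
    have h' : ∑ i, ∑ j ∈ Finset.univ.erase i, τ (Function.update (Function.update x i
          (M.nabla w (x i))) j (M.nabla v (x j))) =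
        ∑ i, ∑ j ∈ Finset.univ.erase i, τ (Function.update (Function.update x i
          (M.nabla v (x i))) j (M.nabla w (x j))) := by
      rw [Finset.sum_comm' (t' := Finset.univ) (s' := fun i => Finset.univ.erase i)
        (by simp [ne_comm])]
      refine Finset.sum_congr rfl fun i _ => Finset.sum_congr rfl fun j hj => ?_
      rw [Function.update_comm (Finset.ne_of_mem_erase hj)]
    rw [h, h, h']
    abel

variable (F)

/-- The tensors `Γ(B^{⊗ n} ⊗ (B^∨)^{⊗ m})`, as `A`-multilinear maps on `n` sections of `B^∨` and `m`
sections of `B`. The two notions agree since `B` is a vector bundle of finite rank. -/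
abbrev NormalTensors (n m : ℕ) : Type _ :=
  MultilinearMap A (fun _ : Fin n => Module.Dual A (NormalSections F))
    (MultilinearMap A (fun _ : Fin m => NormalSections F) A)

/-- The representation on these tensors that is induced by the Bott connection. -/
def normalTensorModule (n m : ℕ) : FModule F (NormalTensors F n m) :=
  multilinearModule n (dualModule (bottModule F))
    (multilinearModule m (bottModule F) (trivialModule F))

end Modules

/-! ### Functions and vector fields on the graded manifold `F[1]` -/

section GradedManifold

variable {𝕂 A : Type*} [CommRing 𝕂] [CommRing A] [Algebra 𝕂 A]
  (F : LieRinehartSubalgebra A (Derivation 𝕂 A A))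

instance alternatingMap_isScalarTower {V E ι : Type*} [AddCommGroup V] [Module A V]
    [AddCommGroup E] [Module A E] [Module 𝕂 E] [IsScalarTower 𝕂 A E] :
    IsScalarTower 𝕂 A (V [⋀^ι]→ₗ[A] E) where
  smul_assoc c f τ := AlternatingMap.ext fun x => smul_assoc c f (τ x)

/-- The functions on the graded manifold `F[1]`, which are the forms on `F`, `Γ(⋀ F^∨)`. -/
abbrev Functions : Type _ := Forms A F A

instance functionsAddCommGroup : AddCommGroup (Functions F) := inferInstance

instance functionsModule : Module A (Functions F) := inferInstance

instance functionsScalarModule : Module 𝕂 (Functions F) := inferInstance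

variable {F}

/-- The product of functions on `F[1]`, the wedge product. -/
def fmul : Functions F →ₗ[𝕂] Functions F →ₗ[𝕂] Functions F :=
  LinearMap.mk₂ 𝕂 (wedge (LinearMap.mul A A)) (wedge_add_left _)
    (fun c a b => by
      rw [← algebraMap_smul A c a, ← algebraMap_smul A c (wedge _ a b), wedge_smul_left])
    (wedge_add_right _)
    (fun c a b => by
      rw [← algebraMap_smul A c b, ← algebraMap_smul A c (wedge _ a b), wedge_smul_right])

lemma fmul_apply (a b : Functions F) : fmul a b = wedge (LinearMap.mul A A) a b := rfl

/-- Multiplication of functions of degree `k` by `(-1)^(p k)`. -/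
def ftwist (p : ℤ) : Functions F →ₗ[𝕂] Functions F := (twist p).restrictScalars 𝕂

lemma ftwist_apply (p : ℤ) (a : Functions F) : ftwist p a = twist p a := rfl

variable (F) in
/-- The homological vector field of `F[1]`, the Chevalley-Eilenberg differential of `F`. -/
def dF : Functions F →ₗ[𝕂] Functions F := ceDiff (trivialModule F)

lemma lieDer_twist {E : Type*} [AddCommGroup E] [Module A E] [Module 𝕂 E] [IsScalarTower 𝕂 A E]
    (M : FModule F E) (v : F) (q : ℤ) (a : Forms A F E) :
    lieDer M v (twist q a) = twist q (lieDer M v a) := formsDer_twist _ _ _ _ _ _ _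

lemma ceDiff_twist {E : Type*} [AddCommGroup E] [Module A E] [Module 𝕂 E] [IsScalarTower 𝕂 A E]
    (M : FModule F E) (q : ℤ) (a : Forms A F E) :
    ceDiff M (twist q a) = q.negOnePow • twist q (ceDiff M a) := by
  ext1 k
  cases k with
  | zero => simp [ceDiff_zero]
  | succ k =>
    ext v
    have h : q.negOnePow * (q * ((k + 1 : ℕ) : ℤ)).negOnePow = (q * k).negOnePow := by
      push_cast
      rw [mul_add, Int.negOnePow_add, mul_one, mul_comm, mul_assoc, Int.units_mul_self, mul_one]
    rw [Forms.units_smul_apply, twist_apply, smul_smul, h, AlternatingMap.smul_apply, ceDiff_succ_apply,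
      ceDiff_succ_apply, twist_apply]
    rcases Int.units_eq_one_or (q * k).negOnePow with h | h
    · simp [h]
    · have := koszulFun_smul' M (-1 : 𝕂) (a k) v
      simpa [h] using this

lemma contract_fmul (v : F) (a b : Functions F) :
    contract v (fmul a b) = fmul (contract v a) b + fmul (ftwist 1 a) (contract v b) :=
  contract_wedge _ v a b

lemma lieDer_fmul (v : F) (a b : Functions F) :
    lieDer (trivialModule F) v (fmul a b) =
      fmul (lieDer (trivialModule F) v a) b + fmul a (lieDer (trivialModule F) v b) :=
  formsDer_wedge _ _ _ _ a b

lemma dF_ftwist (a : Functions F) : dF F (ftwist 1 a) = - ftwist 1 (dF F a) := by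
  have := ceDiff_twist (trivialModule F) 1 a
  rw [Int.negOnePow_one, Units.neg_smul, one_smul] at this
  exact this

lemma contract_ftwist (v : F) (a : Functions F) :
    contract v (ftwist 1 a) = - ftwist 1 (contract v a) := by
  have := contract_twist 1 v a
  rw [Int.negOnePow_one, Units.neg_smul, one_smul] at this
  exact this

lemma ftwist_one_one (a : Functions F) : ftwist 1 (ftwist 1 a) = a := twist_one_one a

lemma contract_dF (v : F) (a : Functions F) :
    contract v (dF F a) = lieDer (trivialModule F) v a - dF F (contract v a) :=
  contract_ceDiff _ v a

lemma dF_fmul (a b : Functions F) :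
    dF F (fmul a b) = fmul (dF F a) b + fmul (ftwist 1 a) (dF F b) := by
  ext1 n
  induction n generalizing a b with
  | zero => ext v; simp [dF, ceDiff_zero, fmul_apply, wedge_zero_apply]
  | succ n ih =>
    refine forms_succ_ext fun v => ?_
    rw [contract_dF, contract_fmul, lieDer_fmul, LinearMap.map_add, LinearMap.map_add,
      contract_fmul, contract_fmul, contract_dF, contract_dF, contract_ftwist]
    simp only [Forms.add_apply, Forms.sub_apply, ih, map_sub, map_neg, LinearMap.sub_apply,
      LinearMap.neg_apply, ftwist_one_one, dF_ftwist, Forms.neg_apply]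
    abel

section Projections

variable {E : Type*} [AddCommGroup E] [Module A E]

/-- The homogeneous component of degree `k` of a form. -/
def component (k : ℤ) : Forms A F E →ₗ[A] Forms A F E where
  toFun a i := if (i : ℤ) = k then a i else 0
  map_add' a b := Forms.ext fun i => by
    change (if (i : ℤ) = k then a i + b i else 0) =
      (if (i : ℤ) = k then a i else 0) + (if (i : ℤ) = k then b i else 0)
    split_ifs <;> simp
  map_smul' c a := Forms.ext fun i => by
    change (if (i : ℤ) = k then c • a i else 0) = c • (if (i : ℤ) = k then a i else 0)
    split_ifs <;> simp

lemma component_apply (k : ℤ) (a : Forms A F E) (i : ℕ) :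
    component k a i = if (i : ℤ) = k then a i else 0 := rfl

lemma component_self (a : Forms A F E) (i : ℕ) : component i a i = a i := by
  simp [component_apply]

variable [Module 𝕂 E] [IsScalarTower 𝕂 A E]

lemma component_mem (k : ℤ) (a : Forms A F E) : component k a ∈ formsOfDegree 𝕂 k := by
  intro i hi
  simp [component_apply, hi]

lemma component_of_mem {k : ℤ} {a : Forms A F E} (ha : a ∈ formsOfDegree 𝕂 k) :
    component k a = a := by
  ext1 i
  by_cases h : (i : ℤ) = k
  · simp [component_apply, h]
  · simp [component_apply, h, ha i h]

lemma ext_component {a b : Forms A F E} (h : ∀ k : ℤ, component k a = component k b) : a = b := by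
  ext1 i
  rw [← component_self a, h, component_self]

lemma component_twist (k q : ℤ) (a : Forms A F E) :
    component k (twist q a) = (q * k).negOnePow • component k a := by
  ext1 i
  by_cases h : (i : ℤ) = k
  · subst h; simp [component_apply]
  · simp [component_apply, h]

lemma component_ceDiff (M : FModule F E) (k : ℤ) (a : Forms A F E) :
    component (k + 1) (ceDiff M a) = ceDiff M (component k a) := by
  ext1 i
  cases i with
  | zero => simp [component_apply, ceDiff_zero]
  | succ i =>
    by_cases h : (i : ℤ) = k
    · subst h
      ext v
      simp [component_apply, ceDiff_succ_apply]
    · ext v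
      simp [component_apply, ceDiff_succ_apply, h, koszulFun]

lemma wedge_component_aux {r : ℤ} {a b : Functions F} (ha : a ∈ formsOfDegree 𝕂 r) (n : ℕ)
    (hb : ∀ i : ℕ, (n : ℤ) = r + i → b i = 0) : fmul a b n = 0 := by
  induction n generalizing a b r with
  | zero =>
    ext v
    rw [fmul_apply, wedge_zero_apply]
    by_cases hr : ((0 : ℕ) : ℤ) = r
    · rw [hb 0 (by omega)]; simp
    · rw [ha 0 hr]; simp
  | succ n ih =>
    refine forms_succ_ext (b := 0) fun v => ?_
    have e1 : fmul (contract v a) b n = 0 :=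
      ih (contract_mem ha v) fun i hi => hb i (by push_cast; omega)
    have e2 : fmul (ftwist 1 a) (contract v b) n = 0 := by
      refine ih (a := ftwist 1 a) (twist_mem ha 1) fun i hi => ?_
      rw [contract_apply, hb (i + 1) (by push_cast; omega), AlternatingMap.curryLeft_zero]
      rfl
    rw [contract_fmul, Forms.add_apply, e1, e2]
    simp

lemma fmul_component {r : ℤ} {a : Functions F} (ha : a ∈ formsOfDegree 𝕂 r) (k : ℤ)
    (b : Functions F) : component (k + r) (fmul a b) = fmul a (component k b) := by
  have h : fmul a b = fmul a (component k b) + fmul a (b - component k b) := by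
    rw [← map_add, add_sub_cancel]
  have h1 : component (k + r) (fmul a (component k b)) = fmul a (component k b) := by
    refine component_of_mem (𝕂 := 𝕂) ?_
    rw [add_comm]
    exact wedge_mem _ ha (component_mem k b)
  have h2 : component (k + r) (fmul a (b - component k b)) = 0 := by
    ext1 n
    rw [component_apply]
    split_ifs with hn
    · refine wedge_component_aux ha n fun i hi => ?_
      have : (i : ℤ) = k := by omega
      simp [component_apply, this]
    · rfl
  rw [h, map_add, h1, h2, add_zero]

end Projections

/-- The vector fields of degree `p` on `F[1]`: the derivations of degree `p` of the algebra of
functions, `X (a b) = X(a) b + (-1)^(p |a|) a X(b)`. -/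
def vectorFieldsOfDegree (F : LieRinehartSubalgebra A (Derivation 𝕂 A A)) (p : ℤ) :
    Submodule 𝕂 (Functions F →ₗ[𝕂] Functions F) where
  carrier := {X | (∀ (k : ℤ) (a : Functions F), component (k + p) (X a) = X (component k a)) ∧
    ∀ a b, X (fmul a b) = fmul (X a) b + fmul (ftwist p a) (X b)}
  add_mem' := by
    rintro X Y ⟨hX, hX'⟩ ⟨hY, hY'⟩
    refine ⟨fun k a => ?_, fun a b => ?_⟩
    · simp only [LinearMap.add_apply, map_add, hX, hY]
    · simp only [LinearMap.add_apply, map_add, hX', hY']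
      abel
  zero_mem' := ⟨fun k a => by simp, fun a b => by simp⟩
  smul_mem' := by
    rintro c X ⟨hX, hX'⟩
    refine ⟨fun k a => ?_, fun a b => ?_⟩
    · have := (component (F := F) (E := A) (k + p)).map_smul_of_tower c (X a)
      simp only [LinearMap.smul_apply, this, hX]
    · simp only [LinearMap.smul_apply, map_smul, hX', smul_add]

/-- The vector fields on `F[1]`, the sums of homogeneous ones. -/
def vectorFields (F : LieRinehartSubalgebra A (Derivation 𝕂 A A)) :
    Submodule 𝕂 (Functions F →ₗ[𝕂] Functions F) := ⨆ p : ℤ, vectorFieldsOfDegree F p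

lemma vf_le (p : ℤ) : vectorFieldsOfDegree F p ≤ vectorFields F :=
  le_iSup (vectorFieldsOfDegree F) p

lemma vf_twist {p : ℤ} {X : Functions F →ₗ[𝕂] Functions F} (hX : X ∈ vectorFieldsOfDegree F p)
    (q : ℤ) (a : Functions F) : X (ftwist q a) = (q * p).negOnePow • ftwist q (X a) := by
  refine ext_component (𝕂 := 𝕂) fun k => ?_
  obtain ⟨k, rfl⟩ : ∃ l, k = l + p := ⟨k - p, by ring⟩
  rw [hX.1, map_units_smul, ftwist_apply, ftwist_apply, component_twist, component_twist, hX.1,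
    map_units_smul (A := 𝕂), smul_smul, mul_add, Int.negOnePow_add, mul_left_comm,
    Int.units_mul_self, mul_one]

/-- The operator that is `(-1)^p` on vector fields of degree `p`, see `conjTwist_eq`. -/
def conjTwist (F : LieRinehartSubalgebra A (Derivation 𝕂 A A)) :
    (Functions F →ₗ[𝕂] Functions F) →ₗ[𝕂] (Functions F →ₗ[𝕂] Functions F) where
  toFun X := ftwist 1 ∘ₗ X ∘ₗ ftwist 1
  map_add' X Y := by ext1 a; simp
  map_smul' c X := by ext1 a; simp

lemma conjTwist_eq {p : ℤ} {X : Functions F →ₗ[𝕂] Functions F}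
    (hX : X ∈ vectorFieldsOfDegree F p) : conjTwist F X = p.negOnePow • X := by
  refine LinearMap.ext fun a => ?_
  change ftwist 1 (X (ftwist 1 a)) = p.negOnePow • X a
  have h3 : ftwist 1 (ftwist 1 (X a)) = X a := twist_one_one _
  rw [vf_twist hX, one_mul, map_units_smul, h3]

lemma units_smul_mem' {M : Type*} [AddCommGroup M] [Module 𝕂 M] (S : Submodule 𝕂 M) (u : ℤˣ)
    {x : M} (hx : x ∈ S) : u • x ∈ S := by
  rcases Int.units_eq_one_or u with rfl | rfl
  · simpa
  · simpa using hx

/-- The graded commutator `X ↦ [d_F, X] = d_F X - (-1)^|X| X d_F`. -/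
def bracketQ (F : LieRinehartSubalgebra A (Derivation 𝕂 A A)) :
    (Functions F →ₗ[𝕂] Functions F) →ₗ[𝕂] (Functions F →ₗ[𝕂] Functions F) where
  toFun X := dF F ∘ₗ X - conjTwist F X ∘ₗ dF F
  map_add' X Y := by ext1 a; simp; abel
  map_smul' c X := by ext1 a; simp [smul_sub]

lemma bracketQ_apply (X : Functions F →ₗ[𝕂] Functions F) (a : Functions F) :
    bracketQ F X a = dF F (X a) - conjTwist F X (dF F a) := rfl

lemma bracketQ_mem {p : ℤ} {X : Functions F →ₗ[𝕂] Functions F}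
    (hX : X ∈ vectorFieldsOfDegree F p) : bracketQ F X ∈ vectorFieldsOfDegree F (p + 1) := by
  have hd : ∀ (k : ℤ) (a : Functions F), component (k + 1) (dF F a) = dF F (component k a) :=
    fun k a => component_ceDiff _ k a
  refine ⟨fun k a => ?_, fun a b => ?_⟩
  · rw [bracketQ_apply, bracketQ_apply, conjTwist_eq hX, map_sub, ← add_assoc, hd, hX.1,
      LinearMap.smul_apply, LinearMap.smul_apply, map_units_smul, ← hd, ← hX.1 (k + 1),
      add_right_comm]
  · have h1 : ftwist 1 (X a) = p.negOnePow • X (ftwist 1 a) := by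
      rw [vf_twist hX, one_mul, smul_smul, Int.units_mul_self, one_smul]
    have h2 : dF F (ftwist p a) = p.negOnePow • ftwist p (dF F a) := ceDiff_twist _ p a
    have h3 : ftwist 1 (ftwist p a) = ftwist (p + 1) a := by
      rw [add_comm]; exact twist_twist 1 p a
    have h4 : ftwist p (ftwist 1 a) = ftwist (p + 1) a := twist_twist p 1 a
    rcases Int.units_eq_one_or p.negOnePow with h | h <;>
    · simp only [bracketQ_apply, conjTwist_eq hX, hX.2, dF_fmul,
        LinearMap.map_add, h1, h2, h3, h4, h, one_smul, Units.neg_smul, LinearMap.map_neg,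
        LinearMap.map_sub, LinearMap.sub_apply, LinearMap.neg_apply]
      abel

end GradedManifold

/-! ### One-forms on `F[1]` and Lie derivatives along `d_F` -/

section OneForms

variable {𝕂 A : Type*} [CommRing 𝕂] [CommRing A] [Algebra 𝕂 A]
  (F : LieRinehartSubalgebra A (Derivation 𝕂 A A))

instance vectorFieldsAddCommGroup : AddCommGroup (vectorFields F) := inferInstance

instance vectorFieldsModule : Module 𝕂 (vectorFields F) := inferInstance

lemma mem_vectorFields_map (T : (Functions F →ₗ[𝕂] Functions F) →ₗ[𝕂] (Functions F →ₗ[𝕂] Functions F))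
    (h : ∀ p : ℤ, ∀ X ∈ vectorFieldsOfDegree F p, T X ∈ vectorFields F) :
    ∀ X ∈ vectorFields F, T X ∈ vectorFields F := by
  have : vectorFields F ≤ (vectorFields F).comap T := iSup_le fun p X hX => h p X hX
  exact this

/-- The parity operator `X ↦ (-1)^|X| X` on vector fields. -/
def parityVF : vectorFields F →ₗ[𝕂] vectorFields F :=
  (conjTwist F).restrict (mem_vectorFields_map F _ fun p X hX => by
    rw [conjTwist_eq hX]
    exact units_smul_mem' _ _ (vf_le p hX))

/-- The Lie derivative `X ↦ [d_F, X]` of vector fields along `d_F`. -/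
def lieVF : vectorFields F →ₗ[𝕂] vectorFields F :=
  (bracketQ F).restrict (mem_vectorFields_map F _ fun p _ hX => vf_le (p + 1) (bracketQ_mem hX))

variable {F}

lemma parityVF_eq {p : ℤ} {X : vectorFields F} (hX : X.1 ∈ vectorFieldsOfDegree F p) :
    parityVF F X = p.negOnePow • X := by
  have : (p.negOnePow • X).1 = p.negOnePow • X.1 := by
    rcases Int.units_eq_one_or p.negOnePow with h | h <;> simp [h]
  exact Subtype.ext ((conjTwist_eq hX).trans this.symm)

lemma fmul_mem {r s : ℤ} {a b : Functions F} (ha : a ∈ formsOfDegree 𝕂 r)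
    (hb : b ∈ formsOfDegree 𝕂 s) : fmul a b ∈ formsOfDegree 𝕂 (r + s) :=
  wedge_mem _ ha hb

lemma fmul_assoc (a b c : Functions F) : fmul (fmul a b) c = fmul a (fmul b c) :=
  wedge_assoc a b c

lemma fmul_comm {r : ℤ} {a : Functions F} (ha : a ∈ formsOfDegree 𝕂 r) (b : Functions F) :
    fmul a b = fmul (ftwist r b) a := wedge_comm ha b

lemma fmul_comm' {r s : ℤ} {a b : Functions F} (ha : a ∈ formsOfDegree 𝕂 r)
    (hb : b ∈ formsOfDegree 𝕂 s) : fmul a b = (r * s).negOnePow • fmul b a := by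
  rw [fmul_comm ha, ftwist_apply, twist_eq hb]
  exact wedge_units_smul_left _ _ _ _

lemma fmul_units_left (u : ℤˣ) (a b : Functions F) : fmul (u • a) b = u • fmul a b :=
  wedge_units_smul_left _ u a b

lemma fmul_units_right (u : ℤˣ) (a b : Functions F) : fmul a (u • b) = u • fmul a b :=
  wedge_units_smul_right _ u a b

lemma vfSmul_mem {r p : ℤ} {a : Functions F} (ha : a ∈ formsOfDegree 𝕂 r)
    {X : Functions F →ₗ[𝕂] Functions F} (hX : X ∈ vectorFieldsOfDegree F p) :
    fmul a ∘ₗ X ∈ vectorFieldsOfDegree F (p + r) := by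
  refine ⟨fun k b => ?_, fun b c => ?_⟩
  · rw [LinearMap.comp_apply, LinearMap.comp_apply, ← add_assoc, fmul_component ha, hX.1]
  · have h : ftwist r (ftwist p b) = ftwist (p + r) b := by
      rw [add_comm]; exact twist_twist r p b
    rw [LinearMap.comp_apply, LinearMap.comp_apply, LinearMap.comp_apply, hX.2, map_add,
      fmul_assoc, ← fmul_assoc a (ftwist p b), fmul_comm ha (ftwist p b), h, fmul_assoc]

/-- The product `a X` of a homogeneous function and a vector field. -/
def vfSmul {r : ℤ} (a : formsOfDegree (A := A) (V := F) (E := A) 𝕂 r) :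
    vectorFields F →ₗ[𝕂] vectorFields F :=
  (LinearMap.llcomp 𝕂 (Functions F) (Functions F) (Functions F) (fmul a.1)).restrict
    (mem_vectorFields_map F _ fun p _ hX => vf_le (p + r) (vfSmul_mem a.2 hX))

lemma vfSmul_apply {r : ℤ} (a : formsOfDegree (A := A) (V := F) (E := A) 𝕂 r)
    (X : vectorFields F) (b : Functions F) : (vfSmul a X).1 b = fmul a.1 (X.1 b) := rfl

variable (F)

/-- The one-forms of degree `q` on `F[1]`, that is the sections of degree `q` of the dual of the
tangent bundle: the maps `α` of degree `q` from vector fields to functions such that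
`α(a X) = (-1)^(q |a|) a α(X)`. -/
def oneFormsOfDegree (q : ℤ) : Submodule 𝕂 (vectorFields F →ₗ[𝕂] Functions F) where
  carrier := {α |
    (∀ (p : ℤ) (X : vectorFields F), X.1 ∈ vectorFieldsOfDegree F p →
      α X ∈ formsOfDegree 𝕂 (p + q)) ∧
    ∀ (r : ℤ) (a : formsOfDegree (A := A) (V := F) (E := A) 𝕂 r) (X : vectorFields F),
      α (vfSmul a X) = (q * r).negOnePow • fmul a.1 (α X)}
  add_mem' := by
    rintro α β ⟨h1, h2⟩ ⟨h3, h4⟩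
    refine ⟨fun p X hX => add_mem (h1 p X hX) (h3 p X hX), fun r a X => ?_⟩
    simp only [LinearMap.add_apply, h2, h4, map_add, smul_add]
  zero_mem' := ⟨fun p X _ => zero_mem _, fun r a X => by simp⟩
  smul_mem' := by
    rintro c α ⟨h1, h2⟩
    refine ⟨fun p X hX => Submodule.smul_mem _ c (h1 p X hX), fun r a X => ?_⟩
    simp only [LinearMap.smul_apply, h2, map_smul]
    exact smul_comm _ _ _

/-- The one-forms on `F[1]`, the sums of homogeneous ones. -/
def oneForms : Submodule 𝕂 (vectorFields F →ₗ[𝕂] Functions F) := ⨆ q : ℤ, oneFormsOfDegree F q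

instance oneFormsAddCommGroup : AddCommGroup (oneForms F) := inferInstance

instance oneFormsModule : Module 𝕂 (oneForms F) := inferInstance

variable {F}

lemma oneForms_le (q : ℤ) : oneFormsOfDegree F q ≤ oneForms F := le_iSup (oneFormsOfDegree F) q

lemma mem_oneForms_map (T : (vectorFields F →ₗ[𝕂] Functions F) →ₗ[𝕂]
      (vectorFields F →ₗ[𝕂] Functions F))
    (h : ∀ q : ℤ, ∀ α ∈ oneFormsOfDegree F q, T α ∈ oneForms F) :
    ∀ α ∈ oneForms F, T α ∈ oneForms F := by
  have : oneForms F ≤ (oneForms F).comap T := iSup_le fun p X hX => h p X hX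
  exact this

lemma exists_sum_component {X : Functions F →ₗ[𝕂] Functions F} (hX : X ∈ vectorFields F) :
    X ∈ Submodule.span 𝕂 {Y | ∃ p : ℤ, Y ∈ vectorFieldsOfDegree F p} := by
  have : vectorFields F ≤ Submodule.span 𝕂 {Y | ∃ p : ℤ, Y ∈ vectorFieldsOfDegree F p} :=
    iSup_le fun p Y hY => Submodule.subset_span ⟨p, hY⟩
  exact this hX

/-- Linear maps on vector fields are determined by their values on homogeneous ones. -/
lemma vf_ext {N : Type*} [AddCommGroup N] [Module 𝕂 N] {f g : vectorFields F →ₗ[𝕂] N}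
    (h : ∀ (p : ℤ) (X : vectorFields F), X.1 ∈ vectorFieldsOfDegree F p → f X = g X) : f = g := by
  have : vectorFields F ≤ (LinearMap.eqLocus f g).map (vectorFields F).subtype :=
    iSup_le fun p X hX => ⟨⟨X, vf_le p hX⟩, h p ⟨X, vf_le p hX⟩ hX, rfl⟩
  refine LinearMap.ext fun X => ?_
  obtain ⟨Y, hY, hYX⟩ := this X.2
  have : Y = X := Subtype.ext hYX
  subst this
  exact hY

variable (F)

/-- The operator that is `(-1)^q` on one-forms of degree `q`, see `conjDual_eq`. -/
def conjDual : (vectorFields F →ₗ[𝕂] Functions F) →ₗ[𝕂] (vectorFields F →ₗ[𝕂] Functions F) where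
  toFun α := ftwist 1 ∘ₗ α ∘ₗ parityVF F
  map_add' α β := by ext1 X; simp
  map_smul' c α := by ext1 X; simp

variable {F}

lemma conjDual_eq {q : ℤ} {α : vectorFields F →ₗ[𝕂] Functions F} (hα : α ∈ oneFormsOfDegree F q) :
    conjDual F α = q.negOnePow • α := by
  refine vf_ext fun p X hX => ?_
  change ftwist 1 (α (parityVF F X)) = q.negOnePow • α X
  rw [parityVF_eq hX, map_units_smul (A := 𝕂), map_units_smul (A := 𝕂), ftwist_apply,
    twist_eq (hα.1 p X hX), smul_smul, one_mul, Int.negOnePow_add, ← mul_assoc,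
    Int.units_mul_self, one_mul]

variable (F)

/-- The Lie derivative of one-forms along `d_F`:
`(L α)(X) = d_F (α X) - (-1)^|α| α [d_F, X]`. -/
def lieDual : (vectorFields F →ₗ[𝕂] Functions F) →ₗ[𝕂] (vectorFields F →ₗ[𝕂] Functions F) where
  toFun α := dF F ∘ₗ α - conjDual F α ∘ₗ lieVF F
  map_add' α β := by ext1 X; simp; abel
  map_smul' c α := by ext1 X; simp [smul_sub]

variable {F}

lemma lieDual_apply (α : vectorFields F →ₗ[𝕂] Functions F) (X : vectorFields F) :
    lieDual F α X = dF F (α X) - conjDual F α (lieVF F X) := rfl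

lemma dF_mem {k : ℤ} {a : Functions F} (ha : a ∈ formsOfDegree 𝕂 k) :
    dF F a ∈ formsOfDegree 𝕂 (k + 1) := by
  have h := component_ceDiff (trivialModule F) k a
  rw [component_of_mem ha] at h
  change ceDiff (trivialModule F) a ∈ _
  rw [← h]
  exact component_mem _ _

lemma ftwist_of_mem {k : ℤ} {a : Functions F} (ha : a ∈ formsOfDegree 𝕂 k) (q : ℤ) :
    ftwist q a = (q * k).negOnePow • a := twist_eq ha q

lemma lieVF_vfSmul {r : ℤ} (a : formsOfDegree (A := A) (V := F) (E := A) 𝕂 r)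
    (X : vectorFields F) : lieVF F (vfSmul a X) =
      vfSmul ⟨dF F a.1, dF_mem a.2⟩ X + r.negOnePow • vfSmul a (lieVF F X) := by
  have key : lieVF F ∘ₗ vfSmul a =
      vfSmul ⟨dF F a.1, dF_mem a.2⟩ + r.negOnePow • (vfSmul a ∘ₗ lieVF F) := by
    refine vf_ext fun p X hX => ?_
    refine Subtype.ext (LinearMap.ext fun b => ?_)
    have h1 : ∀ (u : ℤˣ) (Y : vectorFields F), (u • Y).1 b = u • Y.1 b := fun u Y => by
      rcases Int.units_eq_one_or u with rfl | rfl <;> simp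
    have h2 : (lieVF F X).1 b = dF F (X.1 b) - p.negOnePow • X.1 (dF F b) := by
      change bracketQ F X.1 b = _
      rw [bracketQ_apply, conjTwist_eq hX]
      rfl
    have h3 : (lieVF F (vfSmul a X)).1 b =
        dF F (fmul a.1 (X.1 b)) - (p + r).negOnePow • fmul a.1 (X.1 (dF F b)) := by
      change bracketQ F (fmul a.1 ∘ₗ X.1) b = _
      rw [bracketQ_apply, conjTwist_eq (vfSmul_mem a.2 hX)]
      rfl
    change (lieVF F (vfSmul a X)).1 b =
      fmul (dF F a.1) (X.1 b) + (r.negOnePow • vfSmul a (lieVF F X)).1 b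
    rw [h3, h1, vfSmul_apply, h2, dF_fmul, ftwist_of_mem a.2, one_mul, fmul_units_left, map_sub,
      fmul_units_right, smul_sub, smul_smul, Int.negOnePow_add, mul_comm r.negOnePow]
    abel
  exact LinearMap.congr_fun key X

lemma dF_units (u : ℤˣ) (a : Functions F) : dF F (u • a) = u • dF F a := by
  rcases Int.units_eq_one_or u with rfl | rfl
  · rw [one_smul, one_smul]
  · rw [Units.neg_smul, Units.neg_smul, one_smul, one_smul, LinearMap.map_neg]

set_option maxHeartbeats 2000000 in
lemma lieDual_mem {q : ℤ} {α : vectorFields F →ₗ[𝕂] Functions F} (hα : α ∈ oneFormsOfDegree F q) :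
    lieDual F α ∈ oneFormsOfDegree F (q + 1) := by
  refine ⟨fun p X hX => ?_, fun r a X => ?_⟩
  · rw [lieDual_apply, conjDual_eq hα, ← add_assoc]
    refine sub_mem (dF_mem (hα.1 p X hX)) ?_
    have h := hα.1 (p + 1) (lieVF F X) (bracketQ_mem hX)
    rw [add_right_comm] at h
    exact units_smul_mem' _ _ h
  · have h : ∀ Y, lieDual F α Y = dF F (α Y) - q.negOnePow • α (lieVF F Y) := fun Y => by
      rw [lieDual_apply, conjDual_eq hα]
      rfl
    have e1 : α (lieVF F (vfSmul a X)) = (q * (r + 1)).negOnePow • fmul (dF F a.1) (α X) +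
        r.negOnePow • (q * r).negOnePow • fmul a.1 (α (lieVF F X)) := by
      rw [lieVF_vfSmul, α.map_add, map_units_smul α, hα.2 r a, hα.2 (r + 1)]
    have e2 : dF F (α (vfSmul a X)) = (q * r).negOnePow • (fmul (dF F a.1) (α X) +
        r.negOnePow • fmul a.1 (dF F (α X))) := by
      refine (congrArg (dF F) (hα.2 r a X)).trans ((dF_units _ _).trans (congrArg _ ?_))
      refine (dF_fmul _ _).trans (congrArg _ ?_)
      rw [ftwist_of_mem a.2, one_mul, fmul_units_left]
    have e3 : fmul a.1 (dF F (α X) - q.negOnePow • α (lieVF F X)) =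
        fmul a.1 (dF F (α X)) - q.negOnePow • fmul a.1 (α (lieVF F X)) := by
      rw [(fmul a.1).map_sub, fmul_units_right]
    rw [h, h, e1, e2, e3]
    generalize fmul (dF F a.1) (α X) = x
    generalize fmul a.1 (dF F (α X)) = y
    generalize fmul a.1 (α (lieVF F X)) = z
    simp only [smul_add, smul_sub, smul_smul, mul_add, add_mul, mul_one, one_mul,
      Int.negOnePow_add]
    rcases Int.units_eq_one_or q.negOnePow with hq | hq <;>
    rcases Int.units_eq_one_or r.negOnePow with hr | hr <;>
    rcases Int.units_eq_one_or (q * r).negOnePow with hqr | hqr <;>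
    · simp only [hq, hr, hqr, mul_one, one_smul, Units.neg_smul, mul_neg,
        neg_neg]
      abel

variable (F)

/-- The parity operator `α ↦ (-1)^|α| α` on one-forms. -/
def parityForm : oneForms F →ₗ[𝕂] oneForms F :=
  (conjDual F).restrict (mem_oneForms_map _ fun p X hX => by
    rw [conjDual_eq hX]
    exact units_smul_mem' _ _ (oneForms_le p hX))

/-- The Lie derivative of one-forms along `d_F`. -/
def lieForm : oneForms F →ₗ[𝕂] oneForms F :=
  (lieDual F).restrict (mem_oneForms_map _ fun p _ hX => oneForms_le (p + 1) (lieDual_mem hX))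

variable {F}

lemma parityForm_eq {q : ℤ} {α : oneForms F} (hα : α.1 ∈ oneFormsOfDegree F q) :
    parityForm F α = q.negOnePow • α := by
  have : (q.negOnePow • α).1 = q.negOnePow • α.1 := by
    rcases Int.units_eq_one_or q.negOnePow with h | h <;> simp [h]
  exact Subtype.ext ((conjDual_eq hα).trans this.symm)

lemma formSmul_mem {r q : ℤ} {a : Functions F} (ha : a ∈ formsOfDegree 𝕂 r)
    {α : vectorFields F →ₗ[𝕂] Functions F} (hα : α ∈ oneFormsOfDegree F q) :
    fmul a ∘ₗ α ∈ oneFormsOfDegree F (q + r) := by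
  refine ⟨fun p X hX => ?_, fun s b X => ?_⟩
  · rw [LinearMap.comp_apply, ← add_assoc, add_comm]
    exact fmul_mem ha (hα.1 p X hX)
  · rw [LinearMap.comp_apply, LinearMap.comp_apply, hα.2, fmul_units_right, ← fmul_assoc,
      fmul_comm' ha b.2, fmul_units_left, fmul_assoc, smul_smul, add_mul, Int.negOnePow_add]

/-- The product `a α` of a homogeneous function and a one-form. -/
def formSmul {r : ℤ} (a : formsOfDegree (A := A) (V := F) (E := A) 𝕂 r) :
    oneForms F →ₗ[𝕂] oneForms F :=
  (LinearMap.llcomp 𝕂 (vectorFields F) (Functions F) (Functions F) (fmul a.1)).restrict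
    (mem_oneForms_map _ fun q _ hα => oneForms_le (q + r) (formSmul_mem a.2 hα))

end OneForms

/-! ### Concatenation of multilinear maps -/

section Join

variable {R : Type*} [CommRing R] {V E₁ E₂ E₃ : Type*} [AddCommGroup V] [Module R V]
  [AddCommGroup E₁] [Module R E₁] [AddCommGroup E₂] [Module R E₂] [AddCommGroup E₃] [Module R E₃]

/-- The concatenation of two multilinear maps, whose values are paired by `B`: the product uses the
first arguments for the first factor and the remaining ones for the second. -/
def joinFun (B : E₁ →ₗ[R] E₂ →ₗ[R] E₃) {k l : ℕ}
    (σ : MultilinearMap R (fun _ : Fin k => V) E₁) (τ : MultilinearMap R (fun _ : Fin l => V) E₂) :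
    MultilinearMap R (fun _ : Fin (k + l) => V) E₃ :=
  MultilinearMap.mk' (fun x => B (σ fun i => x (Fin.castAdd l i)) (τ fun i => x (Fin.natAdd k i)))
    (by
      intro x i v w
      induction i using Fin.addCases with
      | left i =>
        have h1 : ∀ u : V, (fun j => Function.update x (Fin.castAdd l i) u (Fin.castAdd l j)) =
            Function.update (fun j => x (Fin.castAdd l j)) i u := fun u =>
          Function.update_comp_eq_of_injective x (Fin.castAdd_injective k l) i u
        have h2 : ∀ u : V, (fun j => Function.update x (Fin.castAdd l i) u (Fin.natAdd k j)) =
            fun j => x (Fin.natAdd k j) := fun u => funext fun j => by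
          refine Function.update_of_ne ?_ _ _
          intro h; simp [Fin.ext_iff] at h; omega
        simp only [h1, h2, MultilinearMap.map_update_add, map_add, LinearMap.add_apply]
      | right i =>
        have h1 : ∀ u : V, (fun j => Function.update x (Fin.natAdd k i) u (Fin.natAdd k j)) =
            Function.update (fun j => x (Fin.natAdd k j)) i u := fun u =>
          Function.update_comp_eq_of_injective x (Fin.natAdd_injective l k) i u
        have h2 : ∀ u : V, (fun j => Function.update x (Fin.natAdd k i) u (Fin.castAdd l j)) =
            fun j => x (Fin.castAdd l j) := fun u => funext fun j => by
          refine Function.update_of_ne ?_ _ _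
          intro h; simp [Fin.ext_iff] at h; omega
        simp only [h1, h2, MultilinearMap.map_update_add, map_add])
    (by
      intro x i c v
      induction i using Fin.addCases with
      | left i =>
        have h1 : ∀ u : V, (fun j => Function.update x (Fin.castAdd l i) u (Fin.castAdd l j)) =
            Function.update (fun j => x (Fin.castAdd l j)) i u := fun u =>
          Function.update_comp_eq_of_injective x (Fin.castAdd_injective k l) i u
        have h2 : ∀ u : V, (fun j => Function.update x (Fin.castAdd l i) u (Fin.natAdd k j)) =
            fun j => x (Fin.natAdd k j) := fun u => funext fun j => by
          refine Function.update_of_ne ?_ _ _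
          intro h; simp [Fin.ext_iff] at h; omega
        simp only [h1, h2, MultilinearMap.map_update_smul, map_smul, LinearMap.smul_apply]
      | right i =>
        have h1 : ∀ u : V, (fun j => Function.update x (Fin.natAdd k i) u (Fin.natAdd k j)) =
            Function.update (fun j => x (Fin.natAdd k j)) i u := fun u =>
          Function.update_comp_eq_of_injective x (Fin.natAdd_injective l k) i u
        have h2 : ∀ u : V, (fun j => Function.update x (Fin.natAdd k i) u (Fin.castAdd l j)) =
            fun j => x (Fin.castAdd l j) := fun u => funext fun j => by
          refine Function.update_of_ne ?_ _ _
          intro h; simp [Fin.ext_iff] at h; omega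
        simp only [h1, h2, MultilinearMap.map_update_smul, map_smul])

lemma joinFun_apply (B : E₁ →ₗ[R] E₂ →ₗ[R] E₃) {k l : ℕ}
    (σ : MultilinearMap R (fun _ : Fin k => V) E₁) (τ : MultilinearMap R (fun _ : Fin l => V) E₂)
    (x : Fin (k + l) → V) : joinFun B σ τ x =
      B (σ fun i => x (Fin.castAdd l i)) (τ fun i => x (Fin.natAdd k i)) := rfl

/-- The concatenation, as a bilinear map. -/
def join (B : E₁ →ₗ[R] E₂ →ₗ[R] E₃) {k l : ℕ} :
    MultilinearMap R (fun _ : Fin k => V) E₁ →ₗ[R]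
      MultilinearMap R (fun _ : Fin l => V) E₂ →ₗ[R]
        MultilinearMap R (fun _ : Fin (k + l) => V) E₃ :=
  LinearMap.mk₂ R (joinFun B)
    (fun σ σ' τ => by ext x; simp [joinFun_apply])
    (fun c σ τ => by ext x; simp [joinFun_apply])
    (fun σ τ τ' => by ext x; simp [joinFun_apply])
    (fun c σ τ => by ext x; simp [joinFun_apply])

lemma join_apply (B : E₁ →ₗ[R] E₂ →ₗ[R] E₃) {k l : ℕ}
    (σ : MultilinearMap R (fun _ : Fin k => V) E₁) (τ : MultilinearMap R (fun _ : Fin l => V) E₂)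
    (x : Fin (k + l) → V) : join B σ τ x =
      B (σ fun i => x (Fin.castAdd l i)) (τ fun i => x (Fin.natAdd k i)) := rfl

end Join

/-! ### Cohomology -/

section Cohomology

variable {𝕂 M : Type*} [CommRing 𝕂] [AddCommGroup M] [Module 𝕂 M]
  (C : ℤ → Submodule 𝕂 M) (d : ℤ → M →ₗ[𝕂] M)

/-- Cocycles of degree `k` in the complex of the spaces `C k` with the differentials `d k`. -/
def cocycles (k : ℤ) : Submodule 𝕂 M := C k ⊓ LinearMap.ker (d k)

/-- Coboundaries of degree `k`. -/
def coboundaries (k : ℤ) : Submodule 𝕂 M := (C (k - 1)).map (d (k - 1))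

/-- The cohomology in degree `k`. -/
def Cohomology (k : ℤ) : Type _ :=
  cocycles C d k ⧸ (coboundaries C d k).submoduleOf (cocycles C d k)

instance (k : ℤ) : AddCommGroup (Cohomology C d k) :=
  inferInstanceAs (AddCommGroup (cocycles C d k ⧸
    (coboundaries C d k).submoduleOf (cocycles C d k)))

instance (k : ℤ) : Module 𝕂 (Cohomology C d k) :=
  inferInstanceAs (Module 𝕂 (cocycles C d k ⧸
    (coboundaries C d k).submoduleOf (cocycles C d k)))

/-- The cohomology class of a cocycle. -/
def cohomologyClass (k : ℤ) : cocycles C d k →ₗ[𝕂] Cohomology C d k :=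
  Submodule.mkQ ((coboundaries C d k).submoduleOf (cocycles C d k))

end Cohomology

/-! ### Graded multilinear maps

Here `Ω` stands for the functions, `D` for the one-forms and `X` for the vector fields. -/

section MultilinearForms

variable {𝕂 Ω D X : Type*} [CommRing 𝕂] [AddCommGroup Ω] [Module 𝕂 Ω] [AddCommGroup D] [Module 𝕂 D]
  [AddCommGroup X] [Module 𝕂 X]

variable (𝕂 Ω D X) in
/-- The space of all `𝕂`-multilinear maps on `n` arguments from `D` and `m` from `X`. -/
abbrev MultilinearForms (n m : ℕ) : Type _ :=
  MultilinearMap 𝕂 (fun _ : Fin n => D) (MultilinearMap 𝕂 (fun _ : Fin m => X) Ω)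

variable {n m : ℕ}

/-- The `Ω`-multilinear maps of degree `k`, in the graded sense. For homogeneous arguments, `τ (α; x)`
has degree `k` plus the sum of the degrees of the arguments, and a homogeneous function `a` of degree
`r` comes out of an argument with the sign `(-1)^(r s)`, where `s` is `k` plus the sum of the degrees
of the arguments that stand before. The arguments in `D` stand before those in `X`. -/
def gradedMultilinearForms (gradΩ : ℤ → Submodule 𝕂 Ω) (gradD : ℤ → Submodule 𝕂 D)
    (gradX : ℤ → Submodule 𝕂 X) (mul : Ω →ₗ[𝕂] Ω →ₗ[𝕂] Ω)
    (actD : ∀ r, gradΩ r → D →ₗ[𝕂] D) (actX : ∀ r, gradΩ r → X →ₗ[𝕂] X) (n m : ℕ) (k : ℤ) :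
    Submodule 𝕂 (MultilinearForms 𝕂 Ω D X n m) where
  carrier := {τ | ∀ (p : Fin n → ℤ) (q : Fin m → ℤ) (α : Fin n → D) (x : Fin m → X),
      (∀ i, α i ∈ gradD (p i)) → (∀ j, x j ∈ gradX (q j)) →
      τ α x ∈ gradΩ (k + ∑ i, p i + ∑ j, q j) ∧
      ∀ (r : ℤ) (a : gradΩ r),
        (∀ i, τ (Function.update α i (actD r a (α i))) x =
          (r * (k + ∑ i' ∈ Finset.Iio i, p i')).negOnePow • mul a.1 (τ α x)) ∧
        ∀ j, τ α (Function.update x j (actX r a (x j))) =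
          (r * (k + ∑ i, p i + ∑ j' ∈ Finset.Iio j, q j')).negOnePow • mul a.1 (τ α x)}
  add_mem' := by
    intro σ τ hσ hτ p q α x hα hx
    obtain ⟨h1, h2⟩ := hσ p q α x hα hx
    obtain ⟨h3, h4⟩ := hτ p q α x hα hx
    refine ⟨add_mem h1 h3, fun r a => ⟨fun i => ?_, fun j => ?_⟩⟩
    · simp only [_root_.add_apply, (h2 r a).1 i, (h4 r a).1 i, map_add, smul_add]
    · simp only [_root_.add_apply, (h2 r a).2 j, (h4 r a).2 j, map_add, smul_add]
  zero_mem' := fun p q α x hα hx => ⟨zero_mem _, fun r a => ⟨fun i => by simp, fun j => by simp⟩⟩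
  smul_mem' := by
    intro c σ hσ p q α x hα hx
    obtain ⟨h1, h2⟩ := hσ p q α x hα hx
    refine ⟨Submodule.smul_mem _ c h1, fun r a => ⟨fun i => ?_, fun j => ?_⟩⟩
    · simp only [_root_.smul_apply, (h2 r a).1 i, map_smul]
      exact smul_comm _ _ _
    · simp only [_root_.smul_apply, (h2 r a).2 j, map_smul]
      exact smul_comm _ _ _

/-- Composition with linear maps in the arguments. -/
def pullback (f : Fin n → (D →ₗ[𝕂] D)) (g : Fin m → (X →ₗ[𝕂] X)) :
    MultilinearForms 𝕂 Ω D X n m →ₗ[𝕂] MultilinearForms 𝕂 Ω D X n m :=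
  MultilinearMap.compLinearMapₗ f ∘ₗ
    (MultilinearMap.compLinearMapₗ g).compMultilinearMapₗ 𝕂

lemma pullback_apply (f : Fin n → (D →ₗ[𝕂] D)) (g : Fin m → (X →ₗ[𝕂] X))
    (τ : MultilinearForms 𝕂 Ω D X n m) (α : Fin n → D) (x : Fin m → X) :
    pullback f g τ α x = τ (fun i => f i (α i)) (fun j => g j (x j)) := rfl

/-- Composition with a linear map on the values. -/
def pushforward (f : Ω →ₗ[𝕂] Ω) :
    MultilinearForms 𝕂 Ω D X n m →ₗ[𝕂] MultilinearForms 𝕂 Ω D X n m :=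
  (f.compMultilinearMapₗ 𝕂).compMultilinearMapₗ 𝕂

lemma pushforward_apply (f : Ω →ₗ[𝕂] Ω) (τ : MultilinearForms 𝕂 Ω D X n m)
    (α : Fin n → D) (x : Fin m → X) : pushforward f τ α x = f (τ α x) := rfl

/-- The family of operators with `ε` before the place `i`, `T` at `i` and the identity behind. -/
def insertAt {N : ℕ} (ε T : X →ₗ[𝕂] X) (i l : Fin N) : X →ₗ[𝕂] X :=
  if l < i then ε else if l = i then T else LinearMap.id

/-- The Lie derivative of a multilinear map `τ` of degree `k` on arguments `x₁, …, x_N` (first those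
from `D`, then those from `X`):
`(L τ)(x₁, …, x_N) = d (τ (x₁, …, x_N))
  - (-1)^k ∑ i, (-1)^(|x₁| + ⋯ + |xᵢ₋₁|) τ (x₁, …, L xᵢ, …, x_N)`. -/
def gradedLie (d : Ω →ₗ[𝕂] Ω) (εD LD : D →ₗ[𝕂] D) (εX LX : X →ₗ[𝕂] X) (n m : ℕ) (k : ℤ) :
    MultilinearForms 𝕂 Ω D X n m →ₗ[𝕂] MultilinearForms 𝕂 Ω D X n m :=
  pushforward d - k.negOnePow •
    ((∑ i, pullback (insertAt εD LD i) fun _ => LinearMap.id) +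
      ∑ j, pullback (fun _ => εD) (insertAt εX LX j))

/-- The product of the values of two multilinear maps, without signs. -/
def plainProduct (mul : Ω →ₗ[𝕂] Ω →ₗ[𝕂] Ω) {n₁ m₁ n₂ m₂ : ℕ} :
    MultilinearForms 𝕂 Ω D X n₁ m₁ →ₗ[𝕂] MultilinearForms 𝕂 Ω D X n₂ m₂ →ₗ[𝕂]
      MultilinearForms 𝕂 Ω D X (n₁ + n₂) (m₁ + m₂) :=
  join (join mul)

/-- The tensor product of multilinear maps `σ` and `τ` with the Koszul sign, `τ` being of degree `k`:
`(σ ⊗ τ)(α', α''; x', x'') = (-1)^(k (|α'| + |x'|) + |x'| |α''|) σ(α'; x') τ(α''; x'')`,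
see `gradedProduct_apply`. Here `εD` and `εX` are the parity operators, and `(-1)^(u w)` is written as
`(1 + (-1)^u + (-1)^w - (-1)^u (-1)^w) / 2`. -/
def gradedProduct (mul : Ω →ₗ[𝕂] Ω →ₗ[𝕂] Ω) (εD : D →ₗ[𝕂] D) (εX : X →ₗ[𝕂] X)
    {n₁ m₁ n₂ m₂ : ℕ} (k : ℤ) (σ : MultilinearForms 𝕂 Ω D X n₁ m₁)
    (τ : MultilinearForms 𝕂 Ω D X n₂ m₂) :
    MultilinearForms 𝕂 Ω D X (n₁ + n₂) (m₁ + m₂) :=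
  let σ₀ := if Even k then σ else pullback (fun _ => εD) (fun _ => εX) σ
  let σ₁ := pullback (fun _ => LinearMap.id) (fun _ => εX) σ₀
  let τ₁ := pullback (fun _ => εD) (fun _ => LinearMap.id) τ
  Ring.inverse (2 : 𝕂) • (plainProduct mul σ₀ τ + plainProduct mul σ₁ τ +
    plainProduct mul σ₀ τ₁ - plainProduct mul σ₁ τ₁)

lemma multilinear_units_smul {R ι M N : Type*} [CommRing R] [Fintype ι]
    [AddCommGroup M] [Module R M] [AddCommGroup N] [Module R N]
    (f : MultilinearMap R (fun _ : ι => M) N) (u : ι → ℤˣ) (x : ι → M) :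
    f (fun i => u i • x i) = (∏ i, u i) • f x := by
  classical
  have h := f.map_smul_univ (fun i => (((u i : ℤˣ) : ℤ) : R)) x
  have e1 : ∀ i, (((u i : ℤˣ) : ℤ) : R) • x i = u i • x i := fun i => by
    rcases Int.units_eq_one_or (u i) with h | h <;> simp [h]
  have e2 : (∏ i, (((u i : ℤˣ) : ℤ) : R)) = (((∏ i, u i : ℤˣ) : ℤ) : R) := by
    push_cast; rfl
  rw [e2] at h
  simp only [e1] at h
  rw [h]
  rcases Int.units_eq_one_or (∏ i, u i) with h | h <;> simp [h]

lemma prod_negOnePow {ι : Type*} (s : Finset ι) (p : ι → ℤ) :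
    ∏ i ∈ s, (p i).negOnePow = (∑ i ∈ s, p i).negOnePow := by
  classical
  induction s using Finset.induction_on with
  | empty => simp
  | insert i s hi ih => rw [Finset.prod_insert hi, Finset.sum_insert hi, ih, Int.negOnePow_add]

lemma parity_apply {εX : X →ₗ[𝕂] X} {q : Fin m → ℤ} {x : Fin m → X}
    (hx : ∀ j, εX (x j) = (q j).negOnePow • x j) (f : MultilinearMap 𝕂 (fun _ : Fin m => X) Ω) :
    f (fun j => εX (x j)) = (∑ j, q j).negOnePow • f x := by
  simp only [hx, multilinear_units_smul, prod_negOnePow]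

/-- The formula for the tensor product on homogeneous arguments. -/
lemma gradedProduct_apply [Invertible (2 : 𝕂)] (mul : Ω →ₗ[𝕂] Ω →ₗ[𝕂] Ω) (εD : D →ₗ[𝕂] D)
    (εX : X →ₗ[𝕂] X) {n₁ m₁ n₂ m₂ : ℕ} (k : ℤ) (σ : MultilinearForms 𝕂 Ω D X n₁ m₁)
    (τ : MultilinearForms 𝕂 Ω D X n₂ m₂) {p : Fin (n₁ + n₂) → ℤ} {q : Fin (m₁ + m₂) → ℤ}
    {α : Fin (n₁ + n₂) → D} {x : Fin (m₁ + m₂) → X}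
    (hα : ∀ i, εD (α i) = (p i).negOnePow • α i) (hx : ∀ j, εX (x j) = (q j).negOnePow • x j) :
    gradedProduct mul εD εX k σ τ α x =
      (k * (∑ i, p (Fin.castAdd n₂ i) + ∑ j, q (Fin.castAdd m₂ j)) +
        (∑ j, q (Fin.castAdd m₂ j)) * ∑ i, p (Fin.natAdd n₁ i)).negOnePow •
      mul (σ (fun i => α (Fin.castAdd n₂ i)) fun j => x (Fin.castAdd m₂ j))
        (τ (fun i => α (Fin.natAdd n₁ i)) fun j => x (Fin.natAdd m₁ j)) := by
  have happ : ∀ {a b : ℕ} (u : ℤˣ) (f : MultilinearMap 𝕂 (fun _ : Fin a => D)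
      (MultilinearMap 𝕂 (fun _ : Fin b => X) Ω)) y z, (u • f y) z = u • f y z :=
    fun u f y z => rfl
  have h1 : ∀ f : MultilinearForms 𝕂 Ω D X n₁ m₁,
      pullback (fun _ => LinearMap.id) (fun _ => εX) f (fun i => α (Fin.castAdd n₂ i))
        (fun j => x (Fin.castAdd m₂ j)) = (∑ j, q (Fin.castAdd m₂ j)).negOnePow •
        f (fun i => α (Fin.castAdd n₂ i)) (fun j => x (Fin.castAdd m₂ j)) := fun f =>
    parity_apply (fun j => hx (Fin.castAdd m₂ j)) (f fun i => α (Fin.castAdd n₂ i))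
  have h2 : pullback (fun _ => εD) (fun _ => LinearMap.id) τ (fun i => α (Fin.natAdd n₁ i))
        (fun j => x (Fin.natAdd m₁ j)) = (∑ i, p (Fin.natAdd n₁ i)).negOnePow •
        τ (fun i => α (Fin.natAdd n₁ i)) (fun j => x (Fin.natAdd m₁ j)) :=
    congrArg (fun f => f fun j => x (Fin.natAdd m₁ j))
      (parity_apply (fun i => hα (Fin.natAdd n₁ i)) τ)
  have h3 : (if Even k then σ else pullback (fun _ => εD) (fun _ => εX) σ)
      (fun i => α (Fin.castAdd n₂ i)) (fun j => x (Fin.castAdd m₂ j)) =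
      (k * (∑ i, p (Fin.castAdd n₂ i) + ∑ j, q (Fin.castAdd m₂ j))).negOnePow •
        σ (fun i => α (Fin.castAdd n₂ i)) fun j => x (Fin.castAdd m₂ j) := by
    split_ifs with hk
    · rw [Int.negOnePow_even _ (hk.mul_right _), one_smul]
    · have e := parity_apply (fun i => hα (Fin.castAdd n₂ i)) σ
      rw [pullback_apply, parity_apply (fun j => hx (Fin.castAdd m₂ j)), e, happ, smul_smul,
        ← Int.negOnePow_add, add_comm]
      congr 1
      have : Odd k := Int.not_even_iff_odd.mp hk
      obtain ⟨l, rfl⟩ := this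
      rw [add_mul, Int.negOnePow_add (2 * l * _), one_mul, mul_assoc, Int.negOnePow_two_mul, one_mul]
  simp only [gradedProduct, plainProduct, _root_.smul_apply, _root_.add_apply,
    _root_.sub_apply, join_apply, h1, h2, h3]
  generalize σ (fun i => α (Fin.castAdd n₂ i)) (fun j => x (Fin.castAdd m₂ j)) = s
  generalize τ (fun i => α (Fin.natAdd n₁ i)) (fun j => x (Fin.natAdd m₁ j)) = t
  generalize (∑ j, q (Fin.castAdd m₂ j)) = u
  generalize (∑ i, p (Fin.natAdd n₁ i)) = w
  generalize (∑ i, p (Fin.castAdd n₂ i)) = z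
  rw [Int.negOnePow_add (k * _)]
  have key : ∀ y : Ω, Ring.inverse (2 : 𝕂) • (y + y) = y := fun y => by
    rw [← two_smul 𝕂 y, smul_smul, Ring.inverse_mul_cancel _ (isUnit_of_invertible 2), one_smul]
  have hm : ∀ (v : ℤˣ) (s t : Ω), mul (v • s) t = v • mul s t := fun v s t => by
    rcases Int.units_eq_one_or v with rfl | rfl <;> simp
  have hm' : ∀ (v : ℤˣ) (s t : Ω), mul s (v • t) = v • mul s t := fun v s t => by
    rcases Int.units_eq_one_or v with rfl | rfl <;> simp
  simp only [hm, hm', smul_smul]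
  generalize (k * (z + u)).negOnePow = c
  generalize mul s t = y
  rcases Int.even_or_odd u with hu | hu <;> rcases Int.even_or_odd w with hw | hw
  · simp only [Int.negOnePow_even _ hu, Int.negOnePow_even _ hw,
      Int.negOnePow_even _ (hu.mul_right w), one_mul, mul_one, add_sub_cancel_right, key]
  · simp only [Int.negOnePow_even _ hu, Int.negOnePow_odd _ hw,
      Int.negOnePow_even _ (hu.mul_right w), one_mul, mul_one, add_sub_cancel_right, key]
  · simp only [Int.negOnePow_odd _ hu, Int.negOnePow_even _ hw,
      Int.negOnePow_even _ (hw.mul_left u), mul_one, add_sub_cancel_right, key,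
      add_right_comm (c • y)]
  · simp only [Int.negOnePow_odd _ hu, Int.negOnePow_odd _ hw,
      Int.negOnePow_odd _ (hu.mul hw), mul_one, mul_neg, neg_mul, one_mul, neg_neg,
      Units.neg_smul]
    have e : c • y + -(c • y) + -(c • y) - c • y = -(c • y) + -(c • y) := by abel
    rw [e, key]

end MultilinearForms

/-! ### Tensor fields on `F[1]` and the two cohomologies -/

section Cochains

variable {𝕂 A : Type*} [CommRing 𝕂] [CommRing A] [Algebra 𝕂 A]
  (F : LieRinehartSubalgebra A (Derivation 𝕂 A A))

/-- Multilinear maps from one-forms and vector fields on `F[1]` to functions. -/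
abbrev MultilinearFormsOn (n m : ℕ) : Type _ :=
  MultilinearForms 𝕂 (Functions F) (oneForms F) (vectorFields F) n m

/-- The tensor fields on `F[1]` of type `(n, m)` and degree `k`, that is the sections of degree `k` of
`T^{⊗ n} ⊗ (T^∨)^{⊗ m}` for the tangent bundle `T` of `F[1]`. They are the graded multilinear maps on
`n` one-forms and `m` vector fields; a vector field `X` acts on one-forms by
`α ↦ (-1)^(|X| |α|) α(X)`. The two notions agree since `T` is a graded vector bundle of finite rank. -/
def tensorFieldsOfDegree (n m : ℕ) (k : ℤ) : Submodule 𝕂 (MultilinearFormsOn F n m) :=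
  gradedMultilinearForms (formsOfDegree 𝕂)
    (fun q => (oneFormsOfDegree F q).comap (oneForms F).subtype)
    (fun p => (vectorFieldsOfDegree F p).comap (vectorFields F).subtype)
    fmul (fun _ => formSmul) (fun _ => vfSmul) n m k

/-- The Lie derivative of tensor fields of degree `k` along `d_F`. -/
def lieTensor (n m : ℕ) (k : ℤ) : MultilinearFormsOn F n m →ₗ[𝕂] MultilinearFormsOn F n m :=
  gradedLie (dF F) (parityForm F) (lieForm F) (parityVF F) (lieVF F) n m k

/-- The tensor fields of type `(n, m)` and degree `k` with `L τ = 0`. -/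
abbrev tensorCocycles (n m : ℕ) (k : ℤ) : Submodule 𝕂 (MultilinearFormsOn F n m) :=
  cocycles (tensorFieldsOfDegree F n m) (lieTensor F n m) k

/-- The cohomology in degree `k` of the tensor fields of type `(n, m)` with the Lie derivative. -/
def TensorCohomology (n m : ℕ) (k : ℤ) : Type _ :=
  Cohomology (tensorFieldsOfDegree F n m) (lieTensor F n m) k

instance (n m : ℕ) (k : ℤ) : AddCommGroup (TensorCohomology F n m k) :=
  inferInstanceAs (AddCommGroup (Cohomology (tensorFieldsOfDegree F n m) (lieTensor F n m) k))

instance (n m : ℕ) (k : ℤ) : Module 𝕂 (TensorCohomology F n m k) :=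
  inferInstanceAs (Module 𝕂 (Cohomology (tensorFieldsOfDegree F n m) (lieTensor F n m) k))

/-- The cohomology class of a tensor field with `L τ = 0`. -/
def tensorClass {n m : ℕ} {k : ℤ} : tensorCocycles F n m k →ₗ[𝕂] TensorCohomology F n m k :=
  cohomologyClass (tensorFieldsOfDegree F n m) (lieTensor F n m) k

/-- The tensor product of two tensor fields, the second of which has degree `k`. -/
def tensorFieldProduct {n₁ m₁ n₂ m₂ : ℕ} (k : ℤ) (σ : MultilinearFormsOn F n₁ m₁)
    (τ : MultilinearFormsOn F n₂ m₂) : MultilinearFormsOn F (n₁ + n₂) (m₁ + m₂) :=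
  gradedProduct fmul (parityForm F) (parityVF F) k σ τ

/-- The Chevalley-Eilenberg cocycles of degree `k` with values in the tensors of `B`. -/
abbrev ceCocycles (n m : ℕ) (k : ℤ) : Submodule 𝕂 (Forms A F (NormalTensors F n m)) :=
  cocycles (formsOfDegree 𝕂) (fun _ => ceDiff (normalTensorModule F n m)) k

/-- The Chevalley-Eilenberg cohomology of `F` in degree `k` with values in the tensors of type `(n, m)`
of `B`. -/
def CECohomology (n m : ℕ) (k : ℤ) : Type _ :=
  Cohomology (formsOfDegree (A := A) (V := F) 𝕂) (fun _ => ceDiff (normalTensorModule F n m)) k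

instance (n m : ℕ) (k : ℤ) : AddCommGroup (CECohomology F n m k) :=
  inferInstanceAs (AddCommGroup
    (Cohomology (formsOfDegree (A := A) (V := F) 𝕂) (fun _ => ceDiff (normalTensorModule F n m)) k))

instance (n m : ℕ) (k : ℤ) : Module 𝕂 (CECohomology F n m k) :=
  inferInstanceAs (Module 𝕂
    (Cohomology (formsOfDegree (A := A) (V := F) 𝕂) (fun _ => ceDiff (normalTensorModule F n m)) k))

/-- The cohomology class of a Chevalley-Eilenberg cocycle. -/
def ceClass {n m : ℕ} {k : ℤ} : ceCocycles F n m k →ₗ[𝕂] CECohomology F n m k :=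
  cohomologyClass (formsOfDegree (A := A) (V := F) 𝕂) (fun _ => ceDiff (normalTensorModule F n m)) k

/-- The tensor product of tensors of `B`,
`(s ⊗ t)(ω', ω''; Z', Z'') = s(ω'; Z') t(ω''; Z'')`. -/
def normalTensorProduct (n₁ m₁ n₂ m₂ : ℕ) : NormalTensors F n₁ m₁ →ₗ[A] NormalTensors F n₂ m₂ →ₗ[A]
    NormalTensors F (n₁ + n₂) (m₁ + m₂) :=
  join (join (LinearMap.mul A A))

/-- The tensor product of forms with values in the tensors of `B`. -/
def ceProduct {n₁ m₁ n₂ m₂ : ℕ} (s : Forms A F (NormalTensors F n₁ m₁))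
    (t : Forms A F (NormalTensors F n₂ m₂)) : Forms A F (NormalTensors F (n₁ + n₂) (m₁ + m₂)) :=
  wedge (normalTensorProduct F n₁ m₁ n₂ m₂) s t

end Cochains

/-! ### The maps `φ` and `ψ_j` -/

section Comparison

variable {𝕂 A : Type*} [CommRing 𝕂] [CommRing A] [Algebra 𝕂 A]
  {F : LieRinehartSubalgebra A (Derivation 𝕂 A A)}

variable (F) in
/-- A function on the base as a function of degree zero on `F[1]`. -/
def ofFun : A →ₗ[A] Functions F where
  toFun f
    | 0 => AlternatingMap.constOfIsEmpty A F (Fin 0) f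
    | _ + 1 => 0
  map_add' f g := by
    ext1 k
    cases k with
    | zero => rfl
    | succ k => exact (add_zero 0).symm
  map_smul' c f := by
    ext1 k
    cases k with
    | zero => rfl
    | succ k => exact (smul_zero c).symm

lemma ofFun_zero_apply (f : A) (v : Fin 0 → F) : ofFun F f 0 v = f := rfl

lemma ofFun_succ (f : A) (k : ℕ) : ofFun F f (k + 1) = 0 := rfl

lemma ofFun_mem (f : A) : ofFun F f ∈ formsOfDegree 𝕂 0 := by
  intro i hi
  cases i with
  | zero => exact absurd rfl hi
  | succ i => rfl

lemma contract_ofFun (v : F) (f : A) : contract v (ofFun F f) = 0 := by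
  ext k
  simp [contract_apply, ofFun_succ]

lemma twist_ofFun (q : ℤ) (f : A) : twist q (ofFun F f) = ofFun F f := by
  ext1 k
  cases k with
  | zero => simp
  | succ k => simp [ofFun_succ]

lemma fmul_ofFun_left (f : A) (a : Functions F) : fmul (ofFun F f) a = f • a := by
  ext1 n
  induction n generalizing a with
  | zero => ext v; simp [fmul_apply, wedge_zero_apply, ofFun_zero_apply]
  | succ n ih =>
    refine forms_succ_ext fun v => ?_
    rw [contract_fmul, contract_ofFun, ftwist_apply, twist_ofFun, map_zero, LinearMap.zero_apply,
      zero_add, ih, map_smul]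

lemma fmul_ofFun_right (f : A) (a : Functions F) : fmul a (ofFun F f) = f • a := by
  ext1 n
  induction n generalizing a with
  | zero => ext v; simp [fmul_apply, wedge_zero_apply, ofFun_zero_apply, mul_comm]
  | succ n ih =>
    refine forms_succ_ext fun v => ?_
    rw [contract_fmul, contract_ofFun, map_zero, add_zero, ih, map_smul]

lemma vf_ofFun_mul (X : vectorFields F) (f g : A) :
    X.1 (ofFun F (f * g)) = f • X.1 (ofFun F g) + g • X.1 (ofFun F f) := by
  have h1 : ofFun F (f * g) = fmul (ofFun F f) (ofFun F g) := by
    rw [fmul_ofFun_left, ← map_smul, smul_eq_mul]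
  have key : vectorFields F ≤ LinearMap.ker
      (LinearMap.applyₗ (R := 𝕂) (M₂ := Functions F) (ofFun F (f * g)) -
        (f • LinearMap.applyₗ (R := 𝕂) (M₂ := Functions F) (ofFun F g) +
          g • LinearMap.applyₗ (R := 𝕂) (M₂ := Functions F) (ofFun F f))) := by
    refine iSup_le fun p X hX => ?_
    rw [LinearMap.mem_ker]
    change X (ofFun F (f * g)) - (f • X (ofFun F g) + g • X (ofFun F f)) = 0
    rw [h1, hX.2, fmul_ofFun_right, ftwist_apply, twist_ofFun, fmul_ofFun_left]
    abel
  have := key X.2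
  rw [LinearMap.mem_ker] at this
  exact sub_eq_zero.mp this

/-- The projection of a vector field `X` on `F[1]` to the base, a form on `F` with values in vector
fields: `f ↦ X(f)` for functions `f` on the base. -/
def restrictDer (X : vectorFields F) : Forms A F (Derivation 𝕂 A A) := fun k =>
  { toFun := fun v => Derivation.mk'
      { toFun := fun f => X.1 (ofFun F f) k v
        map_add' := fun f g => by
          rw [map_add, map_add]
          rfl
        map_smul' := fun c f => by
          have : ofFun F (c • f) = c • ofFun F f := by
            rw [← algebraMap_smul A c f, map_smul, algebraMap_smul]
          rw [this, map_smul]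
          rfl }
      (fun f g => by
        change X.1 (ofFun F (f * g)) k v = _
        rw [vf_ofFun_mul]
        rfl)
    map_update_add' := fun v i x y => by
      ext f
      exact (X.1 (ofFun F f) k).map_update_add v i x y
    map_update_smul' := fun v i c x => by
      ext f
      exact (X.1 (ofFun F f) k).map_update_smul v i c x
    map_eq_zero_of_eq' := fun v i j hij hne => by
      ext f
      exact (X.1 (ofFun F f) k).map_eq_zero_of_eq v hij hne }

lemma restrictDer_apply (X : vectorFields F) (k : ℕ) (v : Fin k → F) (f : A) :
    restrictDer X k v f = X.1 (ofFun F f) k v := rfl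

/-- Composition of a form with a linear map on the values. -/
def mapForms {E E' : Type*} [AddCommGroup E] [Module A E] [AddCommGroup E'] [Module A E']
    (g : E →ₗ[A] E') : Forms A F E →ₗ[A] Forms A F E' where
  toFun a k := g.compAlternatingMap (a k)
  map_add' a b := by ext k v; exact map_add g _ _
  map_smul' c a := by ext k v; exact map_smul g _ _

lemma mapForms_apply {E E' : Type*} [AddCommGroup E] [Module A E] [AddCommGroup E'] [Module A E']
    (g : E →ₗ[A] E') (a : Forms A F E) (k : ℕ) (v : Fin k → F) :
    mapForms g a k v = g (a k v) := rfl

lemma mapForms_wedge {E₁ E₂ E₃ E₂' E₃' : Type*} [AddCommGroup E₁] [Module A E₁] [AddCommGroup E₂]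
    [Module A E₂] [AddCommGroup E₃] [Module A E₃] [AddCommGroup E₂'] [Module A E₂']
    [AddCommGroup E₃'] [Module A E₃'] (p : E₁ →ₗ[A] E₂ →ₗ[A] E₃) (p' : E₁ →ₗ[A] E₂' →ₗ[A] E₃')
    (g : E₂ →ₗ[A] E₂') (h : E₃ →ₗ[A] E₃') (hp : ∀ x y, h (p x y) = p' x (g y))
    (a : Forms A F E₁) (b : Forms A F E₂) :
    mapForms h (wedge p a b) = wedge p' a (mapForms g b) := by
  ext1 n
  induction n generalizing a b with
  | zero => ext v; simp [mapForms_apply, wedge_zero_apply, hp]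
  | succ n ih =>
    refine forms_succ_ext fun v => ?_
    have e1 : contract v (mapForms h (wedge p a b)) = mapForms h (contract v (wedge p a b)) := rfl
    have e2 : contract v (mapForms g b) = mapForms g (contract v b) := rfl
    rw [e1, contract_wedge, contract_wedge, map_add, Forms.add_apply, Forms.add_apply, ih, e2, ih]

/-- The map `φ` from vector fields on `F[1]` to forms on `F` with values in `B`: the projection to the
base, followed by the projection onto `B`. -/
def normalPart (X : vectorFields F) : Forms A F (NormalSections F) :=
  mapForms F.toSubmodule.mkQ (restrictDer X)

lemma restrictDer_vfSmul {r : ℤ} (a : formsOfDegree (A := A) (V := F) (E := A) 𝕂 r)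
    (X : vectorFields F) :
    restrictDer (vfSmul a X) = wedge (LinearMap.lsmul A _) a.1 (restrictDer X) := by
  ext k v f
  let ev : Derivation 𝕂 A A →ₗ[A] A :=
    { toFun := fun D => D f, map_add' := fun _ _ => rfl, map_smul' := fun _ _ => rfl }
  have := mapForms_wedge (F := F) (LinearMap.lsmul A (Derivation 𝕂 A A)) (LinearMap.mul A A) ev ev
    (fun _ _ => rfl) a.1 (restrictDer X)
  exact (congrArg (fun w => w k v) this).symm

lemma normalPart_vfSmul {r : ℤ} (a : formsOfDegree (A := A) (V := F) (E := A) 𝕂 r)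
    (X : vectorFields F) :
    normalPart (vfSmul a X) = wedge (LinearMap.lsmul A _) a.1 (normalPart X) := by
  rw [normalPart, restrictDer_vfSmul]
  exact mapForms_wedge _ _ _ _ (fun _ _ => map_smul _ _ _) _ _

/-- The pull-back along `φ` of a section `ω` of `B^∨`, as a linear map on vector fields: `X ↦ ω(φ X)`. -/
def phiDualFun (ω : Module.Dual A (NormalSections F)) : vectorFields F →ₗ[𝕂] Functions F where
  toFun X := mapForms ω (normalPart X)
  map_add' X Y := by
    have : restrictDer (X + Y) = restrictDer X + restrictDer Y := by
      ext k v f; rfl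
    rw [normalPart, this, map_add, map_add]
    rfl
  map_smul' c X := by
    have : restrictDer (c • X) = c • restrictDer X := by
      ext k v f; rfl
    rw [normalPart, this, LinearMap.map_smul_of_tower, LinearMap.map_smul_of_tower]
    rfl

lemma phiDualFun_mem (ω : Module.Dual A (NormalSections F)) :
    phiDualFun ω ∈ oneFormsOfDegree F 0 := by
  refine ⟨fun p X hX => ?_, fun r a X => ?_⟩
  · rw [add_zero]
    intro i hi
    have h : restrictDer X i = 0 := by
      ext v f
      have := hX.1 0 (ofFun F f)
      rw [component_of_mem (𝕂 := 𝕂) (ofFun_mem f), zero_add] at this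
      rw [restrictDer_apply, ← this, component_apply, if_neg hi]
      rfl
    ext v
    change ω (F.toSubmodule.mkQ (restrictDer X i v)) = 0
    rw [h]
    simp
  · rw [zero_mul, Int.negOnePow_zero, one_smul]
    change mapForms ω (normalPart (vfSmul a X)) = _
    rw [normalPart_vfSmul]
    exact mapForms_wedge _ _ _ _ (fun _ _ => map_smul _ _ _) _ _

/-- The pull-back along `φ` of a section of `B^∨`, as a one-form of degree zero on `F[1]`. -/
def phiDual (ω : Module.Dual A (NormalSections F)) : oneForms F :=
  ⟨phiDualFun ω, oneForms_le 0 (phiDualFun_mem ω)⟩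

/-- A splitting `j` of the projection of vector fields onto the sections of `B`. -/
def IsSplitting (j : NormalSections F →ₗ[A] Derivation 𝕂 A A) : Prop :=
  ∀ Z, F.toSubmodule.mkQ (j Z) = Z

/-- The projection `pr_F X = X - j (pr_B X)` onto the sections of `F` given by a splitting. -/
def projF (j : NormalSections F →ₗ[A] Derivation 𝕂 A A) (hj : IsSplitting j) :
    Derivation 𝕂 A A →ₗ[A] F where
  toFun X := ⟨X - j (F.toSubmodule.mkQ X), by
    have h : X - j (F.toSubmodule.mkQ X) ∈ F.toSubmodule := by
      refine (Submodule.Quotient.mk_eq_zero F.toSubmodule).mp ?_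
      change F.toSubmodule.mkQ (X - j (F.toSubmodule.mkQ X)) = 0
      rw [map_sub, hj, sub_self]
    exact h⟩
  map_add' X Y := Subtype.ext (by
    change X + Y - j (F.toSubmodule.mkQ (X + Y)) = (X - j _) + (Y - j _)
    rw [map_add, map_add]; abel)
  map_smul' c X := Subtype.ext (by
    change c • X - j (F.toSubmodule.mkQ (c • X)) = c • (X - j _)
    rw [map_smul, map_smul, smul_sub])

lemma projF_coe (j : NormalSections F →ₗ[A] Derivation 𝕂 A A) (hj : IsSplitting j) (v : F) :
    projF j hj v = v := Subtype.ext (by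
  change (v : Derivation 𝕂 A A) - j (F.toSubmodule.mkQ v) = v
  have : F.toSubmodule.mkQ (v : Derivation 𝕂 A A) = 0 := by
    rw [← LinearMap.mem_ker, Submodule.ker_mkQ]; exact v.2
  rw [this, map_zero, sub_zero])

lemma projF_split (j : NormalSections F →ₗ[A] Derivation 𝕂 A A) (hj : IsSplitting j)
    (Z : NormalSections F) : projF j hj (j Z) = 0 := Subtype.ext (by
  change j Z - j (F.toSubmodule.mkQ (j Z)) = 0
  rw [hj, sub_self])

/-- The operator `v ↦ pr_F [j Z, v]` on the sections of `F`. -/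
def projBracket (j : NormalSections F →ₗ[A] Derivation 𝕂 A A) (hj : IsSplitting j)
    (Z : NormalSections F) : F →ₗ[𝕂] F where
  toFun v := projF j hj ⁅j Z, (v : Derivation 𝕂 A A)⁆
  map_add' v w := by
    change projF j hj ⁅j Z, (v : Derivation 𝕂 A A) + w⁆ = _
    rw [lie_add, map_add]
  map_smul' c v := by
    change projF j hj ⁅j Z, c • (v : Derivation 𝕂 A A)⁆ = _
    have : ⁅j Z, c • (v : Derivation 𝕂 A A)⁆ = c • ⁅j Z, (v : Derivation 𝕂 A A)⁆ := by
      ext g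
      simp [Derivation.commutator_apply, smul_sub]
    rw [this, LinearMap.map_smul_of_tower]
    rfl

lemma projBracket_leibniz (j : NormalSections F →ₗ[A] Derivation 𝕂 A A) (hj : IsSplitting j)
    (Z : NormalSections F) (f : A) (v : F) :
    projBracket j hj Z (f • v) = f • projBracket j hj Z v + j Z f • v := by
  change projF j hj ⁅j Z, f • (v : Derivation 𝕂 A A)⁆ = _
  have : ⁅j Z, f • (v : Derivation 𝕂 A A)⁆ = f • ⁅j Z, (v : Derivation 𝕂 A A)⁆ +
      j Z f • (v : Derivation 𝕂 A A) := by
    ext g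
    simp [Derivation.commutator_apply]
  rw [this, map_add, map_smul, map_smul, projF_coe]
  rfl

/-- The derivation `ψ_j Z` of the functions on `F[1]`, determined by `(ψ_j Z) f = (j Z) f` on functions
of the base and `⟨v, (ψ_j Z) ξ⟩ = (j Z)⟨v, ξ⟩ - ⟨pr_F [j Z, v], ξ⟩` on sections `ξ` of `F^∨`. -/
def psiFun (j : NormalSections F →ₗ[A] Derivation 𝕂 A A) (hj : IsSplitting j)
    (Z : NormalSections F) : Functions F →ₗ[𝕂] Functions F :=
  formsDer (j Z) (projBracket j hj Z) (j Z).toLinearMap (projBracket_leibniz j hj Z)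
    (fun f g => by simp [mul_comm])

lemma psiFun_apply (j : NormalSections F →ₗ[A] Derivation 𝕂 A A) (hj : IsSplitting j)
    (Z : NormalSections F) (a : Functions F) (k : ℕ) (v : Fin k → F) :
    psiFun j hj Z a k v = j Z (a k v) -
      ∑ i, a k (Function.update v i (projF j hj ⁅j Z, (v i : Derivation 𝕂 A A)⁆)) := rfl

lemma psiFun_mem (j : NormalSections F →ₗ[A] Derivation 𝕂 A A) (hj : IsSplitting j)
    (Z : NormalSections F) : psiFun j hj Z ∈ vectorFieldsOfDegree F 0 := by
  refine ⟨fun k a => ?_, fun a b => ?_⟩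
  · rw [add_zero]
    ext n v
    by_cases h : (n : ℤ) = k
    · simp [component_apply, h, psiFun_apply]
    · simp [component_apply, h, psiFun_apply]
  · have h : ftwist 0 a = a := by
      ext1 k
      simp [ftwist_apply]
    rw [h]
    exact formsDer_wedge _ _ _ _ a b

/-- The vector field `ψ_j Z` of degree zero on `F[1]`. -/
def psi (j : NormalSections F →ₗ[A] Derivation 𝕂 A A) (hj : IsSplitting j)
    (Z : NormalSections F) : vectorFields F := ⟨psiFun j hj Z, vf_le 0 (psiFun_mem j hj Z)⟩

lemma psi_add (j : NormalSections F →ₗ[A] Derivation 𝕂 A A) (hj : IsSplitting j)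
    (Z Z' : NormalSections F) : psi j hj (Z + Z') = psi j hj Z + psi j hj Z' := by
  refine Subtype.ext (LinearMap.ext fun a => Forms.ext fun k => AlternatingMap.ext fun v => ?_)
  change psiFun j hj (Z + Z') a k v = psiFun j hj Z a k v + psiFun j hj Z' a k v
  simp only [psiFun_apply, map_add, add_lie, AlternatingMap.map_update_add, Derivation.add_apply,
    Finset.sum_add_distrib]
  abel

lemma psi_smul (j : NormalSections F →ₗ[A] Derivation 𝕂 A A) (hj : IsSplitting j) (f : A)
    (Z : NormalSections F) : psi j hj (f • Z) = vfSmul ⟨ofFun F f, ofFun_mem f⟩ (psi j hj Z) := by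
  refine Subtype.ext (LinearMap.ext fun a => ?_)
  rw [vfSmul_apply, fmul_ofFun_left]
  refine Forms.ext fun k => AlternatingMap.ext fun v => ?_
  change psiFun j hj (f • Z) a k v = f • psiFun j hj Z a k v
  have h : ∀ w : F, projF j hj ⁅f • j Z, (w : Derivation 𝕂 A A)⁆ =
      f • projF j hj ⁅j Z, (w : Derivation 𝕂 A A)⁆ := fun w => by
    have : ⁅f • j Z, (w : Derivation 𝕂 A A)⁆ = f • ⁅j Z, (w : Derivation 𝕂 A A)⁆ -
        (w : Derivation 𝕂 A A) f • j Z := by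
      ext g
      simp [Derivation.commutator_apply]
      ring
    rw [this, map_sub, map_smul, map_smul, projF_split, smul_zero, sub_zero]
  simp only [psiFun_apply, map_smul, h, AlternatingMap.map_update_smul, Derivation.smul_apply,
    smul_sub, Finset.smul_sum]

lemma phiDual_add (ω η : Module.Dual A (NormalSections F)) :
    phiDual (ω + η) = phiDual ω + phiDual η := by
  refine Subtype.ext (LinearMap.ext fun X => ?_)
  ext k v
  rfl

lemma phiDual_smul (f : A) (ω : Module.Dual A (NormalSections F)) :
    phiDual (f • ω) = formSmul ⟨ofFun F f, ofFun_mem f⟩ (phiDual ω) := by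
  refine Subtype.ext (LinearMap.ext fun X => ?_)
  change mapForms (f • ω) (normalPart X) = fmul (ofFun F f) (mapForms ω (normalPart X))
  rw [fmul_ofFun_left]
  rfl

end Comparison

/-! ### Restriction of multilinear maps -/

section Restriction

variable {𝕂 A : Type*} [CommRing 𝕂] [CommRing A] {Ω D X P Q V E : Type*}
  [AddCommGroup Ω] [Module 𝕂 Ω] [Module A Ω] [AddCommGroup D] [Module 𝕂 D] [AddCommGroup X]
  [Module 𝕂 X] [AddCommGroup P] [Module A P] [AddCommGroup Q] [Module A Q] [AddCommGroup V]
  [Module A V] [AddCommGroup E] [Module A E] {n m : ℕ}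

lemma comp_update {M N : Type*} {N' : ℕ} (g : M → N) (z : Fin N' → M) (i : Fin N') (y : M) :
    (fun l => g (Function.update z i y l)) = Function.update (fun l => g (z l)) i (g y) := by
  funext l
  by_cases hl : l = i
  · subst hl; simp
  · simp [hl]

lemma apply_update_actD {gradΩ : ℤ → Submodule 𝕂 Ω} {gradD : ℤ → Submodule 𝕂 D}
    {gradX : ℤ → Submodule 𝕂 X} {mul : Ω →ₗ[𝕂] Ω →ₗ[𝕂] Ω} {actD : ∀ r, gradΩ r → D →ₗ[𝕂] D}
    {actX : ∀ r, gradΩ r → X →ₗ[𝕂] X} {k : ℤ} {τ : MultilinearForms 𝕂 Ω D X n m}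
    (hτ : τ ∈ gradedMultilinearForms gradΩ gradD gradX mul actD actX n m k) (a : gradΩ 0)
    {α : Fin n → D} {x : Fin m → X} (hα : ∀ i, α i ∈ gradD 0) (hx : ∀ j, x j ∈ gradX 0)
    (i : Fin n) {y : D} {z : Ω} (hy : y = actD 0 a (α i)) (hz : z = mul a.1 (τ α x)) :
    τ (Function.update α i y) x = z := by
  have h := ((hτ (fun _ => 0) (fun _ => 0) α x hα hx).2 0 a).1 i
  rw [zero_mul, Int.negOnePow_zero, one_smul] at h
  rw [hy, hz, h]

lemma apply_update_actX {gradΩ : ℤ → Submodule 𝕂 Ω} {gradD : ℤ → Submodule 𝕂 D}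
    {gradX : ℤ → Submodule 𝕂 X} {mul : Ω →ₗ[𝕂] Ω →ₗ[𝕂] Ω} {actD : ∀ r, gradΩ r → D →ₗ[𝕂] D}
    {actX : ∀ r, gradΩ r → X →ₗ[𝕂] X} {k : ℤ} {τ : MultilinearForms 𝕂 Ω D X n m}
    (hτ : τ ∈ gradedMultilinearForms gradΩ gradD gradX mul actD actX n m k) (a : gradΩ 0)
    {α : Fin n → D} {x : Fin m → X} (hα : ∀ i, α i ∈ gradD 0) (hx : ∀ j, x j ∈ gradX 0)
    (i : Fin m) {y : X} {z : Ω} (hy : y = actX 0 a (x i)) (hz : z = mul a.1 (τ α x)) :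
    τ α (Function.update x i y) = z := by
  have h := ((hτ (fun _ => 0) (fun _ => 0) α x hα hx).2 0 a).2 i
  rw [zero_mul, Int.negOnePow_zero, one_smul] at h
  rw [hy, hz, h]

/-- The restriction of a multilinear map to the arguments `φ ω` and `ψ Z`, when that is linear over
`A`. -/
def restrictArgs (φ : P →+ D) (ψ : Q →+ X) (τ : MultilinearForms 𝕂 Ω D X n m)
    (hφ : ∀ (ω : Fin n → P) (Z : Fin m → Q) (i : Fin n) (f : A),
      τ (Function.update (fun l => φ (ω l)) i (φ (f • ω i))) (fun l => ψ (Z l)) =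
        f • τ (fun l => φ (ω l)) (fun l => ψ (Z l)))
    (hψ : ∀ (ω : Fin n → P) (Z : Fin m → Q) (i : Fin m) (f : A),
      τ (fun l => φ (ω l)) (Function.update (fun l => ψ (Z l)) i (ψ (f • Z i))) =
        f • τ (fun l => φ (ω l)) (fun l => ψ (Z l))) :
    MultilinearMap A (fun _ : Fin n => P) (MultilinearMap A (fun _ : Fin m => Q) Ω) :=
  MultilinearMap.mk' (fun ω => MultilinearMap.mk' (fun Z => τ (fun l => φ (ω l)) (fun l => ψ (Z l)))
      (fun Z i y y' => by simp only [comp_update, map_add, MultilinearMap.map_update_add])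
      (fun Z i f y => by
        have h := hψ ω (Function.update Z i y) i f
        simp only [comp_update, Function.update_self, Function.update_idem] at h ⊢
        exact h))
    (fun ω i η η' => MultilinearMap.ext fun Z => by
      simp only [MultilinearMap.mk'_apply, _root_.add_apply, comp_update, map_add,
        MultilinearMap.map_update_add])
    (fun ω i f η => MultilinearMap.ext fun Z => by
      have h := hφ (Function.update ω i η) Z i f
      simp only [MultilinearMap.mk'_apply, _root_.smul_apply, comp_update, Function.update_self,
        Function.update_idem] at h ⊢
      exact h)

/-- A multilinear map with values in forms is a form with values in multilinear maps. -/
def swapForms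
    (T : MultilinearMap A (fun _ : Fin n => P) (MultilinearMap A (fun _ : Fin m => Q) (Forms A V E))) :
    Forms A V (MultilinearMap A (fun _ : Fin n => P) (MultilinearMap A (fun _ : Fin m => Q) E)) :=
  fun k =>
  { toFun := fun v => MultilinearMap.mk' (fun ω => MultilinearMap.mk' (fun Z => T ω Z k v)
        (fun Z i y y' => by simp [MultilinearMap.map_update_add])
        (fun Z i f y => by simp [MultilinearMap.map_update_smul]))
      (fun ω i η η' => MultilinearMap.ext fun Z => by simp [MultilinearMap.map_update_add])
      (fun ω i f η => MultilinearMap.ext fun Z => by simp [MultilinearMap.map_update_smul])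
    map_update_add' := fun v l x y => by
      ext ω Z
      exact (T ω Z k).map_update_add v l x y
    map_update_smul' := fun v l c x => by
      ext ω Z
      exact (T ω Z k).map_update_smul v l c x
    map_eq_zero_of_eq' := fun v l l' h hne => by
      ext ω Z
      exact (T ω Z k).map_eq_zero_of_eq v h hne }

end Restriction

/-! ### The comparison map -/

section ComparisonMap

variable {𝕂 A : Type*} [CommRing 𝕂] [CommRing A] [Algebra 𝕂 A]
  {F : LieRinehartSubalgebra A (Derivation 𝕂 A A)} {n m : ℕ} {k : ℤ}

/-- The pull-back along `φ`, as an additive map. -/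
def phiDualHom : Module.Dual A (NormalSections F) →+ oneForms F where
  toFun := phiDual
  map_zero' := by
    have h := phiDual_add (F := F) 0 0
    rw [add_zero] at h
    exact left_eq_add.mp h
  map_add' := phiDual_add

/-- The map `ψ_j`, as an additive map. -/
def psiHom (j : NormalSections F →ₗ[A] Derivation 𝕂 A A) (hj : IsSplitting j) :
    NormalSections F →+ vectorFields F where
  toFun := psi j hj
  map_zero' := by
    have h := psi_add j hj 0 0
    rw [add_zero] at h
    exact left_eq_add.mp h
  map_add' := psi_add j hj

/-- The map `(ψ_j^∨)^{⊗ m} ⊗ φ^{⊗ n}` given by a splitting `j`, from tensor fields on `F[1]` to forms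
on `F` with values in the tensors of `B`: in the vectors `v` its value on sections `ω` of `B^∨` and
`Z` of `B` is `τ (φ^∨ ω₁, …; ψ_j Z₁, …)(v)`, see `comparisonMap_apply`. -/
def comparisonMap (j : NormalSections F →ₗ[A] Derivation 𝕂 A A) (hj : IsSplitting j)
    (τ : tensorFieldsOfDegree F n m k) : Forms A F (NormalTensors F n m) :=
  swapForms (restrictArgs phiDualHom (psiHom j hj) τ.1
    (fun ω Z i f => apply_update_actD τ.2 ⟨ofFun F f, ofFun_mem f⟩
      (fun l => phiDualFun_mem (ω l)) (fun l => psiFun_mem j hj (Z l)) i (phiDual_smul f (ω i))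
      (fmul_ofFun_left f _).symm)
    (fun ω Z i f => apply_update_actX τ.2 ⟨ofFun F f, ofFun_mem f⟩
      (fun l => phiDualFun_mem (ω l)) (fun l => psiFun_mem j hj (Z l)) i (psi_smul j hj f (Z i))
      (fmul_ofFun_left f _).symm))

lemma comparisonMap_apply (j : NormalSections F →ₗ[A] Derivation 𝕂 A A) (hj : IsSplitting j)
    (τ : tensorFieldsOfDegree F n m k) (i : ℕ) (v : Fin i → F)
    (ω : Fin n → Module.Dual A (NormalSections F)) (Z : Fin m → NormalSections F) :
    comparisonMap j hj τ i v ω Z =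
      τ.1 (fun l => phiDual (ω l)) (fun l => psi j hj (Z l)) i v := rfl

variable (F) in
/-- The families of linear isomorphisms from the cohomology of tensor fields to the
Chevalley-Eilenberg cohomology, for all types and degrees. -/
abbrev CohomologyIsomorphisms : Type _ :=
  ∀ (n m : ℕ) (k : ℤ), TensorCohomology F n m k ≃ₗ[𝕂] CECohomology F n m k

/-- The isomorphisms `Φ` are those induced on cohomology by the map `(ψ_j^∨)^{⊗ m} ⊗ φ^{⊗ n}` for the
splitting `j`; this map sends cocycles to cocycles. -/
def IsInducedBy (Φ : CohomologyIsomorphisms F) (j : NormalSections F →ₗ[A] Derivation 𝕂 A A)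
    (hj : IsSplitting j) : Prop :=
  ∀ (n m : ℕ) (k : ℤ) (τ : tensorCocycles F n m k),
    ∃ h : comparisonMap j hj ⟨τ.1, τ.2.1⟩ ∈ ceCocycles F n m k,
      Φ n m k (tensorClass F τ) = ceClass F ⟨comparisonMap j hj ⟨τ.1, τ.2.1⟩, h⟩

/-- The isomorphisms `Φ` intertwine the tensor product of cohomology classes of tensor fields with the
tensor product of Chevalley-Eilenberg classes, both being well defined on cocycles. -/
def RespectsTensorProducts (Φ : CohomologyIsomorphisms F) : Prop :=
  ∀ (n₁ m₁ n₂ m₂ : ℕ) (k₁ k₂ : ℤ) (σ : tensorCocycles F n₁ m₁ k₁) (τ : tensorCocycles F n₂ m₂ k₂)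
    (s : ceCocycles F n₁ m₁ k₁) (t : ceCocycles F n₂ m₂ k₂),
    Φ n₁ m₁ k₁ (tensorClass F σ) = ceClass F s → Φ n₂ m₂ k₂ (tensorClass F τ) = ceClass F t →
    ∃ (h : tensorFieldProduct F k₂ σ.1 τ.1 ∈ tensorCocycles F (n₁ + n₂) (m₁ + m₂) (k₁ + k₂))
      (h' : ceProduct F s.1 t.1 ∈ ceCocycles F (n₁ + n₂) (m₁ + m₂) (k₁ + k₂)),
      Φ (n₁ + n₂) (m₁ + m₂) (k₁ + k₂) (tensorClass F ⟨tensorFieldProduct F k₂ σ.1 τ.1, h⟩) =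
        ceClass F ⟨ceProduct F s.1 t.1, h'⟩

end ComparisonMap

/-! ### Integrable distributions on manifolds -/

section Geometry

open scoped Manifold ContDiff

variable (𝕂 : Type*) [RCLike 𝕂] (E : Type*) [NormedAddCommGroup E] [NormedSpace ℝ E]
  (M : Type*) [TopologicalSpace M] [ChartedSpace E M]

/-- The smooth `𝕂`-valued functions on `M`. -/
def smoothSubalgebra : Subalgebra 𝕂 (M → 𝕂) where
  carrier := {f | ContMDiff 𝓘(ℝ, E) 𝓘(ℝ, 𝕂) ∞ f}
  mul_mem' hf hg := contDiff_mul.contMDiff.comp (hf.prodMk_space hg)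
  add_mem' hf hg := contDiff_add.contMDiff.comp (hf.prodMk_space hg)
  algebraMap_mem' _ := contMDiff_const

/-- The algebra of smooth `𝕂`-valued functions on `M`. -/
def SmoothFunctions : Type _ := smoothSubalgebra 𝕂 E M

instance : CommRing (SmoothFunctions 𝕂 E M) := inferInstanceAs (CommRing (smoothSubalgebra 𝕂 E M))

instance : Algebra 𝕂 (SmoothFunctions 𝕂 E M) :=
  inferInstanceAs (Algebra 𝕂 (smoothSubalgebra 𝕂 E M))

instance : CoeFun (SmoothFunctions 𝕂 E M) fun _ => M → 𝕂 := ⟨fun f => Subtype.val f⟩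

/-- The fibre of `T_𝕂 M = T M ⊗ 𝕂` at `x`. -/
abbrev ScalarTangentSpace (x : M) : Type _ := 𝕂 ⊗[ℝ] TangentSpace 𝓘(ℝ, E) x

variable {M}

/-- The derivative of `f` at `x` in the direction of a vector of `T_𝕂 M`. -/
def dirDeriv (f : M → 𝕂) (x : M) : ScalarTangentSpace 𝕂 E M x →ₗ[𝕂] 𝕂 :=
  let D : TangentSpace 𝓘(ℝ, E) x →ₗ[ℝ] 𝕂 := (mfderiv 𝓘(ℝ, E) 𝓘(ℝ, 𝕂) f x).toLinearMap
  D.liftBaseChange 𝕂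

variable (M)

/-- The sections of `T_𝕂 M`, as the derivations of the algebra of smooth `𝕂`-valued functions. -/
abbrev VectorFieldsOn : Type _ :=
  Derivation 𝕂 (SmoothFunctions 𝕂 E M) (SmoothFunctions 𝕂 E M)

variable {M}

variable {𝕂 E} in
/-- The vector field `X` has the value `v` at `x`. -/
def HasValue (X : VectorFieldsOn 𝕂 E M) (x : M) (v : ScalarTangentSpace 𝕂 E M x) : Prop :=
  ∀ f : SmoothFunctions 𝕂 E M, X f x = dirDeriv 𝕂 E f x v

variable (M)

/-- A smooth subbundle of `T_𝕂 M` whose space of sections is closed under the bracket. -/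
structure IntegrableDistribution where
  /-- the fibres -/
  fiber : ∀ x : M, Submodule 𝕂 (ScalarTangentSpace 𝕂 E M x)
  /-- local frames of finite rank by smooth vector fields -/
  locallyTrivial : ∀ x₀ : M, ∃ (r : ℕ) (S : Fin r → VectorFieldsOn 𝕂 E M), ∃ U ∈ nhds x₀,
    ∀ x ∈ U, ∃ b : Module.Basis (Fin r) 𝕂 (fiber x), ∀ i, HasValue (S i) x (b i : _)
  /-- the sections are closed under the bracket -/
  involutive : ∀ X Y : VectorFieldsOn 𝕂 E M, (∀ x, ∃ v ∈ fiber x, HasValue X x v) →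
    (∀ x, ∃ v ∈ fiber x, HasValue Y x v) → ∀ x, ∃ v ∈ fiber x, HasValue ⁅X, Y⁆ x v

variable {M 𝕂 E}

/-- The Lie-Rinehart algebra of sections of an integrable distribution. -/
def IntegrableDistribution.sections (F : IntegrableDistribution 𝕂 E M) :
    LieRinehartSubalgebra (SmoothFunctions 𝕂 E M) (VectorFieldsOn 𝕂 E M) where
  carrier := {X | ∀ x, ∃ v ∈ F.fiber x, HasValue X x v}
  add_mem' := by
    intro X Y hX hY x
    obtain ⟨v, hv, h⟩ := hX x
    obtain ⟨w, hw, h'⟩ := hY x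
    refine ⟨v + w, add_mem hv hw, fun f => ?_⟩
    rw [map_add, ← h f, ← h' f]
    rfl
  zero_mem' := fun x => ⟨0, zero_mem _, fun f => by rw [map_zero]; rfl⟩
  smul_mem' := by
    intro g X hX x
    obtain ⟨v, hv, h⟩ := hX x
    refine ⟨g x • v, Submodule.smul_mem _ _ hv, fun f => ?_⟩
    rw [map_smul, ← h f]
    rfl
  lie_mem' := fun hX hY => F.involutive _ _ hX hY

end Geometry

end DGFoliation

end

open scoped Manifold ContDiff

set_option linter.unusedSectionVars false

noncomputable section

/-! Vector fields and one-forms on `F[1]` are differential graded modules over the functions, with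
differential the Lie derivative along `d_F`, and tensor fields are the graded multilinear maps on
them. The theorem holds because the directions of `T(F[1])` that come from `F` are contractible: the
contraction `ι_v` with a section `v` of `F` and its Lie derivative `[d_F, ι_v] = L_v` form an
acyclic pair, and what remains is the normal bundle `B`, embedded by `ψ_j`.

To make this precise, choose a splitting `j` and finite dual bases of `Γ(F)` and `Γ(B)`. The
homotopy `h` takes the `F`-part of the restriction of a vector field to the base and replaces each
`v_i` by `ι_{v_i}`, with a sign. Then `[d_F, h] = id - ψ_j ∘ φ` (`homotopyDefect_eq_zero`): the
defect of this identity is linear over the functions, vector fields are generated by the `ι_v`, the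
`L_v` and the `ψ_j Z`, and on each kind the identity is read off. Transposition gives the homotopy
on one-forms.

Put `P = ψ_j ∘ φ` on vector fields and its transpose on one-forms. Working place by place, a cocycle
`τ` is cohomologous to its composition with `P` in all places (`DGMod.Homotopy.exists_primitive`).
By multilinearity that composition is determined by the values of `τ` on the degree-zero arguments
`φ^∨ ω` and `ψ_j Z` (`DGMod.Frame.onSlots_eq`), which is what the comparison map records. The
comparison map is a map of complexes, since the Lie derivatives of these arguments are expressed
through the Bott connection (`L_pairLift`, `ceDiff_comparisonMap`). Extending values from the frame
gives a right inverse `extendTensor`, which is a left inverse up to homotopy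
(`exists_lieTensor_eq`); so cohomology is mapped isomorphically.

Canonicity follows because `φ ∘ ψ_{j'} = id` for every splitting: the extension built from `j` is a
right inverse of the comparison map of `j'` as well (`comparisonMap_extendTensor`), so both induce
the inverse of the same map. Products are respected on cochains already, since all arguments of the
comparison map have degree zero and no Koszul sign survives (`comparisonMap_tensorFieldProduct`).

The geometric input is the splitting and the dual bases. Finitely many functions `f_i` whose
differentials separate tangent vectors exist on `M` by a Whitney-type immersion argument. For a
subbundle `W`, project the standard vectors orthogonally to the image of `W` under `(df_i)`; this
gives global fields `w_i` in `W` with `X = ∑ X(f_i) w_i` for all sections `X`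
(`exists_generating_fields`). To apply this to all derivations, one needs that a derivation has a
value at each point, which is Hadamard's lemma (`exists_hasValue`). -/

namespace DGFoliation

/-! ### The ring of scalar-valued forms -/

section FormsRing

variable {A : Type*} [CommRing A] {V : Type*} [AddCommGroup V] [Module A V]

/-- The unit form. -/
def oneForm : Forms A V A := fun k =>
  match k with
  | 0 => AlternatingMap.constOfIsEmpty A V (Fin 0) 1
  | _ + 1 => 0

lemma contract_oneForm (v : V) : contract v (oneForm : Forms A V A) = 0 := by
  ext k x
  rfl

lemma twist_oneForm (q : ℤ) : twist q (oneForm : Forms A V A) = oneForm := by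
  ext1 k
  cases k with
  | zero => simp
  | succ k =>
    change (q * ((k + 1 : ℕ) : ℤ)).negOnePow • (0 : V [⋀^Fin (k + 1)]→ₗ[A] A) = 0
    simp

lemma wedge_oneForm_left {E : Type*} [AddCommGroup E] [Module A E] (a : Forms A V E) :
    wedge (LinearMap.lsmul A E) (oneForm : Forms A V A) a = a := by
  ext1 n
  induction n generalizing a with
  | zero => ext v; simp [wedge_zero_apply, oneForm]
  | succ n ih =>
    refine forms_succ_ext fun v => ?_
    have h0 : wedge (LinearMap.lsmul A E) (0 : Forms A V A) a = 0 := by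
      have := wedge_smul_left (LinearMap.lsmul A E) (0 : A) (0 : Forms A V A) a
      simpa using this
    rw [contract_wedge, contract_oneForm, twist_oneForm, h0, zero_add, ih]

lemma wedge_oneForm_right (a : Forms A V A) :
    wedge (LinearMap.mul A A) a oneForm = a := by
  ext1 n
  induction n generalizing a with
  | zero => ext v; simp [wedge_zero_apply, oneForm]
  | succ n ih =>
    refine forms_succ_ext fun v => ?_
    have h0 : ∀ b : Forms A V A, wedge (LinearMap.mul A A) b (0 : Forms A V A) = 0 := fun b => by
      have := wedge_smul_right (LinearMap.mul A A) (0 : A) b (0 : Forms A V A)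
      simpa using this
    rw [contract_wedge, contract_oneForm, h0, add_zero, ih]

lemma wedge_zero_left {E₁ E₂ E₃ : Type*} [AddCommGroup E₁] [Module A E₁]
    [AddCommGroup E₂] [Module A E₂] [AddCommGroup E₃] [Module A E₃] (p : E₁ →ₗ[A] E₂ →ₗ[A] E₃)
    (b : Forms A V E₂) : wedge p (0 : Forms A V E₁) b = 0 := by
  simpa using wedge_smul_left p (0 : A) (0 : Forms A V E₁) b

lemma wedge_zero_right {E₁ E₂ E₃ : Type*} [AddCommGroup E₁] [Module A E₁]
    [AddCommGroup E₂] [Module A E₂] [AddCommGroup E₃] [Module A E₃] (p : E₁ →ₗ[A] E₂ →ₗ[A] E₃)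
    (a : Forms A V E₁) : wedge p a (0 : Forms A V E₂) = 0 := by
  simpa using wedge_smul_right p (0 : A) a (0 : Forms A V E₂)

/-- Scalar-valued forms with the wedge product. -/
instance formsRing : Ring (Forms A V A) where
  mul := wedge (LinearMap.mul A A)
  one := oneForm
  left_distrib := wedge_add_right _
  right_distrib := wedge_add_left _
  zero_mul := wedge_zero_left _
  mul_zero := wedge_zero_right _
  mul_assoc := wedge_assoc
  one_mul := wedge_oneForm_left
  mul_one := wedge_oneForm_right
  -- The integer multiples are those of the existing additive group, so that the two additive
  -- structures on forms coincide definitionally.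
  zsmul := (inferInstance : AddCommGroup (Forms A V A)).zsmul
  zsmul_zero' := (inferInstance : AddCommGroup (Forms A V A)).zsmul_zero'
  zsmul_succ' := (inferInstance : AddCommGroup (Forms A V A)).zsmul_succ'
  zsmul_neg' := (inferInstance : AddCommGroup (Forms A V A)).zsmul_neg'
  neg_add_cancel := neg_add_cancel
  sub_eq_add_neg := sub_eq_add_neg

lemma mul_eq_wedge (a b : Forms A V A) : a * b = wedge (LinearMap.mul A A) a b := rfl

instance formsAlgebra {𝕂 : Type*} [CommRing 𝕂] [Algebra 𝕂 A] : Algebra 𝕂 (Forms A V A) :=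
  Algebra.ofModule
    (fun c a b => by
      rw [← algebraMap_smul A c a, ← algebraMap_smul A c (a * b)]
      exact wedge_smul_left _ _ _ _)
    (fun c a b => by
      rw [← algebraMap_smul A c b, ← algebraMap_smul A c (a * b)]
      exact wedge_smul_right _ _ _ _)

end FormsRing

/-! ### Cartan calculus and the square of the Chevalley-Eilenberg differential -/

section CartanCalculus

variable {𝕂 A : Type*} [CommRing 𝕂] [CommRing A] [Algebra 𝕂 A]
  {F : LieRinehartSubalgebra A (Derivation 𝕂 A A)}
  {E : Type*} [AddCommGroup E] [Module A E] [Module 𝕂 E] [IsScalarTower 𝕂 A E]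

lemma fmul_eq_mul (a b : Functions F) : fmul a b = a * b := rfl

lemma contract_lieDer (M : FModule F E) (v w : F) (a : Forms A F E) :
    contract w (lieDer M v a) = lieDer M v (contract w a) - contract ⁅v, w⁆ a :=
  contract_formsDer _ _ _ _ _ a w

/-- Polarization of `ι_v ι_v = 0`. -/
lemma contract_contract_comm (v w : F) (a : Forms A F E) :
    contract v (contract w a) = - contract w (contract v a) := by
  have h := contract_contract_self (v + w) a
  simp only [contract_add, map_add, contract_contract_self, add_zero, zero_add] at h
  exact eq_neg_of_add_eq_zero_left (by rw [add_comm]; exact h)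

/-- Induction on the degree by contracting with a vector, as in the other identities of this
section: in degree zero this is flatness of the connection, and the step is the Jacobi identity. -/
lemma lieDer_lieDer (M : FModule F E) (v w : F) (a : Forms A F E) :
    lieDer M v (lieDer M w a) - lieDer M w (lieDer M v a) = lieDer M ⁅v, w⁆ a := by
  ext1 n
  induction n generalizing a with
  | zero =>
    ext x
    simp [lieDer_apply, M.flat]
  | succ n ih =>
    refine forms_succ_ext fun x => ?_
    have hc : ∀ y z : F, contract (y - z) a = contract y a - contract z a := fun y z => by
      rw [eq_sub_iff_add_eq, ← contract_add, sub_add_cancel]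
    have hj : ⁅⁅v, w⁆, x⁆ = ⁅v, ⁅w, x⁆⁆ - ⁅w, ⁅v, x⁆⁆ := lie_lie v w x
    simp only [contract_lieDer, map_sub, hj, hc, ← ih, Forms.sub_apply]
    abel

/-- Contraction with `x` and the Cartan formula reduce this to the same statement for `ι_x a` and to
`[L_v, L_x] = L_{[v,x]}`. -/
lemma lieDer_ceDiff (M : FModule F E) (v : F) (a : Forms A F E) :
    lieDer M v (ceDiff M a) = ceDiff M (lieDer M v a) := by
  ext1 n
  induction n generalizing a with
  | zero => ext x; simp [ceDiff_zero, lieDer_apply]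
  | succ n ih =>
    refine forms_succ_ext fun x => ?_
    rw [contract_lieDer, contract_ceDiff, contract_ceDiff, contract_ceDiff, contract_lieDer,
      ← lieDer_lieDer M v x a]
    simp only [map_sub, Forms.sub_apply, ih, Forms.sub_apply]
    abel

/-- By the Cartan formula `ι_x d d = L_x d - d L_x + d d ι_x`; the first two terms cancel and the
third is the induction hypothesis. -/
lemma ceDiff_ceDiff (M : FModule F E) (a : Forms A F E) : ceDiff M (ceDiff M a) = 0 := by
  ext1 n
  induction n generalizing a with
  | zero => rfl
  | succ n ih =>
    refine forms_succ_ext (b := 0) fun x => ?_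
    rw [contract_ceDiff, contract_ceDiff, map_sub, lieDer_ceDiff, map_zero]
    simp only [Forms.sub_apply, ih, Forms.zero_apply]
    abel

lemma dF_dF (a : Functions F) : dF F (dF F a) = 0 := ceDiff_ceDiff _ a

lemma lieDer_wedge {E₁ E₂ E₃ : Type*} [AddCommGroup E₁] [Module A E₁] [Module 𝕂 E₁]
    [IsScalarTower 𝕂 A E₁] [AddCommGroup E₂] [Module A E₂] [Module 𝕂 E₂] [IsScalarTower 𝕂 A E₂]
    [AddCommGroup E₃] [Module A E₃] [Module 𝕂 E₃] [IsScalarTower 𝕂 A E₃]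
    (M₁ : FModule F E₁) (M₂ : FModule F E₂) (M₃ : FModule F E₃) (p : E₁ →ₗ[A] E₂ →ₗ[A] E₃)
    (hp : ∀ v x y, M₃.nabla v (p x y) = p (M₁.nabla v x) y + p x (M₂.nabla v y))
    (v : F) (a : Forms A F E₁) (b : Forms A F E₂) :
    lieDer M₃ v (wedge p a b) = wedge p (lieDer M₁ v a) b + wedge p a (lieDer M₂ v b) := by
  ext1 n
  induction n generalizing a b with
  | zero =>
    ext x
    simp [lieDer_apply, wedge_zero_apply, hp]
  | succ n ih =>
    refine forms_succ_ext fun x => ?_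
    have e1 : ∀ x y : Forms A F E₁, wedge p (x - y) b = wedge p x b - wedge p y b := fun x y => by
        rw [eq_sub_iff_add_eq, ← wedge_add_left, sub_add_cancel]
    have e2 : ∀ (z : Forms A F E₁) (x y : Forms A F E₂),
        wedge p z (x - y) = wedge p z x - wedge p z y := fun z x y => by
        rw [eq_sub_iff_add_eq, ← wedge_add_right, sub_add_cancel]
    simp only [contract_lieDer, contract_wedge, map_add, Forms.add_apply, Forms.sub_apply, ih, e1,
      e2, lieDer_twist]
    abel

/-- The Leibniz rule for the Chevalley-Eilenberg differential. -/
lemma ceDiff_wedge {E₁ E₂ E₃ : Type*} [AddCommGroup E₁] [Module A E₁] [Module 𝕂 E₁]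
    [IsScalarTower 𝕂 A E₁] [AddCommGroup E₂] [Module A E₂] [Module 𝕂 E₂] [IsScalarTower 𝕂 A E₂]
    [AddCommGroup E₃] [Module A E₃] [Module 𝕂 E₃] [IsScalarTower 𝕂 A E₃]
    (M₁ : FModule F E₁) (M₂ : FModule F E₂) (M₃ : FModule F E₃) (p : E₁ →ₗ[A] E₂ →ₗ[A] E₃)
    (hp : ∀ v x y, M₃.nabla v (p x y) = p (M₁.nabla v x) y + p x (M₂.nabla v y))
    (a : Forms A F E₁) (b : Forms A F E₂) :
    ceDiff M₃ (wedge p a b) = wedge p (ceDiff M₁ a) b + wedge p (twist 1 a) (ceDiff M₂ b) := by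
  ext1 n
  induction n generalizing a b with
  | zero => ext x; simp [ceDiff_zero, wedge_zero_apply]
  | succ n ih =>
    refine forms_succ_ext fun x => ?_
    have e1 : ∀ x y : Forms A F E₁, wedge p (x - y) b = wedge p x b - wedge p y b := fun x y => by
        rw [eq_sub_iff_add_eq, ← wedge_add_left, sub_add_cancel]
    have e2 : ∀ (z : Forms A F E₁) (x y : Forms A F E₂),
        wedge p z (x - y) = wedge p z x - wedge p z y := fun z x y => by
        rw [eq_sub_iff_add_eq, ← wedge_add_right, sub_add_cancel]
    have e3 : ∀ (x : Forms A F E₁) (y : Forms A F E₂), wedge p (-x) y = - wedge p x y :=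
      fun x y => by rw [eq_neg_iff_add_eq_zero, ← wedge_add_left, neg_add_cancel, wedge_zero_left]
    have h1 : ceDiff M₁ (twist 1 a) = - twist 1 (ceDiff M₁ a) := by
      rw [ceDiff_twist, Int.negOnePow_one, Units.neg_smul, one_smul]
    have h2 : contract x (twist 1 a) = - twist 1 (contract x a) := by
      rw [contract_twist, Int.negOnePow_one, Units.neg_smul, one_smul]
    simp only [contract_ceDiff, contract_wedge, map_add, Forms.add_apply, Forms.sub_apply, ih, e1,
      e2, lieDer_wedge M₁ M₂ M₃ p hp, h1, h2, e3, Forms.neg_apply, twist_one_one]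
    abel

end CartanCalculus

/-- Evaluation on the values is compatible with wedge products. -/
lemma mapForms_wedge_map {𝕂 A : Type*} [CommRing 𝕂] [CommRing A] [Algebra 𝕂 A]
    {F : LieRinehartSubalgebra A (Derivation 𝕂 A A)} {E₁ E₂ E₃ E₁' E₂' E₃' : Type*}
    [AddCommGroup E₁] [Module A E₁] [AddCommGroup E₂] [Module A E₂] [AddCommGroup E₃] [Module A E₃]
    [AddCommGroup E₁'] [Module A E₁'] [AddCommGroup E₂'] [Module A E₂'] [AddCommGroup E₃']
    [Module A E₃'] (p : E₁ →ₗ[A] E₂ →ₗ[A] E₃) (p' : E₁' →ₗ[A] E₂' →ₗ[A] E₃')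
    (f : E₁ →ₗ[A] E₁') (g : E₂ →ₗ[A] E₂') (h : E₃ →ₗ[A] E₃')
    (hp : ∀ x y, h (p x y) = p' (f x) (g y)) (a : Forms A F E₁) (b : Forms A F E₂) :
    mapForms h (wedge p a b) = wedge p' (mapForms f a) (mapForms g b) := by
  ext1 n
  induction n generalizing a b with
  | zero => ext v; simp [mapForms_apply, wedge_zero_apply, hp]
  | succ n ih =>
    refine forms_succ_ext fun v => ?_
    have e1 : contract v (mapForms h (wedge p a b)) = mapForms h (contract v (wedge p a b)) := rfl
    have e2 : contract v (mapForms g b) = mapForms g (contract v b) := rfl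
    have e3 : contract v (mapForms f a) = mapForms f (contract v a) := rfl
    have e4 : twist 1 (mapForms f a) = mapForms f (twist 1 a) := by
      ext1 k
      ext x
      exact (map_units_smul f _ _).symm
    rw [e1, contract_wedge, contract_wedge, map_add, Forms.add_apply, Forms.add_apply, ih, e2, ih,
      e3, e4]

/-! ### Differential graded modules, their graded multilinear maps, and homotopies -/

section GradedModules

variable {𝕂 Ω Y Y' : Type*} [CommRing 𝕂] [Ring Ω] [Algebra 𝕂 Ω] [AddCommGroup Y] [Module 𝕂 Y]
  [AddCommGroup Y'] [Module 𝕂 Y']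

variable (𝕂 Ω) in
/-- A graded commutative differential graded algebra; `deg` are the homogeneous elements. -/
structure DGAlg where
  /-- the elements of a given degree -/
  deg : ℤ → Submodule 𝕂 Ω
  /-- the differential -/
  d : Ω →ₗ[𝕂] Ω
  one_mem : (1 : Ω) ∈ deg 0
  mul_mem : ∀ {r s : ℤ} {a b : Ω}, a ∈ deg r → b ∈ deg s → a * b ∈ deg (r + s)
  comm : ∀ {r s : ℤ} {a b : Ω}, a ∈ deg r → b ∈ deg s → a * b = (r * s).negOnePow • (b * a)
  d_mem : ∀ {r : ℤ} {a : Ω}, a ∈ deg r → d a ∈ deg (r + 1)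
  leibniz : ∀ {r : ℤ} {a : Ω}, a ∈ deg r → ∀ b, d (a * b) = d a * b + r.negOnePow • (a * d b)

variable (R : DGAlg 𝕂 Ω) (Y) in
/-- A differential graded module that is the sum of its homogeneous parts. -/
structure DGMod where
  /-- the elements of a given degree -/
  deg : ℤ → Submodule 𝕂 Y
  /-- the action of homogeneous elements -/
  act : ∀ r, R.deg r → Y →ₗ[𝕂] Y
  /-- multiplication by `(-1)^p` in degree `p` -/
  parity : Y →ₗ[𝕂] Y
  /-- the differential -/
  L : Y →ₗ[𝕂] Y
  iSup_deg : ⨆ p, deg p = ⊤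
  act_mem : ∀ {r p : ℤ} (a : R.deg r) {y : Y}, y ∈ deg p → act r a y ∈ deg (p + r)
  -- Additivity of the action in the function is not part of the structure; the value at zero is
  -- what allows the correction term in `slotMap_act` to be switched off by `a' = 0`.
  zero_act : ∀ (r : ℤ) (y : Y), act r 0 y = 0
  parity_eq : ∀ {p : ℤ} {y : Y}, y ∈ deg p → parity y = p.negOnePow • y
  L_mem : ∀ {p : ℤ} {y : Y}, y ∈ deg p → L y ∈ deg (p + 1)
  L_act : ∀ {r : ℤ} (a : R.deg r) (y : Y),
    L (act r a y) = r.negOnePow • act r a (L y) + act (r + 1) ⟨R.d a.1, R.d_mem a.2⟩ y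

variable {R : DGAlg 𝕂 Ω} {M : DGMod Y R} {M' : DGMod Y' R}

lemma linearMap_units_smul {P Q : Type*} [AddCommGroup P] [Module 𝕂 P] [AddCommGroup Q] [Module 𝕂 Q]
    (f : P →ₗ[𝕂] Q) (u : ℤˣ) (x : P) : f (u • x) = u • f x := by
  rcases Int.units_eq_one_or u with rfl | rfl <;> simp

lemma units_mul_left (u : ℤˣ) (a b : Ω) : (u • a) * b = u • (a * b) := by
  rcases Int.units_eq_one_or u with rfl | rfl <;> simp

lemma units_mul_right (u : ℤˣ) (a b : Ω) : a * (u • b) = u • (a * b) := by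
  rcases Int.units_eq_one_or u with rfl | rfl <;> simp

/-- Comparisons of Koszul signs are reduced by this to identities of integers; the witness is half
the difference of the exponents. -/
lemma negOnePow_congr {a b : ℤ} (h : ∃ c, a = b + 2 * c) : a.negOnePow = b.negOnePow := by
  obtain ⟨c, rfl⟩ := h
  rw [Int.negOnePow_add, Int.negOnePow_two_mul, mul_one]

namespace DGMod

/-- Linear maps are determined by their values on homogeneous elements. -/
lemma linearMap_ext {Q : Type*} [AddCommGroup Q] [Module 𝕂 Q] (M : DGMod Y R) {f g : Y →ₗ[𝕂] Q}
    (h : ∀ p, ∀ y ∈ M.deg p, f y = g y) : f = g := by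
  have : (⊤ : Submodule 𝕂 Y) ≤ LinearMap.eqLocus f g := by
    rw [← M.iSup_deg]
    exact iSup_le h
  exact LinearMap.ext fun y => this trivial

lemma parity_parity (M : DGMod Y R) (y : Y) : M.parity (M.parity y) = y := by
  have : M.parity ∘ₗ M.parity = LinearMap.id := M.linearMap_ext fun p y hy => by
    rw [LinearMap.comp_apply, M.parity_eq hy, linearMap_units_smul, M.parity_eq hy, smul_smul,
      Int.units_mul_self, one_smul, LinearMap.id_apply]
  exact LinearMap.congr_fun this y

/-- An operator of odd degree anticommutes with the parity. -/
lemma parity_odd (M : DGMod Y R) {S : Y →ₗ[𝕂] Y} {s : ℤ} (hs : Odd s)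
    (hS : ∀ p, ∀ y ∈ M.deg p, S y ∈ M.deg (p + s)) (y : Y) :
    M.parity (S y) = - S (M.parity y) := by
  have : M.parity ∘ₗ S = - S ∘ₗ M.parity := M.linearMap_ext fun p y hy => by
    simp only [LinearMap.comp_apply, LinearMap.neg_apply]
    rw [M.parity_eq hy, M.parity_eq (hS p y hy), linearMap_units_smul, Int.negOnePow_add,
      Int.negOnePow_odd _ hs, mul_neg, mul_one, Units.neg_smul]
  exact LinearMap.congr_fun this y

/-- An operator of degree zero commutes with the parity. -/
lemma parity_even (M : DGMod Y R) {S : Y →ₗ[𝕂] Y}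
    (hS : ∀ p, ∀ y ∈ M.deg p, S y ∈ M.deg p) (y : Y) :
    M.parity (S y) = S (M.parity y) := by
  have : M.parity ∘ₗ S = S ∘ₗ M.parity := M.linearMap_ext fun p y hy => by
    simp only [LinearMap.comp_apply]
    rw [M.parity_eq hy, M.parity_eq (hS p y hy), linearMap_units_smul]
  exact LinearMap.congr_fun this y

/-- The direct sum of two differential graded modules. -/
def prod (M : DGMod Y R) (M' : DGMod Y' R) : DGMod (Y × Y') R where
  deg p := (M.deg p).prod (M'.deg p)
  act r a := (M.act r a).prodMap (M'.act r a)
  parity := M.parity.prodMap M'.parity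
  L := M.L.prodMap M'.L
  iSup_deg := by
    refine eq_top_iff.mpr fun y _ => ?_
    have h1 : (⨆ p, M.deg p) ≤ (⨆ p, (M.deg p).prod (M'.deg p)).comap (LinearMap.inl 𝕂 Y Y') :=
      iSup_le fun p x hx => Submodule.mem_iSup_of_mem p ⟨hx, zero_mem _⟩
    have h2 : (⨆ p, M'.deg p) ≤ (⨆ p, (M.deg p).prod (M'.deg p)).comap (LinearMap.inr 𝕂 Y Y') :=
      iSup_le fun p x hx => Submodule.mem_iSup_of_mem p ⟨zero_mem _, hx⟩
    have k1 : (y.1, 0) ∈ ⨆ p, (M.deg p).prod (M'.deg p) :=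
      h1 (M.iSup_deg.symm ▸ trivial : y.1 ∈ ⨆ p, M.deg p)
    have k2 : (0, y.2) ∈ ⨆ p, (M.deg p).prod (M'.deg p) :=
      h2 (M'.iSup_deg.symm ▸ trivial : y.2 ∈ ⨆ p, M'.deg p)
    simpa using add_mem k1 k2
  act_mem a _ hy := ⟨M.act_mem a hy.1, M'.act_mem a hy.2⟩
  zero_act r y := Prod.ext (M.zero_act r y.1) (M'.zero_act r y.2)
  parity_eq hy := Prod.ext (M.parity_eq hy.1) (M'.parity_eq hy.2)
  L_mem hy := ⟨M.L_mem hy.1, M'.L_mem hy.2⟩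
  L_act a y := Prod.ext (M.L_act a y.1) (M'.L_act a y.2)

variable {N : ℕ}

/-- The graded multilinear maps of degree `k` on one module. -/
def IsGraded (M : DGMod Y R) (τ : MultilinearMap 𝕂 (fun _ : Fin N => Y) Ω) (k : ℤ) : Prop :=
  ∀ (p : Fin N → ℤ) (y : Fin N → Y), (∀ i, y i ∈ M.deg (p i)) →
    τ y ∈ R.deg (k + ∑ i, p i) ∧
    ∀ (r : ℤ) (a : R.deg r) (i : Fin N), τ (Function.update y i (M.act r a (y i))) =
      (r * (k + ∑ l ∈ Finset.Iio i, p l)).negOnePow • (a.1 * τ y)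

/-- Composition with `S` in the place `i` and with the parity in the places before. -/
def slotMap (M : DGMod Y R) (S : Y →ₗ[𝕂] Y) (i : Fin N) :
    MultilinearMap 𝕂 (fun _ : Fin N => Y) Ω →ₗ[𝕂] MultilinearMap 𝕂 (fun _ : Fin N => Y) Ω :=
  MultilinearMap.compLinearMapₗ (insertAt M.parity S i)

/-- The differential of multilinear maps of degree `k`. -/
def lie (M : DGMod Y R) (N : ℕ) (k : ℤ) :
    MultilinearMap 𝕂 (fun _ : Fin N => Y) Ω →ₗ[𝕂] MultilinearMap 𝕂 (fun _ : Fin N => Y) Ω :=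
  R.d.compMultilinearMapₗ 𝕂 - k.negOnePow • ∑ i, M.slotMap M.L i

lemma slotMap_apply (M : DGMod Y R) (S : Y →ₗ[𝕂] Y) (i : Fin N)
    (τ : MultilinearMap 𝕂 (fun _ : Fin N => Y) Ω) (y : Fin N → Y) :
    M.slotMap S i τ y = τ fun l => insertAt M.parity S i l (y l) := rfl

lemma lie_apply (M : DGMod Y R) (k : ℤ) (τ : MultilinearMap 𝕂 (fun _ : Fin N => Y) Ω)
    (y : Fin N → Y) : M.lie N k τ y = R.d (τ y) - k.negOnePow • ∑ i, M.slotMap M.L i τ y := by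
  rcases Int.units_eq_one_or k.negOnePow with h | h <;>
  simp [lie, h]

lemma sum_Iio_update (p : Fin N → ℤ) (i j : Fin N) (q : ℤ) :
    ∑ l ∈ Finset.Iio i, Function.update p j q l =
      ∑ l ∈ Finset.Iio i, p l + if j < i then q - p j else 0 := by
  split_ifs with h
  · rw [Finset.sum_update_of_mem (Finset.mem_Iio.mpr h), Finset.sdiff_singleton_eq_erase,
      ← Finset.add_sum_erase _ p (Finset.mem_Iio.mpr h)]
    ring
  · rw [Finset.sum_update_of_notMem (by simpa using h), add_zero]

lemma sum_update_univ (p : Fin N → ℤ) (j : Fin N) (q : ℤ) :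
    ∑ l, Function.update p j q l = ∑ l, p l + (q - p j) := by
  rw [Finset.sum_update_of_mem (Finset.mem_univ j), Finset.sdiff_singleton_eq_erase,
      ← Finset.add_sum_erase _ p (Finset.mem_univ j)]
  ring

lemma update_mem (M : DGMod Y R) {p : Fin N → ℤ} {y : Fin N → Y} (hy : ∀ i, y i ∈ M.deg (p i))
    (i : Fin N) {q : ℤ} {z : Y} (hz : z ∈ M.deg q) (l : Fin N) :
    Function.update y i z l ∈ M.deg (Function.update p i q l) := by
  by_cases h : l = i
  · subst h; simpa
  · simpa [h] using hy l

/-- On homogeneous arguments the parity operators before the place `i` are signs, which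
multilinearity collects into the Koszul sign. -/
lemma slotMap_eq (M : DGMod Y R) (S : Y →ₗ[𝕂] Y) (i : Fin N)
    (τ : MultilinearMap 𝕂 (fun _ : Fin N => Y) Ω) {p : Fin N → ℤ} {y : Fin N → Y}
    (hy : ∀ i, y i ∈ M.deg (p i)) : M.slotMap S i τ y =
      (∑ l ∈ Finset.Iio i, p l).negOnePow • τ (Function.update y i (S (y i))) := by
  have h : (fun l => insertAt M.parity S i l (y l)) =
      fun l => (if l < i then (p l).negOnePow else 1 : ℤˣ) • Function.update y i (S (y i)) l := by
    funext l
    unfold insertAt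
    split_ifs with h1 h2
    · rw [M.parity_eq (hy l), Function.update_of_ne h1.ne]
    · subst h2; simp
    · simp [h2]
  rw [slotMap_apply, h, multilinear_units_smul, ← prod_negOnePow]
  congr 1
  rw [Finset.prod_ite, Finset.prod_const_one, mul_one]
  congr 1
  ext l; simp

lemma lie_eq (M : DGMod Y R) (k : ℤ) (τ : MultilinearMap 𝕂 (fun _ : Fin N => Y) Ω)
    {p : Fin N → ℤ} {y : Fin N → Y} (hy : ∀ i, y i ∈ M.deg (p i)) :
    M.lie N k τ y = R.d (τ y) - k.negOnePow • ∑ i, (∑ l ∈ Finset.Iio i, p l).negOnePow •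
      τ (Function.update y i (M.L (y i))) := by
  simp only [lie_apply, M.slotMap_eq _ _ _ hy]

/-- The behaviour of `slotMap S j` under the action in the place `i`, for an odd operator `S`. -/
lemma slotMap_act (M : DGMod Y R) {S : Y →ₗ[𝕂] Y} {s : ℤ} (hs : Odd s)
    (hS : ∀ p, ∀ y ∈ M.deg p, S y ∈ M.deg (p + s)) {r : ℤ} {a : R.deg r} {a' : R.deg (r + 1)}
    (hSa : ∀ y, S (M.act r a y) = r.negOnePow • M.act r a (S y) + M.act (r + 1) a' y)
    {τ : MultilinearMap 𝕂 (fun _ : Fin N => Y) Ω} {k : ℤ} (hτ : M.IsGraded τ k)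
    {p : Fin N → ℤ} {y : Fin N → Y} (hy : ∀ i, y i ∈ M.deg (p i)) (i j : Fin N) :
    M.slotMap S j τ (Function.update y i (M.act r a (y i))) =
      (r * (k + 1 + ∑ l ∈ Finset.Iio i, p l)).negOnePow • (a.1 * M.slotMap S j τ y) +
        if j = i then (k + r * (k + ∑ l ∈ Finset.Iio i, p l)).negOnePow • (a'.1 * τ y) else 0 := by
  obtain ⟨t, rfl⟩ := hs
  have hy' := M.update_mem hy i (M.act_mem a (hy i))
  have hy'' := M.update_mem hy j (hS _ _ (hy j))
  rw [M.slotMap_eq S j τ hy', M.slotMap_eq S j τ hy, sum_Iio_update, units_mul_right, smul_smul]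
  by_cases hij : j = i
  · subst hij
    simp only [Function.update_self, Function.update_idem, lt_irrefl, if_false, add_zero, if_true]
    rw [hSa, τ.map_update_add]
    have h1 := ((hτ _ _ hy'').2 r a j)
    simp only [Function.update_self, Function.update_idem, sum_Iio_update, lt_irrefl, if_false,
      add_zero] at h1
    have h2 := ((hτ _ _ hy).2 (r + 1) a' j)
    have h3 : ∀ (u : ℤˣ) z, τ (Function.update y j (u • z)) = u • τ (Function.update y j z) :=
      fun u z => by
        rcases Int.units_eq_one_or u with rfl | rfl
        · simp
        · rw [Units.neg_smul, Units.neg_smul, one_smul, one_smul, τ.map_update_neg]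
    rw [h3, h1, h2, smul_add, smul_smul, smul_smul, smul_smul, ← Int.negOnePow_add,
      ← Int.negOnePow_add, ← Int.negOnePow_add, ← Int.negOnePow_add]
    congr 2
    · exact negOnePow_congr ⟨0, by ring⟩
    · exact negOnePow_congr ⟨∑ l ∈ Finset.Iio j, p l, by ring⟩
  · have hji : i ≠ j := Ne.symm hij
    have h1 := ((hτ _ _ hy'').2 r a i)
    rw [Function.update_of_ne hji, sum_Iio_update] at h1
    rw [if_neg hij, add_zero, Function.update_of_ne hij, Function.update_comm hji, h1, smul_smul,
      ← Int.negOnePow_add, ← Int.negOnePow_add]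
    congr 1
    -- Both cases yield an extra `(-1)^r`: for `j < i` because `a` also passes the odd degree `s` of
    -- `S`, for `i < j` because the argument in the place `i` has gained the degree `r` that `S` has
    -- to pass.
    rcases lt_or_gt_of_ne hij with h | h
    · rw [if_pos h, if_neg h.not_gt]
      exact negOnePow_congr ⟨r * t, by ring⟩
    · rw [if_neg h.not_gt, if_pos h]
      exact negOnePow_congr ⟨0, by ring⟩

lemma slotMap_mem (M : DGMod Y R) {S : Y →ₗ[𝕂] Y} {s : ℤ}
    (hS : ∀ p, ∀ y ∈ M.deg p, S y ∈ M.deg (p + s))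
    {τ : MultilinearMap 𝕂 (fun _ : Fin N => Y) Ω} {k : ℤ} (hτ : M.IsGraded τ k)
    {p : Fin N → ℤ} {y : Fin N → Y} (hy : ∀ i, y i ∈ M.deg (p i)) (j : Fin N) :
    M.slotMap S j τ y ∈ R.deg (k + s + ∑ l, p l) := by
  rw [M.slotMap_eq S j τ hy]
  refine units_smul_mem' _ _ ?_
  have := (hτ _ _ (M.update_mem hy j (hS _ _ (hy j)))).1
  rw [sum_update_univ] at this
  convert this using 2
  ring

/-- Meant for homotopies, which commute with the action up to sign: inserting one in a place
preserves linearity over the functions, so primitives built from it are again graded multilinear. -/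
lemma IsGraded.slotMap {S : Y →ₗ[𝕂] Y} {s : ℤ} (hs : Odd s)
    (hS : ∀ p, ∀ y ∈ M.deg p, S y ∈ M.deg (p + s))
    (hSa : ∀ (r : ℤ) (a : R.deg r) y, S (M.act r a y) = r.negOnePow • M.act r a (S y))
    {τ : MultilinearMap 𝕂 (fun _ : Fin N => Y) Ω} {k : ℤ} (hτ : M.IsGraded τ k) (j : Fin N) :
    M.IsGraded (M.slotMap S j τ) (k + s) := by
  refine fun p y hy => ⟨M.slotMap_mem hS hτ hy j, fun r a i => ?_⟩
  have h := M.slotMap_act hs hS (a' := 0) (fun y => by rw [hSa, M.zero_act, add_zero]) hτ hy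
    (a := a) i j
  rw [h]
  obtain ⟨t, rfl⟩ := hs
  simp only [ZeroMemClass.coe_zero, zero_mul, smul_zero, ite_self, add_zero]
  congr 1
  exact negOnePow_congr ⟨-r * t, by ring⟩

/-- For an argument `a yᵢ`, the term `(da) τ(y)` arises twice, from the Leibniz rule of `d` and from
`L (a yᵢ)` in the place `i`. The signs are such that the two cancel, and only terms with the factor
`a` are left. -/
lemma IsGraded.lie {τ : MultilinearMap 𝕂 (fun _ : Fin N => Y) Ω} {k : ℤ} (hτ : M.IsGraded τ k) :
    M.IsGraded (M.lie N k τ) (k + 1) := by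
  refine fun p y hy => ⟨?_, fun r a i => ?_⟩
  · rw [lie_apply]
    have h := R.d_mem (hτ p y hy).1
    rw [add_right_comm] at h
    exact sub_mem h (units_smul_mem' _ _ (sum_mem fun i _ =>
      M.slotMap_mem (fun p y hy => M.L_mem hy) hτ hy i))
  · simp only [lie_apply, M.slotMap_act odd_one (fun p y hy => M.L_mem hy) (M.L_act a) hτ hy,
      Finset.sum_add_distrib, Finset.sum_ite_eq', Finset.mem_univ, if_true, (hτ p y hy).2 r a i,
      linearMap_units_smul, R.leibniz a.2]
    rw [mul_sub, units_mul_right, Finset.mul_sum, smul_add, smul_add, smul_sub, smul_smul,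
      smul_smul, smul_smul, ← Finset.smul_sum, smul_smul, ← Int.negOnePow_add, ← Int.negOnePow_add,
      ← Int.negOnePow_add, ← Int.negOnePow_add]
    have e1 : (k + (k + r * (k + ∑ l ∈ Finset.Iio i, p l))).negOnePow =
        (r * (k + ∑ l ∈ Finset.Iio i, p l)).negOnePow := negOnePow_congr ⟨k, by ring⟩
    have e2 : (r * (k + ∑ l ∈ Finset.Iio i, p l) + r).negOnePow =
        (r * (k + 1 + ∑ l ∈ Finset.Iio i, p l)).negOnePow := negOnePow_congr ⟨0, by ring⟩
    rw [e1, e2, add_comm k (r * _)]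
    abel

lemma IsGraded.sub {σ τ : MultilinearMap 𝕂 (fun _ : Fin N => Y) Ω} {k : ℤ}
    (hσ : M.IsGraded σ k) (hτ : M.IsGraded τ k) : M.IsGraded (σ - τ) k := fun p y hy =>
  ⟨sub_mem (hσ p y hy).1 (hτ p y hy).1, fun r a i => by
    rw [_root_.sub_apply, _root_.sub_apply, (hσ p y hy).2, (hτ p y hy).2, mul_sub,
      smul_sub]⟩

lemma IsGraded.units_smul {τ : MultilinearMap 𝕂 (fun _ : Fin N => Y) Ω} {k : ℤ} (u : ℤˣ)
    (hτ : M.IsGraded τ k) : M.IsGraded (u • τ) k := fun p y hy =>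
  ⟨units_smul_mem' _ _ (hτ p y hy).1, fun r a i => by
    change u • τ _ = _ • (a.1 * u • τ y)
    rw [(hτ p y hy).2, units_mul_right, smul_comm]⟩

/-- Maps agreeing on homogeneous arguments are equal. -/
lemma multilinearMap_ext {Q : Type*} [AddCommGroup Q] [Module 𝕂 Q] (M : DGMod Y R)
    {σ τ : MultilinearMap 𝕂 (fun _ : Fin N => Y) Q}
    (h : ∀ (p : Fin N → ℤ) (y : Fin N → Y), (∀ i, y i ∈ M.deg (p i)) → σ y = τ y) : σ = τ := by
  have key : ∀ (s : Finset (Fin N)) (y : Fin N → Y),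
      (∀ i, i ∉ s → ∃ p, y i ∈ M.deg p) → σ y = τ y := by
    intro s
    induction s using Finset.induction_on with
    | empty =>
      intro y hy
      choose p hp using fun i => hy i (Finset.notMem_empty i)
      exact h p y hp
    | insert i s _ ih =>
      intro y hy
      have := M.linearMap_ext (f := σ.toLinearMap y i) (g := τ.toLinearMap y i) fun p z hz => by
        refine ih _ fun l hl => ?_
        by_cases hli : l = i
        · subst hli; exact ⟨p, by simpa⟩
        · simpa [hli] using hy l (by simp [hli, hl])
      simpa using LinearMap.congr_fun this (y i)
  exact MultilinearMap.ext fun y => key Finset.univ y fun i hi => absurd (Finset.mem_univ i) hi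

/-- Composition with `f` in the places in `s`. -/
def onSlots (f : Y →ₗ[𝕂] Y) (s : Finset (Fin N)) (τ : MultilinearMap 𝕂 (fun _ : Fin N => Y) Ω) :
    MultilinearMap 𝕂 (fun _ : Fin N => Y) Ω :=
  τ.compLinearMap fun l => if l ∈ s then f else LinearMap.id

/-- Both compositions apply `T` in the place `j`. They differ in the place `i` alone, where the
parity acts after `S` in one and before it in the other; `S` is odd, so this is a sign. -/
lemma slotMap_slotMap_ne (M : DGMod Y R) {S T : Y →ₗ[𝕂] Y}
    (hS : ∀ y, M.parity (S y) = - S (M.parity y))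
    {i j : Fin N} (hij : i < j) (τ : MultilinearMap 𝕂 (fun _ : Fin N => Y) Ω) :
    M.slotMap S i (M.slotMap T j τ) + M.slotMap T j (M.slotMap S i τ) = 0 := by
  refine MultilinearMap.ext fun y => ?_
  rw [_root_.add_apply, slotMap_apply, slotMap_apply, slotMap_apply, slotMap_apply,
    _root_.zero_apply]
  have h : (fun l => insertAt M.parity T j l (insertAt M.parity S i l (y l))) =
      Function.update (fun l => insertAt M.parity S i l (insertAt M.parity T j l (y l))) i
        (- insertAt M.parity S i i (insertAt M.parity T j i (y i))) := by
    funext l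
    by_cases hl : l = i
    · subst hl
      simp [insertAt, hij, hS]
    · rw [Function.update_of_ne hl]
      unfold insertAt
      rcases lt_or_gt_of_ne hl with h | h
      · simp [h, h.trans hij]
      · simp [h.not_gt, hl]
  rw [h, MultilinearMap.map_update_neg]
  simp

/-- In the places before `i` the parity is applied twice and disappears. -/
lemma slotMap_slotMap_self (M : DGMod Y R) (S T : Y →ₗ[𝕂] Y) (i : Fin N)
    (τ : MultilinearMap 𝕂 (fun _ : Fin N => Y) Ω) (y : Fin N → Y) :
    M.slotMap S i (M.slotMap T i τ) y = τ (Function.update y i (T (S (y i)))) := by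
  rw [slotMap_apply, slotMap_apply]
  congr 1
  funext l
  by_cases hl : l = i
  · subst hl
    simp [insertAt]
  · rw [Function.update_of_ne hl]
    unfold insertAt
    rcases lt_or_gt_of_ne hl with h | h
    · simp [h, M.parity_parity]
    · simp [h.not_gt, hl]

/-- The operator `id - [L, h]` for a homotopy `h`. -/
structure Homotopy (M : DGMod Y R) (h P : Y →ₗ[𝕂] Y) : Prop where
  -- The shift is written `p + -1` to match the form `p + s` of an odd operator in `parity_odd` and
  -- `IsGraded.slotMap`.
  mem : ∀ p, ∀ y ∈ M.deg p, h y ∈ M.deg (p + -1)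
  act : ∀ (r : ℤ) (a : R.deg r) y, h (M.act r a y) = r.negOnePow • M.act r a (h y)
  eq : ∀ y, M.L (h y) + h (M.L y) = y - P y
  L_L : ∀ y, M.L (M.L y) = 0

variable {h P : Y →ₗ[𝕂] Y}

/-- Both sides equal `L - L h L`, because `L` has square zero. -/
lemma Homotopy.P_L (H : M.Homotopy h P) (y : Y) : P (M.L y) = M.L (P y) := by
  have h1 := H.eq (M.L y)
  have h2 := congrArg M.L (H.eq y)
  rw [H.L_L, map_zero, add_zero] at h1
  rw [map_add, H.L_L, zero_add, map_sub] at h2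
  exact sub_right_injective (h1.symm.trans h2)

lemma Homotopy.P_mem (H : M.Homotopy h P) {p : ℤ} {y : Y} (hy : y ∈ M.deg p) : P y ∈ M.deg p := by
  have e : P y = y - (M.L (h y) + h (M.L y)) := by rw [H.eq, sub_sub_cancel]
  have h1 := M.L_mem (H.mem p y hy)
  have h2 := H.mem _ _ (M.L_mem hy)
  rw [neg_add_cancel_right] at h1
  rw [add_neg_cancel_right] at h2
  rw [e]
  exact sub_mem hy (add_mem h1 h2)

/-- Inserting `h` in the place `i` commutes with the differential of the values and anticommutes
with `L` in every other place. In the place `i` itself there remains `L h + h L = id - P`. -/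
lemma Homotopy.slot (H : M.Homotopy h P) (k : ℤ) (i : Fin N)
    (τ : MultilinearMap 𝕂 (fun _ : Fin N => Y) Ω) (hτ : M.lie N k τ = 0) :
    M.lie N (k - 1) (k.negOnePow • M.slotMap h i τ) = τ - onSlots P {i} τ := by
  have hL : ∀ y, M.parity (M.L y) = - M.L (M.parity y) :=
    M.parity_odd odd_one fun p y hy => M.L_mem hy
  have hh : ∀ y, M.parity (h y) = - h (M.parity y) :=
    M.parity_odd (by decide) H.mem
  have h1 : k.negOnePow • M.slotMap h i (M.lie N k τ) = 0 := by rw [hτ, map_zero, smul_zero]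
  have h2 : M.slotMap h i (R.d.compMultilinearMapₗ 𝕂 τ) =
      R.d.compMultilinearMapₗ 𝕂 (M.slotMap h i τ) := rfl
  have h3 : ∑ j, (M.slotMap M.L j (M.slotMap h i τ) + M.slotMap h i (M.slotMap M.L j τ)) =
      τ - onSlots P {i} τ := by
    rw [Finset.sum_eq_single i]
    · refine MultilinearMap.ext fun y => ?_
      rw [_root_.add_apply, slotMap_slotMap_self, slotMap_slotMap_self,
        ← MultilinearMap.map_update_add, add_comm, H.eq, MultilinearMap.map_update_sub,
        Function.update_eq_self, _root_.sub_apply, onSlots,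
        MultilinearMap.compLinearMap_apply]
      congr 2
      funext l
      by_cases hl : l = i
      · subst hl; simp
      · simp [hl]
    · intro j _ hj
      rcases lt_or_gt_of_ne hj with hl | hl
      · exact M.slotMap_slotMap_ne hL hl τ
      · rw [add_comm]
        exact M.slotMap_slotMap_ne hh hl τ
    · simp
  -- Subtracting the vanishing element `h1` completes the anticommutator. The factor `(-1)^k` is
  -- there to absorb the signs of the differentials of degrees `k - 1` and `k`.
  rw [← h3, Finset.sum_add_distrib, ← map_sum, ← sub_zero (M.lie N (k - 1) _), ← h1, lie, lie]
  simp only [LinearMap.sub_apply, map_sub, h2]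
  rcases Int.units_eq_one_or k.negOnePow with hk | hk
  all_goals
    simp only [Int.negOnePow_sub, hk, Int.negOnePow_one, one_smul, Units.neg_smul,
      LinearMap.sum_apply, map_neg, mul_neg, neg_neg, mul_one]
    simp
  abel

/-- `P` commutes with `L` and, having degree zero, with the parity; these are the only operators
that the differential inserts in the places. -/
lemma Homotopy.onSlots_lie (H : M.Homotopy h P) (k : ℤ) (s : Finset (Fin N))
    (τ : MultilinearMap 𝕂 (fun _ : Fin N => Y) Ω) :
    M.lie N k (onSlots P s τ) = onSlots P s (M.lie N k τ) := by
  refine MultilinearMap.ext fun y => ?_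
  change _ = M.lie N k τ _
  rw [lie_apply, lie_apply]
  congr 2
  refine Finset.sum_congr rfl fun i _ => ?_
  change τ _ = τ _
  congr 1
  funext l
  have h1 := H.P_L (y l)
  have h2 := M.parity_even (fun p y hy => H.P_mem hy) (y l)
  unfold insertAt
  by_cases hs : l ∈ s <;> rcases lt_trichotomy l i with hl | hl | hl
  all_goals first | subst hl | skip
  all_goals simp [*, not_lt_of_gt, ne_of_gt]

lemma onSlots_insert (f : Y →ₗ[𝕂] Y) {s : Finset (Fin N)} {i : Fin N} (hi : i ∉ s)
    (τ : MultilinearMap 𝕂 (fun _ : Fin N => Y) Ω) :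
    onSlots f (insert i s) τ = onSlots f {i} (onSlots f s τ) := by
  refine MultilinearMap.ext fun y => ?_
  change τ _ = τ _
  congr 1
  funext l
  by_cases hl : l = i
  · subst hl; simp [hi]
  · simp [hl]

/-- A cocycle is cohomologous to its composition with the projection `P` in all places. -/
lemma Homotopy.exists_primitive (H : M.Homotopy h P) {k : ℤ} {s : Finset (Fin N)}
    {τ : MultilinearMap 𝕂 (fun _ : Fin N => Y) Ω} (hτ : M.IsGraded τ k) (hL : M.lie N k τ = 0) :
    ∃ σ, M.IsGraded σ (k - 1) ∧ M.lie N (k - 1) σ = τ - onSlots P s τ := by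
  induction s using Finset.induction_on with
  | empty =>
    refine ⟨0, fun p y hy => ⟨zero_mem _, fun r a i => by simp⟩, ?_⟩
    rw [map_zero, eq_comm, sub_eq_zero]
    exact MultilinearMap.ext fun y => by simp [onSlots]
  | insert i s hi ih =>
    obtain ⟨σ, hσ, hσ'⟩ := ih
    -- By the induction hypothesis this map is `τ` minus a coboundary, so it is graded without an
    -- appeal to linearity of `P` over the functions.
    have h1 : M.IsGraded (onSlots P s τ) k := by
      have := hσ.lie
      rw [sub_add_cancel, hσ'] at this
      simpa using hτ.sub this
    have h2 : M.lie N k (onSlots P s τ) = 0 := by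
      rw [H.onSlots_lie, hL]
      rfl
    refine ⟨σ + k.negOnePow • M.slotMap h i (onSlots P s τ), ?_, ?_⟩
    · have h3 := (h1.slotMap (s := -1) (by decide) H.mem H.act i).units_smul (-k.negOnePow)
      have h4 := hσ.sub h3
      rwa [Units.neg_smul, sub_neg_eq_add] at h4
    · rw [map_add, hσ', H.slot k i _ h2, onSlots_insert P hi]
      abel

end DGMod

end GradedModules

/-! ### Expansion of graded multilinear maps in a frame -/

section Frames

variable {𝕂 Ω Y : Type*} [CommRing 𝕂] [Ring Ω] [Algebra 𝕂 Ω] [AddCommGroup Y] [Module 𝕂 Y]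
  {R : DGAlg 𝕂 Ω} {M : DGMod Y R} {N : ℕ}

lemma sum_Iio_eq (p : Fin N → ℤ) (i : Fin N) :
    ∑ l ∈ Finset.Iio i, p l = ∑ l, if l < i then p l else 0 := by
  rw [← Finset.sum_filter]
  congr 1
  ext l; simp

lemma DGAlg.list_prod_mem (R : DGAlg 𝕂 Ω) {p : Fin N → ℤ} {z : Fin N → Ω}
    (hz : ∀ i, z i ∈ R.deg (p i)) : (List.ofFn z).prod ∈ R.deg (∑ i, p i) := by
  induction N with
  | zero => simpa using R.one_mem
  | succ N ih =>
    rw [List.ofFn_succ, List.prod_cons, Fin.sum_univ_succ]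
    exact R.mul_mem (hz 0) (ih fun i => hz i.succ)

/-- The sign is that of moving `a` to the front past the factors before the place `i`. -/
lemma DGAlg.list_prod_update (R : DGAlg 𝕂 Ω) {p : Fin N → ℤ} {z : Fin N → Ω}
    (hz : ∀ i, z i ∈ R.deg (p i)) {r : ℤ} {a : Ω} (ha : a ∈ R.deg r) (i : Fin N) :
    (List.ofFn (Function.update z i (a * z i))).prod =
      (r * ∑ l ∈ Finset.Iio i, p l).negOnePow • (a * (List.ofFn z).prod) := by
  induction N with
  | zero => exact i.elim0
  | succ N ih =>
    rw [sum_Iio_eq, Fin.sum_univ_succ, List.ofFn_succ, List.ofFn_succ, List.prod_cons,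
      List.prod_cons]
    induction i using Fin.cases with
    | zero => simp [mul_assoc]
    | succ i =>
      have h := ih (fun i => hz i.succ) i
      have e : (fun l : Fin N => Function.update z i.succ (a * z i.succ) l.succ) =
          Function.update (fun l => z l.succ) i (a * z i.succ) := by
        funext l
        by_cases hl : l = i
        · subst hl; simp
        · simp [hl]
      rw [e, h, Function.update_of_ne (Fin.succ_ne_zero i).symm, units_mul_right, ← mul_assoc,
        R.comm (hz 0) ha, units_mul_left, smul_smul, mul_assoc, ← Int.negOnePow_add, sum_Iio_eq]
      congr 1
      simp only [Fin.succ_pos, if_true, Fin.succ_lt_succ_iff]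
      exact negOnePow_congr ⟨0, by ring⟩

namespace DGMod

/-- Pulled out to the left, a coefficient acquires exactly the sign with which it commutes with the
value of the map. Written on the right it carries no sign, provided that the coefficients are
inserted one after the other from the first place on. -/
lemma IsGraded.apply_act {k : ℤ} {τ : MultilinearMap 𝕂 (fun _ : Fin N => Y) Ω}
    (hτ : M.IsGraded τ k) {p : Fin N → ℤ} (a : ∀ i, R.deg (p i)) {y : Fin N → Y}
    (hy : ∀ i, y i ∈ M.deg 0) :
    τ (fun i => M.act (p i) (a i) (y i)) = τ y * (List.ofFn fun i => (a i).1).prod := by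
  have key : ∀ (m : ℕ) (hm : m ≤ N),
      τ (fun i => if i.1 < m then M.act (p i) (a i) (y i) else y i) =
        τ y * (List.ofFn fun i : Fin m => (a (Fin.castLE hm i)).1).prod := by
    intro m
    induction m with
    | zero => intro _; simp
    | succ m ih =>
      intro hm
      have h1 : ∀ i : Fin N, (if i.1 < m then M.act (p i) (a i) (y i) else y i) ∈
          M.deg (if i.1 < m then p i else 0) := fun i => by
        split_ifs
        · have := M.act_mem (a i) (hy i)
          rwa [zero_add] at this
        · exact hy i
      have h2 := hτ _ _ h1
      have h3 := h2.2 _ (a ⟨m, hm⟩) ⟨m, hm⟩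
      have e1 : Function.update (fun i : Fin N => if i.1 < m then M.act (p i) (a i) (y i) else y i)
          ⟨m, hm⟩ (M.act _ (a ⟨m, hm⟩) (if (⟨m, hm⟩ : Fin N).1 < m then
            M.act (p ⟨m, hm⟩) (a ⟨m, hm⟩) (y ⟨m, hm⟩) else y ⟨m, hm⟩)) =
          fun i => if i.1 < m + 1 then M.act (p i) (a i) (y i) else y i := by
        funext i
        by_cases hi : i = ⟨m, hm⟩
        · subst hi; simp
        · have : i.1 ≠ m := fun h => hi (Fin.ext h)
          rw [Function.update_of_ne hi]
          have : i.1 < m + 1 ↔ i.1 < m := by omega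
          simp [this]
      -- Only the places before `m` contribute to the degree of the value, since the vectors `y i`
      -- have degree zero; hence the two signs have equal exponents.
      have e2 : (∑ i : Fin N, if i.1 < m then p i else 0) =
          ∑ l ∈ Finset.Iio (⟨m, hm⟩ : Fin N), (if l.1 < m then p l else 0) := by
        rw [sum_Iio_eq]
        refine Finset.sum_congr rfl fun l _ => ?_
        by_cases h : l.1 < m <;> simp [h, Fin.lt_def]
      rw [e1, R.comm (a _).2 h2.1, smul_smul, ← Int.negOnePow_add, e2,
        Int.negOnePow_even _ ⟨_, rfl⟩, one_smul, ih (by omega), mul_assoc] at h3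
      rw [h3, List.ofFn_succ' (n := m), List.prod_concat]
      rfl
  have := key N le_rfl
  simpa using this

/-- Coefficient maps and vectors of degree zero for the projection `P`. -/
structure Frame (M : DGMod Y R) (P : Y →ₗ[𝕂] Y) (ι : Type*) [Fintype ι] where
  /-- the coefficients -/
  coeff : ι → Y →ₗ[𝕂] Ω
  /-- the vectors -/
  vec : ι → Y
  coeff_mem : ∀ i {p : ℤ} {y : Y}, y ∈ M.deg p → coeff i y ∈ R.deg p
  coeff_act : ∀ i {r : ℤ} (a : R.deg r) (y : Y), coeff i (M.act r a y) = a.1 * coeff i y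
  vec_mem : ∀ i, vec i ∈ M.deg 0
  P_eq : ∀ {p : ℤ} {y : Y} (hy : y ∈ M.deg p),
    P y = ∑ i, M.act p ⟨coeff i y, coeff_mem i hy⟩ (vec i)

variable {ι : Type*} [Fintype ι] {P : Y →ₗ[𝕂] Y}

/-- The multilinear map with given values on the vectors of a frame. -/
def Frame.extend (B : M.Frame P ι) (S : (Fin N → ι) → Ω) :
    MultilinearMap 𝕂 (fun _ : Fin N => Y) Ω :=
  ∑ f, (LinearMap.mulLeft 𝕂 (S f)).compMultilinearMap
    ((MultilinearMap.mkPiAlgebraFin 𝕂 N Ω).compLinearMap fun i => B.coeff (f i))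

lemma Frame.extend_apply (B : M.Frame P ι) (S : (Fin N → ι) → Ω) (y : Fin N → Y) :
    B.extend S y = ∑ f, S f * (List.ofFn fun i => B.coeff (f i) (y i)).prod := by
  simp [Frame.extend, MultilinearMap.mkPiAlgebraFin_apply]

/-- The values `S f` of degree `k` stand to the left of the coefficients, so that a function coming
out of the place `i` passes the coefficients before it and then `S f`, which accounts for `k` in the
sign. -/
lemma Frame.extend_isGraded (B : M.Frame P ι) {k : ℤ} {S : (Fin N → ι) → Ω}
    (hS : ∀ f, S f ∈ R.deg k) : M.IsGraded (B.extend S) k := by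
  refine fun p y hy => ⟨?_, fun r a i => ?_⟩
  · rw [B.extend_apply]
    exact sum_mem fun f _ => R.mul_mem (hS f) (R.list_prod_mem fun i => B.coeff_mem _ (hy i))
  · rw [B.extend_apply, B.extend_apply, Finset.mul_sum, Finset.smul_sum]
    refine Finset.sum_congr rfl fun f _ => ?_
    have e : (fun l => B.coeff (f l) (Function.update y i (M.act r a (y i)) l)) =
        Function.update (fun l => B.coeff (f l) (y l)) i (a.1 * B.coeff (f i) (y i)) := by
      funext l
      by_cases hl : l = i
      · subst hl; simp [B.coeff_act]
      · simp [hl]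
    rw [e, R.list_prod_update (fun l => B.coeff_mem _ (hy l)) a.2, units_mul_right, ← mul_assoc,
      R.comm (hS f) a.2, units_mul_left, smul_smul, mul_assoc, ← Int.negOnePow_add]
    congr 1
    exact negOnePow_congr ⟨0, by ring⟩

/-- Expanding every `P y` in the frame and pulling the coefficients out shows that the composition
with `P` depends on `τ` only through its values on the frame vectors. -/
lemma Frame.onSlots_eq (B : M.Frame P ι) {k : ℤ} {τ : MultilinearMap 𝕂 (fun _ : Fin N => Y) Ω}
    (hτ : M.IsGraded τ k) : onSlots P Finset.univ τ = B.extend fun f => τ fun i => B.vec (f i) := by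
  refine M.multilinearMap_ext fun p y hy => ?_
  have h : onSlots P Finset.univ τ y = τ fun i => ∑ j, M.act (p i)
      ⟨B.coeff j (y i), B.coeff_mem j (hy i)⟩ (B.vec j) := by
    change τ _ = τ _
    congr 1
    funext i
    simp [B.P_eq (hy i)]
  rw [h, τ.map_sum, B.extend_apply]
  exact Finset.sum_congr rfl fun f _ => hτ.apply_act
    (fun i => ⟨B.coeff (f i) (y i), B.coeff_mem (f i) (hy i)⟩) fun i => B.vec_mem (f i)

end DGMod

end Frames

/-! ### Reduction of two kinds of arguments to one, by passing to pairs -/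

section Pairs

variable {𝕂 Ω D X : Type*} [CommRing 𝕂] [AddCommGroup D] [Module 𝕂 D]
  [AddCommGroup X] [Module 𝕂 X] {n m : ℕ}

lemma append_update_left {α : Type*} (f : Fin n → α) (g : Fin m → α) (i : Fin n) (a : α) :
    Fin.append (Function.update f i a) g = Function.update (Fin.append f g) (Fin.castAdd m i) a := by
  funext l
  induction l using Fin.addCases with
  | left l =>
    by_cases h : l = i
    · subst h; simp
    · simp [h, (Fin.castAdd_injective n m).ne h]
  | right l =>
    have : Fin.natAdd n l ≠ Fin.castAdd m i := fun h => by simp [Fin.ext_iff] at h; omega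
    simp [this]

lemma append_update_right {α : Type*} (f : Fin n → α) (g : Fin m → α) (i : Fin m) (a : α) :
    Fin.append f (Function.update g i a) = Function.update (Fin.append f g) (Fin.natAdd n i) a := by
  funext l
  induction l using Fin.addCases with
  | right l =>
    by_cases h : l = i
    · subst h; simp
    · simp [h, (Fin.natAdd_injective m n).ne h]
  | left l =>
    have : Fin.castAdd m l ≠ Fin.natAdd n i := fun h => by simp [Fin.ext_iff] at h; omega
    simp [this]

lemma update_castAdd_left {α β : Type*} (g : α → β) (y : Fin (n + m) → α) (i : Fin n) (a : α) :
    (fun l : Fin n => g (Function.update y (Fin.castAdd m i) a (Fin.castAdd m l))) =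
      Function.update (fun l => g (y (Fin.castAdd m l))) i (g a) := by
  funext l
  by_cases h : l = i
  · subst h; simp
  · simp [h, (Fin.castAdd_injective n m).ne h]

lemma update_castAdd_right {α β : Type*} (g : α → β) (y : Fin (n + m) → α) (i : Fin n) (a : α) :
    (fun l : Fin m => g (Function.update y (Fin.castAdd m i) a (Fin.natAdd n l))) =
      fun l => g (y (Fin.natAdd n l)) := by
  funext l
  have : Fin.natAdd n l ≠ Fin.castAdd m i := fun h => by simp [Fin.ext_iff] at h; omega
  simp [this]

lemma update_natAdd_left {α β : Type*} (g : α → β) (y : Fin (n + m) → α) (i : Fin m) (a : α) :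
    (fun l : Fin n => g (Function.update y (Fin.natAdd n i) a (Fin.castAdd m l))) =
      fun l => g (y (Fin.castAdd m l)) := by
  funext l
  have : Fin.castAdd m l ≠ Fin.natAdd n i := fun h => by simp [Fin.ext_iff] at h; omega
  simp [this]

lemma update_natAdd_right {α β : Type*} (g : α → β) (y : Fin (n + m) → α) (i : Fin m) (a : α) :
    (fun l : Fin m => g (Function.update y (Fin.natAdd n i) a (Fin.natAdd n l))) =
      Function.update (fun l => g (y (Fin.natAdd n l))) i (g a) := by
  funext l
  by_cases h : l = i
  · subst h; simp
  · simp [h, (Fin.natAdd_injective m n).ne h]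

lemma sum_Iio_castAdd (p : Fin (n + m) → ℤ) (i : Fin n) :
    ∑ l ∈ Finset.Iio (Fin.castAdd m i), p l = ∑ l ∈ Finset.Iio i, p (Fin.castAdd m l) := by
  rw [sum_Iio_eq, sum_Iio_eq, Fin.sum_univ_add]
  have h : ∀ l : Fin m, ¬ Fin.natAdd n l < Fin.castAdd m i := fun l h => by
    simp [Fin.lt_def] at h; omega
  have h' : ∀ l : Fin n, Fin.castAdd m l < Fin.castAdd m i ↔ l < i := fun l => Iff.rfl
  simp [h, h']

lemma sum_Iio_natAdd (p : Fin (n + m) → ℤ) (i : Fin m) :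
    ∑ l ∈ Finset.Iio (Fin.natAdd n i), p l =
      ∑ l, p (Fin.castAdd m l) + ∑ l ∈ Finset.Iio i, p (Fin.natAdd n l) := by
  rw [sum_Iio_eq, sum_Iio_eq, Fin.sum_univ_add]
  have h : ∀ l : Fin n, Fin.castAdd m l < Fin.natAdd n i := fun l => by
    simp [Fin.lt_def]; omega
  simp [h]

section
variable [AddCommGroup Ω] [Module 𝕂 Ω]

/-- A multilinear map on two kinds of arguments as a multilinear map on pairs. -/
def toPairs : MultilinearForms 𝕂 Ω D X n m →ₗ[𝕂]
    MultilinearMap 𝕂 (fun _ : Fin (n + m) => D × X) Ω where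
  toFun τ := MultilinearMap.mk'
    (fun y => τ (fun i => (y (Fin.castAdd m i)).1) fun j => (y (Fin.natAdd n j)).2)
    (fun y i a b => by
      induction i using Fin.addCases with
      | left i => simp [update_castAdd_left Prod.fst, update_castAdd_right Prod.snd]
      | right i => simp [update_natAdd_left Prod.fst, update_natAdd_right Prod.snd])
    (fun y i c a => by
      induction i using Fin.addCases with
      | left i => simp [update_castAdd_left Prod.fst, update_castAdd_right Prod.snd]
      | right i => simp [update_natAdd_left Prod.fst, update_natAdd_right Prod.snd])
  map_add' _ _ := rfl
  map_smul' _ _ := rfl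

lemma toPairs_apply (τ : MultilinearForms 𝕂 Ω D X n m) (y : Fin (n + m) → D × X) :
    toPairs τ y = τ (fun i => (y (Fin.castAdd m i)).1) fun j => (y (Fin.natAdd n j)).2 := rfl

variable (𝕂) in
/-- The pairs with one component zero. -/
def pairArgs (α : Fin n → D) (x : Fin m → X) : Fin (n + m) → D × X :=
  Fin.append (fun i => (α i, 0)) fun j => (0, x j)

lemma pairArgs_update_left (α : Fin n → D) (x : Fin m → X) (i : Fin n) (a : D) :
    pairArgs (Function.update α i a) x =
      Function.update (pairArgs α x) (Fin.castAdd m i) (a, 0) := by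
  rw [pairArgs, pairArgs, ← append_update_left]
  congr 1
  exact comp_update (fun a => (a, (0 : X))) α i a

lemma pairArgs_update_right (α : Fin n → D) (x : Fin m → X) (i : Fin m) (a : X) :
    pairArgs α (Function.update x i a) =
      Function.update (pairArgs α x) (Fin.natAdd n i) (0, a) := by
  rw [pairArgs, pairArgs, ← append_update_right]
  congr 1
  exact comp_update (fun a => ((0 : D), a)) x i a

@[simp] lemma pairArgs_castAdd (α : Fin n → D) (x : Fin m → X) (i : Fin n) :
    pairArgs α x (Fin.castAdd m i) = (α i, 0) := by simp [pairArgs]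

@[simp] lemma pairArgs_natAdd (α : Fin n → D) (x : Fin m → X) (i : Fin m) :
    pairArgs α x (Fin.natAdd n i) = (0, x i) := by simp [pairArgs]

/-- The restriction of a multilinear map on pairs to arguments of two kinds. -/
def ofPairs : MultilinearMap 𝕂 (fun _ : Fin (n + m) => D × X) Ω →ₗ[𝕂]
    MultilinearForms 𝕂 Ω D X n m where
  toFun σ := MultilinearMap.mk' (fun α => MultilinearMap.mk' (fun x => σ (pairArgs α x))
      (fun x i a b => by
        have h : ((0, a + b) : D × X) = (0, a) + (0, b) := by simp
        simp only [pairArgs_update_right, h, σ.map_update_add])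
      (fun x i c a => by
        have h : ((0, c • a) : D × X) = c • (0, a) := by simp
        simp only [pairArgs_update_right, h, σ.map_update_smul]))
    (fun α i a b => MultilinearMap.ext fun x => by
        have h : ((a + b, 0) : D × X) = (a, 0) + (b, 0) := by simp
        simp only [MultilinearMap.mk'_apply, _root_.add_apply, pairArgs_update_left, h,
          σ.map_update_add])
    (fun α i c a => MultilinearMap.ext fun x => by
        have h : ((c • a, 0) : D × X) = c • (a, 0) := by simp
        simp only [MultilinearMap.mk'_apply, _root_.smul_apply, pairArgs_update_left, h,
          σ.map_update_smul])
  map_add' _ _ := rfl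
  map_smul' _ _ := rfl

lemma ofPairs_apply (σ : MultilinearMap 𝕂 (fun _ : Fin (n + m) => D × X) Ω) (α : Fin n → D)
    (x : Fin m → X) : ofPairs σ α x = σ (pairArgs α x) := rfl

-- Only this composition is the identity: a map on pairs may also depend on the components that
-- `toPairs` ignores.
@[simp] lemma ofPairs_toPairs (τ : MultilinearForms 𝕂 Ω D X n m) : ofPairs (toPairs τ) = τ := by
  refine MultilinearMap.ext fun α => MultilinearMap.ext fun x => ?_
  simp [ofPairs_apply, toPairs_apply]

end

variable [Ring Ω] [Algebra 𝕂 Ω] {R : DGAlg 𝕂 Ω} {M : DGMod D R} {M' : DGMod X R} {k : ℤ}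

variable (M M') in
/-- The graded multilinear maps on two modules. -/
abbrev gradedForms (n m : ℕ) (k : ℤ) : Submodule 𝕂 (MultilinearForms 𝕂 Ω D X n m) :=
  gradedMultilinearForms R.deg M.deg M'.deg (LinearMap.mul 𝕂 Ω) M.act M'.act n m k

lemma isGraded_toPairs {τ : MultilinearForms 𝕂 Ω D X n m} (hτ : τ ∈ gradedForms M M' n m k) :
    (M.prod M').IsGraded (toPairs τ) k := by
  intro p y hy
  obtain ⟨h1, h2⟩ := hτ (fun i => p (Fin.castAdd m i)) (fun j => p (Fin.natAdd n j))
    (fun i => (y (Fin.castAdd m i)).1) (fun j => (y (Fin.natAdd n j)).2)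
    (fun i => (hy (Fin.castAdd m i)).1) (fun j => (hy (Fin.natAdd n j)).2)
  refine ⟨?_, fun r a i => ?_⟩
  · rw [Fin.sum_univ_add, ← add_assoc]
    exact h1
  · rw [toPairs_apply, toPairs_apply]
    induction i using Fin.addCases with
    | left i =>
      rw [update_castAdd_left Prod.fst, update_castAdd_right Prod.snd, sum_Iio_castAdd]
      exact (h2 r a).1 i
    | right i =>
      rw [update_natAdd_left Prod.fst, update_natAdd_right Prod.snd, sum_Iio_natAdd, ← add_assoc]
      exact (h2 r a).2 i

lemma pairArgs_mem {α : Fin n → D} {x : Fin m → X} {p : Fin n → ℤ} {q : Fin m → ℤ}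
    (hα : ∀ i, α i ∈ M.deg (p i)) (hx : ∀ j, x j ∈ M'.deg (q j)) (l : Fin (n + m)) :
    pairArgs α x l ∈ (M.prod M').deg (Fin.append p q l) := by
  induction l using Fin.addCases with
  | left i =>
    rw [pairArgs_castAdd, Fin.append_left]
    exact ⟨hα i, zero_mem _⟩
  | right j =>
    rw [pairArgs_natAdd, Fin.append_right]
    exact ⟨zero_mem _, hx j⟩

lemma ofPairs_mem {σ : MultilinearMap 𝕂 (fun _ : Fin (n + m) => D × X) Ω}
    (hσ : (M.prod M').IsGraded σ k) : ofPairs σ ∈ gradedForms M M' n m k := by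
  intro p q α x hα hx
  obtain ⟨h1, h2⟩ := hσ _ _ (pairArgs_mem hα hx)
  refine ⟨?_, fun r a => ⟨fun i => ?_, fun j => ?_⟩⟩
  · simpa [ofPairs_apply, Fin.sum_univ_add, ← add_assoc] using h1
  · have h := h2 r a (Fin.castAdd m i)
    rw [sum_Iio_castAdd] at h
    simp only [Fin.append_left, pairArgs_castAdd] at h
    rw [ofPairs_apply, ofPairs_apply, pairArgs_update_left, LinearMap.mul_apply', ← h]
    congr 2
    exact Prod.ext rfl (map_zero (M'.act r a)).symm
  · have h := h2 r a (Fin.natAdd n j)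
    rw [sum_Iio_natAdd] at h
    simp only [Fin.append_left, Fin.append_right, pairArgs_natAdd, ← add_assoc] at h
    rw [ofPairs_apply, ofPairs_apply, pairArgs_update_right, LinearMap.mul_apply', ← h]
    congr 2
    exact Prod.ext (map_zero (M.act r a)).symm rfl

variable (M M') in
/-- The differential on multilinear maps on two modules. -/
abbrev formsLie (n m : ℕ) (k : ℤ) :
    MultilinearForms 𝕂 Ω D X n m →ₗ[𝕂] MultilinearForms 𝕂 Ω D X n m :=
  gradedLie R.d M.parity M.L M'.parity M'.L n m k

lemma formsLie_apply (k : ℤ) (τ : MultilinearForms 𝕂 Ω D X n m) (α : Fin n → D) (x : Fin m → X) :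
    formsLie M M' n m k τ α x = R.d (τ α x) - k.negOnePow •
      ((∑ i, τ (fun l => insertAt M.parity M.L i l (α l)) x) +
        ∑ j, τ (fun l => M.parity (α l)) fun l => insertAt M'.parity M'.L j l (x l)) := by
  have h : formsLie M M' n m k τ α x = R.d (τ α x) - k.negOnePow •
      ((∑ i, pullback (insertAt M.parity M.L i) fun _ => LinearMap.id) +
        ∑ j, pullback (fun _ => M.parity) (insertAt M'.parity M'.L j) :
        MultilinearForms 𝕂 Ω D X n m →ₗ[𝕂] MultilinearForms 𝕂 Ω D X n m) τ α x := rfl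
  rw [h]
  simp [pullback_apply]

lemma insertAt_castAdd_castAdd (ε T : D →ₗ[𝕂] D) (i l : Fin n) :
    insertAt ε T (Fin.castAdd m i) (Fin.castAdd m l) = insertAt ε T i l := by
  have h1 : Fin.castAdd m l < Fin.castAdd m i ↔ l < i := Iff.rfl
  simp only [insertAt, h1, (Fin.castAdd_injective n m).eq_iff]

lemma insertAt_castAdd_natAdd (ε T : D →ₗ[𝕂] D) (i : Fin n) (l : Fin m) :
    insertAt ε T (Fin.castAdd m i) (Fin.natAdd n l) = LinearMap.id := by
  have h1 : ¬ n + l.1 < i.1 := by omega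
  have h2 : ¬ n + l.1 = i.1 := by omega
  simp [insertAt, Fin.lt_def, Fin.ext_iff, h1, h2]

lemma insertAt_natAdd_castAdd (ε T : D →ₗ[𝕂] D) (i : Fin m) (l : Fin n) :
    insertAt ε T (Fin.natAdd n i) (Fin.castAdd m l) = ε := by
  have h1 : l.1 < n + i.1 := by omega
  simp [insertAt, Fin.lt_def, h1]

lemma insertAt_natAdd_natAdd (ε T : D →ₗ[𝕂] D) (i l : Fin m) :
    insertAt ε T (Fin.natAdd n i) (Fin.natAdd n l) = insertAt ε T i l := by
  have h1 : Fin.natAdd n l < Fin.natAdd n i ↔ l < i := by simp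
  simp only [insertAt, h1, (Fin.natAdd_injective m n).eq_iff]

lemma insertAt_prod {N : ℕ} (i l : Fin N) (y : D × X) :
    insertAt (M.prod M').parity (M.prod M').L i l y =
      (insertAt M.parity M.L i l y.1, insertAt M'.parity M'.L i l y.2) := by
  unfold insertAt
  split_ifs <;> rfl

lemma prod_parity_apply (y : D × X) :
    (M.prod M').parity y = (M.parity y.1, M'.parity y.2) := rfl

/-- The sum over all places splits into the places of one-forms and those of vector fields. The
latter come behind all one-forms, so each one-form receives the parity, as in the definition of
`gradedLie`. -/
lemma lie_toPairs (k : ℤ) (τ : MultilinearForms 𝕂 Ω D X n m) :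
    (M.prod M').lie (n + m) k (toPairs τ) = toPairs (formsLie M M' n m k τ) := by
  refine MultilinearMap.ext fun y => ?_
  rw [DGMod.lie_apply, toPairs_apply, toPairs_apply, formsLie_apply, Fin.sum_univ_add]
  simp only [DGMod.slotMap_apply, toPairs_apply, insertAt_prod, insertAt_castAdd_castAdd,
    insertAt_castAdd_natAdd, insertAt_natAdd_castAdd, insertAt_natAdd_natAdd, LinearMap.id_apply]

lemma ofPairs_lie (k : ℤ) (σ : MultilinearMap 𝕂 (fun _ : Fin (n + m) => D × X) Ω) :
    ofPairs ((M.prod M').lie (n + m) k σ) = formsLie M M' n m k (ofPairs σ) := by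
  refine MultilinearMap.ext fun α => MultilinearMap.ext fun x => ?_
  rw [ofPairs_apply, DGMod.lie_apply, formsLie_apply, Fin.sum_univ_add]
  simp only [DGMod.slotMap_apply, ofPairs_apply]
  congr 3 <;> refine Finset.sum_congr rfl fun i _ => ?_ <;> congr 1 <;> funext l <;>
    induction l using Fin.addCases <;>
    simp [insertAt_prod, insertAt_castAdd_castAdd, insertAt_castAdd_natAdd,
      insertAt_natAdd_castAdd, insertAt_natAdd_natAdd, prod_parity_apply]

end Pairs

/-! ### Functions, vector fields and one-forms on `F[1]` as differential graded objects -/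

section Instances

variable {𝕂 A : Type*} [CommRing 𝕂] [CommRing A] [Algebra 𝕂 A]
  (F : LieRinehartSubalgebra A (Derivation 𝕂 A A))

/-- The functions on `F[1]` as a differential graded algebra. -/
abbrev functionsDGAlg : DGAlg 𝕂 (Functions F) where
  deg := formsOfDegree 𝕂
  d := dF F
  one_mem := by
    intro i hi
    cases i with
    | zero => exact absurd rfl hi
    | succ i => rfl
  mul_mem := fmul_mem
  comm := fmul_comm'
  d_mem := dF_mem
  leibniz {_ a} ha b := by
    have h := dF_fmul a b
    rw [ftwist_of_mem ha, one_mul, fmul_units_left] at h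
    exact h

/-- The vector fields on `F[1]` as a differential graded module. -/
abbrev vectorFieldsDGMod : DGMod (vectorFields F) (functionsDGAlg F) where
  deg p := (vectorFieldsOfDegree F p).comap (vectorFields F).subtype
  act _ := vfSmul
  parity := parityVF F
  L := lieVF F
  iSup_deg := by
    set S := ⨆ p, (vectorFieldsOfDegree F p).comap (vectorFields F).subtype
    -- The quotient map by the sum of the homogeneous parts vanishes on homogeneous vector fields,
    -- hence everywhere; so that sum is its kernel, the whole space.
    have h : S.mkQ = 0 := vf_ext fun p X hX => (Submodule.Quotient.mk_eq_zero S).mpr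
      (Submodule.mem_iSup_of_mem p hX)
    rw [← Submodule.ker_mkQ S, h, LinearMap.ker_zero]
  act_mem a _ hy := vfSmul_mem a.2 hy
  zero_act r X := Subtype.ext (LinearMap.ext fun b => by
    change fmul (0 : Functions F) (X.1 b) = 0
    rw [map_zero, LinearMap.zero_apply])
  parity_eq := parityVF_eq
  L_mem := bracketQ_mem
  L_act a X := (lieVF_vfSmul a X).trans (add_comm _ _)

variable {F}

/-- Linear maps on one-forms are determined by their values on homogeneous ones. -/
lemma oneForms_ext {N : Type*} [AddCommGroup N] [Module 𝕂 N] {f g : oneForms F →ₗ[𝕂] N}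
    (h : ∀ (q : ℤ) (α : oneForms F), α.1 ∈ oneFormsOfDegree F q → f α = g α) : f = g := by
  have : oneForms F ≤ (LinearMap.eqLocus f g).map (oneForms F).subtype :=
    iSup_le fun p X hX => ⟨⟨X, oneForms_le p hX⟩, h p ⟨X, oneForms_le p hX⟩ hX, rfl⟩
  refine LinearMap.ext fun X => ?_
  obtain ⟨Y, hY, hYX⟩ := this X.2
  have : Y = X := Subtype.ext hYX
  subst this
  exact hY

lemma formSmul_apply {r : ℤ} (a : formsOfDegree (A := A) (V := F) (E := A) 𝕂 r)
    (α : oneForms F) (X : vectorFields F) : (formSmul a α).1 X = fmul a.1 (α.1 X) := rfl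

lemma coe_units_smul {V : Type*} [AddCommGroup V] [Module 𝕂 V] {S : Submodule 𝕂 V} (u : ℤˣ)
    (x : S) : ((u • x : S) : V) = u • (x : V) := by
  rcases Int.units_eq_one_or u with rfl | rfl <;> simp

lemma lieForm_apply {q : ℤ} {α : oneForms F} (hα : α.1 ∈ oneFormsOfDegree F q)
    (X : vectorFields F) :
    (lieForm F α).1 X = dF F (α.1 X) - q.negOnePow • α.1 (lieVF F X) := by
  change lieDual F α.1 X = _
  rw [lieDual_apply, conjDual_eq hα]
  rfl

lemma lieVF_apply {p : ℤ} {X : vectorFields F} (hX : X.1 ∈ vectorFieldsOfDegree F p)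
    (a : Functions F) : (lieVF F X).1 a = dF F (X.1 a) - p.negOnePow • X.1 (dF F a) := by
  change bracketQ F X.1 a = _
  rw [bracketQ_apply, conjTwist_eq hX]
  rfl

lemma lieForm_formSmul {r : ℤ} (a : formsOfDegree (A := A) (V := F) (E := A) 𝕂 r)
    (α : oneForms F) : lieForm F (formSmul a α) =
      r.negOnePow • formSmul a (lieForm F α) + formSmul ⟨dF F a.1, dF_mem a.2⟩ α := by
  have key : lieForm F ∘ₗ formSmul a =
      r.negOnePow • (formSmul a ∘ₗ lieForm F) + formSmul ⟨dF F a.1, dF_mem a.2⟩ := by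
    refine oneForms_ext fun q α hα => Subtype.ext (LinearMap.ext fun X => ?_)
    change (lieForm F (formSmul a α)).1 X =
      (r.negOnePow • formSmul a (lieForm F α)).1 X + fmul (dF F a.1) (α.1 X)
    have h : (r.negOnePow • formSmul a (lieForm F α)).1 X =
        r.negOnePow • fmul a.1 ((lieForm F α).1 X) := by
      rw [coe_units_smul]; rfl
    rw [lieForm_apply (formSmul_mem a.2 hα), h, lieForm_apply hα, formSmul_apply, formSmul_apply,
      dF_fmul, ftwist_of_mem a.2, one_mul, fmul_units_left, map_sub, fmul_units_right, smul_sub,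
      smul_smul, Int.negOnePow_add, mul_comm r.negOnePow]
    abel
  exact LinearMap.congr_fun key α

variable (F) in
/-- The one-forms on `F[1]` as a differential graded module. -/
abbrev oneFormsDGMod : DGMod (oneForms F) (functionsDGAlg F) where
  deg p := (oneFormsOfDegree F p).comap (oneForms F).subtype
  act _ := formSmul
  parity := parityForm F
  L := lieForm F
  iSup_deg := by
    set S := ⨆ p, (oneFormsOfDegree F p).comap (oneForms F).subtype
    have h : S.mkQ = 0 := oneForms_ext fun p X hX => (Submodule.Quotient.mk_eq_zero S).mpr
      (Submodule.mem_iSup_of_mem p hX)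
    rw [← Submodule.ker_mkQ S, h, LinearMap.ker_zero]
  act_mem a _ hy := formSmul_mem a.2 hy
  zero_act r X := Subtype.ext (LinearMap.ext fun b => by
    change fmul (0 : Functions F) (X.1 b) = 0
    rw [map_zero, LinearMap.zero_apply])
  parity_eq := parityForm_eq
  L_mem := lieDual_mem
  L_act := lieForm_formSmul

/-- The two mixed terms `d_F X d_F` have opposite signs, since the degree goes up by one; the others
contain `d_F` squared. -/
lemma lieVF_lieVF (X : vectorFields F) : lieVF F (lieVF F X) = 0 := by
  have key : lieVF F ∘ₗ lieVF F = 0 := by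
    refine vf_ext fun p X hX => Subtype.ext (LinearMap.ext fun a => ?_)
    change (lieVF F (lieVF F X)).1 a = 0
    rw [lieVF_apply (bracketQ_mem hX), lieVF_apply hX, lieVF_apply hX, map_sub, dF_units, dF_dF,
      dF_dF, map_zero, Int.negOnePow_succ]
    simp
  exact LinearMap.congr_fun key X

lemma lieForm_lieForm (α : oneForms F) : lieForm F (lieForm F α) = 0 := by
  have key : lieForm F ∘ₗ lieForm F = 0 := by
    refine oneForms_ext fun q α hα => Subtype.ext (LinearMap.ext fun X => ?_)
    change (lieForm F (lieForm F α)).1 X = 0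
    rw [lieForm_apply (lieDual_mem hα), lieForm_apply hα, lieForm_apply hα, map_sub, dF_units,
      dF_dF, lieVF_lieVF, map_zero, Int.negOnePow_succ]
    simp
  exact LinearMap.congr_fun key α

/-- This identification holds by definition; through it the results on abstract differential graded
modules apply to tensor fields on `F[1]`. -/
lemma lieTensor_eq (n m : ℕ) (k : ℤ) : lieTensor F n m k =
    formsLie (oneFormsDGMod F) (vectorFieldsDGMod F) n m k := rfl

lemma DGMod.parity_act {𝕂 Ω Y : Type*} [CommRing 𝕂] [Ring Ω] [Algebra 𝕂 Ω] [AddCommGroup Y]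
    [Module 𝕂 Y] {R : DGAlg 𝕂 Ω} (M : DGMod Y R) {r : ℤ} (a : R.deg r) (y : Y) :
    M.parity (M.act r a y) = r.negOnePow • M.act r a (M.parity y) := by
  have : M.parity ∘ₗ M.act r a = r.negOnePow • (M.act r a ∘ₗ M.parity) :=
    M.linearMap_ext fun p y hy => by
      change M.parity (M.act r a y) = r.negOnePow • M.act r a (M.parity y)
      rw [M.parity_eq (M.act_mem a hy), M.parity_eq hy, linearMap_units_smul, smul_smul,
        Int.negOnePow_add, mul_comm]
  exact LinearMap.congr_fun this y

end Instances

/-! ### Dual bases, functions of degree one and the Euler operator -/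

section Generators

variable {𝕂 A : Type*} [CommRing 𝕂] [CommRing A] [Algebra 𝕂 A]
  {F : LieRinehartSubalgebra A (Derivation 𝕂 A A)}

variable (A) in
/-- A finite dual basis of a module. -/
structure FiniteDualBasis (V : Type*) [AddCommGroup V] [Module A V] (ι : Type*) [Fintype ι] where
  /-- the vectors -/
  vec : ι → V
  /-- the coordinate functionals -/
  coord : ι → V →ₗ[A] A
  sum_eq : ∀ v, ∑ i, coord i v • vec i = v

/-- A section of `F^∨` as a function of degree one on `F[1]`. -/
def ofDual (ξ : F →ₗ[A] A) : Functions F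
  | 0 => 0
  | 1 => AlternatingMap.ofSubsingleton A F A (0 : Fin 1) ξ
  | _ + 2 => 0

lemma ofDual_mem (ξ : F →ₗ[A] A) : ofDual ξ ∈ formsOfDegree 𝕂 1 := by
  intro i hi
  match i with
  | 0 => rfl
  | 1 => exact absurd rfl hi
  | i + 2 => rfl

lemma contract_ofDual (v : F) (ξ : F →ₗ[A] A) : contract v (ofDual ξ) = ofFun F (ξ v) := by
  ext k x
  match k with
  | 0 =>
    change AlternatingMap.ofSubsingleton A F A (0 : Fin 1) ξ _ = _
    simp [ofFun_zero_apply]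
  | k + 1 => rfl

/-- The expansion of `ξ` in the coordinate functionals, written with the product of functions on
`F[1]` so that derivations can be applied to it. -/
lemma ofDual_sum {ι : Type*} [Fintype ι] (FB : FiniteDualBasis A F ι) (ξ : F →ₗ[A] A) :
    ofDual ξ = ∑ i, ofFun F (ξ (FB.vec i)) * ofDual (FB.coord i) := by
  have h : ξ = ∑ i, ξ (FB.vec i) • FB.coord i := by
    refine LinearMap.ext fun v => ?_
    conv_lhs => rw [← FB.sum_eq v]
    simp [mul_comm]
  have h2 : ∀ i, ofFun F (ξ (FB.vec i)) * ofDual (FB.coord i) =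
      ξ (FB.vec i) • ofDual (FB.coord i) := fun i =>
    fmul_ofFun_left (𝕂 := 𝕂) (ξ (FB.vec i)) (ofDual (FB.coord i))
  simp only [h2]
  let T : (F →ₗ[A] A) →ₗ[A] Functions F :=
    { toFun := ofDual
      map_add' := fun ξ η => by
        ext k x
        match k with
        | 0 => exact (add_zero _).symm
        | 1 => rfl
        | k + 2 => exact (add_zero _).symm
      map_smul' := fun c ξ => by
        ext k x
        match k with
        | 0 => exact (smul_zero c).symm
        | 1 => rfl
        | k + 2 => exact (smul_zero c).symm }
  have h3 := congrArg T h
  rw [map_sum] at h3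
  simp only [map_smul] at h3
  exact h3

/-- The operator `∑ ξ^i ι_{v_i}` counts the degree. In characteristic zero it exhibits forms of
positive degree as sums of products of the coordinate one-forms with forms of lower degree. -/
lemma euler_apply {ι : Type*} [Fintype ι] (FB : FiniteDualBasis A F ι) (a : Functions F) (n : ℕ) :
    (∑ i, ofDual (FB.coord i) * contract (FB.vec i) a) n = n • a n := by
  obtain ⟨E, hE⟩ : ∃ E : Functions F → Functions F,
      ∀ a, E a = ∑ i, ofDual (FB.coord i) * contract (FB.vec i) a := ⟨_, fun _ => rfl⟩
  rw [← hE]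
  have hsum : ∀ (f : ι → Functions F) n, (∑ i, f i) n = ∑ i, f i n := fun f n =>
    Finset.sum_apply n Finset.univ f
  induction n generalizing a with
  | zero =>
    rw [zero_smul, hE, hsum]
    refine Finset.sum_eq_zero fun i _ => ?_
    ext x
    rw [mul_eq_wedge, wedge_zero_apply]
    simp [ofDual]
  | succ n ih =>
    -- The commutation rule `ι_w E = ι_w + E ι_w`: contraction of the coordinate one-forms gives
    -- back `w` by the dual basis, and the rest anticommutes twice. It turns `n` into `n + 1` in the
    -- induction.
    have h : ∀ w, contract w (E a) = contract w a + E (contract w a) := by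
      intro w
      have h1 : contract w a = ∑ i, ofFun F (FB.coord i w) * contract (FB.vec i) a := by
        have h2 : ∀ i, ofFun F (FB.coord i w) * contract (FB.vec i) a =
          FB.coord i w • contract (FB.vec i) a := fun i => fmul_ofFun_left (𝕂 := 𝕂) _ _
        let T : F →ₗ[A] Functions F :=
          { toFun := fun w => contract w a
            map_add' := fun v w => contract_add v w a
            map_smul' := fun c v => contract_smul c v a }
        have h3 := congrArg T (FB.sum_eq w)
        simp only [map_sum, map_smul] at h3
        simp only [h2]
        exact h3.symm
      refine Eq.trans ?_ (congrArg (· + E (contract w a)) h1.symm)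
      simp only [hE]
      rw [map_sum, ← Finset.sum_add_distrib]
      refine Finset.sum_congr rfl fun i _ => ?_
      have h6 := contract_fmul (𝕂 := 𝕂) w (ofDual (FB.coord i)) (contract (FB.vec i) a)
      rw [contract_ofDual, ftwist_of_mem (ofDual_mem _), mul_one, Int.negOnePow_one,
        fmul_units_left, contract_contract_comm w] at h6
      rw [fmul_eq_mul, fmul_eq_mul, fmul_eq_mul] at h6
      rw [h6, Units.neg_smul, one_smul, mul_neg, neg_neg]
    refine forms_succ_ext (b := (n + 1) • a) fun w => ?_
    rw [h, Forms.add_apply, ih, map_nsmul, add_smul, one_smul, add_comm]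
    rfl

lemma ofFun_zero_eq {a : Functions F} (ha : a ∈ formsOfDegree 𝕂 0) : ofFun F (a 0 0) = a := by
  ext1 k
  cases k with
  | zero =>
    ext x
    rw [Subsingleton.elim x 0, ofFun_zero_apply]
  | succ k =>
    rw [ha (k + 1) (by push_cast; omega)]
    rfl

end Generators

/-! ### Vector fields are determined in degrees zero and one -/

section Derivations

variable {𝕂 A : Type*} [Field 𝕂] [CharZero 𝕂] [CommRing A] [Algebra 𝕂 A]
  {F : LieRinehartSubalgebra A (Derivation 𝕂 A A)} {ι : Type*} [Fintype ι]

/-- A vector field that vanishes on the functions of degree zero and on a frame of one-forms is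
zero. -/
lemma vectorField_eq_zero (FB : FiniteDualBasis A F ι) {p : ℤ}
    {X : Functions F →ₗ[𝕂] Functions F} (hX : X ∈ vectorFieldsOfDegree F p)
    (h0 : ∀ f, X (ofFun F f) = 0) (h1 : ∀ i, X (ofDual (FB.coord i)) = 0) : X = 0 := by
  have key : ∀ (n : ℕ) (a : Functions F), a ∈ formsOfDegree 𝕂 (n : ℤ) → X a = 0 := by
    intro n
    induction n with
    | zero =>
      intro a ha
      rw [← ofFun_zero_eq ha, h0]
    | succ n ih =>
      intro a ha
      -- The Euler identity in degree `n + 1`; the factor `n + 1` is divided out at the end, which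
      -- is where characteristic zero enters.
      have hE : ((n + 1 : ℕ) : 𝕂) • a = ∑ i, fmul (ofDual (FB.coord i)) (contract (FB.vec i) a) := by
        ext1 l
        refine Eq.trans ?_ (euler_apply FB a l).symm
        rw [Forms.smul_apply, Nat.cast_smul_eq_nsmul]
        by_cases hl : l = n + 1
        · rw [hl]
        · rw [ha l (by exact_mod_cast hl), smul_zero, smul_zero]
      have h2 : X (((n + 1 : ℕ) : 𝕂) • a) = 0 := by
        rw [hE, map_sum]
        refine Finset.sum_eq_zero fun i _ => ?_
        have hc := contract_mem ha (FB.vec i)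
        rw [Nat.cast_succ, add_sub_cancel_right] at hc
        rw [hX.2, h1, ih _ hc]
        simp
      rw [map_smul] at h2
      exact (smul_eq_zero.mp h2).resolve_left (Nat.cast_ne_zero.mpr n.succ_ne_zero)
  refine LinearMap.ext fun a => ext_component (𝕂 := 𝕂) fun k => ?_
  obtain ⟨k, rfl⟩ : ∃ l, k = l + p := ⟨k - p, by ring⟩
  rw [hX.1, LinearMap.zero_apply, map_zero]
  rcases lt_or_ge k 0 with hk | hk
  · have : component k a = 0 := by
      ext1 i
      rw [component_apply, if_neg (by omega)]
      rfl
    rw [this, map_zero]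
  · obtain ⟨n, rfl⟩ := Int.eq_ofNat_of_zero_le hk
    exact key n _ (component_mem _ _)

end Derivations

/-! ### One-forms from the base, contractions and the values of `[d_F, ψ_j Z]` -/

section BaseForms

variable {𝕂 A : Type*} [CommRing 𝕂] [CommRing A] [Algebra 𝕂 A]
  {F : LieRinehartSubalgebra A (Derivation 𝕂 A A)}

lemma restrictDer_add (X Y : vectorFields F) :
    restrictDer (X + Y) = restrictDer X + restrictDer Y := by
  ext k v f; rfl

lemma restrictDer_smul (c : 𝕂) (X : vectorFields F) :
    restrictDer (c • X) = c • restrictDer X := by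
  ext k v f; rfl

/-- The one-form `X ↦ η(X|_A)` on `F[1]` given by a one-form `η` on the base. -/
def baseForm (η : Derivation 𝕂 A A →ₗ[A] A) : vectorFields F →ₗ[𝕂] Functions F where
  toFun X := mapForms η (restrictDer X)
  map_add' X Y := by rw [restrictDer_add, map_add]
  map_smul' c X := by
    rw [restrictDer_smul, LinearMap.map_smul_of_tower]
    rfl

lemma baseForm_apply (η : Derivation 𝕂 A A →ₗ[A] A) (X : vectorFields F) (k : ℕ) (v : Fin k → F) :
    baseForm η X k v = η (restrictDer X k v) := rfl

lemma phiDualFun_eq_baseForm (w : Module.Dual A (NormalSections F)) :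
    phiDualFun w = baseForm (w ∘ₗ F.toSubmodule.mkQ) := rfl

lemma restrictDer_eq_zero {p : ℤ} {X : vectorFields F} (hX : X.1 ∈ vectorFieldsOfDegree F p) {i : ℕ}
    (hi : (i : ℤ) ≠ p) : restrictDer X i = 0 := by
  ext v f
  have := hX.1 0 (ofFun F f)
  rw [component_of_mem (𝕂 := 𝕂) (ofFun_mem f), zero_add] at this
  rw [restrictDer_apply, ← this, component_apply, if_neg hi]
  rfl

lemma baseForm_mem (η : Derivation 𝕂 A A →ₗ[A] A) :
    baseForm (F := F) η ∈ oneFormsOfDegree F 0 := by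
  refine ⟨fun p X hX => ?_, fun r a X => ?_⟩
  · rw [add_zero]
    intro i hi
    ext v
    rw [baseForm_apply, restrictDer_eq_zero hX hi]
    simp
  · rw [zero_mul, Int.negOnePow_zero, one_smul]
    change mapForms η (restrictDer (vfSmul a X)) = _
    rw [restrictDer_vfSmul]
    exact mapForms_wedge _ _ _ _ (fun _ _ => map_smul _ _ _) _ _

/-- The value of a base form on a vector field of degree zero. -/
lemma baseForm_eq_ofFun (η : Derivation 𝕂 A A →ₗ[A] A) {X : vectorFields F} {W : Derivation 𝕂 A A}
    (hX : ∀ f, X.1 (ofFun F f) = ofFun F (W f)) : baseForm η X = ofFun F (η W) := by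
  ext k v
  rw [baseForm_apply]
  cases k with
  | zero =>
    have : restrictDer X 0 v = W := by
      ext f
      rw [restrictDer_apply, hX]
      rfl
    rw [this]
    rfl
  | succ k =>
    have : restrictDer X (k + 1) v = 0 := by
      ext f
      rw [restrictDer_apply, hX]
      rfl
    rw [this, map_zero]
    rfl

lemma component_contract (k : ℤ) (v : F) (a : Functions F) :
    component (k + -1) (contract v a) = contract v (component k a) := by
  ext1 i
  rw [component_apply, contract_apply, contract_apply, component_apply]
  by_cases h : (i : ℤ) = k + -1
  · rw [if_pos h, if_pos (by push_cast; omega)]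
  · rw [if_neg h, if_neg (by push_cast; omega), AlternatingMap.curryLeft_zero]
    rfl

/-- The contraction with a section of `F` as a vector field of degree `-1`. -/
def contractVF (v : F) : vectorFields F :=
  ⟨(contract v).restrictScalars 𝕂, vf_le (-1) ⟨fun k a => component_contract k v a, fun a b => by
    have h : ftwist (-1) a = ftwist 1 a := by
      ext1 k
      rw [ftwist_apply, ftwist_apply, twist_apply, twist_apply, neg_mul, Int.negOnePow_neg]
    rw [h]
    exact contract_fmul v a b⟩⟩

lemma contractVF_apply (v : F) (a : Functions F) : (contractVF v).1 a = contract v a := rfl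

lemma contractVF_mem (v : F) : (contractVF v).1 ∈ vectorFieldsOfDegree F (-1) :=
  ⟨fun k a => component_contract k v a, fun a b => by
    have h : ftwist (-1) a = ftwist 1 a := by
      ext1 k
      rw [ftwist_apply, ftwist_apply, twist_apply, twist_apply, neg_mul, Int.negOnePow_neg]
    rw [h]
    exact contract_fmul v a b⟩

/-- Cartan's formula: `ι_v` has degree `-1`, so that the graded commutator with `d_F` is an
anticommutator. -/
lemma lieVF_contractVF (v : F) (a : Functions F) :
    (lieVF F (contractVF v)).1 a = lieDer (trivialModule F) v a := by
  rw [lieVF_apply (contractVF_mem v), contractVF_apply, contractVF_apply, contract_dF,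
    Int.negOnePow_neg, Int.negOnePow_one, Units.neg_smul, one_smul]
  abel

lemma lieDer_ofFun (v : F) (f : A) :
    lieDer (trivialModule F) v (ofFun F f) = ofFun F ((v : Derivation 𝕂 A A) f) := by
  ext k x
  cases k with
  | zero =>
    rw [lieDer_apply]
    simp only [Finset.univ_eq_empty, Finset.sum_empty, sub_zero]
    rfl
  | succ k =>
    rw [lieDer_apply]
    simp [ofFun_succ]

lemma lieVF_contractVF_mem (v : F) : (lieVF F (contractVF v)).1 ∈ vectorFieldsOfDegree F 0 :=
  bracketQ_mem (contractVF_mem v)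

lemma psi_ofFun (j : NormalSections F →ₗ[A] Derivation 𝕂 A A) (hj : IsSplitting j)
    (Z : NormalSections F) (f : A) : (psi j hj Z).1 (ofFun F f) = ofFun F (j Z f) := by
  ext k x
  change psiFun j hj Z _ k x = _
  rw [psiFun_apply]
  cases k with
  | zero => simp [ofFun_zero_apply]
  | succ k => simp [ofFun_succ]

/-- By the Cartan formula, since contractions kill functions of the base. -/
lemma dF_ofFun_one (f : A) (v : Fin 1 → F) : dF F (ofFun F f) 1 v = (v 0 : Derivation 𝕂 A A) f := by
  have h : ∀ (w : F) (x : Fin 0 → F), contract w (dF F (ofFun F f)) 0 x =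
      (w : Derivation 𝕂 A A) f := fun w x => by
    rw [contract_dF, lieDer_ofFun, contract_ofFun, map_zero, sub_zero]
    rfl
  have := h (v 0) (Fin.tail v)
  rw [contract_apply, AlternatingMap.curryLeft_apply_apply] at this
  rw [← this]
  congr 1
  exact (Fin.cons_self_tail v).symm

/-- The restriction of `[d_F, ψ_j Z]` to the functions on the base. -/
lemma restrictDer_lieVF_psi (j : NormalSections F →ₗ[A] Derivation 𝕂 A A) (hj : IsSplitting j)
    (Z : NormalSections F) (v : Fin 1 → F) : restrictDer (lieVF F (psi j hj Z)) 1 v =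
      ⁅(v 0 : Derivation 𝕂 A A), j Z⁆ - projF j hj ⁅(v 0 : Derivation 𝕂 A A), j Z⁆ := by
  ext f
  rw [restrictDer_apply, lieVF_apply (psiFun_mem j hj Z), psi_ofFun, Int.negOnePow_zero, one_smul,
    Forms.sub_apply, AlternatingMap.sub_apply, dF_ofFun_one]
  change _ - psiFun j hj Z _ 1 v = _
  rw [psiFun_apply, dF_ofFun_one, Fin.sum_univ_one, dF_ofFun_one, Function.update_self,
    Derivation.sub_apply, Derivation.commutator_apply, ← lie_skew (j Z), map_neg]
  have : ((-projF j hj ⁅(v 0 : Derivation 𝕂 A A), j Z⁆ : F) : Derivation 𝕂 A A) =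
    - (projF j hj ⁅(v 0 : Derivation 𝕂 A A), j Z⁆ : Derivation 𝕂 A A) := rfl
  rw [this, Derivation.neg_apply]
  ring

end BaseForms

/-! ### The contracting homotopy on vector fields -/

section Contraction

variable {𝕂 A : Type*} [CommRing 𝕂] [CommRing A] [Algebra 𝕂 A]
  {F : LieRinehartSubalgebra A (Derivation 𝕂 A A)} {I J : Type*} [Fintype I] [Fintype J]

/-- The operator `X ↦ β(X) Z` on vector fields, for a one-form `β` of degree zero. -/
def rankOne {β : vectorFields F →ₗ[𝕂] Functions F} (hβ : β ∈ oneFormsOfDegree F 0)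
    (Z : vectorFields F) : vectorFields F →ₗ[𝕂] vectorFields F :=
  LinearMap.codRestrict (vectorFields F)
    ((LinearMap.lcomp 𝕂 (Functions F) Z.1) ∘ₗ fmul ∘ₗ β) (by
      -- The product `β(X) Z` is known to be a vector field when `β(X)` is homogeneous. The general
      -- case follows by linearity, since the class modulo vector fields vanishes for homogeneous
      -- `X`.
      have h : (vectorFields F).mkQ ∘ₗ ((LinearMap.lcomp 𝕂 (Functions F) Z.1) ∘ₗ fmul ∘ₗ β) = 0 :=
        vf_ext fun p X hX => (Submodule.Quotient.mk_eq_zero _).mpr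
          (vfSmul ⟨β X, hβ.1 p X hX⟩ Z).2
      exact fun X => (Submodule.Quotient.mk_eq_zero _).mp (LinearMap.congr_fun h X))

lemma rankOne_apply {β : vectorFields F →ₗ[𝕂] Functions F} (hβ : β ∈ oneFormsOfDegree F 0)
    (Z X : vectorFields F) (b : Functions F) : (rankOne hβ Z X).1 b = fmul (β X) (Z.1 b) := rfl

lemma rankOne_eq {β : vectorFields F →ₗ[𝕂] Functions F} (hβ : β ∈ oneFormsOfDegree F 0)
    (Z X : vectorFields F) {r : ℤ} (a : formsOfDegree (A := A) (V := F) (E := A) 𝕂 r)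
    (h : β X = a.1) : rankOne hβ Z X = vfSmul a Z :=
  Subtype.ext (LinearMap.ext fun b => by rw [rankOne_apply, vfSmul_apply, h])

lemma rankOne_vfSmul {β : vectorFields F →ₗ[𝕂] Functions F} (hβ : β ∈ oneFormsOfDegree F 0)
    (Z X : vectorFields F) {r : ℤ} (a : formsOfDegree (A := A) (V := F) (E := A) 𝕂 r) :
    rankOne hβ Z (vfSmul a X) = vfSmul a (rankOne hβ Z X) :=
  Subtype.ext (LinearMap.ext fun b => by
    rw [rankOne_apply, vfSmul_apply, rankOne_apply, hβ.2, zero_mul, Int.negOnePow_zero, one_smul,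
      fmul_assoc])

lemma rankOne_mem {β : vectorFields F →ₗ[𝕂] Functions F} (hβ : β ∈ oneFormsOfDegree F 0)
    {Z X : vectorFields F} {p q : ℤ} (hX : X.1 ∈ vectorFieldsOfDegree F p)
    (hZ : Z.1 ∈ vectorFieldsOfDegree F q) : (rankOne hβ Z X).1 ∈ vectorFieldsOfDegree F (p + q) := by
  have h := hβ.1 p X hX
  rw [add_zero] at h
  rw [rankOne_eq hβ Z X ⟨β X, h⟩ rfl, add_comm]
  exact vfSmul_mem h hZ

lemma coe_sum_apply {ι : Type*} (s : Finset ι) (f : ι → vectorFields F) (b : Functions F) :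
    (∑ i ∈ s, f i).1 b = ∑ i ∈ s, (f i).1 b := by
  simp

/-- Used for `v ↦ ι_v` and `Z ↦ ψ_j Z`, which are linear over the functions of the base. That
linearity is expressed by `vfSmul`, because vector fields carry only the structure of a `𝕂`-module
here. -/
lemma vfSmul_ofFun_sum {ι V : Type*} [Fintype ι] [AddCommGroup V] [Module A V]
    (B : FiniteDualBasis A V ι) (T : V → vectorFields F) (hadd : ∀ v w, T (v + w) = T v + T w)
    (hsmul : ∀ (f : A) v, T (f • v) = vfSmul ⟨ofFun F f, ofFun_mem f⟩ (T v)) (v : V) :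
    ∑ i, vfSmul ⟨ofFun F (B.coord i v), ofFun_mem _⟩ (T (B.vec i)) = T v := by
  let T' : V →+ vectorFields F :=
    { toFun := T
      map_zero' := by
        have h := hadd 0 0
        rw [add_zero] at h
        exact left_eq_add.mp h
      map_add' := hadd }
  have h : T' v = T' (∑ i, B.coord i v • B.vec i) := by rw [B.sum_eq]
  rw [map_sum] at h
  refine Eq.trans (Finset.sum_congr rfl fun i _ => ?_) h.symm
  exact (hsmul _ _).symm

variable (j : NormalSections F →ₗ[A] Derivation 𝕂 A A) (hj : IsSplitting j)
  (FB : FiniteDualBasis A F I) (BB : FiniteDualBasis A (NormalSections F) J)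

/-- The coordinates of the part in `F` of the restriction of a vector field to the base. -/
def tangentCoord (i : I) : Derivation 𝕂 A A →ₗ[A] A := FB.coord i ∘ₗ projF j hj

/-- The contracting homotopy on vector fields. -/
def homotopyVF : vectorFields F →ₗ[𝕂] vectorFields F :=
  (∑ i, rankOne (baseForm_mem (tangentCoord j hj FB i)) (contractVF (FB.vec i))) ∘ₗ parityVF F

/-- The projection `ψ_j ∘ φ` on vector fields. -/
def projVF : vectorFields F →ₗ[𝕂] vectorFields F :=
  ∑ i, rankOne (phiDualFun_mem (BB.coord i)) (psi j hj (BB.vec i))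

lemma homotopyVF_apply (X : vectorFields F) : homotopyVF j hj FB X =
    ∑ i, rankOne (baseForm_mem (tangentCoord j hj FB i)) (contractVF (FB.vec i)) (parityVF F X) := by
  simp [homotopyVF]

lemma projVF_apply (X : vectorFields F) : projVF j hj BB X =
    ∑ i, rankOne (phiDualFun_mem (BB.coord i)) (psi j hj (BB.vec i)) X := by
  simp [projVF]

/-- The sign of an operator of degree `-1` comes from the parity in the definition; the other factor
is linear over the functions. -/
lemma homotopyVF_vfSmul {r : ℤ} (a : formsOfDegree (A := A) (V := F) (E := A) 𝕂 r)
    (X : vectorFields F) :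
    homotopyVF j hj FB (vfSmul a X) = r.negOnePow • vfSmul a (homotopyVF j hj FB X) := by
  have h : parityVF F (vfSmul a X) = r.negOnePow • vfSmul a (parityVF F X) :=
    (vectorFieldsDGMod F).parity_act a X
  rw [homotopyVF_apply, homotopyVF_apply, h, map_sum, Finset.smul_sum]
  refine Finset.sum_congr rfl fun i _ => ?_
  rw [linearMap_units_smul, rankOne_vfSmul]

lemma projVF_vfSmul {r : ℤ} (a : formsOfDegree (A := A) (V := F) (E := A) 𝕂 r)
    (X : vectorFields F) : projVF j hj BB (vfSmul a X) = vfSmul a (projVF j hj BB X) := by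
  rw [projVF_apply, projVF_apply, map_sum]
  exact Finset.sum_congr rfl fun i _ => rankOne_vfSmul _ _ _ _

lemma homotopyVF_mem {p : ℤ} {X : vectorFields F} (hX : X.1 ∈ vectorFieldsOfDegree F p) :
    (homotopyVF j hj FB X).1 ∈ vectorFieldsOfDegree F (p + -1) := by
  rw [homotopyVF_apply, AddSubmonoidClass.coe_finsetSum]
  refine sum_mem fun i _ => ?_
  rw [parityVF_eq hX, linearMap_units_smul, coe_units_smul]
  exact units_smul_mem' _ _ (rankOne_mem _ hX (contractVF_mem _))

/-- The defect of the homotopy, which vanishes, see `homotopyDefect_eq_zero`. -/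
def homotopyDefect : vectorFields F →ₗ[𝕂] vectorFields F :=
  lieVF F ∘ₗ homotopyVF j hj FB + homotopyVF j hj FB ∘ₗ lieVF F - LinearMap.id + projVF j hj BB

lemma homotopyDefect_apply (X : vectorFields F) : homotopyDefect j hj FB BB X =
    lieVF F (homotopyVF j hj FB X) + homotopyVF j hj FB (lieVF F X) - X + projVF j hj BB X := rfl

/-- The terms with `d_F a` in `L h (a X)` and `h L (a X)` cancel. Hence the defect is linear over
the functions, and its vanishing can be checked on generators. -/
lemma homotopyDefect_vfSmul {r : ℤ} (a : formsOfDegree (A := A) (V := F) (E := A) 𝕂 r)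
    (X : vectorFields F) :
    homotopyDefect j hj FB BB (vfSmul a X) = vfSmul a (homotopyDefect j hj FB BB X) := by
  have e : (r + 1).negOnePow = - r.negOnePow := Int.negOnePow_succ r
  rw [homotopyDefect_apply, homotopyDefect_apply, homotopyVF_vfSmul, linearMap_units_smul,
    lieVF_vfSmul, lieVF_vfSmul, map_add, homotopyVF_vfSmul, linearMap_units_smul, homotopyVF_vfSmul,
    projVF_vfSmul, smul_add, smul_smul, smul_smul, Int.units_mul_self, one_smul, e, Units.neg_smul,
    one_smul, map_add, map_sub, map_add]
  abel

/-- A contraction restricts to zero on the base. -/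
lemma baseForm_contractVF (η : Derivation 𝕂 A A →ₗ[A] A) (v : F) :
    baseForm η (contractVF v) = 0 := by
  rw [baseForm_eq_ofFun η (W := 0) fun f => by
    rw [contractVF_apply, contract_ofFun, Derivation.zero_apply, map_zero], map_zero, map_zero]

lemma baseForm_lieVF_contractVF (η : Derivation 𝕂 A A →ₗ[A] A) (v : F) :
    baseForm η (lieVF F (contractVF v)) = ofFun F (η v) :=
  baseForm_eq_ofFun η fun f => by rw [lieVF_contractVF, lieDer_ofFun]

lemma baseForm_psi (η : Derivation 𝕂 A A →ₗ[A] A) (Z : NormalSections F) :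
    baseForm η (psi j hj Z) = ofFun F (η (j Z)) :=
  baseForm_eq_ofFun η fun f => psi_ofFun j hj Z f

lemma rankOne_zero {β : vectorFields F →ₗ[𝕂] Functions F} (hβ : β ∈ oneFormsOfDegree F 0)
    (Z : vectorFields F) {X : vectorFields F} (h : β X = 0) : rankOne hβ Z X = 0 :=
  Subtype.ext (LinearMap.ext fun b => by
    rw [rankOne_apply, h, map_zero]
    rfl)

lemma homotopyVF_eq_zero {p : ℤ} {X : vectorFields F} (hX : X.1 ∈ vectorFieldsOfDegree F p)
    (h : ∀ i, baseForm (tangentCoord j hj FB i) X = 0) : homotopyVF j hj FB X = 0 := by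
  rw [homotopyVF_apply, parityVF_eq hX]
  refine Finset.sum_eq_zero fun i _ => ?_
  rw [linearMap_units_smul, rankOne_zero _ _ (h i), smul_zero]

/-- The restriction of `[d_F, ι_v] = L_v` to the base is `v` itself, and `h` turns its expansion `∑
ξ^i(v) v_i` into `∑ ξ^i(v) ι_{v_i} = ι_v`. -/
lemma homotopyVF_lieVF_contractVF (v : F) :
    homotopyVF j hj FB (lieVF F (contractVF v)) = contractVF v := by
  rw [homotopyVF_apply, parityVF_eq (lieVF_contractVF_mem v), Int.negOnePow_zero, one_smul]
  refine Eq.trans (Finset.sum_congr rfl fun i _ => ?_) (vfSmul_ofFun_sum FB contractVF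
    (fun v w => Subtype.ext (LinearMap.ext fun a => contract_add v w a))
    (fun f v => Subtype.ext (LinearMap.ext fun a => by
      rw [vfSmul_apply, fmul_ofFun_left]
      exact contract_smul f v a)) v)
  refine rankOne_eq _ _ _ _ ?_
  rw [baseForm_lieVF_contractVF]
  simp [tangentCoord, projF_coe]

lemma mkQ_coe (v : F) : F.toSubmodule.mkQ (v : Derivation 𝕂 A A) = 0 := by
  rw [← LinearMap.mem_ker, Submodule.ker_mkQ]
  exact v.2

lemma projVF_eq_zero {X : vectorFields F} (h : ∀ i, phiDualFun (BB.coord i) X = 0) :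
    projVF j hj BB X = 0 := by
  rw [projVF_apply]
  exact Finset.sum_eq_zero fun i _ => rankOne_zero _ _ (h i)

/-- Here `h` and the projection vanish, and `h L` is the identity. -/
lemma homotopyDefect_contractVF (v : F) : homotopyDefect j hj FB BB (contractVF v) = 0 := by
  rw [homotopyDefect_apply, homotopyVF_eq_zero j hj FB (contractVF_mem v)
    (fun i => baseForm_contractVF _ v), homotopyVF_lieVF_contractVF,
    projVF_eq_zero j hj BB fun i => baseForm_contractVF (BB.coord i ∘ₗ F.toSubmodule.mkQ) v]
  simp

/-- Here `L h` is the identity, `h L` vanishes with the square of `L`, and the projection vanishes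
because sections of `F` have no normal part. -/
lemma homotopyDefect_lieVF_contractVF (v : F) :
    homotopyDefect j hj FB BB (lieVF F (contractVF v)) = 0 := by
  rw [homotopyDefect_apply, homotopyVF_lieVF_contractVF, lieVF_lieVF, map_zero,
    projVF_eq_zero j hj BB fun i => ?_]
  · simp
  · rw [phiDualFun_eq_baseForm, baseForm_lieVF_contractVF, LinearMap.comp_apply, mkQ_coe, map_zero,
      map_zero]

/-- This is `φ ∘ ψ_j = id`, a consequence of the splitting property. -/
lemma projVF_psi (Z : NormalSections F) : projVF j hj BB (psi j hj Z) = psi j hj Z := by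
  rw [projVF_apply]
  refine Eq.trans (Finset.sum_congr rfl fun i _ => ?_) (vfSmul_ofFun_sum BB (psi j hj)
    (psi_add j hj) (psi_smul j hj) Z)
  refine rankOne_eq _ _ _ _ ?_
  rw [phiDualFun_eq_baseForm, baseForm_psi, LinearMap.comp_apply, hj]

/-- The field `j Z` has no part in `F`, and neither has the restriction `[v, j Z] - pr_F [v, j Z]`
of `[d_F, ψ_j Z]`; so `h` vanishes on both. The projection fixes `ψ_j Z`. -/
lemma homotopyDefect_psi (Z : NormalSections F) :
    homotopyDefect j hj FB BB (psi j hj Z) = 0 := by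
  have h1 : homotopyVF j hj FB (psi j hj Z) = 0 :=
    homotopyVF_eq_zero j hj FB (psiFun_mem j hj Z) fun i => by
      rw [baseForm_psi, tangentCoord, LinearMap.comp_apply, projF_split, map_zero, map_zero]
  have h2 : homotopyVF j hj FB (lieVF F (psi j hj Z)) = 0 :=
    homotopyVF_eq_zero j hj FB (bracketQ_mem (psiFun_mem j hj Z)) fun i => by
      ext k v
      rw [baseForm_apply]
      by_cases hk : (k : ℤ) = 0 + 1
      · obtain rfl : k = 1 := by omega
        rw [restrictDer_lieVF_psi, tangentCoord, LinearMap.comp_apply, map_sub, projF_coe, sub_self,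
          map_zero]
        rfl
      · rw [restrictDer_eq_zero (bracketQ_mem (psiFun_mem j hj Z)) hk]
        exact map_zero _
  rw [homotopyDefect_apply, h1, h2, projVF_psi]
  simp

end Contraction

/-! ### The homotopy identity, its transpose, and the normal frame -/

section HomotopyDefect

variable {𝕂 A : Type*} [Field 𝕂] [CharZero 𝕂] [CommRing A] [Algebra 𝕂 A]
  {F : LieRinehartSubalgebra A (Derivation 𝕂 A A)} {I J : Type*} [Fintype I] [Fintype J]
  (j : NormalSections F →ₗ[A] Derivation 𝕂 A A) (hj : IsSplitting j)
  (FB : FiniteDualBasis A F I) (BB : FiniteDualBasis A (NormalSections F) J)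

lemma forms_sum_apply {ι V E : Type*} [AddCommGroup V] [Module A V] [AddCommGroup E] [Module A E]
    (s : Finset ι) (g : ι → Forms A V E) (k : ℕ) (v : Fin k → V) :
    (∑ i ∈ s, g i) k v = ∑ i ∈ s, g i k v := by
  let ev : Forms A V E →+ E :=
    { toFun := fun a => a k v, map_zero' := rfl, map_add' := fun _ _ => rfl }
  exact map_sum ev g s

lemma homotopyDefect_rankOne {β : vectorFields F →ₗ[𝕂] Functions F}
    (hβ : β ∈ oneFormsOfDegree F 0) {Z X : vectorFields F} {p : ℤ}
    (hX : X.1 ∈ vectorFieldsOfDegree F p) (hZ : homotopyDefect j hj FB BB Z = 0) :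
    homotopyDefect j hj FB BB (rankOne hβ Z X) = 0 := by
  have h := hβ.1 p X hX
  rw [rankOne_eq hβ Z X ⟨β X, h⟩ rfl, homotopyDefect_vfSmul, hZ, map_zero]

/-- The decomposition `W = pr_F W + j (pr_B W)` with both summands expanded in the dual bases. -/
lemma derivation_decomposition (W : Derivation 𝕂 A A) (f : A) :
    ∑ i, tangentCoord j hj FB i W * (FB.vec i : Derivation 𝕂 A A) f +
      ∑ a, BB.coord a (F.toSubmodule.mkQ W) * j (BB.vec a) f = W f := by
  have h1 : ((∑ i, FB.coord i (projF j hj W) • FB.vec i : F) : Derivation 𝕂 A A) f =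
      (projF j hj W : Derivation 𝕂 A A) f := by rw [FB.sum_eq]
  have h2 : j (∑ a, BB.coord a (F.toSubmodule.mkQ W) • BB.vec a) f = j (F.toSubmodule.mkQ W) f := by
    rw [BB.sum_eq]
  let ev : F →ₗ[A] A :=
    { toFun := fun v => (v : Derivation 𝕂 A A) f
      map_add' := fun _ _ => rfl
      map_smul' := fun _ _ => rfl }
  have h3 : ev (∑ i, FB.coord i (projF j hj W) • FB.vec i) = ev (projF j hj W) := h1
  let ev' : NormalSections F →ₗ[A] A :=
    { toFun := fun Z => j Z f
      map_add' := fun _ _ => by rw [map_add]; rfl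
      map_smul' := fun _ _ => by rw [map_smul]; rfl }
  have h4 : ev' (∑ a, BB.coord a (F.toSubmodule.mkQ W) • BB.vec a) =
    ev' (F.toSubmodule.mkQ W) := h2
  rw [map_sum] at h3 h4
  simp only [map_smul, smul_eq_mul] at h3 h4
  have h5 : (projF j hj W : Derivation 𝕂 A A) f = W f - j (F.toSubmodule.mkQ W) f := rfl
  refine (congrArg₂ (· + ·) h3 h4).trans ?_
  change (projF j hj W : Derivation 𝕂 A A) f + j (F.toSubmodule.mkQ W) f = W f
  rw [h5, sub_add_cancel]

/-- A vector field that vanishes on functions of the base is a combination of contractions. -/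
lemma eq_sum_contractVF {p : ℤ} {X : vectorFields F} (hX : X.1 ∈ vectorFieldsOfDegree F p)
    (h0 : ∀ f, X.1 (ofFun F f) = 0) (hm : ∀ i, X.1 (ofDual (FB.coord i)) ∈ formsOfDegree 𝕂 (p + 1)) :
    X = ∑ i, vfSmul ⟨X.1 (ofDual (FB.coord i)), hm i⟩ (contractVF (FB.vec i)) := by
  rw [← sub_eq_zero]
  have hmem : ∀ i, (vfSmul ⟨X.1 (ofDual (FB.coord i)), hm i⟩ (contractVF (FB.vec i))).1 ∈
      vectorFieldsOfDegree F p := fun i => by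
    have := vfSmul_mem (hm i) (contractVF_mem (FB.vec i))
    rwa [add_comm p 1, neg_add_cancel_left] at this
  refine Subtype.ext (vectorField_eq_zero FB (p := p) ?_ (fun f => ?_) fun l => ?_)
  · rw [AddSubgroupClass.coe_sub, AddSubmonoidClass.coe_finsetSum]
    exact sub_mem hX (sum_mem fun i _ => hmem i)
  · rw [AddSubgroupClass.coe_sub, LinearMap.sub_apply, h0, coe_sum_apply, zero_sub, neg_eq_zero]
    refine Finset.sum_eq_zero fun i _ => ?_
    rw [vfSmul_apply, contractVF_apply, contract_ofFun, map_zero]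
  · rw [AddSubgroupClass.coe_sub, LinearMap.sub_apply, coe_sum_apply, sub_eq_zero]
    have h1 := congrArg X.1 (ofDual_sum (𝕂 := 𝕂) FB (FB.coord l))
    rw [map_sum] at h1
    rw [h1]
    refine Finset.sum_congr rfl fun i _ => ?_
    have h2 := hX.2 (ofFun F (FB.coord l (FB.vec i))) (ofDual (FB.coord i))
    rw [h0, map_zero, LinearMap.zero_apply, zero_add, ftwist_apply, twist_ofFun,
      fmul_ofFun_left (𝕂 := 𝕂) _ (X.1 _)] at h2
    refine Eq.trans h2 ?_
    rw [vfSmul_apply, contractVF_apply, contract_ofDual, fmul_ofFun_right]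

/-- From a homogeneous vector field `X` subtract the combinations `X₁` of the `L_{v_i}` and `X₂` of
the `ψ_j Z_a` that have the tangential and the normal part of its restriction to the base. The
remainder kills functions of the base and is therefore a combination of contractions. The defect is
linear over the functions and vanishes on all three kinds of generators. -/
lemma homotopyDefect_eq_zero (X : vectorFields F) : homotopyDefect j hj FB BB X = 0 := by
  have key : homotopyDefect j hj FB BB = 0 := by
    refine vf_ext fun p X hX => ?_
    rw [LinearMap.zero_apply]
    set X₁ := ∑ i, rankOne (baseForm_mem (tangentCoord j hj FB i))
      (lieVF F (contractVF (FB.vec i))) X with hX₁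
    set X₂ := ∑ a, rankOne (phiDualFun_mem (BB.coord a)) (psi j hj (BB.vec a)) X with hX₂
    have hm₁ : X₁.1 ∈ vectorFieldsOfDegree F p := by
      rw [hX₁, AddSubmonoidClass.coe_finsetSum]
      refine sum_mem fun i _ => ?_
      have := rankOne_mem (baseForm_mem (tangentCoord j hj FB i)) hX
        (lieVF_contractVF_mem (FB.vec i))
      rwa [add_zero] at this
    have hm₂ : X₂.1 ∈ vectorFieldsOfDegree F p := by
      rw [hX₂, AddSubmonoidClass.coe_finsetSum]
      refine sum_mem fun a _ => ?_
      have := rankOne_mem (phiDualFun_mem (BB.coord a)) (Z := psi j hj (BB.vec a)) hX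
        (psiFun_mem j hj (BB.vec a))
      rwa [add_zero] at this
    have hm : (X - (X₁ + X₂)).1 ∈ vectorFieldsOfDegree F p := sub_mem hX (add_mem hm₁ hm₂)
    have h0 : ∀ f, (X - (X₁ + X₂)).1 (ofFun F f) = 0 := fun f => by
      change X.1 (ofFun F f) - (X₁.1 (ofFun F f) + X₂.1 (ofFun F f)) = 0
      rw [sub_eq_zero, hX₁, hX₂, coe_sum_apply, coe_sum_apply]
      simp only [rankOne_apply, lieVF_contractVF, lieDer_ofFun, psi_ofFun, fmul_ofFun_right]
      ext k v
      have h := derivation_decomposition j hj FB BB (restrictDer X k v) f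
      rw [restrictDer_apply] at h
      rw [← h, Forms.add_apply, AlternatingMap.add_apply]
      refine congrArg₂ (· + ·) ((Finset.sum_congr rfl fun i _ => ?_).trans (forms_sum_apply _ _ _ _).symm)
        ((Finset.sum_congr rfl fun i _ => ?_).trans (forms_sum_apply _ _ _ _).symm)
      · exact mul_comm _ _
      · exact mul_comm _ _
    have hm' : ∀ i, (X - (X₁ + X₂)).1 (ofDual (FB.coord i)) ∈ formsOfDegree 𝕂 (p + 1) := fun i => by
      have h := hm.1 1 (ofDual (FB.coord i))
      rw [component_of_mem (𝕂 := 𝕂) (ofDual_mem _), add_comm] at h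
      rw [← h]
      exact component_mem _ _
    have h1 := eq_sum_contractVF FB hm h0 hm'
    have h2 : homotopyDefect j hj FB BB (X - (X₁ + X₂)) = 0 := by
      rw [h1, map_sum]
      refine Finset.sum_eq_zero fun i _ => ?_
      rw [homotopyDefect_vfSmul, homotopyDefect_contractVF, map_zero]
    have h3 : homotopyDefect j hj FB BB X₁ = 0 := by
      rw [hX₁, map_sum]
      exact Finset.sum_eq_zero fun i _ => homotopyDefect_rankOne j hj FB BB _ hX
        (homotopyDefect_lieVF_contractVF j hj FB BB _)
    have h4 : homotopyDefect j hj FB BB X₂ = 0 := by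
      rw [hX₂, map_sum]
      exact Finset.sum_eq_zero fun i _ => homotopyDefect_rankOne j hj FB BB _ hX
        (homotopyDefect_psi j hj FB BB _)
    rwa [map_sub, map_add, h3, h4, add_zero, sub_zero] at h2
  exact LinearMap.congr_fun key X

/-- The identity of vector fields is homotopic to `ψ_j ∘ φ`. -/
lemma homotopy_vectorFields :
    (vectorFieldsDGMod F).Homotopy (homotopyVF j hj FB) (projVF j hj BB) where
  mem _ _ := homotopyVF_mem j hj FB
  act _ := homotopyVF_vfSmul j hj FB
  eq X := by
    have h := homotopyDefect_eq_zero j hj FB BB X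
    rw [homotopyDefect_apply, sub_add_eq_add_sub, sub_eq_zero] at h
    exact eq_sub_of_add_eq h
  L_L := lieVF_lieVF

lemma transpose_homotopy_mem {q : ℤ} {α : vectorFields F →ₗ[𝕂] Functions F}
    (hα : α ∈ oneFormsOfDegree F q) :
    conjDual F α ∘ₗ homotopyVF j hj FB ∈ oneFormsOfDegree F (q + -1) := by
  rw [conjDual_eq hα]
  refine ⟨fun p X hX => ?_, fun r a X => ?_⟩
  · have h := hα.1 _ _ (homotopyVF_mem j hj FB hX)
    rw [add_assoc, add_comm (-1)] at h
    exact units_smul_mem' _ _ h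
  · change q.negOnePow • α (homotopyVF j hj FB (vfSmul a X)) =
      _ • fmul a.1 (q.negOnePow • α (homotopyVF j hj FB X))
    rw [homotopyVF_vfSmul, linearMap_units_smul, hα.2, fmul_units_right, smul_smul, smul_smul,
      smul_smul, ← Int.negOnePow_add, ← Int.negOnePow_add, ← Int.negOnePow_add]
    congr 1
    exact negOnePow_congr ⟨r, by ring⟩

lemma transpose_proj_mem {q : ℤ} {α : vectorFields F →ₗ[𝕂] Functions F}
    (hα : α ∈ oneFormsOfDegree F q) : α ∘ₗ projVF j hj BB ∈ oneFormsOfDegree F q := by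
  refine ⟨fun p X hX => hα.1 _ _ ?_, fun r a X => ?_⟩
  · rw [projVF_apply, AddSubmonoidClass.coe_finsetSum]
    refine sum_mem fun i _ => ?_
    have := rankOne_mem (phiDualFun_mem (BB.coord i)) (Z := psi j hj (BB.vec i)) hX
      (psiFun_mem j hj (BB.vec i))
    rwa [add_zero] at this
  · rw [LinearMap.comp_apply, projVF_vfSmul, hα.2]
    rfl

/-- The transpose of the homotopy on one-forms. -/
def homotopyForm : oneForms F →ₗ[𝕂] oneForms F :=
  ((LinearMap.lcomp 𝕂 (Functions F) (homotopyVF j hj FB)) ∘ₗ conjDual F).restrict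
    (mem_oneForms_map _ fun q _ hα => oneForms_le (q + -1) (transpose_homotopy_mem j hj FB hα))

/-- The transpose of `ψ_j ∘ φ` on one-forms. -/
def projForm : oneForms F →ₗ[𝕂] oneForms F :=
  (LinearMap.lcomp 𝕂 (Functions F) (projVF j hj BB)).restrict
    (mem_oneForms_map _ fun q _ hα => oneForms_le q (transpose_proj_mem j hj BB hα))

lemma homotopyForm_apply {q : ℤ} {α : oneForms F} (hα : α.1 ∈ oneFormsOfDegree F q)
    (X : vectorFields F) :
    (homotopyForm j hj FB α).1 X = q.negOnePow • α.1 (homotopyVF j hj FB X) := by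
  change conjDual F α.1 (homotopyVF j hj FB X) = _
  rw [conjDual_eq hα]
  rfl

lemma homotopyForm_mem {q : ℤ} {α : oneForms F} (hα : α.1 ∈ oneFormsOfDegree F q) :
    (homotopyForm j hj FB α).1 ∈ oneFormsOfDegree F (q + -1) :=
  transpose_homotopy_mem j hj FB hα

/-- The identity of one-forms is homotopic to the transpose of `ψ_j ∘ φ`. -/
lemma homotopy_oneForms :
    (oneFormsDGMod F).Homotopy (homotopyForm j hj FB) (projForm j hj BB) where
  mem _ _ := homotopyForm_mem j hj FB
  act r a α := by
    have key : homotopyForm j hj FB ∘ₗ formSmul a = r.negOnePow • (formSmul a ∘ₗ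
        homotopyForm j hj FB) := by
      refine oneForms_ext fun q α hα => Subtype.ext (LinearMap.ext fun X => ?_)
      change (homotopyForm j hj FB (formSmul a α)).1 X =
        (r.negOnePow • formSmul a (homotopyForm j hj FB α)).1 X
      rw [homotopyForm_apply j hj FB (formSmul_mem a.2 hα), coe_units_smul]
      change _ = r.negOnePow • (fmul a.1 ((homotopyForm j hj FB α).1 X))
      rw [homotopyForm_apply j hj FB hα, fmul_units_right, formSmul_apply, smul_smul,
        Int.negOnePow_add, mul_comm]
    exact LinearMap.congr_fun key α
  eq α := by
    have key : lieForm F ∘ₗ homotopyForm j hj FB + homotopyForm j hj FB ∘ₗ lieForm F =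
        LinearMap.id - projForm j hj BB := by
      refine oneForms_ext fun q α hα => Subtype.ext (LinearMap.ext fun X => ?_)
      change (lieForm F (homotopyForm j hj FB α)).1 X + (homotopyForm j hj FB (lieForm F α)).1 X =
        α.1 X - α.1 (projVF j hj BB X)
      -- The two terms with `d_F (α (h X))` cancel and leave `α ((L h + h L) X)`, to which the
      -- homotopy identity on vector fields applies.
      rw [lieForm_apply (homotopyForm_mem j hj FB hα), homotopyForm_apply j hj FB hα,
        homotopyForm_apply j hj FB hα, homotopyForm_apply j hj FB (lieDual_mem hα),
        lieForm_apply hα, ← map_sub, ← (homotopy_vectorFields j hj FB BB).eq X, map_add, dF_units,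
        Int.negOnePow_succ, Int.negOnePow_add, smul_sub]
      rcases Int.units_eq_one_or q.negOnePow with h | h <;> simp [h] <;> abel
    exact LinearMap.congr_fun key α
  L_L := lieForm_lieForm

lemma DGMod.Homotopy.prod {𝕂 Ω Y Y' : Type*} [CommRing 𝕂] [Ring Ω] [Algebra 𝕂 Ω] [AddCommGroup Y]
    [Module 𝕂 Y] [AddCommGroup Y'] [Module 𝕂 Y'] {R : DGAlg 𝕂 Ω} {M : DGMod Y R} {M' : DGMod Y' R}
    {h P : Y →ₗ[𝕂] Y} {h' P' : Y' →ₗ[𝕂] Y'} (H : M.Homotopy h P) (H' : M'.Homotopy h' P') :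
    (M.prod M').Homotopy (h.prodMap h') (P.prodMap P') where
  mem p _ hy := ⟨H.mem p _ hy.1, H'.mem p _ hy.2⟩
  act r a _ := Prod.ext (H.act r a _) (H'.act r a _)
  eq y := Prod.ext (H.eq y.1) (H'.eq y.2)
  L_L y := Prod.ext (H.L_L y.1) (H'.L_L y.2)

/-- The value of a one-form on a vector field of degree zero, as a linear map. -/
def evalForm (X : vectorFields F) : oneForms F →ₗ[𝕂] Functions F :=
  LinearMap.applyₗ X ∘ₗ (oneForms F).subtype

/-- No sign appears: the sign of pulling the coefficient `φ(X)` out of `α` is the sign of moving it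
behind `α(ψ_j Z_a)`. -/
lemma projForm_eq {q : ℤ} {α : oneForms F} (hα : α.1 ∈ oneFormsOfDegree F q)
    (hm : ∀ a, α.1 (psi j hj (BB.vec a)) ∈ formsOfDegree 𝕂 q) : projForm j hj BB α =
      ∑ a, formSmul ⟨α.1 (psi j hj (BB.vec a)), hm a⟩ (phiDual (BB.coord a)) := by
  refine Subtype.ext (vf_ext fun p X hX => ?_)
  change α.1 (projVF j hj BB X) = _
  rw [projVF_apply, map_sum, AddSubmonoidClass.coe_finsetSum, LinearMap.sum_apply]
  refine Finset.sum_congr rfl fun a _ => ?_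
  have h := (phiDualFun_mem (BB.coord a)).1 p X hX
  rw [add_zero] at h
  rw [rankOne_eq _ _ _ ⟨phiDualFun (BB.coord a) X, h⟩ rfl, hα.2, formSmul_apply,
    fmul_comm' h (hm a), smul_smul, mul_comm q, Int.units_mul_self, one_smul]
  rfl

lemma projVF_eq {p : ℤ} {X : vectorFields F}
    (hm : ∀ a, phiDualFun (BB.coord a) X ∈ formsOfDegree 𝕂 p) : projVF j hj BB X =
      ∑ a, vfSmul ⟨phiDualFun (BB.coord a) X, hm a⟩ (psi j hj (BB.vec a)) := by
  rw [projVF_apply]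
  exact Finset.sum_congr rfl fun a _ => rankOne_eq _ _ _ _ rfl

lemma prodMk_sum_sum {M M' : Type*} [AddCommGroup M] [AddCommGroup M'] (f : J → M) (g : J → M') :
    (∑ a, f a, ∑ a, g a) = ∑ a, (f a, (0 : M')) + ∑ a, ((0 : M), g a) := by
  ext <;> simp [Prod.fst_sum, Prod.snd_sum]

lemma proj_pair_eq {p : ℤ} {α : oneForms F} {X : vectorFields F} (hα : α.1 ∈ oneFormsOfDegree F p)
    (h1 : ∀ a, α.1 (psi j hj (BB.vec a)) ∈ formsOfDegree 𝕂 p)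
    (h2 : ∀ a, phiDualFun (BB.coord a) X ∈ formsOfDegree 𝕂 p) :
    (projForm j hj BB α, projVF j hj BB X) =
      ∑ a, (formSmul ⟨α.1 (psi j hj (BB.vec a)), h1 a⟩ (phiDual (BB.coord a)), 0) +
        ∑ a, (0, vfSmul ⟨phiDualFun (BB.coord a) X, h2 a⟩ (psi j hj (BB.vec a))) := by
  rw [projForm_eq j hj BB hα h1, projVF_eq j hj BB h2, prodMk_sum_sum]

/-- The frame of one-forms and vector fields on `F[1]` given by a dual basis of the normal
bundle. -/
def normalFrame : ((oneFormsDGMod F).prod (vectorFieldsDGMod F)).Frame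
    ((projForm j hj BB).prodMap (projVF j hj BB)) (J ⊕ J) where
  coeff := Sum.elim (fun a => evalForm (psi j hj (BB.vec a)) ∘ₗ LinearMap.fst 𝕂 _ _)
    (fun a => phiDualFun (BB.coord a) ∘ₗ LinearMap.snd 𝕂 _ _)
  vec := Sum.elim (fun a => (phiDual (BB.coord a), 0)) fun a => (0, psi j hj (BB.vec a))
  coeff_mem i p y hy := by
    cases i with
    | inl a =>
      have := hy.1.1 0 (psi j hj (BB.vec a)) (psiFun_mem j hj (BB.vec a))
      rwa [zero_add] at this
    | inr a =>
      have := (phiDualFun_mem (BB.coord a)).1 p y.2 hy.2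
      rwa [add_zero] at this
  coeff_act i r a y := by
    cases i with
    | inl b => rfl
    | inr b =>
      have := (phiDualFun_mem (BB.coord b)).2 r a y.2
      rwa [zero_mul, Int.negOnePow_zero, one_smul] at this
  vec_mem i := by
    cases i with
    | inl a => exact ⟨phiDualFun_mem _, zero_mem _⟩
    | inr a => exact ⟨zero_mem _, psiFun_mem _ _ _⟩
  P_eq {p y} hy := by
    have h1 : ∀ a, y.1.1 (psi j hj (BB.vec a)) ∈ formsOfDegree 𝕂 p := fun a => by
      have := hy.1.1 0 (psi j hj (BB.vec a)) (psiFun_mem j hj (BB.vec a))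
      rwa [zero_add] at this
    have h2 : ∀ a, phiDualFun (BB.coord a) y.2 ∈ formsOfDegree 𝕂 p := fun a => by
      have := (phiDualFun_mem (BB.coord a)).1 p y.2 hy.2
      rwa [add_zero] at this
    rw [Fintype.sum_sum_type]
    refine (proj_pair_eq j hj BB (α := y.1) (X := y.2) hy.1 h1 h2).trans ?_
    refine congrArg₂ (· + ·) (Finset.sum_congr rfl fun a _ => ?_)
      (Finset.sum_congr rfl fun a _ => ?_)
    · exact Prod.ext rfl (map_zero (vfSmul ⟨y.1.1 (psi j hj (BB.vec a)), h1 a⟩)).symm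
    · exact Prod.ext (map_zero (formSmul ⟨phiDualFun (BB.coord a) y.2, h2 a⟩)).symm rfl

end HomotopyDefect

/-! ### The Chevalley-Eilenberg differential in terms of connection forms -/

section NormalPairs

variable {𝕂 A : Type*} [CommRing 𝕂] [CommRing A] [Algebra 𝕂 A]
  {F : LieRinehartSubalgebra A (Derivation 𝕂 A A)} {n m : ℕ}

/-- Reduces a differential with coefficients to `d_F` on scalar forms with connection terms. The
Cartan formula carries the pointwise rule `h` from each degree to the next. -/
lemma mapForms_ceDiff {E ι : Type*} [AddCommGroup E] [Module A E] [Module 𝕂 E]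
    [IsScalarTower 𝕂 A E] [Fintype ι] (M : FModule F E) (l : E →ₗ[A] A) (θ : ι → F →ₗ[A] A)
    (l' : ι → E →ₗ[A] A)
    (h : ∀ (v : F) e, l (M.nabla v e) = (v : Derivation 𝕂 A A) (l e) - ∑ i, θ i v * l' i e)
    (T : Forms A F E) : mapForms l (ceDiff M T) =
      dF F (mapForms l T) - ∑ i, ofDual (θ i) * mapForms (l' i) T := by
  ext1 k
  induction k generalizing T with
  | zero =>
    ext x
    rw [mapForms_apply, ceDiff_zero, AlternatingMap.zero_apply, map_zero, Forms.sub_apply,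
      AlternatingMap.sub_apply, forms_sum_apply, Finset.sum_eq_zero fun i _ => ?_]
    · simp [dF, ceDiff_zero]
    · rw [mul_eq_wedge, wedge_zero_apply]
      simp [ofDual]
  | succ k ih =>
    refine forms_succ_ext fun v => ?_
    have e0 : ∀ T : Forms A F E, contract v (mapForms l T) = mapForms l (contract v T) :=
      fun _ => rfl
    have e1 : ∀ i, contract v (ofDual (θ i) * mapForms (l' i) T) =
        θ i v • mapForms (l' i) T - ofDual (θ i) * mapForms (l' i) (contract v T) := fun i => by
      have h1 := contract_fmul (𝕂 := 𝕂) v (ofDual (θ i)) (mapForms (l' i) T)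
      rw [contract_ofDual, ftwist_of_mem (ofDual_mem _), mul_one, Int.negOnePow_one,
        fmul_units_left, Units.neg_smul, one_smul, ← sub_eq_add_neg, fmul_ofFun_left] at h1
      exact h1
    have e2 : mapForms l (lieDer M v T) = lieDer (trivialModule F) v (mapForms l T) -
        ∑ i, θ i v • mapForms (l' i) T := by
      ext k x
      rw [mapForms_apply, lieDer_apply, map_sub, h, Forms.sub_apply, AlternatingMap.sub_apply,
        forms_sum_apply, lieDer_apply, map_sum]
      exact sub_right_comm _ _ _
    rw [e0, contract_ceDiff, map_sub, map_sub, contract_dF, map_sum, e0,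
      Finset.sum_congr rfl fun i _ => e1 i, Finset.sum_sub_distrib, e2]
    have := ih (contract v T)
    rw [Forms.sub_apply, this]
    simp only [Forms.sub_apply]
    abel

/-- The connection on pairs of a section of `B^∨` and a section of `B`. -/
def pairNabla (v : F) (y : Module.Dual A (NormalSections F) × NormalSections F) :
    Module.Dual A (NormalSections F) × NormalSections F :=
  ((dualModule (bottModule F)).nabla v y.1, (bottModule F).nabla v y.2)

/-- The evaluation of tensors of `B` on pairs. -/
def evalPairs (y : Fin (n + m) → Module.Dual A (NormalSections F) × NormalSections F) :
    NormalTensors F n m →ₗ[A] A where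
  toFun T := toPairs T y
  map_add' _ _ := rfl
  map_smul' _ _ := rfl

lemma evalPairs_apply (y : Fin (n + m) → Module.Dual A (NormalSections F) × NormalSections F)
    (T : NormalTensors F n m) : evalPairs y T = toPairs T y := rfl

/-- Through pairs, the nested connection on tensors acquires one correction term for each place,
without distinction between `B^∨` and `B`. -/
lemma evalPairs_nabla (v : F) (T : NormalTensors F n m)
    (y : Fin (n + m) → Module.Dual A (NormalSections F) × NormalSections F) :
    evalPairs y ((normalTensorModule F n m).nabla v T) = (v : Derivation 𝕂 A A) (evalPairs y T) -
      ∑ i, evalPairs (Function.update y i (pairNabla v (y i))) T := by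
  simp only [evalPairs_apply, toPairs_apply]
  rw [Fin.sum_univ_add]
  simp only [update_castAdd_left Prod.fst, update_castAdd_right Prod.snd,
    update_natAdd_left Prod.fst, update_natAdd_right Prod.snd]
  change nablaMultilinear (dualModule (bottModule F))
    (multilinearModule m (bottModule F) (trivialModule F)) v T _ _ = _
  rw [nablaMultilinear_apply, _root_.sub_apply, _root_.sum_apply]
  change nablaMultilinear (bottModule F) (trivialModule F) v _ _ - _ = _
  rw [nablaMultilinear_apply]
  exact (sub_sub _ _ _).trans (by rw [add_comm]; rfl)

variable {J : Type*} [Fintype J] (BB : FiniteDualBasis A (NormalSections F) J)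

/-- The dual basis of pairs of sections of `B^∨` and `B`. -/
def pairBasis : FiniteDualBasis A (Module.Dual A (NormalSections F) × NormalSections F) (J ⊕ J) where
  vec := Sum.elim (fun a => (BB.coord a, 0)) fun a => (0, BB.vec a)
  coord := Sum.elim (fun a => LinearMap.applyₗ (BB.vec a) ∘ₗ LinearMap.fst A _ _)
    fun a => BB.coord a ∘ₗ LinearMap.snd A _ _
  sum_eq y := by
    rw [Fintype.sum_sum_type]
    refine Prod.ext ?_ ?_
    · rw [Prod.fst_add, Prod.fst_sum, Prod.fst_sum]
      refine LinearMap.ext fun Z => ?_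
      conv_rhs => rw [← BB.sum_eq Z]
      simp [mul_comm]
    · rw [Prod.snd_add, Prod.snd_sum, Prod.snd_sum]
      simp [BB.sum_eq]

/-- The connection forms of a pair. -/
def connectionForm (y : Module.Dual A (NormalSections F) × NormalSections F) (c : J ⊕ J) :
    F →ₗ[A] A where
  toFun v := (pairBasis BB).coord c (pairNabla v y)
  map_add' v w := by
    rw [← map_add]
    congr 1
    exact Prod.ext (by simp [pairNabla]) (by simp [pairNabla])
  map_smul' f v := by
    rw [RingHom.id_apply, ← map_smul]
    congr 1
    exact Prod.ext (by simp [pairNabla]) (by simp [pairNabla])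

/-- The form of the differential that is to be matched with the Lie derivative of tensor fields, see
`L_pairLift`: each connection term is expanded in the dual basis of pairs. -/
lemma mapForms_evalPairs_ceDiff (T : Forms A F (NormalTensors F n m))
    (y : Fin (n + m) → Module.Dual A (NormalSections F) × NormalSections F) :
    mapForms (evalPairs y) (ceDiff (normalTensorModule F n m) T) =
      dF F (mapForms (evalPairs y) T) - ∑ i, ∑ c, ofDual (connectionForm BB (y i) c) *
        mapForms (evalPairs (Function.update y i ((pairBasis BB).vec c))) T := by
  refine (mapForms_ceDiff (normalTensorModule F n m) (evalPairs y)
    (fun q : Fin (n + m) × (J ⊕ J) => connectionForm BB (y q.1) q.2)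
    (fun q => evalPairs (Function.update y q.1 ((pairBasis BB).vec q.2))) (fun v e => ?_) T).trans ?_
  · rw [evalPairs_nabla, Fintype.sum_prod_type]
    congr 1
    refine Finset.sum_congr rfl fun i _ => ?_
    conv_lhs => rw [← (pairBasis BB).sum_eq (pairNabla v (y i))]
    rw [evalPairs_apply, MultilinearMap.map_update_sum]
    simp only [MultilinearMap.map_update_smul]
    rfl
  · rw [Fintype.sum_prod_type]

end NormalPairs

/-! ### Lie derivatives of lifted sections; the comparison map is a map of complexes -/

section LieOfLifts

variable {𝕂 A : Type*} [Field 𝕂] [CharZero 𝕂] [CommRing A] [Algebra 𝕂 A]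
  {F : LieRinehartSubalgebra A (Derivation 𝕂 A A)} {n m : ℕ}
  {I J : Type*} [Fintype I] [Fintype J]
  (BB : FiniteDualBasis A (NormalSections F) J)
  (j j' : NormalSections F →ₗ[A] Derivation 𝕂 A A) (hj : IsSplitting j) (hj' : IsSplitting j')

lemma phiDualFun_psi (w : Module.Dual A (NormalSections F)) (Z : NormalSections F) :
    phiDualFun w (psi j hj Z) = ofFun F (w Z) := by
  rw [phiDualFun_eq_baseForm, baseForm_psi, LinearMap.comp_apply, hj]

lemma eq_ofDual {a : Functions F} (ha : a ∈ formsOfDegree 𝕂 1) (ξ : F →ₗ[A] A)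
    (h : ∀ v : Fin 1 → F, a 1 v = ξ (v 0)) : a = ofDual ξ := by
  ext k v
  by_cases hk : k = 1
  · subst hk
    exact (h v).trans rfl
  · rw [ha k (by exact_mod_cast hk), (ofDual_mem (𝕂 := 𝕂) ξ) k (by exact_mod_cast hk)]

/-- The restriction of `[d_F, ψ_j Z]` to the base in the direction `v` is `[v, j Z]` modulo `F`,
whose class is the Bott derivative of `Z`. -/
lemma phiDualFun_lieVF_psi (y : Module.Dual A (NormalSections F) × NormalSections F) (a : J) :
    phiDualFun (BB.coord a) (lieVF F (psi j hj y.2)) =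
      ofDual (connectionForm BB y (Sum.inr a)) := by
  have hm : (lieVF F (psi j hj y.2)).1 ∈ vectorFieldsOfDegree F (0 + 1) :=
    bracketQ_mem (psiFun_mem j hj y.2)
  refine eq_ofDual (𝕂 := 𝕂) ((phiDualFun_mem (BB.coord a)).1 1 _ hm) _ fun v => ?_
  rw [phiDualFun_eq_baseForm, baseForm_apply, restrictDer_lieVF_psi, LinearMap.comp_apply, map_sub,
    mkQ_coe, sub_zero]
  change _ = BB.coord a ((bottModule F).nabla (v 0) y.2)
  congr 1
  conv_rhs => rw [← hj y.2]
  rfl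

/-- Evaluated at `v` the left side is `v(ω(Z)) - ω(∇_v Z)`, the derivative of `ω` for the dual
connection. -/
lemma lieForm_phiDual_psi (y : Module.Dual A (NormalSections F) × NormalSections F) (a : J) :
    (lieForm F (phiDual y.1)).1 (psi j hj (BB.vec a)) =
      ofDual (connectionForm BB y (Sum.inl a)) := by
  have hm := (lieDual_mem (phiDualFun_mem y.1)).1 0 (psi j hj (BB.vec a)) (psiFun_mem j hj _)
  refine eq_ofDual (𝕂 := 𝕂) hm _ fun v => ?_
  have e : (lieForm F (phiDual y.1)).1 (psi j hj (BB.vec a)) =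
      dF F (phiDualFun y.1 (psi j hj (BB.vec a))) -
        phiDualFun y.1 (lieVF F (psi j hj (BB.vec a))) := by
    rw [lieForm_apply (phiDualFun_mem y.1), Int.negOnePow_zero, one_smul]
    rfl
  refine (congrArg (fun a : Functions F => a 1 v) e).trans ?_
  rw [phiDualFun_psi, Forms.sub_apply, AlternatingMap.sub_apply, dF_ofFun_one,
    phiDualFun_eq_baseForm, baseForm_apply, restrictDer_lieVF_psi, LinearMap.comp_apply, map_sub,
    mkQ_coe, sub_zero]
  change _ = (v 0 : Derivation 𝕂 A A) (y.1 (BB.vec a)) -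
    y.1 ((bottModule F).nabla (v 0) (BB.vec a))
  congr 2
  conv_rhs => rw [← hj (BB.vec a)]
  rfl

/-- The one-form and the vector field on `F[1]` given by a section of `B^∨` and a section of
`B`. -/
def pairLift : Module.Dual A (NormalSections F) × NormalSections F →+
    oneForms F × vectorFields F :=
  phiDualHom.prodMap (psiHom j hj)

lemma pairLift_smul (f : A) (y : Module.Dual A (NormalSections F) × NormalSections F) :
    pairLift j hj (f • y) = ((oneFormsDGMod F).prod (vectorFieldsDGMod F)).act 0
      ⟨ofFun F f, ofFun_mem f⟩ (pairLift j hj y) :=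
  Prod.ext (phiDual_smul f y.1) (psi_smul j hj f y.2)

lemma pairLift_mem (y : Module.Dual A (NormalSections F) × NormalSections F) :
    pairLift j hj y ∈ ((oneFormsDGMod F).prod (vectorFieldsDGMod F)).deg 0 :=
  ⟨phiDualFun_mem y.1, psiFun_mem j hj y.2⟩

lemma normalFrame_vec (c : J ⊕ J) :
    (normalFrame j hj BB).vec c = pairLift j hj ((pairBasis BB).vec c) := by
  cases c with
  | inl a => exact Prod.ext rfl (psiHom j hj).map_zero.symm
  | inr a => exact Prod.ext phiDualHom.map_zero.symm rfl

/-- The frame is built from `j` and the lift from `j'`: since `φ ∘ ψ_{j'} = id`, the coefficients do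
not see the difference. This carries the independence of the splitting. -/
lemma normalFrame_coeff (c : J ⊕ J) (y : Module.Dual A (NormalSections F) × NormalSections F) :
    (normalFrame j hj BB).coeff c (pairLift j' hj' y) = ofFun F ((pairBasis BB).coord c y) := by
  cases c with
  | inl a => exact phiDualFun_psi j hj _ _
  | inr a => exact phiDualFun_psi j' hj' _ _

lemma proj_pairLift (y : Module.Dual A (NormalSections F) × NormalSections F) :
    (projForm j hj BB).prodMap (projVF j hj BB) (pairLift j hj y) = pairLift j hj y := by
  rw [(normalFrame j hj BB).P_eq (pairLift_mem j hj y)]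
  conv_rhs => rw [← (pairBasis BB).sum_eq y, map_sum]
  refine Finset.sum_congr rfl fun c _ => ?_
  rw [pairLift_smul, ← normalFrame_vec]
  congr 2
  exact Subtype.ext (normalFrame_coeff BB j j hj hj c y)

/-- Lifts are fixed by the projection `P`, and `P` commutes with `L` by the homotopy identity. So
`L` of a lift is again in the image of `P` and has an expansion in the frame, with the connection
forms as coefficients. -/
lemma L_pairLift (FB : FiniteDualBasis A F I)
    (y : Module.Dual A (NormalSections F) × NormalSections F) :
    ((oneFormsDGMod F).prod (vectorFieldsDGMod F)).L (pairLift j hj y) =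
      ∑ c, ((oneFormsDGMod F).prod (vectorFieldsDGMod F)).act 1
        ⟨ofDual (connectionForm BB y c), ofDual_mem _⟩ (pairLift j hj ((pairBasis BB).vec c)) := by
  have H := (homotopy_oneForms j hj FB BB).prod (homotopy_vectorFields j hj FB BB)
  have h1 := H.P_L (pairLift j hj y)
  rw [proj_pairLift] at h1
  rw [← h1, (normalFrame j hj BB).P_eq (p := 1) (DGMod.L_mem _ (pairLift_mem j hj y))]
  refine Finset.sum_congr rfl fun c _ => ?_
  rw [← normalFrame_vec]
  congr 2
  refine Subtype.ext ?_
  cases c with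
  | inl a => exact lieForm_phiDual_psi BB j hj y a
  | inr a => exact phiDualFun_lieVF_psi BB j hj y a

lemma forms_ext_evalPairs {S T : Forms A F (NormalTensors F n m)}
    (h : ∀ y, mapForms (evalPairs y) S = mapForms (evalPairs y) T) : S = T := by
  ext k v w Z
  have := congrArg (fun a : Functions F => a k v) (h (pairArgs w Z))
  change toPairs (S k v) _ = toPairs (T k v) _ at this
  simpa [toPairs_apply] using this

lemma mapForms_comparisonMap {k : ℤ} (τ : tensorFieldsOfDegree F n m k)
    (y : Fin (n + m) → Module.Dual A (NormalSections F) × NormalSections F) :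
    mapForms (evalPairs y) (comparisonMap j hj τ) = toPairs τ.1 fun i => pairLift j hj (y i) := rfl

lemma lieTensor_mem {k : ℤ} {τ : MultilinearFormsOn F n m} (hτ : τ ∈ tensorFieldsOfDegree F n m k) :
    lieTensor F n m k τ ∈ tensorFieldsOfDegree F n m (k + 1) := by
  have h1 := (isGraded_toPairs (M := oneFormsDGMod F) (M' := vectorFieldsDGMod F) hτ).lie
  rw [lie_toPairs] at h1
  have h2 := ofPairs_mem h1
  rwa [ofPairs_toPairs] at h2

/-- With all arguments of degree zero, a coefficient of degree one only has to pass the map itself,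
whence the sign `(-1)^k`. -/
lemma DGMod.IsGraded.sum_act {Y Ω ι : Type*} [Ring Ω] [Algebra 𝕂 Ω] [AddCommGroup Y]
    [Module 𝕂 Y] {R : DGAlg 𝕂 Ω} {M : DGMod Y R} {N : ℕ} [Fintype ι] {k : ℤ}
    {τ : MultilinearMap 𝕂 (fun _ : Fin N => Y) Ω} (hτ : M.IsGraded τ k) {y : Fin N → Y}
    (hy : ∀ i, y i ∈ M.deg 0) (θ : ι → R.deg 1) {z : ι → Y} (hz : ∀ c, z c ∈ M.deg 0) (i : Fin N) :
    τ (Function.update y i (∑ c, M.act 1 (θ c) (z c))) =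
      k.negOnePow • ∑ c, (θ c).1 * τ (Function.update y i (z c)) := by
  rw [τ.map_update_sum, Finset.smul_sum]
  refine Finset.sum_congr rfl fun c _ => ?_
  have hy' : ∀ l, Function.update y i (z c) l ∈ M.deg 0 := fun l => by
    by_cases hl : l = i
    · subst hl; simpa using hz c
    · simpa [hl] using hy l
  have h := (hτ (fun _ => 0) _ hy').2 1 (θ c) i
  simpa using h

set_option maxHeartbeats 1000000 in
/-- The comparison map is a map of complexes. -/
lemma ceDiff_comparisonMap (FB : FiniteDualBasis A F I)
    (BB : FiniteDualBasis A (NormalSections F) J) {k : ℤ} (τ : tensorFieldsOfDegree F n m k) :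
    ceDiff (normalTensorModule F n m) (comparisonMap j hj τ) =
      comparisonMap j hj ⟨lieTensor F n m k τ.1, lieTensor_mem τ.2⟩ := by
  refine forms_ext_evalPairs fun y => ?_
  have hτ := isGraded_toPairs (M := oneFormsDGMod F) (M' := vectorFieldsDGMod F) τ.2
  rw [mapForms_evalPairs_ceDiff BB, mapForms_comparisonMap, mapForms_comparisonMap]
  change _ = toPairs (lieTensor F n m k τ.1) _
  rw [lieTensor_eq,
    ← lie_toPairs, DGMod.lie_eq _ _ _ (p := fun _ => 0) fun i => pairLift_mem j hj (y i)]
  rw [Finset.smul_sum]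
  congr 1
  refine Finset.sum_congr rfl fun i _ => ?_
  -- The sign `(-1)^k` from pulling the connection forms out of `τ` cancels the one in the Lie
  -- derivative; the signs from preceding arguments are trivial, since lifts have degree zero.
  rw [L_pairLift BB j hj FB, hτ.sum_act (fun i => pairLift_mem j hj (y i)) _
    (fun c => pairLift_mem j hj _)]
  rw [Finset.sum_const_zero, Int.negOnePow_zero, one_smul, smul_smul, Int.units_mul_self, one_smul]
  refine Finset.sum_congr rfl fun c _ => ?_
  refine congrArg (fun a : Functions F => ofDual (connectionForm BB (y i) c) * a) ?_
  rw [mapForms_comparisonMap]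
  exact congrArg (toPairs τ.1) (comp_update (pairLift j hj) y i _)

end LieOfLifts

/-! ### The right inverse of the comparison map -/

section Extension

variable {𝕂 A : Type*} [Field 𝕂] [CharZero 𝕂] [CommRing A] [Algebra 𝕂 A]
  {F : LieRinehartSubalgebra A (Derivation 𝕂 A A)} {n m : ℕ} {k : ℤ}
  {I J : Type*} [Fintype I] [Fintype J]

section

variable (BB : FiniteDualBasis A (NormalSections F) J)
  (j j' : NormalSections F →ₗ[A] Derivation 𝕂 A A) (hj : IsSplitting j) (hj' : IsSplitting j')

/-- The tensor field on `F[1]` given by a form with values in the tensors of `B` and a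
splitting. -/
def extendTensor (s : Forms A F (NormalTensors F n m)) : MultilinearFormsOn F n m :=
  ofPairs ((normalFrame j hj BB).extend fun f =>
    mapForms (evalPairs fun i => (pairBasis BB).vec (f i)) s)

lemma DGMod.Frame.extend_sub {Y Ω ι : Type*} [Ring Ω] [Algebra 𝕂 Ω] [AddCommGroup Y]
    [Module 𝕂 Y] {R : DGAlg 𝕂 Ω} {M : DGMod Y R} {N : ℕ} [Fintype ι] {P : Y →ₗ[𝕂] Y}
    (B : M.Frame P ι) (S T : (Fin N → ι) → Ω) : B.extend (S - T) = B.extend S - B.extend T := by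
  refine MultilinearMap.ext fun y => ?_
  simp only [DGMod.Frame.extend_apply, _root_.sub_apply, Pi.sub_apply, sub_mul,
    Finset.sum_sub_distrib]

lemma extendTensor_sub (s t : Forms A F (NormalTensors F n m)) :
    extendTensor BB j hj (s - t) = extendTensor BB j hj s - extendTensor BB j hj t := by
  unfold extendTensor
  rw [← map_sub, ← DGMod.Frame.extend_sub]
  congr 2

lemma mapForms_mem {E E' : Type*} [AddCommGroup E] [Module A E] [Module 𝕂 E] [IsScalarTower 𝕂 A E]
    [AddCommGroup E'] [Module A E'] [Module 𝕂 E'] [IsScalarTower 𝕂 A E'] (g : E →ₗ[A] E')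
    {a : Forms A F E} (ha : a ∈ formsOfDegree 𝕂 k) : mapForms g a ∈ formsOfDegree 𝕂 k := by
  intro i hi
  ext v
  rw [mapForms_apply, ha i hi]
  simp

lemma extendTensor_mem {s : Forms A F (NormalTensors F n m)} (hs : s ∈ formsOfDegree 𝕂 k) :
    extendTensor BB j hj s ∈ tensorFieldsOfDegree F n m k :=
  ofPairs_mem ((normalFrame j hj BB).extend_isGraded fun _ => mapForms_mem _ hs)

lemma multilinear_expansion {V E ι : Type*} [AddCommGroup V] [Module A V] [AddCommGroup E]
    [Module A E] [Fintype ι] {N : ℕ} (B : FiniteDualBasis A V ι)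
    (T : MultilinearMap A (fun _ : Fin N => V) E) (y : Fin N → V) :
    T y = ∑ f : Fin N → ι, (∏ i, B.coord (f i) (y i)) • T fun i => B.vec (f i) := by
  conv_lhs => rw [show y = fun i => ∑ c, B.coord c (y i) • B.vec c from
    funext fun i => (B.sum_eq (y i)).symm]
  classical
  rw [T.map_sum]
  exact Finset.sum_congr rfl fun f _ => T.map_smul_univ _ _

lemma list_prod_ofFun {N : ℕ} (f : Fin N → A) :
    (List.ofFn fun i => ofFun F (f i)).prod = ofFun F (∏ i, f i) := by
  induction N with
  | zero =>
    ext k v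
    cases k <;> rfl
  | succ N ih =>
    rw [List.ofFn_succ, List.prod_cons, ih, Fin.prod_univ_succ, ← fmul_eq_mul (𝕂 := 𝕂),
      fmul_ofFun_left, ← map_smul, smul_eq_mul]

/-- The lifts by `j'` have their coordinates as coefficients in the frame built from `j`, so the
extension evaluates to the multilinear expansion of `s`. The two splittings need not agree. -/
lemma comparisonMap_extendTensor {s : Forms A F (NormalTensors F n m)}
    (hs : s ∈ formsOfDegree 𝕂 k) :
    comparisonMap j' hj' ⟨extendTensor BB j hj s, extendTensor_mem BB j hj hs⟩ = s := by
  ext l v w Z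
  rw [comparisonMap_apply]
  change (normalFrame j hj BB).extend _ (pairArgs (fun i => phiDual (w i)) fun i => psi j' hj' (Z i))
    l v = _
  have h : pairArgs (fun i => phiDual (w i)) (fun i => psi j' hj' (Z i)) =
      fun i => pairLift j' hj' (pairArgs w Z i) := by
    funext i
    induction i using Fin.addCases with
    | left i =>
      rw [pairArgs_castAdd, pairArgs_castAdd]
      exact Prod.ext rfl (psiHom j' hj').map_zero.symm
    | right i =>
      rw [pairArgs_natAdd, pairArgs_natAdd]
      exact Prod.ext phiDualHom.map_zero.symm rfl
  rw [h, DGMod.Frame.extend_apply]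
  simp only [normalFrame_coeff, list_prod_ofFun]
  rw [forms_sum_apply]
  have h2 := multilinear_expansion (pairBasis BB) (toPairs (s l v)) (pairArgs w Z)
  have h3 : toPairs (s l v) (pairArgs w Z) = s l v w Z := by simp [toPairs_apply]
  rw [← h3, h2]
  refine Finset.sum_congr rfl fun f _ => ?_
  rw [← fmul_eq_mul (𝕂 := 𝕂), fmul_ofFun_right]
  rfl

lemma comparisonMap_add (σ τ : tensorFieldsOfDegree F n m k) :
    comparisonMap j hj (σ + τ) = comparisonMap j hj σ + comparisonMap j hj τ := rfl

lemma comparisonMap_smul (c : 𝕂) (τ : tensorFieldsOfDegree F n m k) :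
    comparisonMap j hj (c • τ) = c • comparisonMap j hj τ := rfl

lemma comparisonMap_mem (τ : tensorFieldsOfDegree F n m k) :
    comparisonMap j hj τ ∈ formsOfDegree 𝕂 k := by
  intro i hi
  ext v w Z
  have h := (τ.2 (fun _ => 0) (fun _ => 0) (fun l => phiDual (w l)) (fun l => psi j hj (Z l))
    (fun l => phiDualFun_mem (w l)) fun l => psiFun_mem j hj (Z l)).1
  rw [Finset.sum_const_zero, Finset.sum_const_zero, add_zero, add_zero] at h
  rw [comparisonMap_apply, h i hi]
  rfl

/-- The comparison map keeps the values on the frame vectors, and by `DGMod.Frame.onSlots_eq` their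
extension is the composition with the projection in all places. -/
lemma extendTensor_comparisonMap (τ : tensorFieldsOfDegree F n m k) :
    extendTensor BB j hj (comparisonMap j hj τ) = ofPairs (DGMod.onSlots
      ((projForm j hj BB).prodMap (projVF j hj BB)) Finset.univ (toPairs τ.1)) := by
  rw [(normalFrame j hj BB).onSlots_eq (isGraded_toPairs τ.2)]
  unfold extendTensor
  congr 2
  funext f
  rw [mapForms_comparisonMap]
  simp only [normalFrame_vec]

/-- The comparison map depends only on the underlying multilinear map. Allowing the degree `l` to
differ from `k` avoids transport along equalities of degrees. -/
lemma comparisonMap_congr {σ τ : tensorFieldsOfDegree F n m k} {l : ℤ}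
    {ρ : tensorFieldsOfDegree F n m l} (h : ρ.1 = σ.1 - τ.1) :
    comparisonMap j hj ρ = comparisonMap j hj σ - comparisonMap j hj τ := by
  refine forms_ext_evalPairs fun y => ?_
  rw [map_sub, mapForms_comparisonMap, mapForms_comparisonMap, mapForms_comparisonMap, h]
  rfl

end

variable (j : NormalSections F →ₗ[A] Derivation 𝕂 A A) (hj : IsSplitting j)

lemma onSlots_lieTensor (FB : FiniteDualBasis A F I) (BB : FiniteDualBasis A (NormalSections F) J)
    (τ : MultilinearFormsOn F n m) :
    lieTensor F n m k (ofPairs (DGMod.onSlots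
      ((projForm j hj BB).prodMap (projVF j hj BB)) Finset.univ (toPairs τ))) =
    ofPairs (DGMod.onSlots ((projForm j hj BB).prodMap (projVF j hj BB)) Finset.univ
      (toPairs (lieTensor F n m k τ))) := by
  have H := (homotopy_oneForms j hj FB BB).prod (homotopy_vectorFields j hj FB BB)
  rw [lieTensor_eq, ← lie_toPairs, ← H.onSlots_lie, ofPairs_lie]

/-- Extensions are unchanged by composition with the projection `P`, since they are recovered from
their images under the comparison map. As that composition commutes with the Lie derivative and the
comparison map with the differentials, so does the extension. -/
lemma lieTensor_extendTensor (FB : FiniteDualBasis A F I)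
    (BB : FiniteDualBasis A (NormalSections F) J)
    {s : Forms A F (NormalTensors F n m)} (hs : s ∈ formsOfDegree 𝕂 k) :
    lieTensor F n m k (extendTensor BB j hj s) =
      extendTensor BB j hj (ceDiff (normalTensorModule F n m) s) := by
  have hm := extendTensor_mem BB j hj hs
  have h1 := extendTensor_comparisonMap BB j hj ⟨_, hm⟩
  rw [comparisonMap_extendTensor BB j j hj hj hs] at h1
  have h2 := extendTensor_comparisonMap BB j hj ⟨_, lieTensor_mem hm⟩
  rw [← ceDiff_comparisonMap j hj FB BB ⟨_, hm⟩, comparisonMap_extendTensor BB j j hj hj hs] at h2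
  refine Eq.trans ?_ h2.symm
  refine (congrArg (lieTensor F n m k) h1).trans ?_
  exact onSlots_lieTensor j hj FB BB _

set_option maxHeartbeats 2000000 in
lemma exists_lieTensor_onSlots (FB : FiniteDualBasis A F I)
    (BB : FiniteDualBasis A (NormalSections F) J)
    {τ : MultilinearFormsOn F n m} (hτ : τ ∈ tensorFieldsOfDegree F n m k)
    (h : lieTensor F n m k τ = 0) :
    ∃ σ ∈ tensorFieldsOfDegree F n m (k - 1), lieTensor F n m (k - 1) σ = τ - ofPairs (DGMod.onSlots
      ((projForm j hj BB).prodMap (projVF j hj BB)) Finset.univ (toPairs τ)) := by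
  have H := (homotopy_oneForms j hj FB BB).prod (homotopy_vectorFields j hj FB BB)
  have hL : ((oneFormsDGMod F).prod (vectorFieldsDGMod F)).lie (n + m) k (toPairs τ) = 0 := by
    rw [lie_toPairs, ← lieTensor_eq, h, map_zero]
  obtain ⟨σ, hσ, h⟩ := H.exists_primitive (s := Finset.univ) (isGraded_toPairs hτ) hL
  refine ⟨ofPairs σ, ofPairs_mem hσ, ?_⟩
  rw [lieTensor_eq, ← ofPairs_lie, h, map_sub, ofPairs_toPairs]

/-- A cocycle is cohomologous to the extension of its image under the comparison map. -/
lemma exists_lieTensor_eq (FB : FiniteDualBasis A F I)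
    (BB : FiniteDualBasis A (NormalSections F) J) (τ : tensorFieldsOfDegree F n m k)
    (h : lieTensor F n m k τ.1 = 0) :
    ∃ σ ∈ tensorFieldsOfDegree F n m (k - 1), lieTensor F n m (k - 1) σ =
      τ.1 - extendTensor BB j hj (comparisonMap j hj τ) := by
  rw [extendTensor_comparisonMap]
  exact exists_lieTensor_onSlots j hj FB BB τ.2 h

end Extension

/-! ### The isomorphism on cohomology and its independence of the splitting -/

section Isomorphism

section Abstract

variable {𝕂 M M' : Type*} [CommRing 𝕂] [AddCommGroup M] [Module 𝕂 M] [AddCommGroup M'] [Module 𝕂 M']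
  {C : ℤ → Submodule 𝕂 M} {d : ℤ → M →ₗ[𝕂] M} {C' : ℤ → Submodule 𝕂 M'} {d' : ℤ → M' →ₗ[𝕂] M'}
  {k : ℤ}

lemma cohomologyClass_eq_iff {x y : cocycles C d k} :
    cohomologyClass C d k x = cohomologyClass C d k y ↔
      ∃ z ∈ C (k - 1), d (k - 1) z = x.1 - y.1 :=
  Submodule.Quotient.eq _

variable (C d C' d') in
/-- A map of complexes, defined on homogeneous elements. -/
structure ChainMap where
  /-- the map in each degree -/
  toFun : ∀ k, C k →ₗ[𝕂] M'
  mem : ∀ {k : ℤ} (x : C k), toFun k x ∈ C' k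
  -- The target degree is a variable `l` with an equation, so that the degrees `k - 1` and `k` can
  -- be used as well as `k` and `k + 1`.
  comm : ∀ {k l : ℤ} (x : C k) (h : d k x.1 ∈ C l), l = k + 1 →
    d' k (toFun k x) = toFun l ⟨d k x.1, h⟩
  congr : ∀ {k l : ℤ} (x y : C k) (z : C l), z.1 = x.1 - y.1 →
    toFun l z = toFun k x - toFun k y

/-- A right inverse of a map of complexes, up to homotopy a left inverse. -/
structure ChainMap.Section (f : ChainMap C d C' d') (e : M' → M) : Prop where
  d_mem : ∀ {k : ℤ} {x : M}, x ∈ C (k - 1) → d (k - 1) x ∈ C k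
  mem : ∀ {k : ℤ} {s : M'}, s ∈ C' k → e s ∈ C k
  sub : ∀ s t, e (s - t) = e s - e t
  comm : ∀ {k : ℤ} {s : M'}, s ∈ C' k → d k (e s) = e (d' k s)
  rightInv : ∀ {k : ℤ} {s : M'} (hs : s ∈ C' k), f.toFun k ⟨e s, mem hs⟩ = s
  homotopy : ∀ {k : ℤ} (x : C k), d k x.1 = 0 →
    ∃ y ∈ C (k - 1), d (k - 1) y = x.1 - e (f.toFun k x)

namespace ChainMap

variable {f f' : ChainMap C d C' d'} {e : M' → M}

lemma mem_cocycles (f : ChainMap C d C' d') (x : cocycles C d k) :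
    f.toFun k ⟨x.1, x.2.1⟩ ∈ cocycles C' d' k := by
  have h0 : d k x.1 = 0 := x.2.2
  have hz : d k x.1 ∈ C (k + 1) := by rw [h0]; exact zero_mem _
  refine ⟨f.mem _, ?_⟩
  change d' k _ = 0
  -- The differential is zero, but as an element of degree `k + 1`; `congr` shows that its image
  -- vanishes by writing it as the difference of two equal elements of degree `k`.
  rw [f.comm ⟨x.1, x.2.1⟩ hz rfl]
  have := f.congr (0 : C k) 0 ⟨d k x.1, hz⟩ (by simpa using h0)
  rw [this, sub_self]

/-- The map induced on cocycles, with values in cohomology. -/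
def onCocycles (f : ChainMap C d C' d') (k : ℤ) : cocycles C d k →ₗ[𝕂] Cohomology C' d' k :=
  cohomologyClass C' d' k ∘ₗ LinearMap.codRestrict (cocycles C' d' k)
    (f.toFun k ∘ₗ Submodule.inclusion inf_le_left) f.mem_cocycles

lemma onCocycles_apply (f : ChainMap C d C' d') (x : cocycles C d k) :
    f.onCocycles k x = cohomologyClass C' d' k ⟨f.toFun k ⟨x.1, x.2.1⟩, f.mem_cocycles x⟩ := rfl

/-- Cohomologous elements have cohomologous images. -/
lemma onCocycles_eq_of_sub (f : ChainMap C d C' d')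
    (d_mem : ∀ {k : ℤ} {x : M}, x ∈ C (k - 1) → d (k - 1) x ∈ C k) {x y : C k} {z : M}
    (hz : z ∈ C (k - 1)) (h : d (k - 1) z = x.1 - y.1) :
    ∃ w ∈ C' (k - 1), d' (k - 1) w = f.toFun k x - f.toFun k y :=
  ⟨f.toFun (k - 1) ⟨z, hz⟩, f.mem _, by
    rw [f.comm ⟨z, hz⟩ (d_mem hz) (by ring)]
    exact f.congr x y _ h⟩

/-- If `f x = d' s`, then `e (f x) = d (e s)`, and `x` differs from `e (f x)` by some `d y`; so `x =
d (y + e s)`. The converse holds for any map of complexes. -/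
lemma Section.onCocycles_eq_zero (S : f.Section e) (x : cocycles C d k) :
    f.onCocycles k x = 0 ↔ cohomologyClass C d k x = 0 := by
  rw [← (cohomologyClass C d k).map_zero, ← (cohomologyClass C' d' k).map_zero, onCocycles_apply,
    cohomologyClass_eq_iff, cohomologyClass_eq_iff]
  constructor
  · rintro ⟨s, hs, h⟩
    rw [ZeroMemClass.coe_zero, sub_zero] at h
    obtain ⟨y, hy, h'⟩ := S.homotopy ⟨x.1, x.2.1⟩ x.2.2
    refine ⟨y + e s, add_mem hy (S.mem hs), ?_⟩
    rw [map_add, h', S.comm hs, h]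
    simp
  · rintro ⟨z, hz, h⟩
    obtain ⟨w, hw, h'⟩ := f.onCocycles_eq_of_sub S.d_mem (x := ⟨x.1, x.2.1⟩) (y := 0) hz h
    exact ⟨w, hw, by rw [h', map_zero]; rfl⟩

/-- The map `e` sends cocycles to cocycles and is a right inverse. -/
lemma Section.onCocycles_surjective (S : f.Section e) : Function.Surjective (f.onCocycles k) := by
  intro x
  obtain ⟨s, rfl⟩ := Submodule.mkQ_surjective _ x
  have h : d' k s.1 = 0 := s.2.2
  have h0 : e 0 = 0 := by simpa using S.sub 0 0
  refine ⟨⟨e s.1, S.mem s.2.1, ?_⟩, ?_⟩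
  · change d k (e s.1) = 0
    rw [S.comm s.2.1, h, h0]
  · exact congrArg (cohomologyClass C' d' k) (Subtype.ext (S.rightInv s.2.1))

/-- The isomorphism induced on cohomology. -/
def Section.iso (S : f.Section e) (k : ℤ) : Cohomology C d k ≃ₗ[𝕂] Cohomology C' d' k :=
  LinearEquiv.ofBijective
    (Submodule.liftQ ((coboundaries C d k).submoduleOf (cocycles C d k)) (f.onCocycles k)
      fun x hx => (S.onCocycles_eq_zero x).mpr ((Submodule.Quotient.mk_eq_zero _).mpr hx))
    ⟨by
      rw [injective_iff_map_eq_zero]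
      intro x
      obtain ⟨x, rfl⟩ := Submodule.mkQ_surjective _ x
      exact (S.onCocycles_eq_zero x).mp, fun y => by
      obtain ⟨x, rfl⟩ := S.onCocycles_surjective y
      exact ⟨cohomologyClass C d k x, rfl⟩⟩

/-- Two maps of complexes with the same section induce the same map on cohomology. -/
lemma Section.onCocycles_eq (S : f.Section e)
    (hf' : ∀ {k : ℤ} {s : M'} (hs : s ∈ C' k), f'.toFun k ⟨e s, S.mem hs⟩ = s)
    (x : cocycles C d k) : f.onCocycles k x = f'.onCocycles k x := by
  -- The cocycle `x` is cohomologous to `e (f x)`, and `f'` sends the latter to `f x`.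
  obtain ⟨y, hy, h⟩ := S.homotopy ⟨x.1, x.2.1⟩ x.2.2
  have hs := f.mem ⟨x.1, x.2.1⟩
  obtain ⟨w, hw, h'⟩ := f'.onCocycles_eq_of_sub S.d_mem (x := ⟨x.1, x.2.1⟩)
    (y := ⟨_, S.mem hs⟩) hy h
  rw [hf' hs] at h'
  exact (cohomologyClass_eq_iff.mpr ⟨w, hw, h'⟩).symm

end ChainMap

end Abstract

variable {𝕂 A : Type*} [Field 𝕂] [CharZero 𝕂] [CommRing A] [Algebra 𝕂 A]
  {F : LieRinehartSubalgebra A (Derivation 𝕂 A A)} {n m : ℕ} {k : ℤ}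
  {I J : Type*} [Fintype I] [Fintype J]
  (FB : FiniteDualBasis A F I) (BB : FiniteDualBasis A (NormalSections F) J)
  (j j' : NormalSections F →ₗ[A] Derivation 𝕂 A A) (hj : IsSplitting j) (hj' : IsSplitting j')

/-- The comparison map as a map of complexes. -/
def comparisonChainMap (n m : ℕ) : ChainMap (tensorFieldsOfDegree F n m) (lieTensor F n m)
    (formsOfDegree (A := A) (V := F) 𝕂) (fun _ => ceDiff (normalTensorModule F n m)) where
  toFun k :=
    { toFun := comparisonMap j hj
      map_add' := comparisonMap_add j hj
      map_smul' := comparisonMap_smul j hj }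
  mem := comparisonMap_mem j hj
  comm {k l} x h hl := by
    subst hl
    exact ceDiff_comparisonMap j hj FB BB x
  congr _ _ _ := comparisonMap_congr j hj

lemma comparisonSection (n m : ℕ) :
    (comparisonChainMap FB BB j hj n m).Section (extendTensor BB j hj) where
  d_mem {k x} h := by
    have := lieTensor_mem h
    rwa [sub_add_cancel] at this
  mem := extendTensor_mem BB j hj
  sub := extendTensor_sub BB j hj
  comm := lieTensor_extendTensor j hj FB BB
  rightInv := comparisonMap_extendTensor BB j j hj hj
  homotopy := exists_lieTensor_eq j hj FB BB

/-- The isomorphisms induced by the comparison map on cohomology. -/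
def comparisonIso : CohomologyIsomorphisms F := fun n m k =>
  (comparisonSection FB BB j hj n m).iso k

/-- The extension built from `j` is a right inverse of the comparison map of any `j'`, so both
comparison maps induce the same map on cohomology. -/
lemma comparisonIso_isInducedBy : IsInducedBy (comparisonIso FB BB j hj) j' hj' := by
  intro n m k τ
  refine ⟨(comparisonChainMap FB BB j' hj' n m).mem_cocycles τ, ?_⟩
  exact (comparisonSection FB BB j hj n m).onCocycles_eq
    (f' := comparisonChainMap FB BB j' hj' n m)
    (fun hs => comparisonMap_extendTensor BB j j' hj hj' hs) τ

end Isomorphism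

/-! ### Finitely many functions whose differentials span, by an immersion argument -/

section Immersion

open Module Set Topology Function

variable {E : Type*} [NormedAddCommGroup E] [NormedSpace ℝ E] [FiniteDimensional ℝ E]
  {M : Type*} [TopologicalSpace M] [ChartedSpace E M] [IsManifold 𝓘(ℝ, E) ∞ M]
  {V W : Type*} [NormedAddCommGroup V] [NormedSpace ℝ V] [NormedAddCommGroup W] [NormedSpace ℝ W]

/-- The derivative of a function in a chart. -/
lemma mfderiv_eq_fderiv_extChartAt (x₀ : M) {g : M → V} {x : M}
    (hx : x ∈ (extChartAt 𝓘(ℝ, E) x₀).source) (hg : MDifferentiableAt 𝓘(ℝ, E) 𝓘(ℝ, V) g x)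
    (v : TangentSpace 𝓘(ℝ, E) x) :
    mfderiv 𝓘(ℝ, E) 𝓘(ℝ, V) g x v =
      fderiv ℝ (g ∘ (extChartAt 𝓘(ℝ, E) x₀).symm) (extChartAt 𝓘(ℝ, E) x₀ x)
        (mfderiv 𝓘(ℝ, E) 𝓘(ℝ, E) (extChartAt 𝓘(ℝ, E) x₀) x v) := by
  have hy : extChartAt 𝓘(ℝ, E) x₀ x ∈ (extChartAt 𝓘(ℝ, E) x₀).target :=
    (extChartAt 𝓘(ℝ, E) x₀).map_source hx
  have hxx : (extChartAt 𝓘(ℝ, E) x₀).symm (extChartAt 𝓘(ℝ, E) x₀ x) = x :=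
    (extChartAt 𝓘(ℝ, E) x₀).left_inv hx
  have hs : MDifferentiableAt 𝓘(ℝ, E) 𝓘(ℝ, E) (extChartAt 𝓘(ℝ, E) x₀).symm
      (extChartAt 𝓘(ℝ, E) x₀ x) := by
    have := mdifferentiableWithinAt_extChartAt_symm (I := 𝓘(ℝ, E)) hy
    rwa [modelWithCornersSelf_coe, range_id, mdifferentiableWithinAt_univ] at this
  have hgs : MDifferentiableAt 𝓘(ℝ, E) 𝓘(ℝ, V) (g ∘ (extChartAt 𝓘(ℝ, E) x₀).symm)
      (extChartAt 𝓘(ℝ, E) x₀ x) := MDifferentiableAt.comp _ (by rwa [hxx]) hs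
  have hc : MDifferentiableAt 𝓘(ℝ, E) 𝓘(ℝ, E) (extChartAt 𝓘(ℝ, E) x₀) x :=
    mdifferentiableAt_extChartAt (by simpa using hx)
  rw [← mfderiv_eq_fderiv]
  have hcomp := mfderiv_comp x hgs hc
  have heq : (g ∘ (extChartAt 𝓘(ℝ, E) x₀).symm) ∘ extChartAt 𝓘(ℝ, E) x₀ =ᶠ[𝓝 x] g := by
    filter_upwards [extChartAt_source_mem_nhds' (I := 𝓘(ℝ, E)) hx] with z hz
    simp only [Function.comp_apply, (extChartAt 𝓘(ℝ, E) x₀).left_inv hz]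
  rw [heq.mfderiv_eq] at hcomp
  rw [hcomp]
  rfl

lemma contDiffOn_comp_extChartAt_symm (x₀ : M) {g : M → V} (hg : ContMDiff 𝓘(ℝ, E) 𝓘(ℝ, V) ∞ g) :
    ContDiffOn ℝ ∞ (g ∘ (extChartAt 𝓘(ℝ, E) x₀).symm) (extChartAt 𝓘(ℝ, E) x₀).target := by
  rw [← contMDiffOn_iff_contDiffOn]
  exact hg.comp_contMDiffOn (contMDiffOn_extChartAt_symm x₀)

/-- The set of all values of the derivative has small Hausdorff dimension. -/
lemma dimH_iUnion_range_mfderiv_le [SigmaCompactSpace M] {g : M → V}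
    (hg : ContMDiff 𝓘(ℝ, E) 𝓘(ℝ, V) ∞ g) :
    dimH (⋃ x : M, {w : V | ∃ v, mfderiv 𝓘(ℝ, E) 𝓘(ℝ, V) g x v = w}) ≤ (2 * finrank ℝ E : ℕ) := by
  obtain ⟨s, hs, hsM⟩ := countable_cover_nhds_of_sigmaCompact
    (f := fun x : M => (extChartAt 𝓘(ℝ, E) x).source)
    fun x => extChartAt_source_mem_nhds (I := 𝓘(ℝ, E)) x
  -- In a chart the tangent bundle is part of `E × E`, and the derivative is a map of class `C^1` on
  -- it; locally Lipschitz maps do not raise the Hausdorff dimension, which gives twice the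
  -- dimension of `E`.
  let D : M → E × E → V := fun x₀ p => fderiv ℝ (g ∘ (extChartAt 𝓘(ℝ, E) x₀).symm) p.1 p.2
  have hsub : (⋃ x : M, {w : V | ∃ v, mfderiv 𝓘(ℝ, E) 𝓘(ℝ, V) g x v = w}) ⊆
      ⋃ x₀ ∈ s, D x₀ '' ((extChartAt 𝓘(ℝ, E) x₀).target ×ˢ univ) := by
    refine iUnion_subset fun x => ?_
    rintro _ ⟨v, rfl⟩
    have hx : x ∈ ⋃ x₀ ∈ s, (extChartAt 𝓘(ℝ, E) x₀).source := hsM ▸ mem_univ x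
    obtain ⟨x₀, hx₀, hx⟩ := mem_iUnion₂.1 hx
    refine mem_iUnion₂.2 ⟨x₀, hx₀, (extChartAt 𝓘(ℝ, E) x₀ x, mfderiv 𝓘(ℝ, E) 𝓘(ℝ, E) (extChartAt 𝓘(ℝ, E) x₀) x v),
      ⟨(extChartAt 𝓘(ℝ, E) x₀).map_source hx, mem_univ _⟩, ?_⟩
    exact (mfderiv_eq_fderiv_extChartAt x₀ hx (hg.mdifferentiable (by simp) x) v).symm
  refine (dimH_mono hsub).trans ?_
  rw [dimH_bUnion hs]
  refine iSup₂_le fun x₀ _ => ?_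
  have ht : IsOpen (extChartAt 𝓘(ℝ, E) x₀).target := isOpen_extChartAt_target x₀
  have hD : ContDiffOn ℝ 1 (D x₀) ((extChartAt 𝓘(ℝ, E) x₀).target ×ˢ univ) := by
    have h1 : ContDiffOn ℝ 1 (fderiv ℝ (g ∘ (extChartAt 𝓘(ℝ, E) x₀).symm))
        (extChartAt 𝓘(ℝ, E) x₀).target :=
      (contDiffOn_comp_extChartAt_symm x₀ hg).fderiv_of_isOpen ht (by norm_cast)
    exact (h1.comp contDiffOn_fst fun p hp => hp.1).clm_apply contDiffOn_snd
  refine (dimH_image_le_of_locally_lipschitzOn fun p hp => ?_).trans ?_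
  · have hp' : ContDiffAt ℝ 1 (D x₀) p := hD.contDiffAt ((ht.prod isOpen_univ).mem_nhds hp)
    obtain ⟨K, t, ht, hK⟩ := hp'.exists_lipschitzOnWith
    exact ⟨K, t, mem_nhdsWithin_of_mem_nhds ht, hK⟩
  · refine (dimH_mono (subset_univ _)).trans ?_
    rw [Real.dimH_univ_eq_finrank, finrank_prod, two_mul]

lemma mfderiv_clm_comp {g : M → V} (hg : ContMDiff 𝓘(ℝ, E) 𝓘(ℝ, V) ∞ g) (L : V →L[ℝ] W) (x : M)
    (v : TangentSpace 𝓘(ℝ, E) x) : mfderiv 𝓘(ℝ, E) 𝓘(ℝ, W) (fun y => L (g y)) x v =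
      L (mfderiv 𝓘(ℝ, E) 𝓘(ℝ, V) g x v) := by
  have h := mfderiv_comp x (L.mdifferentiableAt (x := g x)) (hg.mdifferentiable (by simp) x)
  change mfderiv 𝓘(ℝ, E) 𝓘(ℝ, W) (L ∘ g) x v = _
  rw [h, L.mfderiv_eq]
  rfl

lemma contMDiff_clm_comp {g : M → V} (hg : ContMDiff 𝓘(ℝ, E) 𝓘(ℝ, V) ∞ g) (L : V →L[ℝ] W) :
    ContMDiff 𝓘(ℝ, E) 𝓘(ℝ, W) ∞ fun y => L (g y) :=
  L.contMDiff.comp hg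

/-- In dimension above `2 * dim M` the values of the derivative miss some vector `u`. Projecting
along `u` keeps the derivative injective, because the values form a set closed under scaling, and so
contain no nonzero multiple of `u`. -/
lemma exists_projection_injective_mfderiv [SigmaCompactSpace M] {r : ℕ} {g : M → Fin (r + 1) → ℝ}
    (hg : ContMDiff 𝓘(ℝ, E) 𝓘(ℝ, Fin (r + 1) → ℝ) ∞ g) (hr : 2 * finrank ℝ E ≤ r) {s : Set M}
    (hs : ∀ x ∈ s, Injective (mfderiv 𝓘(ℝ, E) 𝓘(ℝ, Fin (r + 1) → ℝ) g x)) :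
    ∃ L : (Fin (r + 1) → ℝ) →L[ℝ] (Fin r → ℝ),
      ∀ x ∈ s, Injective (mfderiv 𝓘(ℝ, E) 𝓘(ℝ, Fin r → ℝ) (fun y => L (g y)) x) := by
  -- The point `x₁` serves to show `u ≠ 0`, as zero is a value of the derivative there.
  rcases s.eq_empty_or_nonempty with rfl | ⟨x₁, hx₁⟩
  · exact ⟨0, by simp⟩
  have hd : Dense (⋃ x : M, {w | ∃ v, mfderiv 𝓘(ℝ, E) 𝓘(ℝ, Fin (r + 1) → ℝ) g x v = w})ᶜ := by
    refine dense_compl_of_dimH_lt_finrank ((dimH_iUnion_range_mfderiv_le hg).trans_lt ?_)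
    rw [finrank_fin_fun]
    exact_mod_cast Nat.lt_succ_of_le hr
  obtain ⟨u, hu⟩ := hd.nonempty
  simp only [mem_compl_iff, mem_iUnion, mem_ofPred_eq, not_exists] at hu
  have hu0 : u ≠ 0 := fun h => hu x₁ 0 ((map_zero _).trans h.symm)
  have hq : finrank ℝ ((Fin (r + 1) → ℝ) ⧸ (ℝ ∙ u)) = finrank ℝ (Fin r → ℝ) := by
    have := (ℝ ∙ u).finrank_quotient_add_finrank
    rw [finrank_span_singleton hu0, finrank_fin_fun] at this
    rw [finrank_fin_fun]
    omega
  let e := LinearEquiv.ofFinrankEq _ _ hq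
  let L : (Fin (r + 1) → ℝ) →L[ℝ] (Fin r → ℝ) :=
    LinearMap.toContinuousLinearMap (e.toLinearMap ∘ₗ (ℝ ∙ u).mkQ)
  refine ⟨L, fun x hx => (injective_iff_map_eq_zero _).2 fun v hv => ?_⟩
  rw [mfderiv_clm_comp hg] at hv
  obtain ⟨c, hc⟩ := Submodule.mem_span_singleton.1
    ((Submodule.Quotient.mk_eq_zero _).1 (e.map_eq_zero_iff.1 hv))
  by_cases h0 : c = 0
  · rw [h0, zero_smul] at hc
    exact hs x hx (hc.symm.trans (map_zero _).symm)
  -- Here the derivative sends `v` to `c u`, so it would take the excluded value `u` at `c⁻¹ v`.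
  · refine absurd ?_ (hu x (c⁻¹ • v))
    rw [map_smul, ← hc]
    exact inv_smul_smul₀ h0 u

/-- A smooth map that is an immersion on a set can be composed with a linear map to a space of
dimension `2 * dim M` so that it remains an immersion on that set. -/
lemma exists_linear_injective_mfderiv [SigmaCompactSpace M] [FiniteDimensional ℝ V] {g : M → V}
    (hg : ContMDiff 𝓘(ℝ, E) 𝓘(ℝ, V) ∞ g) {s : Set M}
    (hs : ∀ x ∈ s, Injective (mfderiv 𝓘(ℝ, E) 𝓘(ℝ, V) g x)) :
    ∃ L : V →L[ℝ] (Fin (2 * finrank ℝ E) → ℝ), ∀ x ∈ s, Injective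
      (mfderiv 𝓘(ℝ, E) 𝓘(ℝ, Fin (2 * finrank ℝ E) → ℝ) (fun y => L (g y)) x) := by
  have key : ∀ r : ℕ, ∀ L : V →L[ℝ] (Fin (2 * finrank ℝ E + r) → ℝ), (∀ x ∈ s, Injective
      (mfderiv 𝓘(ℝ, E) 𝓘(ℝ, Fin (2 * finrank ℝ E + r) → ℝ) (fun y => L (g y)) x)) →
      ∃ L : V →L[ℝ] (Fin (2 * finrank ℝ E) → ℝ), ∀ x ∈ s, Injective
        (mfderiv 𝓘(ℝ, E) 𝓘(ℝ, Fin (2 * finrank ℝ E) → ℝ) (fun y => L (g y)) x) := by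
    intro r
    induction r with
    | zero => exact fun L hL => ⟨L, hL⟩
    | succ r ih =>
      intro L hL
      obtain ⟨L', hL'⟩ := exists_projection_injective_mfderiv (contMDiff_clm_comp hg L)
        (Nat.le_add_right _ r) hL
      exact ih (L'.comp L) hL'
  -- Enlarging `V` by `2 * dim M` dimensions brings the target to the form `2 * dim M + r`, whatever
  -- the dimension of `V`, so that the descent `key` can start.
  have hq : finrank ℝ (V × (Fin (2 * finrank ℝ E) → ℝ)) =
      finrank ℝ (Fin (2 * finrank ℝ E + finrank ℝ V) → ℝ) := by
    rw [finrank_prod, finrank_fin_fun, finrank_fin_fun, add_comm]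
  let e := LinearEquiv.ofFinrankEq _ _ hq
  refine key (finrank ℝ V) (LinearMap.toContinuousLinearMap (e.toLinearMap ∘ₗ LinearMap.inl ℝ V _))
    fun x hx v w h => ?_
  rw [mfderiv_clm_comp hg, mfderiv_clm_comp hg] at h
  exact hs x hx (congrArg Prod.fst (e.injective h))

/-- On a neighborhood of a compact set there is an immersion into a space of dimension
`2 * dim M`. -/
lemma exists_immersion_on_compact [T2Space M] [SigmaCompactSpace M] {K U : Set M}
    (hK : IsCompact K) (hU : U ∈ 𝓝ˢ K) :
    ∃ g : M → Fin (2 * finrank ℝ E) → ℝ, ContMDiff 𝓘(ℝ, E) 𝓘(ℝ, Fin (2 * finrank ℝ E) → ℝ) ∞ g ∧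
      support g ⊆ U ∧
      ∀ x ∈ K, Injective (mfderiv 𝓘(ℝ, E) 𝓘(ℝ, Fin (2 * finrank ℝ E) → ℝ) g x) := by
  obtain ⟨ι, f, hf⟩ := SmoothBumpCovering.exists_isSubordinate 𝓘(ℝ, E) hK.isClosed
    (U := fun _ => U) fun x hx => mem_nhdsSet_iff_forall.1 hU x hx
  have hfin : Finite ι := by
    refine Set.finite_univ_iff.1 ((f.locallyFinite.finite_nonempty_inter_compact hK).subset ?_)
    exact fun i _ => ⟨f.c i, (f i).c_mem_support, f.c_mem' i⟩
  cases nonempty_fintype ι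
  -- Near each point of `K` one of the bump functions is `1`, and there the corresponding component
  -- of `g` is a chart.
  let g : M → ι → E := fun x i => f i x • extChartAt 𝓘(ℝ, E) (f.c i) x
  have hg : ContMDiff 𝓘(ℝ, E) 𝓘(ℝ, ι → E) ∞ g :=
    contMDiff_pi_space.2 fun i => (f i).contMDiff_smul contMDiffOn_extChartAt
  have hinj : ∀ x ∈ K, Injective (mfderiv 𝓘(ℝ, E) 𝓘(ℝ, ι → E) g x) := fun x hx => by
    refine (injective_iff_map_eq_zero _).2 fun v hv => ?_
    have h1 := mfderiv_clm_comp hg (ContinuousLinearMap.proj (R := ℝ) (φ := fun _ : ι => E)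
      (f.ind x hx)) x v
    rw [hv] at h1
    have heq : (fun y => ContinuousLinearMap.proj (R := ℝ) (φ := fun _ : ι => E)
        (f.ind x hx) (g y)) =ᶠ[𝓝 x] extChartAt 𝓘(ℝ, E) (f.c (f.ind x hx)) := by
      filter_upwards [f.eventuallyEq_one x hx] with y hy
      simp only [ContinuousLinearMap.proj_apply, g]
      rw [hy, Pi.one_apply, one_smul]
    rw [heq.mfderiv_eq] at h1
    exact (isInvertible_mfderiv_extChartAt (f.mem_extChartAt_ind_source x hx)).injective
      (h1.trans (map_zero _).symm)
  obtain ⟨L, hL⟩ := exists_linear_injective_mfderiv hg hinj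
  refine ⟨_, contMDiff_clm_comp hg L, fun x hx => ?_, hL⟩
  by_contra hxU
  refine hx ?_
  have h0 : g x = 0 := by
    funext i
    have : f i x = 0 := by
      by_contra h
      exact hxU (hf i (subset_tsupport _ h))
    change f i x • _ = (0 : E)
    rw [this, zero_smul]
  exact (congrArg L h0).trans (map_zero L)

/-- There are finitely many smooth functions whose differentials span every cotangent space. -/
lemma exists_finite_spanning_differentials [T2Space M] [SigmaCompactSpace M] :
    ∃ (N : ℕ) (f : Fin N → M → ℝ), (∀ i, ContMDiff 𝓘(ℝ, E) 𝓘(ℝ, ℝ) ∞ (f i)) ∧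
      ∀ (x : M) (v : TangentSpace 𝓘(ℝ, E) x),
        (∀ i, mfderiv 𝓘(ℝ, E) 𝓘(ℝ, ℝ) (f i) x v = 0) → v = 0 := by
  have := ChartedSpace.locallyCompactSpace E M
  let S := (CompactExhaustion.choice M).shiftr
  -- Open annuli around the compact pieces `S (n + 1) \ interior (S n)`. The exhaustion is shifted
  -- so that `S 0` is empty, which makes the truncated `n - 1` at `n = 0` harmless.
  let U : ℕ → Set M := fun n => interior (S (n + 2)) \ S (n - 1)
  have hU : ∀ n, IsOpen (U n) := fun n => isOpen_interior.sdiff (S.isCompact _).isClosed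
  have hA : ∀ n, S (n + 1) \ interior (S n) ⊆ U n := fun n x hx => by
    refine ⟨S.subset_interior (Nat.lt_succ_self _) hx.1, fun h => hx.2 ?_⟩
    cases n with
    | zero => exact absurd h (notMem_empty x)
    | succ n => exact S.subset_interior_succ n h
  have hdis : ∀ n m x, n + 3 ≤ m → x ∈ U n → x ∉ U m := fun n m x hnm hx hx' =>
    hx'.2 (S.subset (by omega) (interior_subset hx.1))
  choose g hg hgU hgi using fun n => exists_immersion_on_compact (E := E) (M := M)
    (K := S (n + 1) \ interior (S n)) (U := U n)
    ((S.isCompact _).diff isOpen_interior) ((hU n).mem_nhdsSet.2 (hA n))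
  -- Annuli whose indices differ by at least three are disjoint. So the immersions can be added up
  -- along each residue class modulo three without interference, and three maps suffice.
  let G : Fin 3 → M → Fin (2 * finrank ℝ E) → ℝ := fun r x => ∑ᶠ k : ℕ, g (3 * k + r) x
  have hG : ∀ r, ContMDiff 𝓘(ℝ, E) 𝓘(ℝ, Fin (2 * finrank ℝ E) → ℝ) ∞ (G r) := fun r => by
    refine contMDiff_finsum (fun k => hg _) fun x => ?_
    obtain ⟨p, hp⟩ := S.exists_mem_nhds x
    refine ⟨S p, hp, (finite_le_nat p).subset ?_⟩
    rintro k ⟨y, hy, hy'⟩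
    by_contra hk
    exact (hgU _ hy).2 (S.subset (by simp at hk; omega) hy')
  have hGx : ∀ (k : ℕ) (r : Fin 3), ∀ x ∈ U (3 * k + r), G r x = g (3 * k + r) x :=
    fun k r x hx => finsum_eq_single _ k fun l hl => by
      by_contra h
      have hx' := hgU _ h
      rcases Nat.lt_or_gt_of_ne hl with hl | hl
      · exact hdis (3 * l + r) (3 * k + r) x (by omega) hx' hx
      · exact hdis (3 * k + r) (3 * l + r) x (by omega) hx hx'
  let e := Fintype.equivFin (Fin 3 × Fin (2 * finrank ℝ E))
  refine ⟨_, fun i x => G (e.symm i).1 x (e.symm i).2,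
    fun i => contMDiff_pi_space.1 (hG _) _, fun x v hv => ?_⟩
  obtain ⟨n, hn⟩ : ∃ n, x ∈ S (n + 1) \ interior (S n) :=
    ⟨_, (CompactExhaustion.choice M).mem_sdiff_shiftr_find x |>.1,
      fun h => ((CompactExhaustion.choice M).mem_sdiff_shiftr_find x).2 (interior_subset h)⟩
  obtain ⟨k, r, rfl⟩ : ∃ (k : ℕ) (r : Fin 3), n = 3 * k + r :=
    ⟨n / 3, ⟨n % 3, Nat.mod_lt _ (by norm_num)⟩, (Nat.div_add_mod n 3).symm⟩
  have heq : G r =ᶠ[𝓝 x] g (3 * k + r) :=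
    Filter.eventually_of_mem ((hU _).mem_nhds (hA _ hn)) (hGx k r)
  have h0 : mfderiv 𝓘(ℝ, E) 𝓘(ℝ, Fin (2 * finrank ℝ E) → ℝ) (G r) x v = 0 := by
    funext i
    have h1 := hv (e (r, i))
    have hfun : (fun y => G (e.symm (e (r, i))).1 y (e.symm (e (r, i))).2) = fun y => G r y i := by
      rw [e.symm_apply_apply]
    beta_reduce at h1
    rw [hfun] at h1
    have h2 := mfderiv_clm_comp (hG r) (ContinuousLinearMap.proj (R := ℝ)
      (φ := fun _ : Fin (2 * finrank ℝ E) => ℝ) i) x v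
    exact h2.symm.trans h1
  rw [heq.mfderiv_eq] at h0
  exact hgi _ x hn (h0.trans (map_zero _).symm)

end Immersion

/-! ### Integrals with parameters and Hadamard's lemma -/

section ParametricIntegral

open MeasureTheory intervalIntegral Set Topology

variable {E : Type*} [NormedAddCommGroup E] [NormedSpace ℝ E] [FiniteDimensional ℝ E]
  {G : Type*} [NormedAddCommGroup G] [NormedSpace ℝ G]

/-- Differentiation under the integral sign; the dominating constant is a bound of the derivative on
the compact set `closedBall x 1 ×ˢ Icc 0 1`. -/
lemma hasFDerivAt_intervalIntegral_of_contDiff {ψ : E × ℝ → G} (hψ : ContDiff ℝ ∞ ψ) (x : E) :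
    HasFDerivAt (fun y => ∫ t in (0 : ℝ)..1, ψ (y, t))
      (∫ t in (0 : ℝ)..1, (fderiv ℝ ψ (x, t)).comp (ContinuousLinearMap.inl ℝ E ℝ)) x := by
  have hc : Continuous fun p : E × ℝ => (fderiv ℝ ψ p).comp (ContinuousLinearMap.inl ℝ E ℝ) :=
    (hψ.continuous_fderiv (by simp)).clm_comp continuous_const
  obtain ⟨C, hC⟩ := ((isCompact_closedBall x 1).prod
    (isCompact_Icc (a := (0 : ℝ)) (b := 1))).exists_bound_of_continuousOn hc.continuousOn
  refine hasFDerivAt_integral_of_dominated_of_fderiv_le (𝕜 := ℝ)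
    (F' := fun y t => (fderiv ℝ ψ (y, t)).comp (ContinuousLinearMap.inl ℝ E ℝ))
    (bound := fun _ => C) (Metric.closedBall_mem_nhds x one_pos) ?_ ?_ ?_ ?_ ?_ ?_
  · exact Filter.Eventually.of_forall fun y =>
      (hψ.continuous.comp (Continuous.prodMk_right y)).aestronglyMeasurable
  · exact (hψ.continuous.comp (Continuous.prodMk_right x)).intervalIntegrable _ _
  · exact (hc.comp (Continuous.prodMk_right x)).aestronglyMeasurable
  · refine Filter.Eventually.of_forall fun t ht y hy => hC (y, t) ⟨hy, ?_⟩
    rw [uIoc_of_le zero_le_one] at ht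
    exact ⟨ht.1.le, ht.2⟩
  · exact _root_.intervalIntegrable_const
  · refine Filter.Eventually.of_forall fun t _ y _ => ?_
    have h1 := (hψ.differentiable (by simp) (y, t)).hasFDerivAt
    exact h1.comp y (hasFDerivAt_prodMk_left y t)

/-- An integral of a smooth function over an interval depends smoothly on parameters. -/
lemma contDiff_intervalIntegral {ψ : E × ℝ → G} (hψ : ContDiff ℝ ∞ ψ) :
    ContDiff ℝ ∞ fun y => ∫ t in (0 : ℝ)..1, ψ (y, t) := by
  refine contDiff_infty.2 fun n => ?_
  induction n generalizing ψ with
  | zero =>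
    exact contDiff_zero.2 (continuous_iff_continuousAt.2 fun x =>
      (hasFDerivAt_intervalIntegral_of_contDiff hψ x).continuousAt)
  | succ n ih =>
    push_cast
    refine contDiff_succ_iff_fderiv_apply.2 ⟨fun x =>
      (hasFDerivAt_intervalIntegral_of_contDiff hψ x).differentiableAt, by simp, fun e => ?_⟩
    -- The derivative in a direction `e` is an integral of the same kind, to which the induction
    -- hypothesis applies.
    have he : ContDiff ℝ ∞ fun p : E × ℝ => fderiv ℝ ψ p (e, 0) :=
      (hψ.fderiv_right (by simp)).clm_apply contDiff_const
    convert! ih he using 2 with x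
    rw [(hasFDerivAt_intervalIntegral_of_contDiff hψ x).fderiv,
      ContinuousLinearMap.intervalIntegral_apply]
    · rfl
    · exact (((hψ.continuous_fderiv (by simp)).comp (Continuous.prodMk_right x)).clm_comp
        continuous_const).intervalIntegrable _ _

/-- Hadamard's lemma. -/
lemma exists_hadamard {ι : Type*} [Fintype ι] (b : Module.Basis ι ℝ E) [CompleteSpace G] {f : E → G}
    (hf : ContDiff ℝ ∞ f) (x : E) :
    ∃ h : ι → E → G, (∀ i, ContDiff ℝ ∞ (h i)) ∧ (∀ i, h i x = fderiv ℝ f x (b i)) ∧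
      ∀ y, f y = f x + ∑ i, b.repr (y - x) i • h i y := by
  have hsm : ∀ i, ContDiff ℝ ∞ fun p : E × ℝ => fderiv ℝ f (x + p.2 • (p.1 - x)) (b i) := fun i =>
    ((hf.fderiv_right (by simp)).comp (by fun_prop)).clm_apply contDiff_const
  -- The coefficients are the averages of the partial derivatives along the segment from `x` to `y`;
  -- the expansion is the fundamental theorem of calculus on that segment.
  refine ⟨fun i y => ∫ t in (0 : ℝ)..1, fderiv ℝ f (x + t • (y - x)) (b i),
    fun i => contDiff_intervalIntegral (hsm i), fun i => by simp, fun y => ?_⟩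
  have hder : ∀ t : ℝ, HasDerivAt (fun t : ℝ => f (x + t • (y - x)))
      (fderiv ℝ f (x + t • (y - x)) (y - x)) t := fun t => by
    have h1 := (hf.differentiable (by simp) (x + t • (y - x))).hasFDerivAt
    have h2 : HasDerivAt (fun t : ℝ => x + t • (y - x)) (y - x) t := by
      simpa using ((hasDerivAt_id t).smul_const (y - x)).const_add x
    exact h1.comp_hasDerivAt t h2
  have hcont : ∀ v : E, Continuous fun t : ℝ => fderiv ℝ f (x + t • (y - x)) v := fun v =>
    ((hf.continuous_fderiv (by simp)).comp (by fun_prop)).clm_apply continuous_const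
  have hint := integral_eq_sub_of_hasDerivAt (a := 0) (b := 1) (fun t _ => hder t)
    ((hcont _).intervalIntegrable _ _)
  have hsum : ∀ t : ℝ, fderiv ℝ f (x + t • (y - x)) (y - x) =
      ∑ i, b.repr (y - x) i • fderiv ℝ f (x + t • (y - x)) (b i) := fun t => by
    have h := congrArg (fderiv ℝ f (x + t • (y - x))) (b.sum_repr (y - x))
    rw [map_sum] at h
    simpa only [map_smul] using h.symm
  simp only [hsum] at hint
  rw [integral_finsetSum (f := fun i t => b.repr (y - x) i • fderiv ℝ f (x + t • (y - x)) (b i))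
    fun i _ => ((hcont _).const_smul _).intervalIntegrable _ _] at hint
  simp only [intervalIntegral.integral_smul] at hint
  beta_reduce
  rw [hint]
  simp

end ParametricIntegral

/-! ### Derivations of the smooth functions are tangent vectors at each point -/

section Values

open Set Topology
open scoped TensorProduct

variable {𝕂 : Type*} [RCLike 𝕂] {E : Type*} [NormedAddCommGroup E] [NormedSpace ℝ E]
  {M : Type*} [TopologicalSpace M] [ChartedSpace E M]

variable (𝕂 E) in
/-- Evaluation of smooth functions at a point. -/
def evalAt (x : M) : SmoothFunctions 𝕂 E M →ₐ[𝕂] 𝕂 :=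
  (Pi.evalAlgHom 𝕂 (fun _ : M => 𝕂) x).comp (smoothSubalgebra 𝕂 E M).val

@[simp] lemma evalAt_apply (x : M) (f : SmoothFunctions 𝕂 E M) : evalAt 𝕂 E x f = f x := rfl

lemma smoothFunctions_ext {f g : SmoothFunctions 𝕂 E M} (h : ∀ x, f x = g x) : f = g :=
  Subtype.ext (funext h)

lemma SmoothFunctions.mdifferentiableAt (f : SmoothFunctions 𝕂 E M) (x : M) :
    MDifferentiableAt 𝓘(ℝ, E) 𝓘(ℝ, 𝕂) f x :=
  ContMDiff.mdifferentiable f.2 (by simp) x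

variable (E) in
/-- The differential of a scalar function. -/
def differential (f : M → 𝕂) (x : M) : TangentSpace 𝓘(ℝ, E) x →L[ℝ] 𝕂 :=
  mfderiv 𝓘(ℝ, E) 𝓘(ℝ, 𝕂) f x

lemma dirDeriv_tmul (f : M → 𝕂) (x : M) (c : 𝕂) (v : TangentSpace 𝓘(ℝ, E) x) :
    dirDeriv 𝕂 E f x (c ⊗ₜ v) = c * differential E f x v :=
  LinearMap.liftBaseChange_tmul 𝕂 (differential E f x).toLinearMap c v

lemma contMDiff_bump_smul [FiniteDimensional ℝ E] [IsManifold 𝓘(ℝ, E) ∞ M] [T2Space M] {x₀ : M}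
    (χ : SmoothBumpFunction 𝓘(ℝ, E) x₀) {G : Type*} [NormedAddCommGroup G] [NormedSpace ℝ G]
    {h : E → G} (hh : ContDiffOn ℝ ∞ h (extChartAt 𝓘(ℝ, E) x₀).target) :
    ContMDiff 𝓘(ℝ, E) 𝓘(ℝ, G) ∞ fun x => χ x • h (extChartAt 𝓘(ℝ, E) x₀ x) := by
  refine χ.contMDiff_smul ?_
  refine (contMDiffOn_iff_contDiffOn.2 hh).comp contMDiffOn_extChartAt fun x hx => ?_
  exact (extChartAt 𝓘(ℝ, E) x₀).map_source (by simpa using hx)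

lemma bump_eq {E : Type*} [NormedAddCommGroup E] [NormedSpace ℝ E]
    {M : Type*} [TopologicalSpace M] [ChartedSpace E M] [FiniteDimensional ℝ E] {x₀ : M}
    (χ : SmoothBumpFunction 𝓘(ℝ, E) x₀) {x : M} (hx : x ∈ (extChartAt 𝓘(ℝ, E) x₀).source) :
    χ x = χ.toContDiffBump (extChartAt 𝓘(ℝ, E) x₀ x) :=
  χ.eqOn_source (by simpa using hx)

lemma bump_eq_zero [FiniteDimensional ℝ E] {x₀ : M} (χ : SmoothBumpFunction 𝓘(ℝ, E) x₀) {x : M}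
    (hx : x ∉ (extChartAt 𝓘(ℝ, E) x₀).source) : χ x = 0 := by
  by_contra h
  exact hx (by simpa using χ.support_subset_source h)

variable [FiniteDimensional ℝ E] [IsManifold 𝓘(ℝ, E) ∞ M]

/-- The support of the bump function lies in the target of the chart, so the product extends by zero
to all of `E`; this makes it accessible to Hadamard's lemma. -/
lemma contDiff_bump_smul {x₀ : M} (χ : SmoothBumpFunction 𝓘(ℝ, E) x₀) {G : Type*}
    [NormedAddCommGroup G] [NormedSpace ℝ G] {h : E → G}
    (hh : ContDiffOn ℝ ∞ h (extChartAt 𝓘(ℝ, E) x₀).target) :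
    ContDiff ℝ ∞ fun y => χ.toContDiffBump y • h y := by
  refine contDiff_iff_contDiffAt.2 fun y => ?_
  by_cases hy : y ∈ tsupport χ.toContDiffBump
  · rw [χ.toContDiffBump.tsupport_eq] at hy
    have hy' : y ∈ (extChartAt 𝓘(ℝ, E) x₀).target := χ.closedBall_subset ⟨hy, by simp⟩
    exact χ.toContDiffBump.contDiffAt.smul
      (hh.contDiffAt ((isOpen_extChartAt_target x₀).mem_nhds hy'))
  · refine (contDiffAt_const (c := (0 : G))).congr_of_eventuallyEq ?_
    filter_upwards [(isClosed_tsupport _).isOpen_compl.mem_nhds hy] with z hz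
    rw [image_eq_zero_of_notMem_tsupport hz, zero_smul]

variable [T2Space M]

/-- Hadamard's lemma, multiplied by bump functions to become an identity of functions on `M`,
determines the value of `X g` at `x₀` from `g` and its first derivatives there. The coefficient `a`
accounts for the derivatives of the bump functions and is seen to vanish in `exists_hasValue`. -/
lemma exists_apply_eq_sum {ι : Type*} [Fintype ι] (b : Module.Basis ι ℝ E)
    (X : VectorFieldsOn 𝕂 E M) (x₀ : M) : ∃ (a : 𝕂) (c : ι → 𝕂), ∀ g : SmoothFunctions 𝕂 E M,
      X g x₀ = a * g x₀ + ∑ i, c i *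
        fderiv ℝ (g ∘ (extChartAt 𝓘(ℝ, E) x₀).symm) (extChartAt 𝓘(ℝ, E) x₀ x₀) (b i) := by
  obtain ⟨χ⟩ : Nonempty (SmoothBumpFunction 𝓘(ℝ, E) x₀) := inferInstance
  have hx₀ := mem_extChartAt_source (I := 𝓘(ℝ, E)) x₀
  let mk : (h : E → 𝕂) → ContDiffOn ℝ ∞ h (extChartAt 𝓘(ℝ, E) x₀).target → SmoothFunctions 𝕂 E M :=
    fun h hh => ⟨_, contMDiff_bump_smul χ hh⟩
  let χ' := mk (fun _ => 1) contDiffOn_const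
  let φ : ι → SmoothFunctions 𝕂 E M := fun i =>
    mk (fun y => RCLike.ofRealCLM (b.equivFunL (y - extChartAt 𝓘(ℝ, E) x₀ x₀) i)) (by fun_prop)
  refine ⟨- X χ' x₀, fun i => X (φ i) x₀, fun g => ?_⟩
  have hg : ContDiffOn ℝ ∞ (g ∘ (extChartAt 𝓘(ℝ, E) x₀).symm) (extChartAt 𝓘(ℝ, E) x₀).target :=
    contDiffOn_comp_extChartAt_symm x₀ g.2
  obtain ⟨h, hh, hh0, hsum⟩ := exists_hadamard b (contDiff_bump_smul χ hg)
    (extChartAt 𝓘(ℝ, E) x₀ x₀)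
  let η : ι → SmoothFunctions 𝕂 E M := fun i => mk (h i) (hh i).contDiffOn
  have hχ : ∀ x, χ' x = (χ x : 𝕂) := fun x => by
    change χ x • (1 : 𝕂) = _
    rw [RCLike.real_smul_eq_coe_mul, mul_one]
  -- One factor `χ'` makes `g` in the chart global on `E`; the other two make the coordinates and
  -- the Hadamard coefficients into functions on `M`. Applying `X` at `x₀`, where `χ'` is `1` and
  -- the coordinates vanish, leaves `a = - X χ'`.
  have key : χ' * χ' * χ' * g = algebraMap 𝕂 _ (g x₀) * (χ' * χ') + ∑ i, φ i * η i := by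
    refine smoothFunctions_ext fun x => ?_
    rw [← evalAt_apply, ← evalAt_apply]
    simp only [map_add, map_mul, map_sum, AlgHom.commutes, evalAt_apply]
    by_cases hx : x ∈ (extChartAt 𝓘(ℝ, E) x₀).source
    · have h1 := hsum (extChartAt 𝓘(ℝ, E) x₀ x)
      rw [Function.comp_apply, Function.comp_apply, (extChartAt 𝓘(ℝ, E) x₀).left_inv hx,
        (extChartAt 𝓘(ℝ, E) x₀).left_inv hx₀, ← bump_eq χ hx, ← bump_eq χ hx₀, χ.eq_one,
        one_smul, RCLike.real_smul_eq_coe_mul] at h1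
      have h2 : ∀ i, φ i x * η i x = (χ x : 𝕂) * χ x * (b.repr (extChartAt 𝓘(ℝ, E) x₀ x -
          extChartAt 𝓘(ℝ, E) x₀ x₀) i • h i (extChartAt 𝓘(ℝ, E) x₀ x)) := fun i => by
        change (χ x • ((b.repr (extChartAt 𝓘(ℝ, E) x₀ x - extChartAt 𝓘(ℝ, E) x₀ x₀) i : ℝ) : 𝕂)) *
          (χ x • h i (extChartAt 𝓘(ℝ, E) x₀ x)) = _
        simp only [RCLike.real_smul_eq_coe_mul]
        ring
      simp only [h2, hχ, ← Finset.mul_sum]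
      linear_combination ((χ x : 𝕂) * χ x) * h1
    · have h0 : χ x = 0 := bump_eq_zero χ hx
      have h1 : ∀ i, φ i x = 0 := fun i => by
        change χ x • _ = (0 : 𝕂)
        rw [h0, zero_smul]
      simp [hχ, h0, h1]
  have hφ0 : ∀ i, φ i x₀ = 0 := fun i => by
    change χ x₀ • ((b.repr (extChartAt 𝓘(ℝ, E) x₀ x₀ - extChartAt 𝓘(ℝ, E) x₀ x₀) i : ℝ) : 𝕂) = 0
    simp
  have hη0 : ∀ i, η i x₀ = fderiv ℝ (g ∘ (extChartAt 𝓘(ℝ, E) x₀).symm)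
      (extChartAt 𝓘(ℝ, E) x₀ x₀) (b i) := fun i => by
    change χ x₀ • h i (extChartAt 𝓘(ℝ, E) x₀ x₀) = _
    rw [χ.eq_one, one_smul, hh0]
    refine congrArg (fun L : E →L[ℝ] 𝕂 => L (b i)) (Filter.EventuallyEq.fderiv_eq ?_)
    filter_upwards [χ.toContDiffBump.eventuallyEq_one] with y hy
    rw [hy, Pi.one_apply, one_smul]
  have key' := congrArg (fun f => evalAt 𝕂 E x₀ (X f)) key
  simp only [Derivation.leibniz, map_add, map_sum, smul_eq_mul, map_mul, Derivation.map_algebraMap,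
    mul_zero, add_zero, AlgHom.commutes, evalAt_apply, hφ0, hη0, hχ, χ.eq_one, RCLike.ofReal_one,
    Algebra.algebraMap_self, RingHom.id_apply, zero_mul, zero_add, one_mul] at key'
  simp only [mul_comm (X _ x₀)]
  linear_combination key'

/-- Every derivation of the smooth functions has a value at every point. -/
lemma exists_hasValue (X : VectorFieldsOn 𝕂 E M) (x : M) : ∃ v, HasValue X x v := by
  obtain ⟨a, c, h⟩ := exists_apply_eq_sum (Module.finBasis ℝ E) X x
  -- Take the constant function `1`, which every derivation kills.
  have ha : a = 0 := by
    have h1 := h 1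
    have h2 : X 1 x = 0 := by rw [X.map_one_eq_zero]; rfl
    have h3 : ∀ i, fderiv ℝ ((1 : SmoothFunctions 𝕂 E M) ∘ (extChartAt 𝓘(ℝ, E) x).symm)
        (extChartAt 𝓘(ℝ, E) x x) (Module.finBasis ℝ E i) = 0 := fun i => by
      change fderiv ℝ (fun _ => (1 : 𝕂)) _ _ = 0
      simp
    have h4 : (1 : SmoothFunctions 𝕂 E M) x = 1 := rfl
    simp only [h2, h3, h4, mul_zero, Finset.sum_const_zero, add_zero, mul_one] at h1
    exact h1.symm
  have hinv := isInvertible_mfderiv_extChartAt (I := 𝓘(ℝ, E)) (mem_extChartAt_source (I := 𝓘(ℝ, E)) x)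
  choose w hw using fun i => hinv.surjective (Module.finBasis ℝ E i)
  refine ⟨∑ i, c i ⊗ₜ w i, fun f => ?_⟩
  rw [h f, ha, zero_mul, zero_add, map_sum]
  refine Finset.sum_congr rfl fun i _ => ?_
  rw [dirDeriv_tmul]
  refine congrArg (c i * ·) ?_
  refine Eq.trans ?_ (mfderiv_eq_fderiv_extChartAt x (mem_extChartAt_source x)
    (f.mdifferentiableAt x) (w i)).symm
  rw [hw]

end Values

/-! ### Orthogonal projection by Gram matrices -/

section GramProjection

open scoped ComplexConjugate ComplexOrder

variable {𝕂 : Type*} [RCLike 𝕂] {V : Type*} [AddCommGroup V] [Module 𝕂 V]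
  {K R : Type*} [Fintype K] [DecidableEq K] [Fintype R] [DecidableEq R]

/-- The vector `w` of `W` is the preimage under the functionals `ℓ` of the orthogonal projection of the
basis vector `i` to the image of `W`. -/
def IsGramProjection (W : Submodule 𝕂 V) (ℓ : K → V →ₗ[𝕂] 𝕂) (i : K) (w : V) : Prop :=
  w ∈ W ∧ ∀ u ∈ W, ∑ k, conj (ℓ k u) * (ℓ k w - (Pi.single i 1 : K → 𝕂) k) = 0

variable {W : Submodule 𝕂 V} {ℓ : K → V →ₗ[𝕂] 𝕂}

/-- The sum is that of the squared absolute values of the `ℓ k v`. -/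
lemma eq_zero_of_sum_conj_mul (hℓ : ∀ v, (∀ k, ℓ k v = 0) → v = 0) {v : V}
    (h : ∑ k, conj (ℓ k v) * ℓ k v = 0) : v = 0 := by
  refine hℓ v fun k => ?_
  simp only [RCLike.conj_mul] at h
  norm_cast at h
  have := (Finset.sum_eq_zero_iff_of_nonneg (fun _ _ => by positivity)).1 h k (Finset.mem_univ k)
  simpa using this

/-- The difference of two such vectors lies in `W` and its image is orthogonal to the image of `W`,
in particular to itself. -/
lemma IsGramProjection.unique (hℓ : ∀ v, (∀ k, ℓ k v = 0) → v = 0) {i : K} {w w' : V}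
    (h : IsGramProjection W ℓ i w) (h' : IsGramProjection W ℓ i w') : w = w' := by
  refine sub_eq_zero.1 (eq_zero_of_sum_conj_mul hℓ ?_)
  have hu := W.sub_mem h.1 h'.1
  have h1 := congrArg₂ (· - ·) (h.2 _ hu) (h'.2 _ hu)
  simp only [← Finset.sum_sub_distrib, sub_zero] at h1
  rw [← h1]
  refine Finset.sum_congr rfl fun k _ => ?_
  rw [map_sub (ℓ k) w w']
  ring

/-- The image of `u` is `∑ ℓ i u` times the basis vectors and is fixed by the orthogonal projection.
In the proof the difference `z` is in `W` while its image is a combination of vectors orthogonal to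
the image of `W`, so it is zero. -/
lemma IsGramProjection.sum_smul (hℓ : ∀ v, (∀ k, ℓ k v = 0) → v = 0) {w : K → V}
    (h : ∀ i, IsGramProjection W ℓ i (w i)) {u : V} (hu : u ∈ W) : ∑ i, ℓ i u • w i = u := by
  refine sub_eq_zero.1 (eq_zero_of_sum_conj_mul hℓ ?_)
  have hz : ∑ i, ℓ i u • w i - u ∈ W :=
    W.sub_mem (W.sum_mem fun i _ => W.smul_mem _ (h i).1) hu
  generalize hz' : ∑ i, ℓ i u • w i - u = z at hz
  have h1 : ∀ k, ℓ k z = ∑ i, ℓ i u * (ℓ k (w i) - (Pi.single i 1 : K → 𝕂) k) := fun k => by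
    simp [← hz', mul_sub, Pi.single_apply]
  conv_lhs => enter [2, k, 2]; rw [h1]
  simp only [Finset.mul_sum]
  rw [Finset.sum_comm]
  refine Finset.sum_eq_zero fun i _ => ?_
  rw [← mul_zero (ℓ i u), ← (h i).2 z hz, Finset.mul_sum]
  exact Finset.sum_congr rfl fun k _ => by ring

/-- The values of the functionals on a basis. -/
def frameMatrix (ℓ : K → V →ₗ[𝕂] 𝕂) (b : R → V) : Matrix K R 𝕂 := Matrix.of fun k a => ℓ k (b a)

open Matrix

/-- The functionals are jointly injective, so the columns of the matrix are independent and the Gram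
matrix has trivial kernel. -/
lemma det_frameMatrix_ne_zero (hℓ : ∀ v, (∀ k, ℓ k v = 0) → v = 0) {b : R → V}
    (hb : LinearIndependent 𝕂 b) : ((frameMatrix ℓ b)ᴴ * frameMatrix ℓ b).det ≠ 0 := by
  intro h
  obtain ⟨c, hc, h0⟩ := Matrix.exists_mulVec_eq_zero_iff.2 h
  rw [Matrix.conjTranspose_mul_self_mulVec_eq_zero] at h0
  have h1 : ∑ a, c a • b a = 0 := hℓ _ fun k => by
    have := congrFun h0 k
    simpa [Matrix.mulVec, dotProduct, frameMatrix, mul_comm] using this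
  exact hc (funext (Fintype.linearIndependent_iff.1 hb c h1))

/-- The usual formula `(Bᴴ B)⁻¹ Bᴴ`. The inverse is written as adjugate over determinant, from which
the smooth dependence on a point is visible. -/
lemma isGramProjection_of_basis (hℓ : ∀ v, (∀ k, ℓ k v = 0) → v = 0) (b : Module.Basis R 𝕂 W)
    (i : K) : IsGramProjection W ℓ i
      (∑ a, (((frameMatrix ℓ fun a => (b a : V))ᴴ * frameMatrix ℓ fun a => (b a : V)).det⁻¹ *
        (((frameMatrix ℓ fun a => (b a : V))ᴴ * frameMatrix ℓ fun a => (b a : V)).adjugate *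
          (frameMatrix ℓ fun a => (b a : V))ᴴ) a i) • (b a : V)) := by
  have hdet := det_frameMatrix_ne_zero hℓ (b.linearIndependent.map' W.subtype W.ker_subtype)
  change ((frameMatrix ℓ fun a => (b a : V))ᴴ * frameMatrix ℓ fun a => (b a : V)).det ≠ 0 at hdet
  set B := frameMatrix ℓ fun a => (b a : V) with hB
  refine ⟨W.sum_mem fun a _ => W.smul_mem _ (b a).2, ?_⟩
  have hval : ∀ k, ℓ k (∑ a, ((Bᴴ * B).det⁻¹ * ((Bᴴ * B).adjugate * Bᴴ) a i) • (b a : V)) =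
      (Bᴴ * B).det⁻¹ * (B * ((Bᴴ * B).adjugate * Bᴴ)) k i := fun k => by
    rw [map_sum, Matrix.mul_apply, Finset.mul_sum]
    refine Finset.sum_congr rfl fun a _ => ?_
    rw [map_smul, smul_eq_mul, hB, frameMatrix, Matrix.of_apply]
    ring
  have hbas : ∀ a, ∑ k, conj (ℓ k (b a)) * ((Bᴴ * B).det⁻¹ * (B * ((Bᴴ * B).adjugate * Bᴴ)) k i -
      (Pi.single i 1 : K → 𝕂) k) = 0 := fun a => by
    have h1 : Bᴴ * (B * ((Bᴴ * B).adjugate * Bᴴ)) = (Bᴴ * B).det • Bᴴ := by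
      rw [← Matrix.mul_assoc, ← Matrix.mul_assoc, Matrix.mul_adjugate, Matrix.smul_mul,
        Matrix.one_mul]
    have h2 := congrFun (congrFun h1 a) i
    rw [Matrix.mul_apply, Matrix.smul_apply, smul_eq_mul] at h2
    have h3 : ∀ k, conj (ℓ k (b a)) = Bᴴ a k := fun k => rfl
    simp only [h3, mul_sub, Finset.sum_sub_distrib, Pi.single_apply, mul_ite, mul_one, mul_zero,
      Finset.sum_ite_eq', Finset.mem_univ, if_true, mul_left_comm _ ((Bᴴ * B).det⁻¹),
      ← Finset.mul_sum, h2]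
    rw [inv_mul_cancel_left₀ hdet, sub_self]
  intro u hu
  have hu' : u = ∑ a, b.repr ⟨u, hu⟩ a • (b a : V) := by
    have h := congrArg W.subtype (b.sum_repr ⟨u, hu⟩)
    rw [map_sum] at h
    exact h.symm
  simp only [hval]
  rw [hu']
  simp only [map_sum, map_smul, smul_eq_mul, map_mul, Finset.sum_mul]
  rw [Finset.sum_comm]
  refine Finset.sum_eq_zero fun a _ => ?_
  rw [← mul_zero (conj (b.repr ⟨u, hu⟩ a)), ← hbas a, Finset.mul_sum]
  exact Finset.sum_congr rfl fun k _ => by ring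

end GramProjection

/-! ### Vector fields from pointwise values -/

section ValuedFields

open Set Topology
open scoped TensorProduct

variable {𝕂 : Type*} [RCLike 𝕂] {E : Type*} [NormedAddCommGroup E] [NormedSpace ℝ E]
  {M : Type*} [TopologicalSpace M] [ChartedSpace E M]

lemma differential_add (f g : SmoothFunctions 𝕂 E M) (x : M) :
    differential E (f + g : SmoothFunctions 𝕂 E M) x = differential E f x + differential E g x :=
  ((f.mdifferentiableAt x).hasMFDerivAt.add (g.mdifferentiableAt x).hasMFDerivAt).mfderiv

lemma differential_mul (f g : SmoothFunctions 𝕂 E M) (x : M) (v : TangentSpace 𝓘(ℝ, E) x) :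
    differential E (f * g : SmoothFunctions 𝕂 E M) x v =
      f x * differential E g x v + g x * differential E f x v := by
  have h := ((f.mdifferentiableAt x).hasMFDerivAt.mul (g.mdifferentiableAt x).hasMFDerivAt).mfderiv
  exact congrArg (fun L : TangentSpace 𝓘(ℝ, E) x →L[ℝ] 𝕂 => L v) h

lemma differential_algebraMap (c : 𝕂) (x : M) :
    differential E (algebraMap 𝕂 (SmoothFunctions 𝕂 E M) c) x = 0 :=
  (hasMFDerivAt_const c x).mfderiv

lemma dirDeriv_add (f g : SmoothFunctions 𝕂 E M) (x : M) (v : ScalarTangentSpace 𝕂 E M x) :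
    dirDeriv 𝕂 E (f + g : SmoothFunctions 𝕂 E M) x v = dirDeriv 𝕂 E f x v + dirDeriv 𝕂 E g x v := by
  induction v using TensorProduct.induction_on with
  | zero => simp
  | add v w hv hw => rw [map_add, map_add, map_add, hv, hw]; ring
  | tmul c v =>
    rw [dirDeriv_tmul, dirDeriv_tmul, dirDeriv_tmul, differential_add, ← mul_add]
    rfl

lemma dirDeriv_mul (f g : SmoothFunctions 𝕂 E M) (x : M) (v : ScalarTangentSpace 𝕂 E M x) :
    dirDeriv 𝕂 E (f * g : SmoothFunctions 𝕂 E M) x v =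
      f x * dirDeriv 𝕂 E g x v + g x * dirDeriv 𝕂 E f x v := by
  induction v using TensorProduct.induction_on with
  | zero => simp
  | add v w hv hw => rw [map_add, map_add, map_add, hv, hw]; ring
  | tmul c v =>
    rw [dirDeriv_tmul, dirDeriv_tmul, dirDeriv_tmul, differential_mul]
    ring

lemma dirDeriv_algebraMap (c : 𝕂) (x : M) (v : ScalarTangentSpace 𝕂 E M x) :
    dirDeriv 𝕂 E (algebraMap 𝕂 (SmoothFunctions 𝕂 E M) c) x v = 0 := by
  induction v using TensorProduct.induction_on with
  | zero => simp
  | add v w hv hw => rw [map_add, hv, hw, add_zero]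
  | tmul c v => rw [dirDeriv_tmul, differential_algebraMap]; exact mul_zero c

/-- The vector field with given values. -/
def derivationOfValues (v : ∀ x : M, ScalarTangentSpace 𝕂 E M x)
    (hv : ∀ f : SmoothFunctions 𝕂 E M,
      ContMDiff 𝓘(ℝ, E) 𝓘(ℝ, 𝕂) ∞ fun x => dirDeriv 𝕂 E f x (v x)) : VectorFieldsOn 𝕂 E M :=
  Derivation.mk'
    { toFun := fun f => ⟨_, hv f⟩
      map_add' := fun f g => smoothFunctions_ext fun x => dirDeriv_add f g x (v x)
      map_smul' := fun c f => smoothFunctions_ext fun x => by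
        rw [Algebra.smul_def]
        refine (dirDeriv_mul _ f x (v x)).trans ?_
        rw [dirDeriv_algebraMap, mul_zero, add_zero]
        rfl }
    fun f g => smoothFunctions_ext fun x => dirDeriv_mul f g x (v x)

lemma hasValue_derivationOfValues (v : ∀ x : M, ScalarTangentSpace 𝕂 E M x) (hv) (x : M) :
    HasValue (derivationOfValues v hv) x (v x) := fun _ => rfl

end ValuedFields

/-! ### Global generators of a bundle with local frames -/

section LocalFrames

open Set Topology Matrix
open scoped TensorProduct ComplexConjugate

variable {𝕂 : Type*} [RCLike 𝕂] {E : Type*} [NormedAddCommGroup E] [NormedSpace ℝ E]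
  [FiniteDimensional ℝ E] {M : Type*} [TopologicalSpace M] [ChartedSpace E M]

/-- The complex conjugate of a smooth function. -/
def conjFunction (f : SmoothFunctions 𝕂 E M) : SmoothFunctions 𝕂 E M :=
  ⟨fun x => conj (f x), (RCLike.conjCLE (K := 𝕂)).contDiff.contMDiff.comp f.2⟩

/-- A smooth family of subspaces with local frames of vector fields. -/
def HasLocalFrames (W : ∀ x : M, Submodule 𝕂 (ScalarTangentSpace 𝕂 E M x)) : Prop :=
  ∀ x₀ : M, ∃ (r : ℕ) (S : Fin r → VectorFieldsOn 𝕂 E M), ∃ U ∈ 𝓝 x₀,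
    ∀ x ∈ U, ∃ b : Module.Basis (Fin r) 𝕂 (W x), ∀ i, HasValue (S i) x (b i : _)

/-- The functions `f` separate the tangent vectors. -/
def SeparatesTangents {N : ℕ} (f : Fin N → SmoothFunctions 𝕂 E M) : Prop :=
  ∀ (x : M) (v : ScalarTangentSpace 𝕂 E M x), (∀ i, dirDeriv 𝕂 E (f i) x v = 0) → v = 0

variable {N : ℕ} {f : Fin N → SmoothFunctions 𝕂 E M}
  {W : ∀ x : M, Submodule 𝕂 (ScalarTangentSpace 𝕂 E M x)}

/-- By uniqueness the projection can be computed near `x₀` from any local frame. There it is a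
quotient of smooth functions on `M`, made from the derivatives `S a (f k)`, their conjugates and `S
a g`, whose denominator, the Gram determinant, does not vanish. -/
lemma contMDiffAt_gramProjection (hf : SeparatesTangents f) (hW : HasLocalFrames W) (i : Fin N)
    (w : ∀ x : M, ScalarTangentSpace 𝕂 E M x)
    (hw : ∀ x, IsGramProjection (W x) (fun k => dirDeriv 𝕂 E (f k) x) i (w x))
    (g : SmoothFunctions 𝕂 E M) :
    ContMDiff 𝓘(ℝ, E) 𝓘(ℝ, 𝕂) ∞ fun x => dirDeriv 𝕂 E g x (w x) := by
  intro x₀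
  obtain ⟨r, S, U, hU, hb⟩ := hW x₀
  let B : Matrix (Fin N) (Fin r) (SmoothFunctions 𝕂 E M) := Matrix.of fun k a => S a (f k)
  let B' : Matrix (Fin r) (Fin N) (SmoothFunctions 𝕂 E M) :=
    Matrix.of fun a k => conjFunction (S a (f k))
  let P : SmoothFunctions 𝕂 E M := ∑ a, ((B' * B).adjugate * B') a i * S a g
  let D : SmoothFunctions 𝕂 E M := (B' * B).det
  have hx : ∀ x ∈ U, D x ≠ 0 ∧ dirDeriv 𝕂 E g x (w x) = (D x)⁻¹ * P x := fun x hx => by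
    obtain ⟨b, hb⟩ := hb x hx
    have hB : B.map (evalAt 𝕂 E x) = frameMatrix (fun k => dirDeriv 𝕂 E (f k) x) fun a => (b a : _) :=
      Matrix.ext fun k a => hb a (f k)
    have hB' : B'.map (evalAt 𝕂 E x) =
        (frameMatrix (fun k => dirDeriv 𝕂 E (f k) x) fun a => (b a : _))ᴴ :=
      Matrix.ext fun a k => congrArg conj (hb a (f k))
    have hBB : (B' * B).map (evalAt 𝕂 E x) =
        (frameMatrix (fun k => dirDeriv 𝕂 E (f k) x) fun a => (b a : _))ᴴ *
          frameMatrix (fun k => dirDeriv 𝕂 E (f k) x) fun a => (b a : _) := by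
      rw [← hB', ← hB, Matrix.map_mul]
    have hD : D x = ((frameMatrix (fun k => dirDeriv 𝕂 E (f k) x) fun a => (b a : _))ᴴ *
          frameMatrix (fun k => dirDeriv 𝕂 E (f k) x) fun a => (b a : _)).det := by
      rw [← hBB, ← evalAt_apply, AlgHom.map_det]
      rfl
    have hdet := det_frameMatrix_ne_zero (hf x) (b.linearIndependent.map' _ (W x).ker_subtype)
    refine ⟨by rw [hD]; exact hdet, ?_⟩
    rw [(hw x).unique (hf x) (isGramProjection_of_basis (hf x) b i), map_sum, ← hD,
      ← evalAt_apply x P, map_sum, Finset.mul_sum]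
    refine Finset.sum_congr rfl fun a _ => ?_
    have hadj : evalAt 𝕂 E x (((B' * B).adjugate * B') a i) =
        ((((frameMatrix (fun k => dirDeriv 𝕂 E (f k) x) fun a => (b a : _))ᴴ *
          frameMatrix (fun k => dirDeriv 𝕂 E (f k) x) fun a => (b a : _)).adjugate *
          (frameMatrix (fun k => dirDeriv 𝕂 E (f k) x) fun a => (b a : _))ᴴ) a i) := by
      rw [← hBB, ← hB', ← AlgHom.mapMatrix_apply (evalAt 𝕂 E x) (B' * B), ← AlgHom.map_adjugate,
        AlgHom.mapMatrix_apply, ← Matrix.map_mul]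
      rfl
    rw [map_smul, smul_eq_mul, map_mul, hadj, mul_assoc]
    refine congrArg _ (congrArg _ (hb a g).symm)
  have hsm : ContMDiffAt 𝓘(ℝ, E) 𝓘(ℝ, 𝕂) ∞ (fun x => (D x)⁻¹ * P x) x₀ := by
    have hinv : ContMDiffAt 𝓘(ℝ, E) 𝓘(ℝ, 𝕂) ∞ (fun x => (D x)⁻¹) x₀ :=
      (contDiffAt_inv ℝ (hx x₀ (mem_of_mem_nhds hU)).1).contMDiffAt.comp x₀ (D.2 x₀)
    exact (contDiff_mul.contMDiff.contMDiffAt).comp x₀ (hinv.prodMk_space (P.2 x₀))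
  exact hsm.congr_of_eventuallyEq (Filter.eventually_of_mem hU fun x h => (hx x h).2)

/-- A family of subspaces with local frames is generated by finitely many vector fields. -/
lemma exists_generating_fields (hf : SeparatesTangents f) (hW : HasLocalFrames W) :
    ∃ v : Fin N → VectorFieldsOn 𝕂 E M, (∀ i x, ∃ w ∈ W x, HasValue (v i) x w) ∧
      ∀ X : VectorFieldsOn 𝕂 E M, (∀ x, ∃ w ∈ W x, HasValue X x w) → ∑ i, X (f i) • v i = X := by
  have hex : ∀ i x, ∃ w, IsGramProjection (W x) (fun k => dirDeriv 𝕂 E (f k) x) i w := fun i x => by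
    obtain ⟨r, S, U, hU, hb⟩ := hW x
    obtain ⟨b, -⟩ := hb x (mem_of_mem_nhds hU)
    exact ⟨_, isGramProjection_of_basis (hf x) b i⟩
  choose w hw using hex
  refine ⟨fun i => derivationOfValues (w i) (contMDiffAt_gramProjection hf hW i (w i) (hw i)),
    fun i x => ⟨w i x, (hw i x).1, hasValue_derivationOfValues _ _ x⟩, fun X hX => ?_⟩
  refine Derivation.ext fun g => smoothFunctions_ext fun x => ?_
  obtain ⟨u, hu, hXu⟩ := hX x
  rw [hXu g]
  conv_rhs => rw [← IsGramProjection.sum_smul (hf x) (fun i => hw i x) hu, map_sum]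
  rw [← evalAt_apply, show ∀ D : Fin N → VectorFieldsOn 𝕂 E M, (∑ i, D i) g = ∑ i, D i g from
    fun D => map_sum (⟨⟨fun D => D g, rfl⟩, fun _ _ => rfl⟩ : VectorFieldsOn 𝕂 E M →+ _) D _,
    map_sum]
  refine Finset.sum_congr rfl fun i _ => ?_
  rw [map_smul, ← hXu (f i)]
  rfl

variable [IsManifold 𝓘(ℝ, E) ∞ M] [T2Space M]

/-- The coordinate fields of a chart, multiplied by a bump function; near `x₀` the bump function is
`1`. -/
lemma hasLocalFrames_top :
    HasLocalFrames fun x : M => (⊤ : Submodule 𝕂 (ScalarTangentSpace 𝕂 E M x)) := by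
  intro x₀
  obtain ⟨χ⟩ : Nonempty (SmoothBumpFunction 𝓘(ℝ, E) x₀) := inferInstance
  let b := Module.finBasis ℝ E
  -- Outside the domain of the chart the value of `inverse` is irrelevant, as the bump function
  -- vanishes there.
  let w : ∀ x : M, E → TangentSpace 𝓘(ℝ, E) x := fun x =>
    (mfderiv 𝓘(ℝ, E) 𝓘(ℝ, E) (extChartAt 𝓘(ℝ, E) x₀) x).inverse
  have hw : ∀ x ∈ (extChartAt 𝓘(ℝ, E) x₀).source, ∀ e : E,
      mfderiv 𝓘(ℝ, E) 𝓘(ℝ, E) (extChartAt 𝓘(ℝ, E) x₀) x (w x e) = e := fun x hx e =>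
    (isInvertible_mfderiv_extChartAt hx).self_apply_inverse e
  have hval : ∀ (g : SmoothFunctions 𝕂 E M) (e : E) (x : M),
      dirDeriv 𝕂 E g x ((χ x : 𝕂) ⊗ₜ w x e) = χ x •
        fderiv ℝ (g ∘ (extChartAt 𝓘(ℝ, E) x₀).symm) (extChartAt 𝓘(ℝ, E) x₀ x) e := fun g e x => by
    rw [dirDeriv_tmul, RCLike.real_smul_eq_coe_mul]
    by_cases hx : x ∈ (extChartAt 𝓘(ℝ, E) x₀).source
    · refine congrArg _ ((mfderiv_eq_fderiv_extChartAt x₀ hx (g.mdifferentiableAt x) _).trans ?_)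
      rw [hw x hx]
    · rw [bump_eq_zero χ hx, RCLike.ofReal_zero, zero_mul, zero_mul]
  have hsm : ∀ (e : E) (g : SmoothFunctions 𝕂 E M),
      ContMDiff 𝓘(ℝ, E) 𝓘(ℝ, 𝕂) ∞ fun x => dirDeriv 𝕂 E g x ((χ x : 𝕂) ⊗ₜ w x e) := fun e g => by
    simp only [hval]
    have h1 : ContDiffOn ℝ ∞ (fderiv ℝ (g ∘ (extChartAt 𝓘(ℝ, E) x₀).symm))
        (extChartAt 𝓘(ℝ, E) x₀).target :=
      (contDiffOn_comp_extChartAt_symm x₀ g.2).fderiv_of_isOpen (isOpen_extChartAt_target x₀)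
        (by simp)
    exact contMDiff_bump_smul χ (h1.clm_apply contDiffOn_const)
  refine ⟨_, fun i => derivationOfValues _ (hsm (b i)), _, Filter.inter_mem
    (extChartAt_source_mem_nhds (I := 𝓘(ℝ, E)) x₀) χ.eventuallyEq_one, fun x hx => ?_⟩
  obtain ⟨e, he⟩ := isInvertible_mfderiv_extChartAt hx.1
  refine ⟨(Algebra.TensorProduct.basis 𝕂 (b.map e.symm.toLinearEquiv)).map
    Submodule.topEquiv.symm, fun i => ?_⟩
  have h1 : ((χ x : 𝕂) ⊗ₜ w x (b i) : ScalarTangentSpace 𝕂 E M x) =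
      (1 : 𝕂) ⊗ₜ e.symm (b i) := by
    have h2 : χ x = 1 := hx.2
    have h3 : w x (b i) = e.symm (b i) := by
      rw [← e.symm_apply_apply (w x (b i))]
      refine congrArg e.symm ?_
      refine Eq.trans ?_ (hw x hx.1 (b i))
      rw [← he]
      rfl
    rw [h2, RCLike.ofReal_one, h3]
  have h4 := hasValue_derivationOfValues _ (hsm (b i)) x
  rw [h1] at h4
  rw [Module.Basis.map_apply, Algebra.TensorProduct.basis_apply]
  exact h4

/-- Real functions with spanning differentials also separate the vectors of `T_𝕂 M`: in a real basis
of the tangent space, the real and imaginary parts of the coordinates are tangent vectors killed by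
all differentials. -/
lemma exists_separatesTangents [SigmaCompactSpace M] :
    ∃ (N : ℕ) (f : Fin N → SmoothFunctions 𝕂 E M), SeparatesTangents f := by
  obtain ⟨N, f, hf, hsep⟩ := exists_finite_spanning_differentials (E := E) (M := M)
  refine ⟨N, fun i => ⟨_, contMDiff_clm_comp (hf i) (RCLike.ofRealCLM (K := 𝕂))⟩,
    fun x v hv => ?_⟩
  have : FiniteDimensional ℝ (TangentSpace 𝓘(ℝ, E) x) := inferInstanceAs (FiniteDimensional ℝ E)
  let b := Module.finBasis ℝ (TangentSpace 𝓘(ℝ, E) x)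
  let B := Algebra.TensorProduct.basis 𝕂 b
  let df : Fin N → TangentSpace 𝓘(ℝ, E) x →ₗ[ℝ] ℝ := fun i =>
    (mfderiv 𝓘(ℝ, E) 𝓘(ℝ, ℝ) (f i) x).toLinearMap
  have hB : ∀ i k, dirDeriv 𝕂 E (fun y => RCLike.ofRealCLM (K := 𝕂) (f i y)) x (B k) =
      (df i (b k) : 𝕂) := fun i k => by
    rw [Algebra.TensorProduct.basis_apply, dirDeriv_tmul, one_mul]
    exact mfderiv_clm_comp (hf i) (RCLike.ofRealCLM (K := 𝕂)) x (b k)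
  have hsum : ∀ i, ∑ k, B.repr v k * (df i (b k) : 𝕂) = 0 := fun i => by
    rw [← hv i]
    conv_rhs => rw [← B.sum_repr v, map_sum]
    refine Finset.sum_congr rfl fun k _ => ?_
    rw [map_smul, smul_eq_mul]
    exact congrArg _ (hB i k).symm
  -- To be used for the real and the imaginary part, which commute with multiplication by real
  -- numbers.
  have hT : ∀ T : 𝕂 →ₗ[ℝ] ℝ, (∀ (c : 𝕂) (r : ℝ), T (c * r) = T c * r) →
      ∀ k, T (B.repr v k) = 0 := fun T hT k => by
    have h0 : ∑ k, T (B.repr v k) • b k = 0 := hsep x _ fun i => by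
      change df i (∑ k, T (B.repr v k) • b k) = 0
      rw [map_sum, ← map_zero T, ← hsum i, map_sum]
      refine Finset.sum_congr rfl fun k _ => ?_
      rw [hT, map_smul, smul_eq_mul]
    exact Fintype.linearIndependent_iff.1 b.linearIndependent _ h0 k
  refine B.ext_elem fun k => ?_
  rw [map_zero, Finsupp.zero_apply]
  refine RCLike.ext ?_ ?_
  · rw [map_zero]
    exact hT RCLike.reLm (fun c r => by simp) k
  · rw [map_zero]
    exact hT RCLike.imLm (fun c r => by simp) k

end LocalFrames

/-! ### Generators for an integrable distribution and for all vector fields -/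

section Bases

variable {𝕂 : Type*} [RCLike 𝕂] {E : Type*} [NormedAddCommGroup E] [NormedSpace ℝ E]
  [FiniteDimensional ℝ E] {M : Type*} [TopologicalSpace M] [ChartedSpace E M]
  [IsManifold 𝓘(ℝ, E) ∞ M] [T2Space M] [SigmaCompactSpace M]

/-- A splitting, together with finite generating systems. -/
lemma IntegrableDistribution.exists_generators (F : IntegrableDistribution 𝕂 E M) :
    ∃ (N : ℕ) (f : Fin N → SmoothFunctions 𝕂 E M) (v : Fin N → F.sections)
      (X : Fin N → VectorFieldsOn 𝕂 E M),
      (∀ Y : F.sections, ∑ i, (Y : VectorFieldsOn 𝕂 E M) (f i) • v i = Y) ∧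
      ∀ Y : VectorFieldsOn 𝕂 E M, ∑ i, Y (f i) • X i = Y := by
  obtain ⟨N, f, hf⟩ := exists_separatesTangents (𝕂 := 𝕂) (E := E) (M := M)
  obtain ⟨v, hv, hvsum⟩ := exists_generating_fields hf (W := F.fiber) F.locallyTrivial
  obtain ⟨X, -, hX⟩ := exists_generating_fields hf (hasLocalFrames_top (𝕂 := 𝕂) (E := E) (M := M))
  refine ⟨N, f, fun i => ⟨v i, hv i⟩, X, fun Y => Subtype.ext ?_, fun Y => hX Y fun x => ?_⟩
  · refine Eq.trans ?_ (hvsum Y Y.2)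
    exact map_sum F.sections.toSubmodule.subtype _ _
  · obtain ⟨w, hw⟩ := exists_hasValue Y x
    exact ⟨w, trivial, hw⟩

end Bases

/-! ### The splitting and the dual bases from generators -/

section Splitting

variable {𝕂 A : Type*} [CommRing 𝕂] [CommRing A] [Algebra 𝕂 A]
  {F : LieRinehartSubalgebra A (Derivation 𝕂 A A)} {N : ℕ}

/-- Generators of `F` whose coefficients are given by the derivatives of functions `f`. -/
def FiniteDualBasis.ofGenerators (f : Fin N → A) (v : Fin N → F)
    (hv : ∀ Y : F, ∑ i, (Y : Derivation 𝕂 A A) (f i) • v i = Y) : FiniteDualBasis A F (Fin N) where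
  vec := v
  coord i :=
    { toFun := fun Y => (Y : Derivation 𝕂 A A) (f i)
      map_add' := fun _ _ => rfl
      map_smul' := fun _ _ => rfl }
  sum_eq := hv

/-- The projection to `F` given by such generators. -/
def projOfGenerators (f : Fin N → A) (v : Fin N → F) : Derivation 𝕂 A A →ₗ[A] Derivation 𝕂 A A where
  toFun Y := ∑ i, Y (f i) • (v i : Derivation 𝕂 A A)
  map_add' Y Z := by
    simp only [Derivation.add_apply, add_smul, Finset.sum_add_distrib]
  map_smul' a Y := by
    simp only [Derivation.smul_apply, smul_eq_mul, mul_smul, Finset.smul_sum, RingHom.id_apply]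

/-- The formula `∑ Y(f_i) v_i` makes sense for all derivations `Y` and projects them onto `F`. Its
complementary projection kills `F` and descends to the quotient, where it is a splitting. -/
lemma exists_isSplitting (f : Fin N → A) (v : Fin N → F)
    (hv : ∀ Y : F, ∑ i, (Y : Derivation 𝕂 A A) (f i) • v i = Y) :
    ∃ j : NormalSections F →ₗ[A] Derivation 𝕂 A A, IsSplitting j := by
  have hsub : ∀ Y : Derivation 𝕂 A A, projOfGenerators f v Y ∈ F.toSubmodule := fun Y => by
    change ∑ i, Y (f i) • (v i : Derivation 𝕂 A A) ∈ F.toSubmodule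
    exact Submodule.sum_mem _ fun i _ => Submodule.smul_mem _ _ (v i).2
  have hF : F.toSubmodule ≤ LinearMap.ker (LinearMap.id - projOfGenerators f v) := fun Y hY => by
    rw [LinearMap.mem_ker, LinearMap.sub_apply, LinearMap.id_apply, sub_eq_zero]
    refine (congrArg Subtype.val (hv ⟨Y, hY⟩)).symm.trans ?_
    exact map_sum F.toSubmodule.subtype _ _
  refine ⟨F.toSubmodule.liftQ _ hF, fun Z => ?_⟩
  obtain ⟨Y, rfl⟩ := F.toSubmodule.mkQ_surjective Z
  change F.toSubmodule.mkQ (Y - projOfGenerators f v Y) = F.toSubmodule.mkQ Y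
  rw [map_sub, sub_eq_self]
  exact (Submodule.Quotient.mk_eq_zero _).2 (hsub Y)

/-- Generators of the normal module, from generators of all derivations and a splitting. -/
def FiniteDualBasis.ofSplitting (j : NormalSections F →ₗ[A] Derivation 𝕂 A A) (hj : IsSplitting j)
    (f : Fin N → A) (X : Fin N → Derivation 𝕂 A A)
    (hX : ∀ Y : Derivation 𝕂 A A, ∑ i, Y (f i) • X i = Y) :
    FiniteDualBasis A (NormalSections F) (Fin N) where
  vec i := F.toSubmodule.mkQ (X i)
  coord i :=
    { toFun := fun Z => j Z (f i)
      map_add' := fun _ _ => by rw [map_add]; rfl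
      map_smul' := fun _ _ => by rw [map_smul]; rfl }
  sum_eq Z := by
    refine Eq.trans ?_ (hj Z)
    conv_rhs => rw [← hX (j Z)]
    exact (map_sum F.toSubmodule.mkQ (fun i => j Z (f i) • X i) Finset.univ).symm

end Splitting

/-! ### Tensor products of graded multilinear maps and the Leibniz rule -/

section ProductOfForms

variable {𝕂 Ω D X : Type*} [CommRing 𝕂] [AddCommGroup D] [Module 𝕂 D]
  [AddCommGroup X] [Module 𝕂 X] [Ring Ω] [Algebra 𝕂 Ω] {R : DGAlg 𝕂 Ω} {M : DGMod D R}
  {M' : DGMod X R} {n m n₁ m₁ n₂ m₂ : ℕ}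

/-- The formula with explicit Koszul signs, obtained from the one for a single module by passing to
pairs. -/
lemma formsLie_eq (k : ℤ) (τ : MultilinearForms 𝕂 Ω D X n m) {α : Fin n → D} {x : Fin m → X}
    {p : Fin n → ℤ} {q : Fin m → ℤ} (hα : ∀ i, α i ∈ M.deg (p i)) (hx : ∀ j, x j ∈ M'.deg (q j)) :
    formsLie M M' n m k τ α x = R.d (τ α x) - k.negOnePow •
      (∑ i, (∑ l ∈ Finset.Iio i, p l).negOnePow • τ (Function.update α i (M.L (α i))) x +
        ∑ j, (∑ i, p i + ∑ l ∈ Finset.Iio j, q l).negOnePow •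
          τ α (Function.update x j (M'.L (x j)))) := by
  have h : formsLie M M' n m k τ = ofPairs ((M.prod M').lie (n + m) k (toPairs τ)) := by
    rw [lie_toPairs, ofPairs_toPairs]
  rw [h, ofPairs_apply, DGMod.lie_eq _ _ _ (pairArgs_mem hα hx), Fin.sum_univ_add]
  have e : ∀ α x, toPairs τ (pairArgs α x) = τ α x := fun α x => by
    rw [← ofPairs_apply, ofPairs_toPairs]
  have e1 : ∀ i, (M.prod M').L (pairArgs α x (Fin.castAdd m i)) = (M.L (α i), 0) := fun i => by
    rw [pairArgs_castAdd]
    exact Prod.ext rfl (map_zero M'.L)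
  have e2 : ∀ i, (M.prod M').L (pairArgs α x (Fin.natAdd n i)) = (0, M'.L (x i)) := fun i => by
    rw [pairArgs_natAdd]
    exact Prod.ext (map_zero M.L) rfl
  simp only [e1, e2, ← pairArgs_update_left, ← pairArgs_update_right, e, sum_Iio_castAdd,
    sum_Iio_natAdd, Fin.append_left, Fin.append_right]

variable [Invertible (2 : 𝕂)]

lemma gradedProduct_eq (k : ℤ) (σ : MultilinearForms 𝕂 Ω D X n₁ m₁)
    (τ : MultilinearForms 𝕂 Ω D X n₂ m₂) {p : Fin (n₁ + n₂) → ℤ} {q : Fin (m₁ + m₂) → ℤ}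
    {α : Fin (n₁ + n₂) → D} {x : Fin (m₁ + m₂) → X}
    (hα : ∀ i, α i ∈ M.deg (p i)) (hx : ∀ j, x j ∈ M'.deg (q j)) :
    gradedProduct (LinearMap.mul 𝕂 Ω) M.parity M'.parity k σ τ α x =
      (k * (∑ i, p (Fin.castAdd n₂ i) + ∑ j, q (Fin.castAdd m₂ j)) +
        (∑ j, q (Fin.castAdd m₂ j)) * ∑ i, p (Fin.natAdd n₁ i)).negOnePow •
      (σ (fun i => α (Fin.castAdd n₂ i)) (fun j => x (Fin.castAdd m₂ j)) *
        τ (fun i => α (Fin.natAdd n₁ i)) fun j => x (Fin.natAdd m₁ j)) :=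
  gradedProduct_apply _ _ _ k σ τ (fun i => M.parity_eq (hα i)) fun j => M'.parity_eq (hx j)

section update
variable (k : ℤ) (σ : MultilinearForms 𝕂 Ω D X n₁ m₁)
    (τ : MultilinearForms 𝕂 Ω D X n₂ m₂) {p : Fin (n₁ + n₂) → ℤ} {q : Fin (m₁ + m₂) → ℤ}
    {α : Fin (n₁ + n₂) → D} {x : Fin (m₁ + m₂) → X} {r : ℤ}

/-- This and the next three lemmas show how the sign of the product changes when one argument
changes its degree by `r`, for each of the four groups of arguments. They serve both for the action
of functions and, with `r = 1`, for the Lie derivative. The degrees of the last group do not enter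
the sign. -/
lemma gradedProduct_update_castAdd_left (hα : ∀ i, α i ∈ M.deg (p i))
    (hx : ∀ j, x j ∈ M'.deg (q j)) (i : Fin n₁) {y : D}
    (hy : y ∈ M.deg (p (Fin.castAdd n₂ i) + r)) :
    gradedProduct (LinearMap.mul 𝕂 Ω) M.parity M'.parity k σ τ
      (Function.update α (Fin.castAdd n₂ i) y) x =
      (k * (∑ i, p (Fin.castAdd n₂ i) + r + ∑ j, q (Fin.castAdd m₂ j)) +
        (∑ j, q (Fin.castAdd m₂ j)) * ∑ i, p (Fin.natAdd n₁ i)).negOnePow •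
      (σ (Function.update (fun i => α (Fin.castAdd n₂ i)) i y) (fun j => x (Fin.castAdd m₂ j)) *
        τ (fun i => α (Fin.natAdd n₁ i)) fun j => x (Fin.natAdd m₁ j)) := by
  rw [gradedProduct_eq k σ τ (M.update_mem hα _ hy) hx]
  simp only [update_castAdd_left fun a => a, update_castAdd_right fun a => a,
    DGMod.sum_update_univ, add_sub_cancel_left]

lemma gradedProduct_update_natAdd_left (hα : ∀ i, α i ∈ M.deg (p i))
    (hx : ∀ j, x j ∈ M'.deg (q j)) (i : Fin n₂) {y : D}
    (hy : y ∈ M.deg (p (Fin.natAdd n₁ i) + r)) :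
    gradedProduct (LinearMap.mul 𝕂 Ω) M.parity M'.parity k σ τ
      (Function.update α (Fin.natAdd n₁ i) y) x =
      (k * (∑ i, p (Fin.castAdd n₂ i) + ∑ j, q (Fin.castAdd m₂ j)) +
        (∑ j, q (Fin.castAdd m₂ j)) * (∑ i, p (Fin.natAdd n₁ i) + r)).negOnePow •
      (σ (fun i => α (Fin.castAdd n₂ i)) (fun j => x (Fin.castAdd m₂ j)) *
        τ (Function.update (fun i => α (Fin.natAdd n₁ i)) i y) fun j => x (Fin.natAdd m₁ j)) := by
  rw [gradedProduct_eq k σ τ (M.update_mem hα _ hy) hx]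
  simp only [update_natAdd_left fun a => a, update_natAdd_right fun a => a,
    DGMod.sum_update_univ, add_sub_cancel_left]

lemma gradedProduct_update_castAdd_right (hα : ∀ i, α i ∈ M.deg (p i))
    (hx : ∀ j, x j ∈ M'.deg (q j)) (i : Fin m₁) {y : X}
    (hy : y ∈ M'.deg (q (Fin.castAdd m₂ i) + r)) :
    gradedProduct (LinearMap.mul 𝕂 Ω) M.parity M'.parity k σ τ α
      (Function.update x (Fin.castAdd m₂ i) y) =
      (k * (∑ i, p (Fin.castAdd n₂ i) + (∑ j, q (Fin.castAdd m₂ j) + r)) +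
        (∑ j, q (Fin.castAdd m₂ j) + r) * ∑ i, p (Fin.natAdd n₁ i)).negOnePow •
      (σ (fun i => α (Fin.castAdd n₂ i)) (Function.update (fun j => x (Fin.castAdd m₂ j)) i y) *
        τ (fun i => α (Fin.natAdd n₁ i)) fun j => x (Fin.natAdd m₁ j)) := by
  rw [gradedProduct_eq k σ τ hα (M'.update_mem hx _ hy)]
  simp only [update_castAdd_left fun a => a, update_castAdd_right fun a => a,
    DGMod.sum_update_univ, add_sub_cancel_left]

lemma gradedProduct_update_natAdd_right (hα : ∀ i, α i ∈ M.deg (p i))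
    (hx : ∀ j, x j ∈ M'.deg (q j)) (i : Fin m₂) {y : X}
    (hy : y ∈ M'.deg (q (Fin.natAdd m₁ i) + r)) :
    gradedProduct (LinearMap.mul 𝕂 Ω) M.parity M'.parity k σ τ α
      (Function.update x (Fin.natAdd m₁ i) y) =
      (k * (∑ i, p (Fin.castAdd n₂ i) + ∑ j, q (Fin.castAdd m₂ j)) +
        (∑ j, q (Fin.castAdd m₂ j)) * ∑ i, p (Fin.natAdd n₁ i)).negOnePow •
      (σ (fun i => α (Fin.castAdd n₂ i)) (fun j => x (Fin.castAdd m₂ j)) *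
        τ (fun i => α (Fin.natAdd n₁ i)) (Function.update (fun j => x (Fin.natAdd m₁ j)) i y)) := by
  rw [gradedProduct_eq k σ τ hα (M'.update_mem hx _ hy)]
  simp only [update_natAdd_left fun a => a, update_natAdd_right fun a => a]

end update

variable {σ : MultilinearForms 𝕂 Ω D X n₁ m₁} {τ : MultilinearForms 𝕂 Ω D X n₂ m₂} {k₁ k₂ : ℤ}

lemma gradedProduct_mem (hσ : σ ∈ gradedForms M M' n₁ m₁ k₁) (hτ : τ ∈ gradedForms M M' n₂ m₂ k₂) :
    gradedProduct (LinearMap.mul 𝕂 Ω) M.parity M'.parity k₂ σ τ ∈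
      gradedForms M M' (n₁ + n₂) (m₁ + m₂) (k₁ + k₂) := by
  intro p q α x hα hx
  obtain ⟨hσ1, hσ2⟩ := hσ _ _ _ _ (fun i => hα (Fin.castAdd n₂ i)) fun j => hx (Fin.castAdd m₂ j)
  obtain ⟨hτ1, hτ2⟩ := hτ _ _ _ _ (fun i => hα (Fin.natAdd n₁ i)) fun j => hx (Fin.natAdd m₁ j)
  rw [gradedProduct_eq k₂ σ τ hα hx, Fin.sum_univ_add, Fin.sum_univ_add]
  refine ⟨units_smul_mem' _ _ ?_, fun r a => ⟨fun i => ?_, fun i => ?_⟩⟩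
  · have h := R.mul_mem hσ1 hτ1
    convert h using 2
    ring
  · induction i using Fin.addCases with
    | left i =>
      rw [gradedProduct_update_castAdd_left k₂ σ τ hα hx i (M.act_mem a (hα _)), (hσ2 r a).1 i,
        sum_Iio_castAdd, LinearMap.mul_apply', LinearMap.mul_apply', units_mul_left,
        units_mul_right, smul_smul, smul_smul, mul_assoc, ← Int.negOnePow_add, ← Int.negOnePow_add]
      congr 1
      exact negOnePow_congr ⟨0, by ring⟩
    | right i =>
      -- A function coming out of an argument of `τ` has to be commuted with the value of `σ` in
      -- addition.
      rw [gradedProduct_update_natAdd_left k₂ σ τ hα hx i (M.act_mem a (hα _)), (hτ2 r a).1 i,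
        sum_Iio_natAdd, LinearMap.mul_apply', LinearMap.mul_apply', units_mul_right,
        units_mul_right, ← mul_assoc, R.comm hσ1 a.2, units_mul_left, smul_smul, smul_smul,
        smul_smul, ← Int.negOnePow_add, ← Int.negOnePow_add, ← Int.negOnePow_add]
      congr 1
      · exact negOnePow_congr ⟨r * ∑ j, q (Fin.castAdd m₂ j), by ring⟩
      · exact mul_assoc _ _ _
  · induction i using Fin.addCases with
    | left i =>
      rw [gradedProduct_update_castAdd_right k₂ σ τ hα hx i (M'.act_mem a (hx _)), (hσ2 r a).2 i,
        sum_Iio_castAdd, LinearMap.mul_apply', LinearMap.mul_apply', units_mul_left,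
        units_mul_right, smul_smul, smul_smul, mul_assoc, ← Int.negOnePow_add, ← Int.negOnePow_add]
      congr 1
      exact negOnePow_congr ⟨0, by ring⟩
    | right i =>
      rw [gradedProduct_update_natAdd_right (r := r) k₂ σ τ hα hx i (M'.act_mem a (hx _)),
        (hτ2 r a).2 i,
        sum_Iio_natAdd, LinearMap.mul_apply', LinearMap.mul_apply', units_mul_right,
        units_mul_right, ← mul_assoc, R.comm hσ1 a.2, units_mul_left, smul_smul, smul_smul,
        smul_smul, ← Int.negOnePow_add, ← Int.negOnePow_add, ← Int.negOnePow_add]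
      congr 1
      · exact negOnePow_congr ⟨0, by ring⟩
      · exact mul_assoc _ _ _

/-- The graded Leibniz rule: the differential of the values obeys it, and each place belongs to `σ`
or to `τ`, so the terms group into the Lie derivative of one factor times the other; only the signs
need a check. -/
lemma formsLie_gradedProduct_apply (hσ : σ ∈ gradedForms M M' n₁ m₁ k₁)
    {p : Fin (n₁ + n₂) → ℤ} {q : Fin (m₁ + m₂) → ℤ}
    {α : Fin (n₁ + n₂) → D} {x : Fin (m₁ + m₂) → X}
    (hα : ∀ i, α i ∈ M.deg (p i)) (hx : ∀ j, x j ∈ M'.deg (q j)) :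
    formsLie M M' (n₁ + n₂) (m₁ + m₂) (k₁ + k₂)
        (gradedProduct (LinearMap.mul 𝕂 Ω) M.parity M'.parity k₂ σ τ) α x =
      (k₂ * (∑ i, p (Fin.castAdd n₂ i) + ∑ j, q (Fin.castAdd m₂ j)) +
        (∑ j, q (Fin.castAdd m₂ j)) * ∑ i, p (Fin.natAdd n₁ i)).negOnePow •
      (formsLie M M' n₁ m₁ k₁ σ (fun i => α (Fin.castAdd n₂ i)) (fun j => x (Fin.castAdd m₂ j)) *
          τ (fun i => α (Fin.natAdd n₁ i)) (fun j => x (Fin.natAdd m₁ j)) +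
        (k₁ + ∑ i, p (Fin.castAdd n₂ i) + ∑ j, q (Fin.castAdd m₂ j)).negOnePow •
          (σ (fun i => α (Fin.castAdd n₂ i)) (fun j => x (Fin.castAdd m₂ j)) *
            formsLie M M' n₂ m₂ k₂ τ (fun i => α (Fin.natAdd n₁ i))
              fun j => x (Fin.natAdd m₁ j))) := by
  obtain ⟨hσ1, -⟩ := hσ _ _ _ _ (fun i => hα (Fin.castAdd n₂ i)) fun j => hx (Fin.castAdd m₂ j)
  rw [formsLie_eq _ _ hα hx, formsLie_eq _ _ (fun i => hα (Fin.castAdd n₂ i))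
    (fun j => hx (Fin.castAdd m₂ j)), formsLie_eq _ _ (fun i => hα (Fin.natAdd n₁ i))
    (fun j => hx (Fin.natAdd m₁ j))]
  simp only [Fin.sum_univ_add, sum_Iio_castAdd, sum_Iio_natAdd,
    gradedProduct_update_castAdd_left k₂ σ τ hα hx _ (M.L_mem (hα _)),
    gradedProduct_update_natAdd_left k₂ σ τ hα hx _ (M.L_mem (hα _)),
    gradedProduct_update_castAdd_right k₂ σ τ hα hx _ (M'.L_mem (hx _)),
    gradedProduct_update_natAdd_right (r := 1) k₂ σ τ hα hx _ (M'.L_mem (hx _)),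
    gradedProduct_eq k₂ σ τ hα hx, linearMap_units_smul, R.leibniz hσ1]
  simp only [sub_mul, mul_sub, units_mul_left, units_mul_right, smul_sub, smul_add, add_mul, mul_add,
    Finset.smul_sum, Finset.sum_mul, Finset.mul_sum, smul_smul, ← Int.negOnePow_add]
  -- The `a` are the two terms of the Leibniz rule for the values, the `b` the sums over one-forms
  -- and the `c` those over vector fields, with index `1` for the places of `σ` and `2` for those of
  -- `τ`.
  have key : ∀ {a₁ a₂ b₁ b₂ c₁ c₂ b₁' b₂' c₁' c₂' : Ω}, b₁ = b₁' → b₂ = b₂' → c₁ = c₁' → c₂ = c₂' →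
      a₁ + a₂ - (b₁ + b₂ + (c₁ + c₂)) = a₁ - (b₁' + c₁') + (a₂ - (b₂' + c₂')) := by
    rintro a₁ a₂ b₁ b₂ c₁ c₂ _ _ _ _ rfl rfl rfl rfl
    abel
  refine key ?_ ?_ ?_ ?_ <;> refine Finset.sum_congr rfl fun i _ => ?_ <;> congr 1
  · exact negOnePow_congr ⟨k₂, by ring⟩
  · exact negOnePow_congr ⟨0, by ring_nf⟩
  · exact negOnePow_congr ⟨k₂ + ∑ i, p (Fin.natAdd n₁ i), by
      simp only [Finset.sum_add_distrib]
      ring_nf⟩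
  · exact negOnePow_congr ⟨0, by ring⟩

/-- The tensor product of cocycles is a cocycle. -/
lemma formsLie_gradedProduct (hσ : σ ∈ gradedForms M M' n₁ m₁ k₁)
    (hσL : formsLie M M' n₁ m₁ k₁ σ = 0) (hτL : formsLie M M' n₂ m₂ k₂ τ = 0) :
    formsLie M M' (n₁ + n₂) (m₁ + m₂) (k₁ + k₂)
      (gradedProduct (LinearMap.mul 𝕂 Ω) M.parity M'.parity k₂ σ τ) = 0 := by
  refine M.multilinearMap_ext fun p α hα => M'.multilinearMap_ext fun q x hx => ?_
  rw [formsLie_gradedProduct_apply hσ hα hx, hσL, hτL]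
  simp

end ProductOfForms

/-! ### Products of cocycles and multiplicativity of the comparison map -/

section Products

variable {𝕂 A : Type*} [CommRing 𝕂] [CommRing A] [Algebra 𝕂 A]
  {F : LieRinehartSubalgebra A (Derivation 𝕂 A A)} {n m n₁ m₁ n₂ m₂ : ℕ} {k₁ k₂ : ℤ}

lemma normalTensorModule_nabla_apply (v : F) (T : NormalTensors F n m)
    (w : Fin n → Module.Dual A (NormalSections F)) (Z : Fin m → NormalSections F) :
    (normalTensorModule F n m).nabla v T w Z = (v : Derivation 𝕂 A A) (T w Z) -
      (∑ i, T (Function.update w i ((dualModule (bottModule F)).nabla v (w i))) Z +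
        ∑ i, T w (Function.update Z i ((bottModule F).nabla v (Z i)))) := by
  have h := evalPairs_nabla v T (pairArgs w Z)
  rw [Fin.sum_univ_add] at h
  have e : ∀ (T : NormalTensors F n m) w Z, evalPairs (pairArgs w Z) T = T w Z := fun T w Z => by
    simp [evalPairs_apply, toPairs_apply]
  have e1 : ∀ i, pairNabla v (pairArgs w Z (Fin.castAdd m i)) =
      ((dualModule (bottModule F)).nabla v (w i), 0) := fun i => by
    rw [pairArgs_castAdd]
    exact Prod.ext rfl (map_zero ((bottModule F).nabla v))
  have e2 : ∀ i, pairNabla v (pairArgs w Z (Fin.natAdd n i)) =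
      (0, (bottModule F).nabla v (Z i)) := fun i => by
    rw [pairArgs_natAdd]
    exact Prod.ext (map_zero ((dualModule (bottModule F)).nabla v)) rfl
  simpa only [e1, e2, ← pairArgs_update_left, ← pairArgs_update_right, e] using h

lemma normalTensorProduct_apply (s : NormalTensors F n₁ m₁) (t : NormalTensors F n₂ m₂)
    (w : Fin (n₁ + n₂) → Module.Dual A (NormalSections F))
    (Z : Fin (m₁ + m₂) → NormalSections F) :
    normalTensorProduct F n₁ m₁ n₂ m₂ s t w Z =
      s (fun i => w (Fin.castAdd n₂ i)) (fun i => Z (Fin.castAdd m₂ i)) *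
        t (fun i => w (Fin.natAdd n₁ i)) fun i => Z (Fin.natAdd m₁ i) := rfl

/-- The connection is a derivation of the tensor product. -/
lemma normalTensorModule_nabla_product (v : F) (s : NormalTensors F n₁ m₁)
    (t : NormalTensors F n₂ m₂) : (normalTensorModule F (n₁ + n₂) (m₁ + m₂)).nabla v
      (normalTensorProduct F n₁ m₁ n₂ m₂ s t) =
    normalTensorProduct F n₁ m₁ n₂ m₂ ((normalTensorModule F n₁ m₁).nabla v s) t +
      normalTensorProduct F n₁ m₁ n₂ m₂ s ((normalTensorModule F n₂ m₂).nabla v t) := by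
  refine MultilinearMap.ext fun w => MultilinearMap.ext fun Z => ?_
  rw [_root_.add_apply, _root_.add_apply, normalTensorModule_nabla_apply]
  simp only [normalTensorProduct_apply, normalTensorModule_nabla_apply, Fin.sum_univ_add,
    update_castAdd_left fun a => a, update_castAdd_right fun a => a,
    update_natAdd_left fun a => a, update_natAdd_right fun a => a,
    Derivation.leibniz, ← Finset.mul_sum, ← Finset.sum_mul, smul_eq_mul]
  ring

lemma ceDiff_ceProduct (s : Forms A F (NormalTensors F n₁ m₁))
    (t : Forms A F (NormalTensors F n₂ m₂)) :
    ceDiff (normalTensorModule F (n₁ + n₂) (m₁ + m₂)) (ceProduct F s t) =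
      ceProduct F (ceDiff (normalTensorModule F n₁ m₁) s) t +
        ceProduct F (twist 1 s) (ceDiff (normalTensorModule F n₂ m₂) t) :=
  ceDiff_wedge (E₁ := NormalTensors F n₁ m₁) (E₂ := NormalTensors F n₂ m₂)
    (E₃ := NormalTensors F (n₁ + n₂) (m₁ + m₂)) (normalTensorModule F n₁ m₁)
    (normalTensorModule F n₂ m₂) (normalTensorModule F (n₁ + n₂) (m₁ + m₂))
    (normalTensorProduct F n₁ m₁ n₂ m₂) normalTensorModule_nabla_product s t

lemma ceProduct_mem {s : Forms A F (NormalTensors F n₁ m₁)} {t : Forms A F (NormalTensors F n₂ m₂)}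
    (hs : s ∈ formsOfDegree 𝕂 k₁) (ht : t ∈ formsOfDegree 𝕂 k₂) :
    ceProduct F s t ∈ formsOfDegree 𝕂 (k₁ + k₂) := wedge_mem _ hs ht

lemma ceProduct_zero_left (t : Forms A F (NormalTensors F n₂ m₂)) :
    ceProduct F (0 : Forms A F (NormalTensors F n₁ m₁)) t = 0 := wedge_zero_left _ _

lemma ceProduct_zero_right (s : Forms A F (NormalTensors F n₁ m₁)) :
    ceProduct F s (0 : Forms A F (NormalTensors F n₂ m₂)) = 0 := wedge_zero_right _ _

lemma ceProduct_add_left (s s' : Forms A F (NormalTensors F n₁ m₁))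
    (t : Forms A F (NormalTensors F n₂ m₂)) :
    ceProduct F (s + s') t = ceProduct F s t + ceProduct F s' t := wedge_add_left _ _ _ _

lemma ceProduct_add_right (s : Forms A F (NormalTensors F n₁ m₁))
    (t t' : Forms A F (NormalTensors F n₂ m₂)) :
    ceProduct F s (t + t') = ceProduct F s t + ceProduct F s t' := wedge_add_right _ _ _ _

lemma ceProduct_mem_ceCocycles (s : ceCocycles F n₁ m₁ k₁) (t : ceCocycles F n₂ m₂ k₂) :
    ceProduct F s.1 t.1 ∈ ceCocycles F (n₁ + n₂) (m₁ + m₂) (k₁ + k₂) := by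
  have hs : ceDiff (normalTensorModule F n₁ m₁) s.1 = 0 := s.2.2
  have ht : ceDiff (normalTensorModule F n₂ m₂) t.1 = 0 := t.2.2
  refine ⟨ceProduct_mem s.2.1 t.2.1, ?_⟩
  change ceDiff (normalTensorModule F (n₁ + n₂) (m₁ + m₂)) (ceProduct F s.1 t.1) = 0
  rw [ceDiff_ceProduct, hs, ht, ceProduct_zero_left, ceProduct_zero_right, add_zero]

/-- Products of cohomologous cocycles are cohomologous. -/
lemma ceClass_ceProduct_congr {s s' : ceCocycles F n₁ m₁ k₁} {t t' : ceCocycles F n₂ m₂ k₂}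
    (hs : ceClass F s = ceClass F s') (ht : ceClass F t = ceClass F t') :
    ceClass F ⟨ceProduct F s.1 t.1, ceProduct_mem_ceCocycles s t⟩ =
      ceClass F ⟨ceProduct F s'.1 t'.1, ceProduct_mem_ceCocycles s' t'⟩ := by
  obtain ⟨u, hu, hu'⟩ := cohomologyClass_eq_iff.mp hs
  obtain ⟨w, hw, hw'⟩ := cohomologyClass_eq_iff.mp ht
  have ds : ceDiff (normalTensorModule F n₁ m₁) s'.1 = 0 := s'.2.2
  have dt : ceDiff (normalTensorModule F n₂ m₂) t.1 = 0 := t.2.2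
  -- From `s t - s' t' = (s - s') t + s' (t - t')`. The twist of `s'` compensates the sign that the
  -- differential produces in passing it.
  refine cohomologyClass_eq_iff.mpr ⟨ceProduct F u t.1 + ceProduct F (twist 1 s'.1) w,
    add_mem ?_ ?_, ?_⟩
  · have := ceProduct_mem hu t.2.1
    rwa [sub_add_eq_add_sub] at this
  · have := ceProduct_mem (twist_mem s'.2.1 1) hw
    rwa [← add_sub_assoc] at this
  · have h1 : ceDiff (normalTensorModule F n₁ m₁) (twist 1 s'.1) = 0 := by
      rw [ceDiff_twist, ds, map_zero, smul_zero]
    have e1 : ceProduct F (s.1 - s'.1) t.1 = ceProduct F s.1 t.1 - ceProduct F s'.1 t.1 := by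
      rw [eq_sub_iff_add_eq, ← ceProduct_add_left, sub_add_cancel]
    have e2 : ceProduct F s'.1 (t.1 - t'.1) = ceProduct F s'.1 t.1 - ceProduct F s'.1 t'.1 := by
      rw [eq_sub_iff_add_eq, ← ceProduct_add_right, sub_add_cancel]
    have hu'' : ceDiff (normalTensorModule F n₁ m₁) u = s.1 - s'.1 := hu'
    have hw'' : ceDiff (normalTensorModule F n₂ m₂) w = t.1 - t'.1 := hw'
    change ceDiff (normalTensorModule F (n₁ + n₂) (m₁ + m₂))
      (ceProduct F u t.1 + ceProduct F (twist 1 s'.1) w) = ceProduct F s.1 t.1 - ceProduct F s'.1 t'.1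
    have a1 := ceDiff_ceProduct u t.1
    rw [hu'', dt, ceProduct_zero_right, add_zero, e1] at a1
    have a2 := ceDiff_ceProduct (twist 1 s'.1) w
    rw [h1, hw'', twist_one_one, ceProduct_zero_left, zero_add, e2] at a2
    exact (map_add _ _ _).trans ((congrArg₂ (· + ·) a1 a2).trans (sub_add_sub_cancel _ _ _))

variable [Invertible (2 : 𝕂)]

lemma tensorFieldProduct_mem {σ : MultilinearFormsOn F n₁ m₁} {τ : MultilinearFormsOn F n₂ m₂}
    (hσ : σ ∈ tensorFieldsOfDegree F n₁ m₁ k₁) (hτ : τ ∈ tensorFieldsOfDegree F n₂ m₂ k₂) :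
    tensorFieldProduct F k₂ σ τ ∈ tensorFieldsOfDegree F (n₁ + n₂) (m₁ + m₂) (k₁ + k₂) :=
  gradedProduct_mem (M := oneFormsDGMod F) (M' := vectorFieldsDGMod F) hσ hτ

lemma tensorFieldProduct_mem_tensorCocycles (σ : tensorCocycles F n₁ m₁ k₁)
    (τ : tensorCocycles F n₂ m₂ k₂) :
    tensorFieldProduct F k₂ σ.1 τ.1 ∈ tensorCocycles F (n₁ + n₂) (m₁ + m₂) (k₁ + k₂) :=
  ⟨tensorFieldProduct_mem σ.2.1 τ.2.1,
    formsLie_gradedProduct (M := oneFormsDGMod F) (M' := vectorFieldsDGMod F) σ.2.1 σ.2.2 τ.2.2⟩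

/-- The comparison map is multiplicative. -/
lemma comparisonMap_tensorFieldProduct (j : NormalSections F →ₗ[A] Derivation 𝕂 A A)
    (hj : IsSplitting j) (σ : tensorFieldsOfDegree F n₁ m₁ k₁)
    (τ : tensorFieldsOfDegree F n₂ m₂ k₂) :
    comparisonMap j hj ⟨tensorFieldProduct F k₂ σ.1 τ.1, tensorFieldProduct_mem σ.2 τ.2⟩ =
      ceProduct F (comparisonMap j hj σ) (comparisonMap j hj τ) := by
  refine Forms.ext fun k => AlternatingMap.ext fun v => MultilinearMap.ext fun w =>
    MultilinearMap.ext fun Z => ?_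
  have e : ∀ {n m : ℕ} (T : NormalTensors F n m) w Z, evalPairs (pairArgs w Z) T = T w Z :=
    fun T w Z => by simp [evalPairs_apply, toPairs_apply]
  have h := mapForms_wedge_map (E₁ := NormalTensors F n₁ m₁) (E₂ := NormalTensors F n₂ m₂)
    (E₃ := NormalTensors F (n₁ + n₂) (m₁ + m₂)) (normalTensorProduct F n₁ m₁ n₂ m₂) (LinearMap.mul A A)
    (evalPairs (pairArgs (fun i => w (Fin.castAdd n₂ i)) fun i => Z (Fin.castAdd m₂ i)))
    (evalPairs (pairArgs (fun i => w (Fin.natAdd n₁ i)) fun i => Z (Fin.natAdd m₁ i)))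
    (evalPairs (pairArgs w Z))
    (fun s t => by rw [e, e, e, normalTensorProduct_apply, LinearMap.mul_apply'])
    (comparisonMap j hj σ) (comparisonMap j hj τ)
  have h1 := congrArg (fun a : Functions F => a k v) h
  have h2 : ∀ {n m : ℕ} {l : ℤ} (τ : tensorFieldsOfDegree F n m l) w Z,
      mapForms (evalPairs (pairArgs w Z)) (comparisonMap j hj τ) =
        τ.1 (fun i => phiDual (w i)) fun i => psi j hj (Z i) := fun τ w Z =>
    Forms.ext fun k => AlternatingMap.ext fun v => e (comparisonMap j hj τ k v) w Z
  -- All arguments have degree zero, so the Koszul sign of the product is trivial.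
  have h3 := gradedProduct_eq (M := oneFormsDGMod F) (M' := vectorFieldsDGMod F) k₂ σ.1 τ.1
    (p := fun _ => 0) (q := fun _ => 0)
    (α := fun i => phiDual (w i)) (x := fun i => psi j hj (Z i)) (fun i => phiDualFun_mem (w i))
    (fun i => psiFun_mem j hj (Z i))
  simp only [Finset.sum_const_zero, mul_zero, add_zero, Int.negOnePow_zero, one_smul] at h3
  rw [h2, h2] at h1
  refine (congrArg (fun a : Functions F => a k v) h3).trans (h1.symm.trans ?_)
  exact e _ w Z

end Products

/-! ### Compatibility of the isomorphisms with products -/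

section RespectsProducts

variable {𝕂 A : Type*} [Field 𝕂] [CharZero 𝕂] [CommRing A] [Algebra 𝕂 A]
  {F : LieRinehartSubalgebra A (Derivation 𝕂 A A)}
  {I J : Type*} [Fintype I] [Fintype J]
  (FB : FiniteDualBasis A F I) (BB : FiniteDualBasis A (NormalSections F) J)
  (j : NormalSections F →ₗ[A] Derivation 𝕂 A A) (hj : IsSplitting j)

lemma comparisonIso_respectsTensorProducts :
    RespectsTensorProducts (comparisonIso FB BB j hj) := by
  intro n₁ m₁ n₂ m₂ k₁ k₂ σ τ s t hs ht
  have : Invertible (2 : 𝕂) := invertibleOfNonzero two_ne_zero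
  refine ⟨tensorFieldProduct_mem_tensorCocycles σ τ, ceProduct_mem_ceCocycles s t, ?_⟩
  obtain ⟨h₁, e₁⟩ := comparisonIso_isInducedBy FB BB j j hj hj n₁ m₁ k₁ σ
  obtain ⟨h₂, e₂⟩ := comparisonIso_isInducedBy FB BB j j hj hj n₂ m₂ k₂ τ
  obtain ⟨h, e⟩ := comparisonIso_isInducedBy FB BB j j hj hj _ _ _
    ⟨_, tensorFieldProduct_mem_tensorCocycles σ τ⟩
  -- The comparison map computes the class of the product from the images of `σ` and `τ`; these are
  -- cohomologous to the given `s` and `t`, and products depend only on classes.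
  refine e.trans (Eq.trans ?_
    (ceClass_ceProduct_congr (e₁.symm.trans hs) (e₂.symm.trans ht)))
  exact congrArg (ceClass F) (Subtype.ext
    (comparisonMap_tensorFieldProduct j hj ⟨σ.1, σ.2.1⟩ ⟨τ.1, τ.2.1⟩))

end RespectsProducts

end DGFoliation

end

theorem theorem1p1 (𝕂 : Type*) [RCLike 𝕂] (E : Type*) [NormedAddCommGroup E] [NormedSpace ℝ E]
    [FiniteDimensional ℝ E] (M : Type*) [TopologicalSpace M] [ChartedSpace E M]
    [IsManifold 𝓘(ℝ, E) ∞ M] [T2Space M] [SigmaCompactSpace M]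
    (F : DGFoliation.IntegrableDistribution 𝕂 E M) :
    (∃ j, DGFoliation.IsSplitting (F := F.sections) j) ∧
    ∃ Φ : DGFoliation.CohomologyIsomorphisms F.sections,
      (∀ j (hj : DGFoliation.IsSplitting (F := F.sections) j), DGFoliation.IsInducedBy Φ j hj) ∧
      DGFoliation.RespectsTensorProducts Φ := by
  obtain ⟨N, f, v, X, hv, hX⟩ := F.exists_generators
  obtain ⟨j, hj⟩ := DGFoliation.exists_isSplitting f v hv
  exact ⟨⟨j, hj⟩, DGFoliation.comparisonIso (DGFoliation.FiniteDualBasis.ofGenerators f v hv)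
      (DGFoliation.FiniteDualBasis.ofSplitting j hj f X hX) j hj,
    fun j' hj' => DGFoliation.comparisonIso_isInducedBy _ _ j j' hj hj',
    DGFoliation.comparisonIso_respectsTensorProducts _ _ j hj⟩
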